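/- **Setting.** Let $p\ge 2$ be an integer, $\mathfrak q=e^{i\pi/p}$, $\mathfrak q^{1/2}=e^{i\pi/(2p)}$, $\xi=1-\mathfrak q^2$, and for $n\in\mathbb Z$ put $\langle n\rangle=\frac{\mathfrak q^{2n}-1}{\mathfrak q^2-1}$, $\langle n\rangle!=\langle1\rangle\cdots\langle n\rangle$, $\binom{r}{s}_{\mathfrak q}=\frac{\langle r\rangle!}{\langle s\rangle!\,\langle r-s\rangle!}$. Consider finite-dimensional complex vector spaces graded by $\mathbb Z/4p$ ("charge"), with the diagonal braiding $\Psi(x\otimes y)=\mathfrak q^{ij/2}\,y\otimes x$ for $x,y$ of charges $i,j$. The rank-one Nichols algebra $\mathfrak B_p$ has the basis $F(r)$, $0\le r\le p-1$, with $F(r)$ of charge $-2r$, product $F(r)F(s)=\binom{r+s}{r}_{\mathfrak q}F(r+s)$ (zero if $r+s\ge p$), coproduct $\Delta F(r)=\sum_{s=0}^rF(s)\otimes F(r-s)$ and antipode $A(F(r))=(-1)^r\mathfrak q^{r(r-1)}F(r)$; $F=F(1)$. A Yetter–Drinfeld module is a finite-dimensional graded left–left Yetter–Drinfeld $\mathfrak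 B_p$-module in this braided category; the braiding of two of them is $\mathsf B=(\text{action}\otimes\mathrm{id})(\mathrm{id}\otimes\Psi)(\text{coaction}\otimes\mathrm{id})$, and the action of $h\in\mathfrak B_p$ on $f$ in the left dual $Z^\vee$ is given by $\mathrm{ev}(h f\otimes z)=\sum_k f_k(h_kz)$ if $\Psi(A(h)\otimes f)=\sum_k f_k\otimes h_k$. *One-vertex modules.* For $1\le r\le p$, $\nu\in\mathbb Z$ and $a=r-1-\nu p$, $\mathcal X(r)_\nu$ has the basis $V^a_s$, $0\le s\le r-1$ ($V^a_s$ is zero out of range), of charge $a-2s$, with $F(k)V^a_s=\binom{s+k}{k}_{\mathfrak q}\xi^k\prod_{i=s}^{s+k-1}\langle i-a\rangle V^a_{s+k}$, $\delta V^a_s=\sum_{k=0}^sF(k)\otimes V^a_{s-k}$, and ribbon map $\theta V^a_s=\mathfrak q^{\frac12((a+1)^2-1)}V^a_s$. *Two-vertex modules.* For $a,b\in\mathbb Z$ let $V^{a,b}_{s,t}$, $0\le s,t\le p-1$ (zero out of range), be of charge $a+b-2s-2t$, with $\delta V^{a,b}_{s,t}=\sum_{k=0}^sF(k)\otimes V^{a,b}_{s-k,t}$,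 $F(r)V^{a,b}_{s,t}=\sum_{u=0}^rc^{a,b}_{s,t}(r,u)V^{a,b}_{s+r-u,t+u}$, $$c^{a,b}_{s,t}(r,u)=\xi^r\mathfrak q^{u(2s-a)}\tbinom{s+r-u}{r-u}_{\mathfrak q}\tbinom{t+u}{u}_{\mathfrak q}\prod_{i=u}^{r-1}\langle s+i+2t-a-b\rangle\prod_{j=0}^{u-1}\langle t+j-b\rangle,$$ and ribbon map $\theta V^{a,b}_{s,t}=\mathfrak q^{\frac12((a+b-2t+1)^2-1)}\sum_{i=0}^s\mathfrak q^{-ia}\xi^i\binom{t+i}{i}_{\mathfrak q}\prod_{j=0}^{i-1}\langle t+j-b\rangle V^{a,b}_{s-i,t+i}$. Write $(a)_p=a\bmod p\in\{0,\dots,p-1\}$. For $1\le r\le p-1$ and $\nu\in\mathbb Z$, say that $(a,b,t)$ with $t\ge0$ realizes $(r,\nu)$ if $a+b-2t=r-1-\nu p$ and either $t\le (a)_p-r$ or $(a)_p+1\le t\le p-r-1$. In that case let $\mathcal P^{a,b}_{0,t}$ be the span of the vectors $v(i)=F^{i-1}V^{a,b}_{0,t}$ and $u(i)=F^{i-1}\sum_{s=0}^{r-1}\langle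 r-1\rangle!\,c^{a,b}_{0,t}(r-1,s)V^{a,b}_{r-s,t+s}$, $i\ge1$. Put $\mathcal P[r]_\nu=\mathcal P^{a,b}_{0,0}$ with $a=p-1$, $b=r-p-\nu p$ for $r<p$, and $\mathcal P[p]_\nu=\mathcal X(p)_\nu$. *Loop operators.* For Yetter–Drinfeld modules $Y,Z$ and an endomorphism $\theta$ of $Z$, let $\chi_Z(Y)\in\mathrm{End}(Y)$ be the composition $$Y\xrightarrow{\mathrm{id}\otimes\mathrm{coev}}Y\otimes Z\otimes Z^\vee\xrightarrow{\mathsf B^2\otimes\mathrm{id}}Y\otimes Z\otimes Z^\vee\xrightarrow{\mathrm{id}\otimes\theta\otimes\mathrm{id}}Y\otimes Z\otimes Z^\vee\xrightarrow{\mathrm{id}\otimes\mathsf B}Y\otimes Z^\vee\otimes Z\xrightarrow{\mathrm{id}\otimes\mathrm{ev}}Y .$$ Let $\mathfrak X(r)_\nu$ and $\mathfrak P(r)_\nu$ ($1\le r\le p$, $\nu\in\mathbb Z$) be the families $Y\mapsto\chi_Z(Y)$ for $Z=\mathcal X(r)_\nu$ and $Z=\mathcal P[r]_\nu$, with $\theta$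 the ribbon map. **Theorem.** 1. The $\mathcal X(r)_\nu$ are Yetter–Drinfeld modules. If $(a,b,t)$ realizes $(r,\nu)$, then $\mathcal P^{a,b}_{0,t}$ is a $2p$-dimensional Yetter–Drinfeld submodule of the two-vertex module, and it is preserved by $\theta$, which restricts to a morphism of Yetter–Drinfeld modules on it. 2. $\mathfrak X(r)_\nu$ and $\mathfrak P(r)_\nu$ are endomorphisms of the identity functor of the category of Yetter–Drinfeld modules. 3. On every Yetter–Drinfeld module, for $1\le r_1,r_2\le p$ and $\nu_1,\nu_2\in\mathbb Z$, $$\mathfrak X(r_1)_{\nu_1}\mathfrak X(r_2)_{\nu_2}=\sum_{\substack{s=|r_1-r_2|+1\\ \text{step}=2}}^{p-1-|r_1+r_2-p|}\mathfrak X(s)_{\nu_1+\nu_2}+\sum_{\substack{s=2p-r_1-r_2+1\\ \text{step}=2}}^{p}\mathfrak P(s)_{\nu_1+\nu_2},$$ where $\mathfrak P(r)_\nu=2\mathfrak X(r)_\nu+2\mathfrak X(p-r)_{\nu+1}$ for $r<p$ and $\mathfrak P(p)_\nu=\mathfrak X(p)_\nu$. Every realization $\mathcal P^{a,b}_{0,t}$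 of $(r,\nu)$, run around the loop with its ribbon map, gives the same operator $\mathfrak P(r)_\nu$. 4. $\mathfrak X(r)_{\nu+2}=\mathfrak X(r)_\nu$ and $\mathfrak P(r)_{\nu+2}=\mathfrak P(r)_\nu$. Moreover, if all charges of a Yetter–Drinfeld module $Y$ are shifted by $2p$ (for $\mathcal X(r')_{\nu'}$ and $\mathcal P[r']_{\nu'}$ this amounts to changing $\nu'$ by $2$), the result is again a Yetter–Drinfeld module, and the operators act on it in the same way as on $Y$. 5. On $\mathcal X(r')_{\nu'}$, $1\le r'\le p$, $\mathfrak X(r)_\nu$ is multiplication by $$\lambda(r',\nu';r,\nu)=(-1)^{\nu'(r+1)+\nu r'+p\nu\nu'}\sum_{i=1}^r\mathfrak q^{r'(r+1-2i)},$$ which equals $(-1)^{\nu'(r+1)+\nu r'+p\nu\nu'}\dfrac{\mathfrak q^{r'r}-\mathfrak q^{-r'r}}{\mathfrak q^{r'}-\mathfrak q^{-r'}}$ and $\lambda(p-r',\nu'+1;r,\nu)$ if $r'<p$, and $(-1)^{(\nu'+1)(r-1-\nu p)}\,r$ if $r'=p$. 6. If $(a,b,t)$ realizes $(r',\nu')$,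 then on $\mathcal P^{a,b}_{0,t}$, for all $i\ge1$, $$\mathfrak X(r)_\nu\,u(i)=\lambda(r',\nu';r,\nu)\,u(i)+\mu(r',\nu';r,\nu)\,v(r'+i),\qquad \mathfrak X(r)_\nu\,v(i)=\lambda(r',\nu';r,\nu)\,v(i),$$ where $$\mu(r',\nu';r,\nu)=(-1)^{1+\nu'(r+1)+\nu r'+p\nu\nu'}\,\mathfrak q^{1-r'}\frac{\mathfrak q-\mathfrak q^{-1}}{(\mathfrak q^{r'}-\mathfrak q^{-r'})^3}\Bigl((\mathfrak q^{r'r}-\mathfrak q^{-r'r})(\mathfrak q^{r'}+\mathfrak q^{-r'})-r(\mathfrak q^{r'r}+\mathfrak q^{-r'r})(\mathfrak q^{r'}-\mathfrak q^{-r'})\Bigr).$$ 7. The $2p$ operators $\mathfrak X(r)_\nu$, $1\le r\le p$, $\nu\in\{0,1\}$, are linearly independent, so that they span a commutative associative $2p$-dimensional algebra. -/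

import Mathlib

open scoped TensorProduct

universe u v w

namespace NicholsLoop

noncomputable section

/-! ### Numerical conventions -/

/-- The primitive `4p`-th root of unity `𝔮^{1/2} = e^{iπ/(2p)}`. -/
def qHalf (p : ℕ) : ℂ := Complex.exp (Real.pi * Complex.I / (2 * p))

/-- The primitive `2p`-th root of unity `𝔮 = e^{iπ/p}`. -/
def q (p : ℕ) : ℂ := Complex.exp (Real.pi * Complex.I / p)

/-- `⟨n⟩ = (𝔮^{2n} - 1) / (𝔮² - 1)`, for every integer `n`. -/
def qInt (p : ℕ) (n : ℤ) : ℂ := (q p ^ (2 * n) - 1) / (q p ^ 2 - 1)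

/-- `⟨n⟩! = ⟨1⟩ ⋯ ⟨n⟩`. -/
def qFac (p n : ℕ) : ℂ := ∏ i ∈ Finset.range n, qInt p (i + 1)

/-- The `q`-binomial coefficient; it is only used for `s ≤ r` with `s, r - s ≤ p - 1`, where the
denominator is nonzero. -/
def qBinom (p r s : ℕ) : ℂ := qFac p r / (qFac p s * qFac p (r - s))

/-- `ξ = 1 - 𝔮²`. -/
def xi (p : ℕ) : ℂ := 1 - q p ^ 2

/-! ### Charges and diagonal braiding

The base category is that of finite-dimensional complex vector spaces graded by "charges" in
`ℤ/4p`, with the diagonal braiding `x ⊗ y ↦ 𝔮^{ij/2} y ⊗ x` for `x`, `y` of charges `i`, `j`.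
A grading is given by its family of projections. The generator `F` of the Nichols algebra has
charge `-2`, and the vertex `V^a` has charge `a`; this gives
`F ⊗ F ↦ 𝔮² F ⊗ F`, `F ⊗ V^a ↦ 𝔮^{-a} V^a ⊗ F` and `V^a ⊗ V^b ↦ 𝔮^{ab/2} V^b ⊗ V^a`. -/

/-- `𝔮^{ij/2}`, which depends on `i` and `j` modulo `4p` only. -/
def chargeForm (p : ℕ) (i j : ZMod (4 * p)) : ℂ := qHalf p ^ (i.val * j.val)

section braid

variable {p : ℕ} [NeZero p] {V : Type u} {W : Type v}
  [AddCommGroup V] [Module ℂ V] [AddCommGroup W] [Module ℂ W]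

/-- The braiding `Ψ : V ⊗ W → W ⊗ V` of two graded spaces with projections `P`, `Q`. -/
def braid (P : ZMod (4 * p) → Module.End ℂ V) (Q : ZMod (4 * p) → Module.End ℂ W) :
    V ⊗[ℂ] W →ₗ[ℂ] W ⊗[ℂ] V :=
  ∑ i, ∑ j, chargeForm p i j •
    ((TensorProduct.comm ℂ V W).toLinearMap ∘ₗ TensorProduct.map (P i) (Q j))

/-- The inverse braiding `Ψ⁻¹ : W ⊗ V → V ⊗ W`. -/
def braidInv (P : ZMod (4 * p) → Module.End ℂ V) (Q : ZMod (4 * p) → Module.End ℂ W) :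
    W ⊗[ℂ] V →ₗ[ℂ] V ⊗[ℂ] W :=
  ∑ i, ∑ j, (chargeForm p i j)⁻¹ •
    ((TensorProduct.comm ℂ W V).toLinearMap ∘ₗ TensorProduct.map (Q j) (P i))

end braid

/-- The linear map with prescribed values on the standard basis. -/
def linOfBasis {ι : Type v} [Fintype ι] [DecidableEq ι] {W : Type w} [AddCommGroup W] [Module ℂ W]
    (c : ι → W) : (ι → ℂ) →ₗ[ℂ] W :=
  (Pi.basisFun ℂ ι).constr ℂ c

/-- The linear map on a tensor product with prescribed values on the standard basis. -/
def linOfBasis₂ {ι : Type u} {κ : Type v} [Fintype ι] [DecidableEq ι] [Fintype κ] [DecidableEq κ]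
    {W : Type w} [AddCommGroup W] [Module ℂ W] (c : ι → κ → W) :
    (ι → ℂ) ⊗[ℂ] (κ → ℂ) →ₗ[ℂ] W :=
  TensorProduct.lift (linOfBasis fun i => linOfBasis fun k => c i k)

/-- The grading of `ι → ℂ` in which the basis vector at `k` has charge `c k`. -/
def coordProj {p : ℕ} {ι : Type u} (c : ι → ZMod (4 * p)) (i : ZMod (4 * p)) :
    Module.End ℂ (ι → ℂ) :=
  LinearMap.pi fun k => if c k = i then LinearMap.proj k else 0

/-- The basis vector of `Fin n → ℂ` with index `k`, and `0` if `k ≥ n`. -/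
def vec (n k : ℕ) : Fin n → ℂ := if h : k < n then Pi.single ⟨k, h⟩ 1 else 0

/-- The basis vector of `Fin n × Fin n → ℂ` with index `(s, t)`, and `0` out of range. -/
def vec₂ (n s t : ℕ) : Fin n × Fin n → ℂ :=
  if h : s < n ∧ t < n then Pi.single (⟨s, h.1⟩, ⟨t, h.2⟩) 1 else 0

/-! ### The rank-one Nichols algebra -/

/-- The underlying space of the Nichols algebra, with basis `F(r)`, `0 ≤ r ≤ p - 1`. -/
abbrev Nich (p : ℕ) : Type := Fin p → ℂ

/-- The element `F(r)`, which is `0` for `r ≥ p`. In particular `1 = F(0)` and `F = F(1)`. -/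
def F (p r : ℕ) : Nich p := vec p r

/-- `F(r)` has charge `-2r`. -/
def nichProj (p : ℕ) : ZMod (4 * p) → Module.End ℂ (Nich p) :=
  coordProj fun r => ((-2 * (r : ℕ) : ℤ) : ZMod (4 * p))

/-- `F(r) F(s) = ⟨r+s choose r⟩ F(r+s)`. -/
def nichMul (p : ℕ) : Nich p ⊗[ℂ] Nich p →ₗ[ℂ] Nich p :=
  linOfBasis₂ fun r s => qBinom p (r + s) r • F p (r + s)

/-- `Δ F(r) = ∑_{s=0}^r F(s) ⊗ F(r-s)`. -/
def nichComul (p : ℕ) : Nich p →ₗ[ℂ] Nich p ⊗[ℂ] Nich p :=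
  linOfBasis fun r => ∑ s ∈ Finset.range ((r : ℕ) + 1), F p s ⊗ₜ[ℂ] F p (r - s)

/-- The counit: `F(0) ↦ 1` and `F(r) ↦ 0` for `r > 0`. -/
def nichCounit (p : ℕ) : Nich p →ₗ[ℂ] ℂ :=
  linOfBasis fun r => if (r : ℕ) = 0 then 1 else 0

/-- The antipode `A(F(r)) = (-1)^r 𝔮^{r(r-1)} F(r)`. -/
def nichAntipode (p : ℕ) : Nich p →ₗ[ℂ] Nich p :=
  linOfBasis fun r => ((-1) ^ (r : ℕ) * q p ^ ((r : ℤ) * ((r : ℤ) - 1))) • F p r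

/-- The inverse of the antipode. -/
def nichAntipodeInv (p : ℕ) : Nich p →ₗ[ℂ] Nich p :=
  linOfBasis fun r => ((-1) ^ (r : ℕ) * q p ^ (-((r : ℤ) * ((r : ℤ) - 1)))) • F p r

/-! ### Yetter–Drinfeld modules -/

/-- The data of a left-left Yetter–Drinfeld module over the rank-one Nichols algebra in the
category of `ℤ/4p`-graded spaces: a finite-dimensional space, the projections onto its graded
components, an action and a coaction. The axioms are collected in `IsYD`. -/
structure ModCo (p : ℕ) : Type (u + 1) where
  carrier : Type u
  [addCommGroup : AddCommGroup carrier]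
  [module : Module ℂ carrier]
  [finite : FiniteDimensional ℂ carrier]
  /-- the projections onto the graded components -/
  proj : ZMod (4 * p) → Module.End ℂ carrier
  /-- the left action -/
  act : Nich p ⊗[ℂ] carrier →ₗ[ℂ] carrier
  /-- the left coaction -/
  coact : carrier →ₗ[ℂ] Nich p ⊗[ℂ] carrier

attribute [instance] ModCo.addCommGroup ModCo.module ModCo.finite

instance (p : ℕ) : CoeSort (ModCo.{u} p) (Type u) := ⟨ModCo.carrier⟩

section YD

variable {p : ℕ} [NeZero p]

/-- The left-hand side of the Yetter–Drinfeld axiom,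
`(mul ⊗ id)(id ⊗ Ψ)(coact ⊗ id)(act ⊗ id)(id ⊗ Ψ)(Δ ⊗ id)`. -/
def ydLeft (M : ModCo.{u} p) : Nich p ⊗[ℂ] M →ₗ[ℂ] Nich p ⊗[ℂ] M :=
  (nichMul p).rTensor M
    ∘ₗ (TensorProduct.assoc ℂ (Nich p) (Nich p) M).symm.toLinearMap
    ∘ₗ (braid M.proj (nichProj p)).lTensor (Nich p)
    ∘ₗ (TensorProduct.assoc ℂ (Nich p) M (Nich p)).toLinearMap
    ∘ₗ M.coact.rTensor (Nich p)
    ∘ₗ M.act.rTensor (Nich p)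
    ∘ₗ (TensorProduct.assoc ℂ (Nich p) M (Nich p)).symm.toLinearMap
    ∘ₗ (braid (nichProj p) M.proj).lTensor (Nich p)
    ∘ₗ (TensorProduct.assoc ℂ (Nich p) (Nich p) M).toLinearMap
    ∘ₗ (nichComul p).rTensor M

/-- The right-hand side of the Yetter–Drinfeld axiom,
`(mul ⊗ act)(id ⊗ Ψ ⊗ id)(Δ ⊗ coact)`. -/
def ydRight (M : ModCo.{u} p) : Nich p ⊗[ℂ] M →ₗ[ℂ] Nich p ⊗[ℂ] M :=
  TensorProduct.map (nichMul p) M.act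
    ∘ₗ (TensorProduct.assoc ℂ (Nich p) (Nich p) (Nich p ⊗[ℂ] M)).symm.toLinearMap
    ∘ₗ ((TensorProduct.assoc ℂ (Nich p) (Nich p) M).toLinearMap
        ∘ₗ (braid (nichProj p) (nichProj p)).rTensor M
        ∘ₗ (TensorProduct.assoc ℂ (Nich p) (Nich p) M).symm.toLinearMap).lTensor (Nich p)
    ∘ₗ (TensorProduct.assoc ℂ (Nich p) (Nich p) (Nich p ⊗[ℂ] M)).toLinearMap
    ∘ₗ TensorProduct.map (nichComul p) M.coact

/-- The axioms of a left-left Yetter–Drinfeld module in the braided category of graded spaces. -/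
structure IsYD (M : ModCo.{u} p) : Prop where
  grading : CompleteOrthogonalIdempotents M.proj
  act_graded : ∀ i j, M.act ∘ₗ TensorProduct.map (nichProj p i) (M.proj j) =
    M.proj (i + j) ∘ₗ M.act ∘ₗ TensorProduct.map (nichProj p i) (M.proj j)
  coact_graded : ∀ k, M.coact ∘ₗ M.proj k =
    (∑ i, TensorProduct.map (nichProj p i) (M.proj (k - i))) ∘ₗ M.coact
  one_act : ∀ x : M, M.act (F p 0 ⊗ₜ[ℂ] x) = x
  mul_act : M.act ∘ₗ (nichMul p).rTensor M =
    M.act ∘ₗ M.act.lTensor (Nich p) ∘ₗ (TensorProduct.assoc ℂ (Nich p) (Nich p) M).toLinearMap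
  counit_coact : ∀ x : M,
    TensorProduct.lid ℂ M ((nichCounit p).rTensor M (M.coact x)) = x
  comul_coact : (TensorProduct.assoc ℂ (Nich p) (Nich p) M).toLinearMap
      ∘ₗ (nichComul p).rTensor M ∘ₗ M.coact =
    M.coact.lTensor (Nich p) ∘ₗ M.coact
  yetterDrinfeld : ydLeft M = ydRight M

/-- Morphisms of Yetter–Drinfeld modules: graded module comodule maps. -/
structure IsHom (M : ModCo.{u} p) (N : ModCo.{v} p) (f : M →ₗ[ℂ] N) : Prop where
  map_proj : ∀ i, f ∘ₗ M.proj i = N.proj i ∘ₗ f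
  map_act : f ∘ₗ M.act = N.act ∘ₗ f.lTensor (Nich p)
  map_coact : N.coact ∘ₗ f = f.lTensor (Nich p) ∘ₗ M.coact

/-- The family `φ` is an endomorphism of the identity functor of the category of
Yetter–Drinfeld modules. -/
structure IsIdentityEndo (φ : (Y : ModCo.{u} p) → Module.End ℂ Y) : Prop where
  isHom : ∀ Y, IsYD Y → IsHom Y Y (φ Y)
  natural : ∀ Y Y', IsYD Y → IsYD Y' → ∀ f : Y →ₗ[ℂ] Y', IsHom Y Y' f → f ∘ₗ φ Y = φ Y' ∘ₗ f

/-- The braiding `B = (act ⊗ id)(id ⊗ Ψ)(coact ⊗ id) : M ⊗ N → N ⊗ M` of Yetter–Drinfeld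
modules. -/
def ydBraid (M : ModCo.{u} p) (N : ModCo.{v} p) : M ⊗[ℂ] N →ₗ[ℂ] N ⊗[ℂ] M :=
  N.act.rTensor M
    ∘ₗ (TensorProduct.assoc ℂ (Nich p) N M).symm.toLinearMap
    ∘ₗ (braid M.proj N.proj).lTensor (Nich p)
    ∘ₗ (TensorProduct.assoc ℂ (Nich p) M N).toLinearMap
    ∘ₗ M.coact.rTensor N

/-- The left dual `Z^∨` of a Yetter–Drinfeld module. On the dual space, the action is determined
by `ev(h·f ⊗ z) = ev(id ⊗ act)(Ψ(A h ⊗ f) ⊗ z)`, and the coaction is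
`(ev ⊗ A⁻¹ ⊗ id)(id ⊗ Ψ⁻¹ ⊗ id)(id ⊗ coact ⊗ id)(id ⊗ coev)`. -/
def dual (Z : ModCo.{u} p) : ModCo.{u} p where
  carrier := Module.Dual ℂ Z
  proj i := (Z.proj (-i)).dualMap
  act :=
    TensorProduct.lift
        (LinearMap.mk₂ ℂ
          (fun (f : Module.Dual ℂ Z) (h : Nich p) => f ∘ₗ Z.act ∘ₗ TensorProduct.mk ℂ (Nich p) Z h)
          (fun _ _ _ => rfl) (fun _ _ _ => rfl)
          (fun _ _ _ => by ext; simp)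
          (fun _ _ _ => by ext; simp))
      ∘ₗ braid (nichProj p) (fun i => (Z.proj (-i)).dualMap)
      ∘ₗ (nichAntipode p).rTensor (Module.Dual ℂ Z)
  coact :=
    (((TensorProduct.lid ℂ (Nich p)).toLinearMap
        ∘ₗ TensorProduct.map (contractLeft ℂ Z) (nichAntipodeInv p)
        ∘ₗ (TensorProduct.assoc ℂ (Module.Dual ℂ Z) Z (Nich p)).symm.toLinearMap
        ∘ₗ (braidInv Z.proj (nichProj p) ∘ₗ Z.coact).lTensor (Module.Dual ℂ Z)).rTensor
          (Module.Dual ℂ Z))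
      ∘ₗ (TensorProduct.assoc ℂ (Module.Dual ℂ Z) Z (Module.Dual ℂ Z)).symm.toLinearMap
      ∘ₗ (coevaluation ℂ Z).lTensor (Module.Dual ℂ Z)
      ∘ₗ (TensorProduct.rid ℂ (Module.Dual ℂ Z)).symm.toLinearMap

/-- The loop diagram: the endomorphism `χ_Z(Y)` of `Y` obtained by running `Z` around the loop,
`Y → Y ⊗ Z ⊗ Z^∨ → Y ⊗ Z ⊗ Z^∨ → Y ⊗ Z ⊗ Z^∨ → Y ⊗ Z^∨ ⊗ Z → Y`, where the arrows are
coevaluation, the squared braiding of `Y` and `Z`, the map `θ` on `Z`, the braiding of `Z` with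
`Z^∨`, and evaluation. -/
def loop (Y : ModCo.{u} p) (Z : ModCo.{v} p) (θ : Module.End ℂ Z) : Module.End ℂ Y :=
  (TensorProduct.rid ℂ Y).toLinearMap
    ∘ₗ (contractLeft ℂ Z).lTensor Y
    ∘ₗ (ydBraid Z (dual Z)).lTensor Y
    ∘ₗ (TensorProduct.assoc ℂ Y Z (dual Z)).toLinearMap
    ∘ₗ (θ.lTensor Y).rTensor (dual Z)
    ∘ₗ (ydBraid Z Y ∘ₗ ydBraid Y Z).rTensor (dual Z)
    ∘ₗ (TensorProduct.assoc ℂ Y Z (dual Z)).symm.toLinearMap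
    ∘ₗ (coevaluation ℂ Z).lTensor Y
    ∘ₗ (TensorProduct.rid ℂ Y).symm.toLinearMap

/-- The same module comodule with all charges increased by `c`. -/
def chargeShift (Y : ModCo.{u} p) (c : ZMod (4 * p)) : ModCo.{u} p where
  carrier := Y
  proj i := Y.proj (i - c)
  act := Y.act
  coact := Y.coact

/-- A linear retraction of `M` onto a subspace. -/
def retraction (M : ModCo.{u} p) (S : Submodule ℂ M) : M →ₗ[ℂ] S :=
  (S.subtype.exists_leftInverse_of_injective S.ker_subtype).choose

/-- The structure induced on a subspace `S` of `M`. If the inclusion of `S` is a morphism (that is,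
`S` is a Yetter–Drinfeld submodule), this is the induced structure and does not depend on the
choice of the retraction; otherwise it is a junk value. -/
def restrict (M : ModCo.{u} p) (S : Submodule ℂ M) : ModCo.{u} p where
  carrier := S
  proj i := retraction M S ∘ₗ M.proj i ∘ₗ S.subtype
  act := retraction M S ∘ₗ M.act ∘ₗ S.subtype.lTensor (Nich p)
  coact := (retraction M S).lTensor (Nich p) ∘ₗ M.coact ∘ₗ S.subtype

/-- The map induced on the subspace `S` by an endomorphism of `M` that preserves it. -/
def restrictEnd (M : ModCo.{u} p) (S : Submodule ℂ M) (f : Module.End ℂ M) :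
    Module.End ℂ (restrict M S) :=
  retraction M S ∘ₗ f ∘ₗ S.subtype

end YD

/-! ### One-vertex modules -/

section modules

variable (p : ℕ) [NeZero p]

/-- The simple Yetter–Drinfeld module `X(r)_ν`, `1 ≤ r ≤ p`: the span of the one-vertex elements
`V^a_s`, `0 ≤ s ≤ r - 1`, with `a = r - 1 - νp`. The charge of `V^a_s` is `a - 2s`,
`F(k) V^a_s = ⟨s+k choose k⟩ ξ^k ∏_{i=s}^{s+k-1} ⟨i-a⟩ V^a_{s+k}`, and the coaction is by
deconcatenation. -/
def simpleMod (r : ℕ) (ν : ℤ) : ModCo.{0} p where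
  carrier := Fin r → ℂ
  proj := coordProj fun s => (((r : ℤ) - 1 - ν * p - 2 * (s : ℕ) : ℤ) : ZMod (4 * p))
  act := linOfBasis₂ fun k s =>
    (qBinom p (s + k) k * xi p ^ (k : ℕ) *
      ∏ i ∈ Finset.range k, qInt p ((s : ℕ) + i - ((r : ℤ) - 1 - ν * p))) • vec r (s + k)
  coact := linOfBasis fun s =>
    ∑ k ∈ Finset.range ((s : ℕ) + 1), F p k ⊗ₜ[ℂ] vec r (s - k)

/-- The ribbon map `θ V^a_s = 𝔮^{((a+1)²-1)/2} V^a_s` on `X(r)_ν`, where `a + 1 = r - νp`. -/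
def simpleRibbon (r : ℕ) (ν : ℤ) : Module.End ℂ (simpleMod p r ν) :=
  (qHalf p ^ (((r : ℤ) - ν * p) ^ 2 - 1)) • 1

/-! ### Two-vertex modules -/

/-- The coefficients in `F(r) V^{a,b}_{s,t} = ∑_{u=0}^r c^{a,b}_{s,t}(r,u) V^{a,b}_{s+r-u,t+u}`. -/
def twoCoeff (a b : ℤ) (s t r u : ℕ) : ℂ :=
  xi p ^ r * q p ^ ((u : ℤ) * (2 * s - a)) * qBinom p (s + (r - u)) (r - u) * qBinom p (t + u) u *
    (∏ i ∈ Finset.Ico u r, qInt p ((s : ℤ) + i + 2 * t - a - b)) *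
    ∏ j ∈ Finset.range u, qInt p ((t : ℤ) + j - b)

/-- The two-vertex Yetter–Drinfeld module spanned by `V^{a,b}_{s,t}`, `0 ≤ s, t ≤ p - 1`, with
fixed `a` and `b`. The charge of `V^{a,b}_{s,t}` is `a + b - 2s - 2t`; the action is the
cumulative left adjoint action and the coaction is by deconcatenation up to the first vertex. -/
def twoVertex (a b : ℤ) : ModCo.{0} p where
  carrier := Fin p × Fin p → ℂ
  proj := coordProj fun st => ((a + b - 2 * (st.1 : ℕ) - 2 * (st.2 : ℕ) : ℤ) : ZMod (4 * p))
  act := linOfBasis₂ fun r st => ∑ u ∈ Finset.range ((r : ℕ) + 1),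
    twoCoeff p a b st.1 st.2 r u • vec₂ p (st.1 + (r - u)) (st.2 + u)
  coact := linOfBasis fun st => ∑ k ∈ Finset.range ((st.1 : ℕ) + 1),
    F p k ⊗ₜ[ℂ] vec₂ p (st.1 - k) st.2

/-- The ribbon map on two-vertex modules,
`θ V^{a,b}_{s,t} = 𝔮^{((a+b-2t+1)²-1)/2} ∑_{i=0}^s 𝔮^{-ia} ξ^i ⟨t+i choose i⟩
  ∏_{j=0}^{i-1} ⟨t+j-b⟩ V^{a,b}_{s-i,t+i}`. -/
def twoRibbon (a b : ℤ) : Module.End ℂ (twoVertex p a b) :=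
  linOfBasis (ι := Fin p × Fin p) fun st =>
    qHalf p ^ ((a + b - 2 * ((st.2 : ℕ) : ℤ) + 1) ^ 2 - 1) •
      ∑ i ∈ Finset.range ((st.1 : ℕ) + 1),
        (q p ^ (-(i * a)) * xi p ^ i * qBinom p (st.2 + i) i *
          ∏ j ∈ Finset.range i, qInt p (((st.2 : ℕ) : ℤ) + j - b)) • vec₂ p (st.1 - i) (st.2 + i)

/-- `r = (a + b - 2t mod p) + 1`. -/
def leftLength (a b : ℤ) (t : ℕ) : ℕ := ((a + b - 2 * t) % p).toNat + 1

/-- The element `v^{a,b}_t(i + 1) = F^i · V^{a,b}_{0,t}`. -/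
def vElt (a b : ℤ) (t i : ℕ) : twoVertex p a b :=
  (fun x : twoVertex p a b => (twoVertex p a b).act (F p 1 ⊗ₜ[ℂ] x))^[i] (vec₂ p 0 t)

/-- The element `u^{a,b}_t(i + 1) = F^i · T`, with
`T = ∑_{s=0}^{r-1} ⟨r-1⟩! c^{a,b}_{0,t}(r-1,s) V^{a,b}_{r-s,t+s}`, `r = (a + b - 2t mod p) + 1`. -/
def uElt (a b : ℤ) (t i : ℕ) : twoVertex p a b :=
  (fun x : twoVertex p a b => (twoVertex p a b).act (F p 1 ⊗ₜ[ℂ] x))^[i]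
    (∑ s ∈ Finset.range (leftLength p a b t),
      (qFac p (leftLength p a b t - 1) * twoCoeff p a b 0 t (leftLength p a b t - 1) s) •
        vec₂ p (leftLength p a b t - s) (t + s))

/-- The span of all `u^{a,b}_t(i)` and `v^{a,b}_t(i)`. -/
def projSpan (a b : ℤ) (t : ℕ) : Submodule ℂ (twoVertex p a b) :=
  Submodule.span ℂ (Set.range (uElt p a b t) ∪ Set.range (vElt p a b t))

/-- The Yetter–Drinfeld module `P^{a,b}_{0,t}`. -/
def projMod (a b : ℤ) (t : ℕ) : ModCo.{0} p := restrict (twoVertex p a b) (projSpan p a b t)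

/-- The ribbon map on `P^{a,b}_{0,t}`. -/
def projRibbon (a b : ℤ) (t : ℕ) : Module.End ℂ (projMod p a b t) :=
  restrictEnd (twoVertex p a b) (projSpan p a b t) (twoRibbon p a b)

/-- The elements `v(i + 1)` of `P^{a,b}_{0,t}`. -/
def vInP (a b : ℤ) (t i : ℕ) : projMod p a b t :=
  (⟨vElt p a b t i, Submodule.subset_span (Or.inr ⟨i, rfl⟩)⟩ : projSpan p a b t)

/-- The elements `u(i + 1)` of `P^{a,b}_{0,t}`. -/
def uInP (a b : ℤ) (t i : ℕ) : projMod p a b t :=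
  (⟨uElt p a b t i, Submodule.subset_span (Or.inl ⟨i, rfl⟩)⟩ : projSpan p a b t)

/-- `P^{a,b}_{0,t}` is a realization of `P[r]_ν`, for `1 ≤ r ≤ p - 1`: one has
`a + b - 2t = r - 1 - νp`, and either `t ≤ (a mod p) - r` or `(a mod p) + 1 ≤ t ≤ p - r - 1`. -/
def Realizes (r : ℕ) (ν a b : ℤ) (t : ℕ) : Prop :=
  1 ≤ r ∧ r ≤ p - 1 ∧ a + b - 2 * t = r - 1 - ν * p ∧
    ((t : ℤ) ≤ a % p - r ∨ (a % p + 1 ≤ t ∧ (t : ℤ) ≤ p - r - 1))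

/-! ### The operators -/

/-- `𝔛(r)_ν`: running `X(r)_ν` around the loop. -/
def opX (r : ℕ) (ν : ℤ) (Y : ModCo.{u} p) : Module.End ℂ Y :=
  loop Y (simpleMod p r ν) (simpleRibbon p r ν)

/-- The operator obtained by running `P^{a,b}_{0,t}` around the loop. -/
def opPab (a b : ℤ) (t : ℕ) (Y : ModCo.{u} p) : Module.End ℂ Y :=
  loop Y (projMod p a b t) (projRibbon p a b t)

/-- `𝔓(r)_ν`: running `P[r]_ν` around the loop. Here `P[p]_ν = X(p)_ν`, and for `r < p` the module
`P[r]_ν` is realized as `P^{a,b}_{0,0}` with `a = p - 1`, `b = r - p - νp`. -/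
def opP (r : ℕ) (ν : ℤ) (Y : ModCo.{u} p) : Module.End ℂ Y :=
  if r = p then opX p p ν Y else opPab p ((p : ℤ) - 1) ((r : ℤ) - p - ν * p) 0 Y

/-- The eigenvalue
`λ(r',ν';r,ν) = (-1)^{ν'(r+1) + νr' + pνν'} ∑_{i=1}^r 𝔮^{r'(r+1-2i)}`. -/
def eigenLam (r' : ℕ) (ν' : ℤ) (r : ℕ) (ν : ℤ) : ℂ :=
  (-1) ^ (ν' * (r + 1) + ν * r' + p * ν * ν') *
    ∑ i ∈ Finset.Icc 1 r, q p ^ ((r' : ℤ) * (r + 1 - 2 * i))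

/-- The off-diagonal coefficient `μ(r',ν';r,ν) = (-1)^{1 + ν'(r+1) + νr' + pνν'} 𝔮^{1-r'}
(𝔮 - 𝔮⁻¹) (𝔮^{r'} - 𝔮^{-r'})^{-3} ((𝔮^{r'r} - 𝔮^{-r'r})(𝔮^{r'} + 𝔮^{-r'})
- r (𝔮^{r'r} + 𝔮^{-r'r})(𝔮^{r'} - 𝔮^{-r'}))`. -/
def offDiagMu (r' : ℕ) (ν' : ℤ) (r : ℕ) (ν : ℤ) : ℂ :=
  (-1) ^ (1 + ν' * (r + 1) + ν * r' + p * ν * ν') * q p ^ (1 - (r' : ℤ)) *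
    ((q p - (q p)⁻¹) / (q p ^ r' - (q p ^ r')⁻¹) ^ 3) *
    ((q p ^ (r' * r) - (q p ^ (r' * r))⁻¹) * (q p ^ r' + (q p ^ r')⁻¹) -
      r * ((q p ^ (r' * r) + (q p ^ (r' * r))⁻¹) * (q p ^ r' - (q p ^ r')⁻¹)))

/-- The values of `s` in the first sum of the fusion rule:
`|r₁ - r₂| + 1 ≤ s ≤ p - 1 - |r₁ + r₂ - p|`, in steps of `2`. -/
def fusionX (r₁ r₂ : ℕ) : Finset ℕ :=
  (Finset.Icc 1 p).filter fun s => |(r₁ : ℤ) - r₂| + 1 ≤ s ∧ (s : ℤ) ≤ p - 1 - |(r₁ : ℤ) + r₂ - p| ∧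
    (2 : ℤ) ∣ s - (|(r₁ : ℤ) - r₂| + 1)

/-- The values of `s` in the second sum of the fusion rule:
`2p - r₁ - r₂ + 1 ≤ s ≤ p`, in steps of `2`. -/
def fusionP (r₁ r₂ : ℕ) : Finset ℕ :=
  (Finset.Icc 1 p).filter fun s => 2 * (p : ℤ) - r₁ - r₂ + 1 ≤ s ∧
    (2 : ℤ) ∣ s - (2 * (p : ℤ) - r₁ - r₂ + 1)

end modules

end

end NicholsLoop

set_option linter.unusedSectionVars false

namespace NicholsLoop
noncomputable section

/-! ### Powers of the root of unity -/

section numbers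

variable {p : ℕ}

/-! Let `E` be the `F(1)`-component of the coaction and `G` the action of `F`. Since `F(r) = F^r /
⟨r⟩!` for `r < p`, and by coassociativity, a Yetter–Drinfeld module is the same as a graded space
with operators `E`, `G` of charge `2`, `-2` such that `E^p = G^p = 0` and `E G - 𝔮² G E = 1 -
𝔮^{-2m}` on charge `m` (`IsEF.isYD`, `IsYD.isEF`). Everything then becomes a highest weight
computation.

On a vector of charge `m` the loop of `Z` acts by `∑_k c(m,k) ⟨k⟩!⁻² G^k E^k`, where `c(m,k)` is a
trace over `Z` (`loop_apply`). If `Z` is filtered by towers `G^s w`, `s < n`, over vectors `w` of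
charge `a` that are highest modulo the previous step, the traced operator is triangular with
explicit diagonal (`IsHighest.loop_mem`), and the loop is a sum of universal operators `chi n a`.
Thus `𝔛(r)_ν` is `chi r (r-1-νp)` (`opX_eq`). The module `P^{a,b}_{0,t}` has two towers of length
`p`, and each of the two operators `chi p _` splits into the same pair `𝔛(r)_ν`, `𝔛(p-r)_{ν+1}`
(`chi_p_eq`, `chi_p_neg_eq`). This gives `𝔓 = 2𝔛 + 2𝔛` and the independence of the realization.

The operators `chi n a` make sense for all `n` and `a`, with or without a module behind them. A
telescoping recursion of the coefficients makes them central when the tower closes up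
(`Closed.chiCoef_recursion`). Moreover `chi 2 1 * chi (r+1) r = chi (r+2) (r+1) + chi r (r-1)` for
every `r` (`chi_two_mul`), so `chi r (r-1)` is the Chebyshev polynomial `S_{r-1}` in `chi 2 1`, and
the braiding index only contributes the sign operators `signOp ν`. The Clebsch–Gordan rule for `S_n`
multiplies the operators without truncation; the terms beyond `p` are folded back by `chiInt (p+j) =
chiInt (p-j) + 2 chiInt j * signOp 1`, which starts from `chi_succ_p`. A pair `p ± j` is then
exactly `𝔓(p-j)`.

On a simple module the eigenvalue is read off the highest weight vector. On `P^{a,b}_{0,t}` the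
operator `chi 2 1` is a Jordan block, and the Chebyshev recursion produces `μ`. For linear
independence, a combination of the `2p` operators is a polynomial of degree less than `2p` in `chi 2
1`. If it vanishes on all modules, it has zeros at `2` and `-2` from the simple modules and double
zeros at the `p - 1` values `𝔮^j + 𝔮^{-j}`, `0 < j < p`, from the Jordan blocks, so it is zero. -/

theorem qHalf_ne_zero (p : ℕ) : qHalf p ≠ 0 := Complex.exp_ne_zero _

theorem q_ne_zero (p : ℕ) : q p ≠ 0 := Complex.exp_ne_zero _

theorem qHalf_sq (p : ℕ) : qHalf p ^ (2 : ℤ) = q p := by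
  rw [qHalf, q, ← Complex.exp_int_mul]
  congr 1
  rcases eq_or_ne (p : ℂ) 0 with h | h
  · simp [h]
  · push_cast; field_simp

theorem q_zpow_eq (p : ℕ) (n : ℤ) : q p ^ n = qHalf p ^ (2 * n) := by
  rw [zpow_mul, qHalf_sq]

theorem q_pow_p [NeZero p] : q p ^ (p : ℤ) = -1 := by
  have h : (p : ℂ) ≠ 0 := Nat.cast_ne_zero.2 (NeZero.ne p)
  rw [q, ← Complex.exp_int_mul, ← Complex.exp_pi_mul_I]
  congr 1
  push_cast; field_simp

theorem q_zpow_mul_p [NeZero p] (n : ℤ) : q p ^ (n * p) = (-1) ^ n := by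
  rw [mul_comm, zpow_mul, q_pow_p]

theorem qHalf_zpow_four_mul [NeZero p] (n : ℤ) : qHalf p ^ (4 * (p : ℤ) * n) = 1 := by
  rw [show 4 * (p : ℤ) * n = 2 * ((2 * n) * p) by ring, ← q_zpow_eq, q_zpow_mul_p, zpow_mul]
  norm_num

/-- `𝔮^{2n}`. -/
def qq (p : ℕ) (n : ℤ) : ℂ := q p ^ (2 * n)

theorem qq_ne_zero (n : ℤ) : qq p n ≠ 0 := zpow_ne_zero _ (q_ne_zero p)

@[simp] theorem qq_zero : qq p 0 = 1 := by simp [qq]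

theorem qq_add (m n : ℤ) : qq p (m + n) = qq p m * qq p n := by
  rw [qq, qq, qq, mul_add, zpow_add₀ (q_ne_zero p)]

theorem qq_neg (n : ℤ) : qq p (-n) = (qq p n)⁻¹ := by
  rw [qq, qq, mul_neg, zpow_neg]

theorem qq_sub (m n : ℤ) : qq p (m - n) = qq p m / qq p n := by
  rw [sub_eq_add_neg, qq_add, qq_neg, div_eq_mul_inv]

theorem qq_one : qq p 1 = q p ^ 2 := by
  rw [qq, mul_one]; norm_cast

/-- `𝔮²` is a primitive `p`-th root of unity. The vanishing and non-vanishing of `⟨n⟩` and `1 -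
𝔮^{2n}` is always reduced to divisibility by `p` through this fact. -/
theorem qq_eq_one_iff [NeZero p] (n : ℤ) : qq p n = 1 ↔ (p : ℤ) ∣ n := by
  have h : (p : ℂ) ≠ 0 := Nat.cast_ne_zero.2 (NeZero.ne p)
  rw [qq, q, ← Complex.exp_int_mul, Complex.exp_eq_one_iff]
  have h2 : (2 * Real.pi * Complex.I : ℂ) ≠ 0 := Complex.two_pi_I_ne_zero
  constructor
  · rintro ⟨k, hk⟩
    refine ⟨k, ?_⟩
    push_cast at hk
    field_simp at hk
    exact_mod_cast hk
  · rintro ⟨k, rfl⟩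
    refine ⟨k, ?_⟩
    push_cast; field_simp

theorem qq_mul_p [NeZero p] (n : ℤ) : qq p (n * p) = 1 :=
  (qq_eq_one_iff _).2 (dvd_mul_left _ _)

theorem qq_congr [NeZero p] {m n : ℤ} (h : (p : ℤ) ∣ m - n) : qq p m = qq p n := by
  have := (qq_eq_one_iff (p := p) _).2 h
  rwa [qq_sub, div_eq_one_iff_eq (qq_ne_zero n)] at this

theorem qq_one_ne [NeZero p] (hp : 2 ≤ p) : qq p 1 ≠ 1 := by
  rw [Ne, qq_eq_one_iff]
  intro h
  have := Int.le_of_dvd one_pos h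
  omega

theorem one_sub_qq_ne [NeZero p] (hp : 2 ≤ p) : 1 - qq p 1 ≠ 0 :=
  sub_ne_zero.2 (qq_one_ne hp).symm

theorem qInt_eq (n : ℤ) : qInt p n = (1 - qq p n) / (1 - qq p 1) := by
  rw [qInt, qq_one, qq, ← neg_sub, ← neg_sub (1 : ℂ), neg_div_neg_eq]

theorem xi_eq : xi p = 1 - qq p 1 := by rw [xi, qq_one]

theorem xi_mul_qInt [NeZero p] (hp : 2 ≤ p) (n : ℤ) : xi p * qInt p n = 1 - qq p n := by
  rw [xi_eq, qInt_eq, mul_div_cancel₀ _ (one_sub_qq_ne hp)]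

@[simp] theorem qInt_zero : qInt p 0 = 0 := by simp [qInt_eq]

theorem qInt_one [NeZero p] (hp : 2 ≤ p) : qInt p 1 = 1 := by
  rw [qInt_eq, div_self (one_sub_qq_ne hp)]

theorem qInt_add (m n : ℤ) : qInt p (m + n) = qInt p m + qq p m * qInt p n := by
  rw [qInt_eq, qInt_eq, qInt_eq, qq_add]; ring

theorem qInt_eq_zero_iff [NeZero p] (hp : 2 ≤ p) (n : ℤ) : qInt p n = 0 ↔ (p : ℤ) ∣ n := by
  rw [qInt_eq, div_eq_zero_iff, or_iff_left (one_sub_qq_ne hp), sub_eq_zero, eq_comm,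
    qq_eq_one_iff]

theorem qInt_ne_zero_of_lt [NeZero p] (hp : 2 ≤ p) {n : ℤ} (h0 : 0 < n) (h : n < p) :
    qInt p n ≠ 0 := by
  rw [Ne, qInt_eq_zero_iff hp]
  intro hd
  have := Int.le_of_dvd h0 hd
  omega

@[simp] theorem qFac_zero : qFac p 0 = 1 := by simp [qFac]

theorem qFac_succ (n : ℕ) : qFac p (n + 1) = qFac p n * qInt p (n + 1) := by
  rw [qFac, qFac, Finset.prod_range_succ]

theorem qFac_one [NeZero p] (hp : 2 ≤ p) : qFac p 1 = 1 := by
  rw [qFac_succ]; simp [qInt_one hp]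

theorem qFac_ne_zero [NeZero p] (hp : 2 ≤ p) {n : ℕ} (h : n < p) : qFac p n ≠ 0 := by
  rw [qFac, Finset.prod_ne_zero_iff]
  intro i hi
  rw [Finset.mem_range] at hi
  exact qInt_ne_zero_of_lt hp (by positivity) (by omega)

/-- `chargeForm` is computed on representatives, but the `4p`-th power of `𝔮^{1/2}` is `1`, so any
integer lifts will do. All braiding exponents can therefore be treated as integer expressions. -/
theorem chargeForm_intCast [NeZero p] (i j : ℤ) :
    chargeForm p (i : ZMod (4 * p)) (j : ZMod (4 * p)) = qHalf p ^ (i * j) := by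
  have key : ∀ a b : ℤ, ((4 * p : ℕ) : ℤ) ∣ a - b → qHalf p ^ a = qHalf p ^ b := by
    rintro a b ⟨k, hk⟩
    rw [show a = b + 4 * (p : ℤ) * k by push_cast at hk; linarith, zpow_add₀ (qHalf_ne_zero p),
      qHalf_zpow_four_mul, mul_one]
  rw [chargeForm, ← zpow_natCast]
  apply key
  rw [← ZMod.intCast_zmod_eq_zero_iff_dvd]
  push_cast
  simp

end numbers

end
end NicholsLoop
namespace NicholsLoop
noncomputable section

/-! ### Bases, gradings and the Nichols algebra on basis vectors -/

section bases

theorem linOfBasis_single {ι : Type v} [Fintype ι] [DecidableEq ι] {W : Type w} [AddCommGroup W]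
    [Module ℂ W] (c : ι → W) (i : ι) : linOfBasis c (Pi.single i 1) = c i := by
  rw [linOfBasis, ← Pi.basisFun_apply, Module.Basis.constr_basis]

theorem vec_eq_single {n k : ℕ} (h : k < n) : vec n k = Pi.single ⟨k, h⟩ 1 := by
  rw [vec, dif_pos h]

theorem vec_eq_zero {n k : ℕ} (h : n ≤ k) : vec n k = 0 := by
  rw [vec, dif_neg (by omega)]

theorem linOfBasis_vec {n : ℕ} {W : Type w} [AddCommGroup W]
    [Module ℂ W] (c : Fin n → W) {k : ℕ} (h : k < n) : linOfBasis c (vec n k) = c ⟨k, h⟩ := by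
  rw [vec_eq_single h, linOfBasis_single]

theorem linOfBasis₂_single {ι : Type u} {κ : Type v} [Fintype ι] [DecidableEq ι] [Fintype κ]
    [DecidableEq κ] {W : Type w} [AddCommGroup W] [Module ℂ W] (c : ι → κ → W) (i : ι) (k : κ) :
    linOfBasis₂ c (Pi.single i 1 ⊗ₜ[ℂ] Pi.single k 1) = c i k := by
  rw [linOfBasis₂, TensorProduct.lift.tmul, linOfBasis_single, linOfBasis_single]

theorem pi_hom_ext {ι : Type u} [Finite ι] [DecidableEq ι] {W : Type w} [AddCommGroup W]
    [Module ℂ W] {f g : (ι → ℂ) →ₗ[ℂ] W} (h : ∀ i, f (Pi.single i 1) = g (Pi.single i 1)) :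
    f = g := by
  refine (Pi.basisFun ℂ ι).ext fun i => ?_
  rw [Pi.basisFun_apply, h]

theorem coordProj_single {p : ℕ} {ι : Type u} [DecidableEq ι] (c : ι → ZMod (4 * p))
    (j : ZMod (4 * p)) (i : ι) :
    coordProj c j (Pi.single i 1) = if c i = j then Pi.single i 1 else 0 := by
  ext k
  simp only [coordProj, LinearMap.pi_apply]
  rcases eq_or_ne k i with rfl | hk
  · split_ifs <;> simp
  · split_ifs <;> simp [hk]

theorem coordProj_complete {p : ℕ} [NeZero p] {ι : Type u} [Finite ι] [DecidableEq ι]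
    (c : ι → ZMod (4 * p)) : CompleteOrthogonalIdempotents (coordProj c) := by
  rw [CompleteOrthogonalIdempotents.iff_ortho_complete]
  constructor
  · intro i j hij
    refine pi_hom_ext fun k => ?_
    rw [Module.End.mul_apply, coordProj_single]
    split_ifs with h
    · rw [coordProj_single, if_neg (by rw [h]; exact hij.symm)]; rfl
    · simp
  · refine pi_hom_ext fun k => ?_
    simp [LinearMap.sum_apply, coordProj_single]

variable {p : ℕ} [NeZero p]

theorem braid_tmul {V : Type u} {W : Type v}
    [AddCommGroup V] [Module ℂ V] [AddCommGroup W] [Module ℂ W]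
    {P : ZMod (4 * p) → Module.End ℂ V} {R : ZMod (4 * p) → Module.End ℂ W}
    (hP : OrthogonalIdempotents P) (hR : OrthogonalIdempotents R) {i j : ZMod (4 * p)} {x : V}
    {y : W} (hx : P i x = x) (hy : R j y = y) :
    braid P R (x ⊗ₜ[ℂ] y) = chargeForm p i j • (y ⊗ₜ[ℂ] x) := by
  have h1 : ∀ i', i' ≠ i → P i' x = 0 := fun i' hi => by
    rw [← hx, ← Module.End.mul_apply, hP.ortho hi]; rfl
  have h2 : ∀ j', j' ≠ j → R j' y = 0 := fun j' hj => by
    rw [← hy, ← Module.End.mul_apply, hR.ortho hj]; rfl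
  simp only [braid, LinearMap.sum_apply, LinearMap.smul_apply, LinearMap.comp_apply,
    TensorProduct.map_tmul]
  rw [Finset.sum_eq_single i, Finset.sum_eq_single j]
  · simp [hx, hy]
  · intro j' _ hj; simp [h2 j' hj]
  · simp
  · intro i' _ hi; simp [h1 i' hi]
  · simp

theorem nichProj_complete : CompleteOrthogonalIdempotents (nichProj p) := coordProj_complete _

theorem F_eq_single {r : ℕ} (h : r < p) : F p r = Pi.single ⟨r, h⟩ 1 := vec_eq_single h

theorem F_eq_zero {r : ℕ} (h : p ≤ r) : F p r = 0 := vec_eq_zero h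

theorem nichProj_F (r : ℕ) : nichProj p ((-2 * (r : ℤ) : ℤ) : ZMod (4 * p)) (F p r) = F p r := by
  rcases lt_or_ge r p with h | h
  · rw [F_eq_single h, nichProj, coordProj_single, if_pos rfl]
  · rw [F_eq_zero h, map_zero]

theorem nichMul_F {r s : ℕ} (hr : r < p) (hs : s < p) :
    nichMul p (F p r ⊗ₜ[ℂ] F p s) = qBinom p (r + s) r • F p (r + s) := by
  rw [F_eq_single hr, F_eq_single hs, nichMul, linOfBasis₂_single]

theorem nichComul_F {r : ℕ} (hr : r < p) :
    nichComul p (F p r) = ∑ s ∈ Finset.range (r + 1), F p s ⊗ₜ[ℂ] F p (r - s) := by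
  rw [F_eq_single hr, nichComul, linOfBasis_single]

theorem nichCounit_F {r : ℕ} (hr : r < p) : nichCounit p (F p r) = if r = 0 then 1 else 0 := by
  rw [F_eq_single hr, nichCounit, linOfBasis_single]

theorem nichAntipode_F {r : ℕ} (hr : r < p) :
    nichAntipode p (F p r) = ((-1) ^ r * q p ^ ((r : ℤ) * ((r : ℤ) - 1))) • F p r := by
  rw [F_eq_single hr, nichAntipode, linOfBasis_single, ← F_eq_single hr]

theorem nich_hom_ext {W : Type w} [AddCommGroup W] [Module ℂ W] {f g : Nich p →ₗ[ℂ] W}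
    (h : ∀ r < p, f (F p r) = g (F p r)) : f = g :=
  pi_hom_ext fun i => by rw [← F_eq_single i.2]; exact h i i.2

theorem nich_tensor_hom_ext {V : Type v} {W : Type w} [AddCommGroup V] [Module ℂ V]
    [AddCommGroup W] [Module ℂ W] {f g : Nich p ⊗[ℂ] V →ₗ[ℂ] W}
    (h : ∀ r < p, ∀ x, f (F p r ⊗ₜ[ℂ] x) = g (F p r ⊗ₜ[ℂ] x)) : f = g := by
  refine TensorProduct.ext (nich_hom_ext fun r hr => LinearMap.ext fun x => ?_)
  exact h r hr x

/-- The functional `F(k) ↦ δ_{n,k}` on the Nichols algebra. -/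
def nichCoord (p n : ℕ) : Nich p →ₗ[ℂ] ℂ := if h : n < p then LinearMap.proj ⟨n, h⟩ else 0

theorem nichCoord_F {n : ℕ} (hn : n < p) (k : ℕ) :
    nichCoord p n (F p k) = if k = n then 1 else 0 := by
  rw [nichCoord, dif_pos hn]
  rcases lt_or_ge k p with h | h
  · rw [F_eq_single h, LinearMap.proj_apply, Pi.single_apply]
    simp [eq_comm]
  · rw [F_eq_zero h, if_neg (by omega)]; rfl

/-- The `F(n)`-component of a tensor. -/
def comp (p n : ℕ) (V : Type v) [AddCommGroup V] [Module ℂ V] : Nich p ⊗[ℂ] V →ₗ[ℂ] V :=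
  (TensorProduct.lid ℂ V).toLinearMap ∘ₗ (nichCoord p n).rTensor V

theorem comp_tmul {n : ℕ} (hn : n < p) {V : Type v} [AddCommGroup V] [Module ℂ V] (k : ℕ) (x : V) :
    comp p n V (F p k ⊗ₜ[ℂ] x) = if k = n then x else 0 := by
  simp only [comp, LinearMap.comp_apply, LinearMap.rTensor_tmul, nichCoord_F hn,
    LinearEquiv.coe_coe, TensorProduct.lid_tmul]
  split_ifs <;> simp

/-- The basis `F(k)` splits the tensor product into `p` copies of `V`; coactions and both sides of
the Yetter–Drinfeld axiom are compared component by component. -/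
theorem sum_comp {V : Type v} [AddCommGroup V] [Module ℂ V] (t : Nich p ⊗[ℂ] V) :
    t = ∑ k ∈ Finset.range p, F p k ⊗ₜ[ℂ] comp p k V t := by
  have : LinearMap.id = ∑ k ∈ Finset.range p,
      (TensorProduct.mk ℂ (Nich p) V (F p k)) ∘ₗ comp p k V := by
    refine nich_tensor_hom_ext fun r hr x => ?_
    simp only [LinearMap.sum_apply, LinearMap.comp_apply, LinearMap.id_apply,
      TensorProduct.mk_apply]
    rw [Finset.sum_eq_single r]
    · rw [comp_tmul hr, if_pos rfl]
    · intro k hk hkr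
      rw [comp_tmul (Finset.mem_range.1 hk), if_neg hkr.symm, TensorProduct.tmul_zero]
    · simp [hr]
  conv_lhs => rw [← LinearMap.id_apply (R := ℂ) t, this]
  simp [LinearMap.sum_apply]

theorem nich_tensor_ext {V : Type v} [AddCommGroup V] [Module ℂ V] {s t : Nich p ⊗[ℂ] V}
    (h : ∀ n < p, comp p n V s = comp p n V t) : s = t := by
  rw [sum_comp s, sum_comp t]
  exact Finset.sum_congr rfl fun k hk => by rw [h k (Finset.mem_range.1 hk)]

theorem comp_sum {V : Type v} [AddCommGroup V] [Module ℂ V] {n : ℕ} (hn : n < p) (x : ℕ → V) :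
    comp p n V (∑ k ∈ Finset.range p, F p k ⊗ₜ[ℂ] x k) = x n := by
  rw [map_sum, Finset.sum_eq_single n]
  · rw [comp_tmul hn, if_pos rfl]
  · intro k _ hk; rw [comp_tmul hn, if_neg hk]
  · simp [hn]

end bases

/-! ### Raising and lowering operators -/

section raising

variable {p : ℕ} [NeZero p]

/-- `x` has charge `m`. -/
def Homog (M : ModCo.{u} p) (m : ℤ) (x : M) : Prop := M.proj (m : ZMod (4 * p)) x = x

/-- The action of `F = F(1)`. -/
def lower (M : ModCo.{u} p) : Module.End ℂ M := M.act ∘ₗ TensorProduct.mk ℂ (Nich p) M (F p 1)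

/-- The `F(1)`-component of the coaction. -/
def raise (M : ModCo.{u} p) : Module.End ℂ M := comp p 1 M ∘ₗ M.coact

/-- The grading, action and coaction of `M` are expressed through a lowering operator `G` and a
raising operator `E`. -/
structure IsLowerRaise (M : ModCo.{u} p) (E G : Module.End ℂ M) : Prop where
  grading : CompleteOrthogonalIdempotents M.proj
  homog_raise : ∀ m x, Homog M m x → Homog M (m + 2) (E x)
  homog_lower : ∀ m x, Homog M m x → Homog M (m - 2) (G x)
  raise_pow : E ^ p = 0
  lower_pow : G ^ p = 0
  act_F : ∀ r < p, ∀ x : M, M.act (F p r ⊗ₜ[ℂ] x) = (qFac p r)⁻¹ • (G ^ r) x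
  coact_eq : ∀ x : M, M.coact x = ∑ k ∈ Finset.range p, F p k ⊗ₜ[ℂ] (E ^ k) x

/-- The commutation relation `E F - 𝔮² F E = 1 - 𝔮^{-2m}` on vectors of charge `m`. -/
def Commutes (M : ModCo.{u} p) (E G : Module.End ℂ M) : Prop :=
  ∀ m x, Homog M m x → E (G x) = qq p 1 • G (E x) + (1 - qq p (-m)) • x

theorem Homog.zero {M : ModCo.{u} p} (m : ℤ) : Homog M m 0 := map_zero _

theorem Homog.add {M : ModCo.{u} p} {m : ℤ} {x y : M} (hx : Homog M m x) (hy : Homog M m y) :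
    Homog M m (x + y) := by rw [Homog, map_add, hx, hy]

theorem Homog.smul {M : ModCo.{u} p} {m : ℤ} {x : M} (hx : Homog M m x) (c : ℂ) :
    Homog M m (c • x) := by rw [Homog, map_smul, hx]

theorem Homog.congr {M : ModCo.{u} p} {m n : ℤ} {x : M} (hx : Homog M m x)
    (h : (m : ZMod (4 * p)) = n) : Homog M n x := by rw [Homog, ← h]; exact hx

theorem homog_proj {M : ModCo.{u} p} (h : CompleteOrthogonalIdempotents M.proj)
    (j : ZMod (4 * p)) (x : M) : Homog M (j.val : ℤ) (M.proj j x) := by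
  rw [Homog, Int.cast_natCast, ZMod.natCast_val, ZMod.cast_id, ← Module.End.mul_apply, h.idem j]

theorem sum_proj {M : ModCo.{u} p} (h : CompleteOrthogonalIdempotents M.proj) (x : M) :
    x = ∑ j, M.proj j x := by
  have := LinearMap.congr_fun h.complete x
  rwa [LinearMap.sum_apply, Module.End.one_apply, eq_comm] at this

/-- Each graded component is homogeneous for the integer representative of its charge, so it is
enough to test on vectors that carry an integer charge. -/
theorem hom_ext_homog {M : ModCo.{u} p} (h : CompleteOrthogonalIdempotents M.proj) {W : Type w}
    [AddCommGroup W] [Module ℂ W] {f g : M →ₗ[ℂ] W}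
    (hfg : ∀ (m : ℤ) (x : M), Homog M m x → f x = g x) : f = g := by
  ext x
  rw [sum_proj h x, map_sum, map_sum]
  exact Finset.sum_congr rfl fun j _ => hfg _ _ (homog_proj h j x)

theorem Homog.proj_eq {M : ModCo.{u} p} (h : CompleteOrthogonalIdempotents M.proj) {m : ℤ} {x : M}
    (hx : Homog M m x) (j : ZMod (4 * p)) : M.proj j x = if (m : ZMod (4 * p)) = j then x else 0 := by
  split_ifs with hj
  · rw [← hj]; exact hx
  · rw [← hx, ← Module.End.mul_apply, h.ortho (Ne.symm hj)]; rfl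

section basic

variable {M : ModCo.{u} p} {E G : Module.End ℂ M} (h : IsLowerRaise M E G)
include h

theorem IsLowerRaise.lower_eq (hp : 2 ≤ p) : lower M = G := by
  ext x
  rw [lower, LinearMap.comp_apply, TensorProduct.mk_apply, h.act_F 1 (by omega), qFac_one hp]
  simp

theorem IsLowerRaise.raise_eq (hp : 2 ≤ p) : raise M = E := by
  ext x
  rw [raise, LinearMap.comp_apply, h.coact_eq, comp_sum (by omega) fun k => (E ^ k) x, pow_one]

theorem IsLowerRaise.homog_raise_pow {m : ℤ} {x : M} (hx : Homog M m x) (k : ℕ) :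
    Homog M (m + 2 * k) ((E ^ k) x) := by
  induction k with
  | zero => simpa using hx
  | succ k ih =>
    rw [pow_succ', Module.End.mul_apply]
    convert h.homog_raise _ _ ih using 1
    push_cast; ring

theorem IsLowerRaise.homog_lower_pow {m : ℤ} {x : M} (hx : Homog M m x) (k : ℕ) :
    Homog M (m - 2 * k) ((G ^ k) x) := by
  induction k with
  | zero => simpa using hx
  | succ k ih =>
    rw [pow_succ', Module.End.mul_apply]
    convert h.homog_lower _ _ ih using 1
    push_cast; ring

/-- Moving `F(r-s)` past `y`, and later past `E^k G^s y`, contributes the exponents `-2(r-s)m` and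
`-2(r-s)(m-2s+2k)` of `𝔮^{1/2}`; together they form a single power of `𝔮²`. -/
theorem IsLowerRaise.ydLeft_apply {r : ℕ} (hr : r < p) {m : ℤ} {y : M} (hy : Homog M m y) :
    ydLeft M (F p r ⊗ₜ[ℂ] y) = ∑ s ∈ Finset.range (r + 1), ∑ k ∈ Finset.range p,
      (qq p (-(((r : ℤ) - s) * (m - s + k))) * qBinom p (k + (r - s)) k * (qFac p s)⁻¹) •
        F p (k + (r - s)) ⊗ₜ[ℂ] (E ^ k) ((G ^ s) y) := by
  have hb : OrthogonalIdempotents (nichProj p) := nichProj_complete.toOrthogonalIdempotents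
  simp only [ydLeft, LinearMap.comp_apply, LinearMap.rTensor_tmul, nichComul_F hr,
    TensorProduct.sum_tmul, map_sum, LinearEquiv.coe_coe, TensorProduct.assoc_tmul,
    LinearMap.lTensor_tmul, braid_tmul hb h.grading.toOrthogonalIdempotents (nichProj_F _) hy,
    TensorProduct.tmul_smul, map_smul, TensorProduct.assoc_symm_tmul]
  refine Finset.sum_congr rfl fun s hs => ?_
  rw [Finset.mem_range] at hs
  rw [h.act_F s (by omega), map_smul, h.coact_eq]
  simp only [TensorProduct.sum_tmul, map_sum, Finset.smul_sum]
  refine Finset.sum_congr rfl fun k hk => ?_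
  rw [Finset.mem_range] at hk
  simp only [← TensorProduct.smul_tmul', map_smul, TensorProduct.assoc_tmul,
    LinearMap.lTensor_tmul]
  rw [braid_tmul h.grading.toOrthogonalIdempotents hb
    (h.homog_raise_pow (h.homog_lower_pow hy s) k) (nichProj_F _)]
  simp only [TensorProduct.tmul_smul, map_smul, TensorProduct.assoc_symm_tmul,
    LinearMap.rTensor_tmul, nichMul_F hk (show r - s < p by omega)]
  rw [← TensorProduct.smul_tmul', smul_smul, smul_smul, smul_smul, chargeForm_intCast,
    chargeForm_intCast]
  congr 1
  rw [qq, q_zpow_eq, Nat.cast_sub (by omega)]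
  rw [show 2 * (2 * -(((r : ℤ) - s) * (m - s + k))) =
    (-2 * ((r : ℤ) - s) * m) + (m - 2 * s + 2 * k) * (-2 * ((r : ℤ) - s)) by ring,
    zpow_add₀ (qHalf_ne_zero p)]
  ring

theorem IsLowerRaise.ydRight_apply {r : ℕ} (hr : r < p) (y : M) :
    ydRight M (F p r ⊗ₜ[ℂ] y) = ∑ s ∈ Finset.range (r + 1), ∑ k ∈ Finset.range p,
      (qq p (((r : ℤ) - s) * k) * qBinom p (s + k) s * (qFac p (r - s))⁻¹) •
        F p (s + k) ⊗ₜ[ℂ] (G ^ (r - s)) ((E ^ k) y) := by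
  have hb : OrthogonalIdempotents (nichProj p) := nichProj_complete.toOrthogonalIdempotents
  simp only [ydRight, LinearMap.comp_apply, TensorProduct.map_tmul, nichComul_F hr, h.coact_eq,
    TensorProduct.sum_tmul, TensorProduct.tmul_sum, map_sum, LinearEquiv.coe_coe,
    TensorProduct.assoc_tmul, LinearMap.lTensor_tmul, TensorProduct.assoc_symm_tmul,
    LinearMap.rTensor_tmul, braid_tmul hb hb (nichProj_F _) (nichProj_F _)]
  rw [Finset.sum_comm]
  refine Finset.sum_congr rfl fun s hs => Finset.sum_congr rfl fun k hk => ?_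
  rw [Finset.mem_range] at hs hk
  simp only [← TensorProduct.smul_tmul', map_smul, TensorProduct.assoc_tmul,
    TensorProduct.assoc_symm_tmul, TensorProduct.tmul_smul, TensorProduct.map_tmul,
    nichMul_F (show s < p by omega) hk, h.act_F (r - s) (by omega)]
  rw [smul_smul, smul_smul, chargeForm_intCast]
  congr 1
  rw [qq, q_zpow_eq, Nat.cast_sub (by omega)]
  rw [show -2 * ((r : ℤ) - s) * (-2 * k) = 2 * (2 * (((r : ℤ) - s) * k)) by ring]
  ring

end basic

end raising

end
end NicholsLoop
namespace NicholsLoop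
noncomputable section

/-! ### The Yetter–Drinfeld axioms in terms of raising and lowering operators -/

section EF

variable {p : ℕ} [NeZero p]

/-- `M` is the Yetter–Drinfeld module given by the raising operator `E` and the lowering
operator `G`. -/
structure IsEF (M : ModCo.{u} p) (E G : Module.End ℂ M) : Prop extends IsLowerRaise M E G where
  comm : Commutes M E G

/-- Iteration of the commutation relation: each passage of an `E` through `G` adds a multiple of
`E^n`, and the accumulated scalar closes up to one product. -/
theorem IsEF.raise_pow_lower {M : ModCo.{u} p} {E G : Module.End ℂ M} (hp : 2 ≤ p)
    (h : IsEF M E G) {m : ℤ} {x : M} (hx : Homog M m x) (n : ℕ) :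
    (E ^ (n + 1)) (G x) = qq p (n + 1) • G ((E ^ (n + 1)) x) +
      (qInt p (n + 1) * (1 - qq p (-(m + n)))) • (E ^ n) x := by
  have h0 := one_sub_qq_ne hp
  induction n with
  | zero =>
    simp [h.comm m x hx, qInt_one hp]
  | succ n ih =>
    rw [pow_succ' E (n + 1), Module.End.mul_apply, ih, map_add, map_smul, map_smul,
      h.comm _ _ (h.homog_raise_pow hx (n + 1)), ← Module.End.mul_apply E, ← pow_succ',
      ← Module.End.mul_apply E, ← pow_succ', smul_add, smul_smul, smul_smul, add_assoc, ← add_smul]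
    congr 2
    · rw [← qq_add]; push_cast; rfl
    · push_cast
      rw [qInt_add (n + 1 : ℤ) 1]
      rw [show (-(m + 2 * (n + 1)) : ℤ) = -m + -n + -n + -1 + -1 by ring,
        show (-(m + n) : ℤ) = -m + -n by ring, show (-(m + (n + 1)) : ℤ) = -m + -n + -1 by ring,
        qInt_eq, qInt_eq]
      simp only [qq_add, qq_neg]
      have h1 := qq_ne_zero (p := p) 1
      have h2 := qq_ne_zero (p := p) n
      have h3 := qq_ne_zero (p := p) m
      field_simp
      ring

theorem IsEF.raise_lower_pow {M : ModCo.{u} p} {E G : Module.End ℂ M} (hp : 2 ≤ p)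
    (h : IsEF M E G) {m : ℤ} {x : M} (hx : Homog M m x) (n : ℕ) :
    E ((G ^ (n + 1)) x) = qq p (n + 1) • (G ^ (n + 1)) (E x) +
      (qInt p (n + 1) * (1 - qq p (-(m - n)))) • (G ^ n) x := by
  have h0 := one_sub_qq_ne hp
  induction n with
  | zero => simp [h.comm m x hx, qInt_one hp]
  | succ n ih =>
    rw [pow_succ' G (n + 1), Module.End.mul_apply, h.comm _ _ (h.homog_lower_pow hx (n + 1)), ih,
      map_add, map_smul, map_smul,
      ← Module.End.mul_apply G, ← pow_succ',
      ← Module.End.mul_apply G, ← pow_succ', smul_add, smul_smul, smul_smul, add_assoc, ← add_smul]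
    congr 2
    · rw [← qq_add]; congr 1; push_cast; ring
    · push_cast
      rw [qInt_add (n + 1 : ℤ) 1]
      rw [show (-(m - 2 * (n + 1)) : ℤ) = -m + n + n + 1 + 1 by ring,
        show (-(m - n) : ℤ) = -m + n by ring, show (-(m - (n + 1)) : ℤ) = -m + n + 1 by ring,
        qInt_eq, qInt_eq]
      simp only [qq_add, qq_neg]
      have h1 := qq_ne_zero (p := p) 1
      have h2 := qq_ne_zero (p := p) n
      have h3 := qq_ne_zero (p := p) m
      field_simp
      ring

/-- The divided powers of an endomorphism, `0` for negative exponents. -/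
def divPow (p : ℕ) {V : Type u} [AddCommGroup V] [Module ℂ V] (E : Module.End ℂ V) (z : ℤ) :
    Module.End ℂ V := if 0 ≤ z then (qFac p z.toNat)⁻¹ • E ^ z.toNat else 0

section divPow

variable {V : Type u} [AddCommGroup V] [Module ℂ V] (E : Module.End ℂ V)

theorem divPow_natCast (n : ℕ) : divPow p E n = (qFac p n)⁻¹ • E ^ n := by
  simp [divPow]

theorem divPow_of_neg {z : ℤ} (hz : z < 0) : divPow p E z = 0 := by
  rw [divPow, if_neg (by omega)]

end divPow

/-- Division by `⟨z⟩!` is possible because `z < p`. With integer exponents, and zero for negative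
ones, the later sums over `j` have no boundary cases. -/
theorem IsEF.divPow_lower (hp : 2 ≤ p) {M : ModCo.{u} p} {E G : Module.End ℂ M} (h : IsEF M E G)
    {m : ℤ} {x : M} (hx : Homog M m x) {z : ℤ} (hz : z < p) :
    divPow p E z (G x) = qq p z • G (divPow p E z x) +
      (1 - qq p (-(m + z - 1))) • divPow p E (z - 1) x := by
  rcases lt_trichotomy z 0 with h0 | rfl | h0
  · simp [divPow_of_neg E h0, divPow_of_neg E (show z - 1 < 0 by omega)]
  · simp [divPow]
  · obtain ⟨n, rfl⟩ : ∃ n : ℕ, z = (n + 1 : ℕ) := ⟨(z - 1).toNat, by push_cast; omega⟩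
    rw [divPow_natCast, show ((n + 1 : ℕ) : ℤ) - 1 = n by push_cast; ring, divPow_natCast,
      LinearMap.smul_apply, h.raise_pow_lower hp hx, LinearMap.smul_apply, LinearMap.smul_apply,
      smul_add, map_smul, smul_smul, smul_smul, smul_smul, smul_smul]
    have hn : qFac p n ≠ 0 := qFac_ne_zero hp (by push_cast at hz; omega)
    have hn1 : qInt p (n + 1) ≠ 0 := qInt_ne_zero_of_lt hp (by omega) (by push_cast at hz; omega)
    congr 2
    · push_cast; ring
    · rw [qFac_succ, show m + ((n + 1 : ℕ) : ℤ) - 1 = m + n by push_cast; ring]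
      field_simp

/-- The pattern of a `q`-Pascal rule: the inner terms split in two, and each of the two end terms
belongs to one sum only. -/
theorem sum_range_eq_add {V : Type u} [AddCommGroup V] {r : ℕ} {t a b : ℕ → V} (h0 : t 0 = a 0)
    (hr : t (r + 1) = b r) (h : ∀ s < r, t (s + 1) = a (s + 1) + b s) :
    ∑ s ∈ Finset.range (r + 2), t s =
      ∑ s ∈ Finset.range (r + 1), a s + ∑ s ∈ Finset.range (r + 1), b s := by
  rw [Finset.sum_range_succ, Finset.sum_range_succ', h0, hr, Finset.sum_range_succ' a,
    Finset.sum_range_succ b,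
    Finset.sum_congr rfl fun s hs => h s (Finset.mem_range.1 hs), Finset.sum_add_distrib]
  abel

/-- The `F(z)`-component of the left-hand side of the Yetter–Drinfeld axiom, divided by `⟨z⟩!`. -/
def ydLeftCoeff (M : ModCo.{u} p) (E G : Module.End ℂ M) (m z : ℤ) (r : ℕ) (y : M) : M :=
  ∑ j ∈ Finset.range (r + 1), (qq p (-(j * (m + z - r))) * (qFac p j)⁻¹ * (qFac p (r - j))⁻¹) •
    divPow p E (z - j) ((G ^ (r - j)) y)

/-- The `F(z)`-component of the right-hand side of the Yetter–Drinfeld axiom, divided by `⟨z⟩!`. -/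
def ydRightCoeff (M : ModCo.{u} p) (E G : Module.End ℂ M) (z : ℤ) (r : ℕ) (y : M) : M :=
  ∑ s ∈ Finset.range (r + 1), (qq p ((r - s) * (z - s)) * (qFac p s)⁻¹ * (qFac p (r - s))⁻¹) •
    (G ^ (r - s)) (divPow p E (z - s) y)

/-- Split `⟨r+1⟩ = ⟨s⟩ + 𝔮^{2s} ⟨r+1-s⟩` in each term. The powers of `G` already stand on the left,
so no commutation of `E` with `G` is needed. -/
theorem ydRightCoeff_succ (hp : 2 ≤ p) (M : ModCo.{u} p) (E G : Module.End ℂ M) (z : ℤ) {r : ℕ}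
    (hr : r + 1 < p) (y : M) :
    qInt p (r + 1) • ydRightCoeff M E G z (r + 1) y =
      qq p z • G (ydRightCoeff M E G z r y) + ydRightCoeff M E G (z - 1) r y := by
  simp only [ydRightCoeff, map_sum, map_smul, Finset.smul_sum, smul_smul]
  have hf : ∀ n, n ≤ r + 1 → qFac p n ≠ 0 := fun n hn => qFac_ne_zero hp (by omega)
  have hi : ∀ n : ℕ, n ≤ r → qInt p (n + 1) ≠ 0 := fun n hn =>
    qInt_ne_zero_of_lt hp (by omega) (by omega)
  apply sum_range_eq_add
  · simp only [Nat.sub_zero, Nat.cast_zero, sub_zero]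
    rw [← Module.End.mul_apply G, ← pow_succ']
    congr 1
    have := hf r (by omega)
    have := hi r le_rfl
    rw [qFac_succ, show (((r + 1 : ℕ) : ℤ)) * z = z + r * z by push_cast; ring, qq_add]
    field_simp
  · have := hf r (by omega)
    have := hi r le_rfl
    rw [show z - ((r + 1 : ℕ) : ℤ) = z - 1 - r by push_cast; ring]
    simp only [Nat.sub_self, sub_self, zero_mul, qq_zero, qFac_succ]
    congr 1
    field_simp
  · intro s hs
    obtain ⟨d, rfl⟩ : ∃ d, r = s + 1 + d := ⟨r - (s + 1), by omega⟩
    rw [show s + 1 + d + 1 - (s + 1) = d + 1 by omega, show s + 1 + d - (s + 1) = d by omega,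
      show s + 1 + d - s = d + 1 by omega, ← Module.End.mul_apply G, ← pow_succ',
      show z - ((s + 1 : ℕ) : ℤ) = z - 1 - s by push_cast; ring, ← add_smul]
    congr 1
    have h1 := hf s (by omega)
    have h2 := hf d (by omega)
    have h3 := hi s (by omega)
    have h4 := hi d (by omega)
    have h5 : qInt p (((s + 1 + d : ℕ) : ℤ) + 1) =
        qInt p (s + 1) + qq p (s + 1) * qInt p (d + 1) := by
      rw [← qInt_add]; congr 1
    have h6 : qq p ((((s + 1 + d + 1 : ℕ) : ℤ) - ((s + 1 : ℕ) : ℤ)) * (z - 1 - s)) =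
        qq p (d * (z - 1 - s)) * qq p (z - 1 - s) := by
      rw [← qq_add]; congr 1; push_cast; ring
    have h7 : qq p ((((s + 1 + d : ℕ) : ℤ) - ((s + 1 : ℕ) : ℤ)) * (z - 1 - s)) =
        qq p (d * (z - 1 - s)) := by
      congr 1; push_cast; ring
    have h8 : qq p ((((s + 1 + d : ℕ) : ℤ) - s) * (z - 1 - s)) =
        qq p (d * (z - 1 - s)) * qq p (z - 1 - s) := by
      rw [← qq_add]; congr 1; push_cast; ring
    have h9 : qq p z = qq p (s + 1) * qq p (z - 1 - s) := by
      rw [← qq_add]; congr 1; ring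
    rw [h5, h6, h7, h8, h9, qFac_succ, qFac_succ]
    field_simp
    ring

/-- The same recursion as `ydRightCoeff_succ`. It comes from the opposite splitting `⟨r+1⟩ = ⟨r+1-j⟩
+ 𝔮^{2(r+1-j)} ⟨j⟩`, after one `G` has been moved to the left of the divided power of `E` by
`divPow_lower`. -/
theorem IsEF.ydLeftCoeff_succ (hp : 2 ≤ p) {M : ModCo.{u} p} {E G : Module.End ℂ M}
    (h : IsEF M E G) {m : ℤ} {y : M} (hy : Homog M m y) {z : ℤ} (hz : z < p) {r : ℕ}
    (hr : r + 1 < p) :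
    qInt p (r + 1) • ydLeftCoeff M E G m z (r + 1) y =
      qq p z • G (ydLeftCoeff M E G m z r y) + ydLeftCoeff M E G m (z - 1) r y := by
  simp only [ydLeftCoeff, map_sum, map_smul, Finset.smul_sum, smul_smul]
  have hf : ∀ n, n ≤ r + 1 → qFac p n ≠ 0 := fun n hn => qFac_ne_zero hp (by omega)
  have hi : ∀ n : ℕ, n ≤ r → qInt p (n + 1) ≠ 0 := fun n hn =>
    qInt_ne_zero_of_lt hp (by omega) (by omega)
  have key := sum_range_eq_add (r := r)
    (t := fun j => (qInt p (r + 1) * (qq p (-(j * (m + z - ((r + 1 : ℕ) : ℤ)))) * (qFac p j)⁻¹ *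
      (qFac p (r + 1 - j))⁻¹)) • divPow p E (z - j) ((G ^ (r + 1 - j)) y))
    (a := fun j => (qq p (-(j * (m + z - ((r + 1 : ℕ) : ℤ)))) * (qFac p j)⁻¹ *
      (qFac p (r - j))⁻¹) • divPow p E (z - j) ((G ^ (r + 1 - j)) y))
    (b := fun j => (qq p (r - j) * qq p (-((j + 1) * (m + z - ((r + 1 : ℕ) : ℤ)))) * (qFac p j)⁻¹ *
      (qFac p (r - j))⁻¹) • divPow p E (z - 1 - j) ((G ^ (r - j)) y)) ?_ ?_ ?_
  · rw [key, ← Finset.sum_add_distrib, ← Finset.sum_add_distrib]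
    refine Finset.sum_congr rfl fun j hj => ?_
    rw [Finset.mem_range] at hj
    rw [show r + 1 - j = (r - j) + 1 by omega, pow_succ', Module.End.mul_apply,
      h.divPow_lower hp (h.homog_lower_pow hy _) (show z - j < p by omega), smul_add, smul_smul,
      smul_smul, add_assoc, show z - j - 1 = z - 1 - j by ring, ← add_smul]
    congr 2
    · rw [show qq p z = qq p (z - j) * qq p j by rw [← qq_add]; congr 1; ring,
        show -((j : ℤ) * (m + z - ((r + 1 : ℕ) : ℤ))) = -((j : ℤ) * (m + z - r)) + j by
          push_cast; ring, qq_add]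
      ring
    · rw [Nat.cast_sub (by omega),
        show (-((j : ℤ) * (m + (z - 1) - r))) = -((j : ℤ) * (m + z - (r + 1 : ℕ))) by
          push_cast; ring, ← qq_add (r - j),
        show ((r : ℤ) - j + -((j + 1) * (m + z - (r + 1 : ℕ)))) =
          -((j : ℤ) * (m + z - (r + 1 : ℕ))) + -(m - 2 * (r - j) + (z - j) - 1) by
            push_cast; ring, qq_add]
      ring
  · have := hf r (by omega)
    have := hi r le_rfl
    simp only [Nat.sub_zero, Nat.cast_zero, zero_mul, neg_zero, qq_zero, qFac_succ]
    congr 1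
    field_simp
  · have := hf r (by omega)
    have := hi r le_rfl
    simp only [Nat.sub_self, sub_self, qq_zero, qFac_succ]
    rw [show z - ((r + 1 : ℕ) : ℤ) = z - 1 - r by push_cast; ring]
    congr 1
    push_cast
    field_simp
  · intro s hs
    obtain ⟨d, rfl⟩ : ∃ d, r = s + 1 + d := ⟨r - (s + 1), by omega⟩
    simp only [show s + 1 + d + 1 - (s + 1) = d + 1 by omega, show s + 1 + d - (s + 1) = d by omega,
      show s + 1 + d - s = d + 1 by omega]
    rw [show z - ((s + 1 : ℕ) : ℤ) = z - 1 - s by push_cast; ring, ← add_smul]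
    congr 1
    have h1 := hf s (by omega)
    have h2 := hf d (by omega)
    have h3 := hi s (by omega)
    have h4 := hi d (by omega)
    have h5 : qInt p (((s + 1 + d : ℕ) : ℤ) + 1) =
        qInt p (d + 1) + qq p (d + 1) * qInt p (s + 1) := by
      rw [← qInt_add]; congr 1; push_cast; ring
    rw [h5, qFac_succ, qFac_succ]
    rw [show ((s + 1 + d : ℕ) : ℤ) - s = d + 1 by push_cast; ring,
      show ((s + 1 : ℕ) : ℤ) = s + 1 by push_cast; ring]
    field_simp

/-- Both sides obey one recursion in `r`, in which `⟨r+1⟩` is invertible. The recursion also uses `z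
- 1`, so `z` stays quantified in the induction and must be allowed to become negative. -/
theorem IsEF.ydLeftCoeff_eq (hp : 2 ≤ p) {M : ModCo.{u} p} {E G : Module.End ℂ M}
    (h : IsEF M E G) {m : ℤ} {y : M} (hy : Homog M m y) {r : ℕ} (hr : r < p) :
    ∀ z : ℤ, z < p → ydLeftCoeff M E G m z r y = ydRightCoeff M E G z r y := by
  induction r with
  | zero => intro z hz; simp [ydLeftCoeff, ydRightCoeff]
  | succ r ih =>
    intro z hz
    have h1 := h.ydLeftCoeff_succ hp hy hz hr
    rw [ih (by omega) z hz, ih (by omega) (z - 1) (by omega), ← ydRightCoeff_succ hp M E G z hr] at h1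
    exact smul_right_injective _ (qInt_ne_zero_of_lt hp (by omega) (by omega)) h1

theorem IsLowerRaise.comp_ydLeft (hp : 2 ≤ p) {M : ModCo.{u} p} {E G : Module.End ℂ M}
    (h : IsLowerRaise M E G) {m : ℤ} {y : M} (hy : Homog M m y) {r n : ℕ} (hr : r < p)
    (hn : n < p) :
    comp p n M (ydLeft M (F p r ⊗ₜ[ℂ] y)) = qFac p n • ydLeftCoeff M E G m n r y := by
  -- The sum is reindexed by `j = r - s`, the degree of the coproduct factor that multiplies into
  -- the algebra instead of acting.
  rw [h.ydLeft_apply hr hy, ydLeftCoeff, map_sum, ← Finset.sum_range_reflect, Finset.smul_sum]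
  refine Finset.sum_congr rfl fun j hj => ?_
  rw [Finset.mem_range] at hj
  rw [map_sum]
  simp only [show r + 1 - 1 - j = r - j by omega, show r - (r - j) = j by omega, map_smul,
    comp_tmul hn]
  rcases lt_or_ge n j with hnj | hnj
  · rw [divPow_of_neg E (show (n : ℤ) - j < 0 by omega), Finset.sum_eq_zero]
    · simp
    · intro k _; rw [if_neg (by omega), smul_zero]
  · obtain ⟨k, rfl⟩ : ∃ k, n = k + j := ⟨n - j, by omega⟩
    rw [Finset.sum_eq_single k]
    · rw [if_pos rfl, show ((k + j : ℕ) : ℤ) - j = k by push_cast; ring, divPow_natCast,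
        LinearMap.smul_apply, smul_smul, smul_smul, qBinom, Nat.add_sub_cancel_left,
        Nat.cast_sub (by omega)]
      congr 1
      rw [show (-(((r : ℤ) - (r - j)) * (m - (r - j) + k))) = -(j * (m + (k + j : ℕ) - r)) by
        push_cast; ring]
      have := qFac_ne_zero hp (show k < p by omega)
      have := qFac_ne_zero hp (show j < p by omega)
      field_simp
    · intro k' _ hk'; rw [if_neg (by omega), smul_zero]
    · intro hk; exact absurd (Finset.mem_range.2 (by omega)) hk

theorem IsLowerRaise.comp_ydRight (hp : 2 ≤ p) {M : ModCo.{u} p} {E G : Module.End ℂ M}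
    (h : IsLowerRaise M E G) (y : M) {r n : ℕ} (hr : r < p) (hn : n < p) :
    comp p n M (ydRight M (F p r ⊗ₜ[ℂ] y)) = qFac p n • ydRightCoeff M E G n r y := by
  rw [h.ydRight_apply hr y, ydRightCoeff, map_sum, Finset.smul_sum]
  refine Finset.sum_congr rfl fun s hs => ?_
  rw [Finset.mem_range] at hs
  rw [map_sum]
  simp only [map_smul, comp_tmul hn]
  rcases lt_or_ge n s with hns | hns
  · rw [divPow_of_neg E (show (n : ℤ) - s < 0 by omega), Finset.sum_eq_zero]
    · simp
    · intro k _; rw [if_neg (by omega), smul_zero]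
  · obtain ⟨k, rfl⟩ : ∃ k, n = s + k := ⟨n - s, by omega⟩
    rw [Finset.sum_eq_single k]
    · rw [if_pos rfl, show ((s + k : ℕ) : ℤ) - s = k by push_cast; ring, divPow_natCast,
        LinearMap.smul_apply, map_smul, smul_smul, smul_smul, qBinom, Nat.add_sub_cancel_left]
      congr 1
      have := qFac_ne_zero hp (show k < p by omega)
      have := qFac_ne_zero hp (show s < p by omega)
      field_simp
    · intro k' _ hk'; rw [if_neg (by omega), smul_zero]
    · intro hk; exact absurd (Finset.mem_range.2 (by omega)) hk

theorem IsEF.ydLeft_eq_ydRight (hp : 2 ≤ p) {M : ModCo.{u} p} {E G : Module.End ℂ M}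
    (h : IsEF M E G) : ydLeft M = ydRight M := by
  refine nich_tensor_hom_ext fun r hr x => ?_
  have : ydLeft M ∘ₗ TensorProduct.mk ℂ (Nich p) M (F p r) =
      ydRight M ∘ₗ TensorProduct.mk ℂ (Nich p) M (F p r) := by
    refine hom_ext_homog h.grading fun m x hx => nich_tensor_ext fun n hn => ?_
    simp only [LinearMap.comp_apply, TensorProduct.mk_apply]
    rw [h.comp_ydLeft hp hx hr hn, h.comp_ydRight hp x hr hn, h.ydLeftCoeff_eq hp hx hr _ (by omega)]
  exact LinearMap.congr_fun this x

/-- The commutation relation is the `F(1)`-component of the axiom at `F(1) ⊗ x`; the rest of the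
axiom carries no further information. -/
theorem IsLowerRaise.commutes_of_ydLeft_eq (hp : 2 ≤ p) {M : ModCo.{u} p} {E G : Module.End ℂ M}
    (h : IsLowerRaise M E G) (hyd : ydLeft M = ydRight M) : Commutes M E G := by
  intro m x hx
  have h1 := h.comp_ydLeft hp hx (r := 1) (n := 1) (by omega) (by omega)
  rw [hyd, h.comp_ydRight hp x (by omega) (by omega), qFac_one hp, one_smul, one_smul] at h1
  have h2 : divPow p E 1 = E := by
    have := divPow_natCast (p := p) E 1
    simpa [qFac_one hp] using this
  have h3 : divPow p E 0 = 1 := by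
    have := divPow_natCast (p := p) E 0
    simpa using this
  simp [ydLeftCoeff, ydRightCoeff, Finset.sum_range_succ, qFac_one hp, h2, h3] at h1
  rw [sub_smul, one_smul, ← add_sub_assoc, h1, add_sub_cancel_right]

end EF

end
end NicholsLoop
namespace NicholsLoop
noncomputable section

/-! ### Yetter–Drinfeld modules are the same as pairs of raising and lowering operators -/

section equivalence

variable {p : ℕ} [NeZero p]

theorem IsLowerRaise.proj_raise_pow {M : ModCo.{u} p} {E G : Module.End ℂ M}
    (h : IsLowerRaise M E G) (k : ℕ) (j : ZMod (4 * p)) (x : M) :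
    (E ^ k) (M.proj j x) = M.proj (j + 2 * k) ((E ^ k) x) := by
  have : (E ^ k) ∘ₗ M.proj j = M.proj (j + 2 * k) ∘ₗ (E ^ k) := by
    refine hom_ext_homog h.grading fun m y hy => ?_
    simp only [LinearMap.comp_apply]
    rw [hy.proj_eq h.grading, (h.homog_raise_pow hy k).proj_eq h.grading]
    push_cast
    simp only [add_left_inj]
    split_ifs <;> simp
  exact LinearMap.congr_fun this x

theorem IsLowerRaise.proj_lower_pow {M : ModCo.{u} p} {E G : Module.End ℂ M}
    (h : IsLowerRaise M E G) (k : ℕ) (j : ZMod (4 * p)) (x : M) :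
    (G ^ k) (M.proj j x) = M.proj (j - 2 * k) ((G ^ k) x) := by
  have : (G ^ k) ∘ₗ M.proj j = M.proj (j - 2 * k) ∘ₗ (G ^ k) := by
    refine hom_ext_homog h.grading fun m y hy => ?_
    simp only [LinearMap.comp_apply]
    rw [hy.proj_eq h.grading, (h.homog_lower_pow hy k).proj_eq h.grading]
    push_cast
    simp only [sub_left_inj]
    split_ifs <;> simp
  exact LinearMap.congr_fun this x

theorem nichProj_F_eq (i : ZMod (4 * p)) (r : ℕ) :
    nichProj p i (F p r) = if ((-2 * (r : ℤ) : ℤ) : ZMod (4 * p)) = i then F p r else 0 := by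
  split_ifs with h
  · rw [← h, nichProj_F]
  · rw [← nichProj_F r, ← Module.End.mul_apply, nichProj_complete.ortho (Ne.symm h)]; rfl

theorem nich_tensor_tensor_hom_ext {V : Type v} {W : Type w} [AddCommGroup V] [Module ℂ V]
    [AddCommGroup W] [Module ℂ W] {f g : (Nich p ⊗[ℂ] Nich p) ⊗[ℂ] V →ₗ[ℂ] W}
    (h : ∀ r < p, ∀ s < p, ∀ x, f ((F p r ⊗ₜ[ℂ] F p s) ⊗ₜ[ℂ] x) = g ((F p r ⊗ₜ[ℂ] F p s) ⊗ₜ[ℂ] x)) :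
    f = g := by
  refine TensorProduct.ext (TensorProduct.ext (nich_hom_ext fun r hr => nich_hom_ext fun s hs => ?_))
  exact LinearMap.ext fun x => h r hr s hs x

theorem comp_lTensor {V : Type v} {W : Type w} [AddCommGroup V] [Module ℂ V]
    [AddCommGroup W] [Module ℂ W] (f : V →ₗ[ℂ] W) {r : ℕ} (hr : r < p) (t : Nich p ⊗[ℂ] V) :
    comp p r W (f.lTensor (Nich p) t) = f (comp p r V t) := by
  have : comp p r W ∘ₗ f.lTensor (Nich p) = f ∘ₗ comp p r V := by
    refine nich_tensor_hom_ext fun k hk y => ?_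
    simp only [LinearMap.comp_apply, LinearMap.lTensor_tmul, comp_tmul hr]
    split_ifs <;> simp
  exact LinearMap.congr_fun this t

/-- The coefficient of `F(r) ⊗ F(s)` in `Δ F(k)` is `δ_{k,r+s}`. For `r + s ≥ p` it is always zero,
and this is what forces `E^p = 0`. -/
theorem comp_comp_comul {V : Type v} [AddCommGroup V] [Module ℂ V] {r s : ℕ} (hr : r < p)
    (hs : s < p) (t : Nich p ⊗[ℂ] V) :
    comp p s V (comp p r _ (TensorProduct.assoc ℂ (Nich p) (Nich p) V
      ((nichComul p).rTensor V t))) = if r + s < p then comp p (r + s) V t else 0 := by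
  have : comp p s V ∘ₗ comp p r _ ∘ₗ (TensorProduct.assoc ℂ (Nich p) (Nich p) V).toLinearMap ∘ₗ
      (nichComul p).rTensor V = if r + s < p then comp p (r + s) V else 0 := by
    refine nich_tensor_hom_ext fun k hk y => ?_
    simp only [LinearMap.comp_apply, LinearMap.rTensor_tmul, nichComul_F hk,
      TensorProduct.sum_tmul, map_sum, LinearEquiv.coe_coe, TensorProduct.assoc_tmul,
      comp_tmul hr]
    have h4 : ∀ i, comp p s V (if i = r then F p (k - i) ⊗ₜ[ℂ] y else 0) =
        if i = r then (if k - i = s then y else 0) else 0 := by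
      intro i
      split_ifs with h5 h6
      · rw [comp_tmul hs, if_pos h6]
      · rw [comp_tmul hs, if_neg h6]
      · simp
    simp only [h4, Finset.sum_ite_eq', Finset.mem_range]
    by_cases hrs : r + s < p
    · rw [if_pos hrs, comp_tmul hrs]
      split_ifs <;> first | rfl | omega
    · rw [if_neg hrs]
      split_ifs <;> first | rfl | omega
  have h5 := LinearMap.congr_fun this t
  simp only [LinearMap.comp_apply, LinearEquiv.coe_coe] at h5
  rw [h5]
  split_ifs <;> rfl

theorem IsLowerRaise.comp_coact {M : ModCo.{u} p} {E G : Module.End ℂ M}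
    (h : IsLowerRaise M E G) {r : ℕ} (hr : r < p) (x : M) : comp p r M (M.coact x) = (E ^ r) x := by
  rw [h.coact_eq, comp_sum hr fun k => (E ^ k) x]

/-- Associativity and coassociativity become additivity of the exponents of `G` and `E`; the
truncation of the Nichols algebra at degree `p` is matched by `G^p = 0` and `E^p = 0`. -/
theorem IsEF.isYD (hp : 2 ≤ p) {M : ModCo.{u} p} {E G : Module.End ℂ M} (h : IsEF M E G) :
    IsYD M where
  grading := h.grading
  act_graded i j := by
    refine nich_tensor_hom_ext fun r hr x => ?_
    simp only [LinearMap.comp_apply, TensorProduct.map_tmul, nichProj_F_eq]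
    split_ifs with hi
    · have := LinearMap.congr_fun (h.grading.idem (j - 2 * r)) ((G ^ r) x)
      rw [h.act_F r hr, map_smul, h.proj_lower_pow, ← hi,
        show (((-2 * (r : ℤ) : ℤ) : ZMod (4 * p)) + j) = j - 2 * r by push_cast; ring]
      exact congrArg _ this.symm
    · simp
  coact_graded k := by
    ext x
    simp only [LinearMap.comp_apply, LinearMap.sum_apply, h.coact_eq, map_sum,
      TensorProduct.map_tmul, nichProj_F_eq]
    refine Finset.sum_congr rfl fun n _ => ?_
    rw [Finset.sum_eq_single ((-2 * (n : ℤ) : ℤ) : ZMod (4 * p))]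
    · rw [if_pos rfl, h.proj_raise_pow]
      congr 3; push_cast; ring
    · intro i _ hi; rw [if_neg hi.symm, TensorProduct.zero_tmul]
    · simp
  one_act x := by rw [h.act_F 0 (by omega)]; simp
  mul_act := by
    refine nich_tensor_tensor_hom_ext fun r hr s hs x => ?_
    simp only [LinearMap.comp_apply, LinearMap.rTensor_tmul, nichMul_F hr hs, LinearEquiv.coe_coe,
      TensorProduct.assoc_tmul, LinearMap.lTensor_tmul, ← TensorProduct.smul_tmul', map_smul]
    rw [h.act_F s hs, TensorProduct.tmul_smul, map_smul, h.act_F r hr, ← Module.End.mul_apply,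
      ← pow_add]
    rcases lt_or_ge (r + s) p with hrs | hrs
    · rw [h.act_F _ hrs, smul_smul, smul_smul, qBinom, Nat.add_sub_cancel_left]
      congr 1
      have := qFac_ne_zero hp hr
      have := qFac_ne_zero hp hs
      have := qFac_ne_zero hp hrs
      field_simp
    · rw [F_eq_zero hrs, pow_eq_zero_of_le hrs h.lower_pow]; simp
  counit_coact x := by
    rw [h.coact_eq, map_sum, map_sum, Finset.sum_eq_single 0]
    · rw [LinearMap.rTensor_tmul, nichCounit_F (by omega)]; simp
    · intro k hk hk0
      rw [LinearMap.rTensor_tmul, nichCounit_F (Finset.mem_range.1 hk), if_neg hk0]; simp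
    · intro h0; exact absurd (Finset.mem_range.2 (by omega)) h0
  comul_coact := by
    ext x
    refine nich_tensor_ext fun r hr => nich_tensor_ext fun s hs => ?_
    simp only [LinearMap.comp_apply, LinearEquiv.coe_coe]
    rw [comp_comp_comul hr hs, comp_lTensor M.coact hr, h.comp_coact hr, h.comp_coact hs,
      ← Module.End.mul_apply, ← pow_add]
    split_ifs with hrs
    · rw [h.comp_coact hrs, add_comm]
    · rw [pow_eq_zero_of_le (show p ≤ s + r by omega) h.raise_pow]; rfl
  yetterDrinfeld := h.ydLeft_eq_ydRight hp

theorem comp_coact_comp_coact {M : ModCo.{u} p} (h : IsYD M) {r s : ℕ} (hr : r < p) (hs : s < p)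
    (x : M) : comp p s M (M.coact (comp p r M (M.coact x))) =
      if r + s < p then comp p (r + s) M (M.coact x) else 0 := by
  rw [← comp_comp_comul hr hs, ← comp_lTensor M.coact hr]
  exact congrArg (comp p s M) (congrArg (comp p r _) (LinearMap.congr_fun h.comul_coact x).symm)

/-- The algebra is generated by `F(1)` and, dually, the coaction is determined by its
`F(1)`-component: induction on the degree recovers `F(r)` as `G^r / ⟨r⟩!` and the `F(k)`-component
as `E^k`. -/
theorem IsYD.isEF (hp : 2 ≤ p) {M : ModCo.{u} p} (h : IsYD M) : IsEF M (raise M) (lower M) := by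
  have hE : ∀ k < p, ∀ x, comp p k M (M.coact x) = (raise M ^ k) x := by
    intro k
    induction k with
    | zero =>
      intro hk x
      have h1 := h.counit_coact x
      have : (TensorProduct.lid ℂ M).toLinearMap ∘ₗ (nichCounit p).rTensor M = comp p 0 M := by
        refine nich_tensor_hom_ext fun r hr y => ?_
        rw [LinearMap.comp_apply, LinearMap.rTensor_tmul, nichCounit_F hr, comp_tmul hk]
        split_ifs <;> simp
      have h2 := LinearMap.congr_fun this (M.coact x)
      simp only [LinearMap.comp_apply, LinearEquiv.coe_coe] at h2
      rw [← h2, h1]; simp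
    | succ k ih =>
      intro hk x
      have := comp_coact_comp_coact h (r := k) (s := 1) (by omega) (by omega) x
      rw [if_pos hk, ih (by omega)] at this
      rw [← this, pow_succ', Module.End.mul_apply]; rfl
  have hmul : ∀ r < p, ∀ x : M, lower M (M.act (F p r ⊗ₜ[ℂ] x)) =
      qInt p (r + 1) • M.act (F p (r + 1) ⊗ₜ[ℂ] x) := by
    intro r hr x
    have h1 := LinearMap.congr_fun h.mul_act ((F p 1 ⊗ₜ[ℂ] F p r) ⊗ₜ[ℂ] x)
    simp only [LinearMap.comp_apply, LinearMap.rTensor_tmul, nichMul_F (show 1 < p by omega) hr,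
      LinearEquiv.coe_coe, TensorProduct.assoc_tmul, LinearMap.lTensor_tmul,
      ← TensorProduct.smul_tmul', map_smul] at h1
    have h2 : qBinom p (1 + r) 1 = qInt p (r + 1) := by
      rw [qBinom, Nat.add_sub_cancel_left, add_comm 1 r, qFac_succ, qFac_one hp]
      have := qFac_ne_zero hp hr
      field_simp
    rw [h2, add_comm 1 r] at h1
    exact h1.symm
  have hG : ∀ r < p, ∀ x : M, M.act (F p r ⊗ₜ[ℂ] x) = (qFac p r)⁻¹ • (lower M ^ r) x := by
    intro r
    induction r with
    | zero => intro hr x; simp [h.one_act]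
    | succ r ih =>
      intro hr x
      have h1 := hmul r (by omega) x
      have h2 : qInt p (r + 1) ≠ 0 := qInt_ne_zero_of_lt hp (by omega) (by omega)
      have h3 := qFac_ne_zero hp (show r < p by omega)
      rw [ih (by omega), map_smul, ← Module.End.mul_apply, ← pow_succ'] at h1
      rw [qFac_succ, mul_inv_rev, mul_smul, h1, inv_smul_smul₀ h2]
  have hL : IsLowerRaise M (raise M) (lower M) :=
    { grading := h.grading
      homog_raise := by
        intro m x hx
        have h1 := congrArg (comp p 1 M) (LinearMap.congr_fun (h.coact_graded m) x)
        simp only [LinearMap.comp_apply, LinearMap.sum_apply, map_sum] at h1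
        rw [show M.proj m x = x from hx, Finset.sum_eq_single ((-2 : ℤ) : ZMod (4 * p))] at h1
        · have h2 : ∀ t : Nich p ⊗[ℂ] M, comp p 1 M (TensorProduct.map
              (nichProj p ((-2 : ℤ) : ZMod (4 * p))) (M.proj (m - ((-2 : ℤ) : ZMod (4 * p)))) t) =
              M.proj (m - ((-2 : ℤ) : ZMod (4 * p))) (comp p 1 M t) := by
            intro t
            conv_lhs => rw [sum_comp t]
            simp only [map_sum, TensorProduct.map_tmul, nichProj_F_eq]
            rw [Finset.sum_eq_single 1]
            · rw [if_pos (by simp), comp_tmul (by omega), if_pos rfl]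
            · intro k _ hk
              split_ifs
              · rw [comp_tmul (by omega), if_neg hk]
              · simp
            · intro h1; exact absurd (Finset.mem_range.2 (by omega)) h1
          rw [h2] at h1
          have h3 : M.proj ((m + 2 : ℤ) : ZMod (4 * p)) (raise M x) = raise M x := by
            rw [show ((m + 2 : ℤ) : ZMod (4 * p)) = m - ((-2 : ℤ) : ZMod (4 * p)) by
              push_cast; ring]
            exact h1.symm
          exact h3
        · intro i _ hi
          rw [sum_comp (M.coact x)]
          simp only [map_sum, TensorProduct.map_tmul, nichProj_F_eq]
          refine Finset.sum_eq_zero fun k _ => ?_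
          split_ifs with h2
          · rw [comp_tmul (by omega), if_neg]
            rintro rfl
            exact hi (by rw [← h2]; simp)
          · simp
        · simp
      homog_lower := by
        intro m x hx
        have h1 := LinearMap.congr_fun (h.act_graded ((-2 * ((1 : ℕ) : ℤ) : ℤ) : ZMod (4 * p)) m)
          (F p 1 ⊗ₜ[ℂ] x)
        simp only [LinearMap.comp_apply, TensorProduct.map_tmul, nichProj_F] at h1
        rw [show M.proj m x = x from hx] at h1
        have h3 : M.proj ((m - 2 : ℤ) : ZMod (4 * p)) (lower M x) = lower M x := by
          rw [show ((m - 2 : ℤ) : ZMod (4 * p)) =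
            ((-2 * ((1 : ℕ) : ℤ) : ℤ) : ZMod (4 * p)) + m by push_cast; ring]
          exact h1.symm
        exact h3
      -- The `(p-1, 1)`-component of coassociativity would belong to degree `p`, where the Nichols
      -- algebra is zero.
      raise_pow := by
        ext x
        have := comp_coact_comp_coact h (r := p - 1) (s := 1) (by omega) (by omega) x
        rw [if_neg (by omega), hE (p - 1) (by omega)] at this
        have h1 : raise M ^ p = raise M * raise M ^ (p - 1) := by
          rw [← pow_succ', Nat.sub_add_cancel (by omega)]
        rw [h1, Module.End.mul_apply]
        exact this
      -- `F(1) F(p-1)` is a multiple of `F(p) = 0`.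
      lower_pow := by
        ext x
        have h1 : lower M ^ p = lower M * lower M ^ (p - 1) := by
          rw [← pow_succ', Nat.sub_add_cancel (by omega)]
        have h2 := hmul (p - 1) (by omega) x
        rw [Nat.sub_add_cancel (by omega), F_eq_zero le_rfl, hG (p - 1) (by omega)] at h2
        simp only [TensorProduct.zero_tmul, map_zero, smul_zero, map_smul, smul_eq_zero,
          inv_eq_zero, qFac_ne_zero hp (show p - 1 < p by omega), false_or] at h2
        rw [h1, Module.End.mul_apply]
        exact h2
      act_F := hG
      coact_eq := fun x => by
        conv_lhs => rw [sum_comp (M.coact x)]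
        exact Finset.sum_congr rfl fun k hk => by rw [hE k (Finset.mem_range.1 hk)] }
  exact { hL with comm := hL.commutes_of_ydLeft_eq hp h.yetterDrinfeld }

theorem IsEF.isHom {M : ModCo.{u} p} {N : ModCo.{v} p} {E G : Module.End ℂ M}
    {E' G' : Module.End ℂ N} (hM : IsEF M E G) (hN : IsEF N E' G') {f : M →ₗ[ℂ] N}
    (hproj : ∀ m x, Homog M m x → Homog N m (f x)) (hE : ∀ x, f (E x) = E' (f x))
    (hG : ∀ x, f (G x) = G' (f x)) : IsHom M N f where
  map_proj i := by
    refine hom_ext_homog hM.grading fun m x hx => ?_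
    rw [LinearMap.comp_apply, LinearMap.comp_apply, hx.proj_eq hM.grading,
      (hproj m x hx).proj_eq hN.grading]
    split_ifs <;> simp
  map_act := by
    have h : ∀ r x, f ((G ^ r) x) = (G' ^ r) (f x) := by
      intro r
      induction r with
      | zero => intro x; rfl
      | succ r ih => intro x; rw [pow_succ, pow_succ, Module.End.mul_apply, ih, hG]; rfl
    refine nich_tensor_hom_ext fun r hr x => ?_
    rw [LinearMap.comp_apply, LinearMap.comp_apply, LinearMap.lTensor_tmul, hM.act_F r hr,
      hN.act_F r hr, map_smul, h]
  map_coact := by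
    have h : ∀ r x, f ((E ^ r) x) = (E' ^ r) (f x) := by
      intro r
      induction r with
      | zero => intro x; rfl
      | succ r ih => intro x; rw [pow_succ, pow_succ, Module.End.mul_apply, ih, hE]; rfl
    ext x
    rw [LinearMap.comp_apply, LinearMap.comp_apply, hM.coact_eq, hN.coact_eq, map_sum]
    exact Finset.sum_congr rfl fun k _ => by rw [LinearMap.lTensor_tmul, h]

theorem IsHom.map_homog {M : ModCo.{u} p} {N : ModCo.{v} p} {f : M →ₗ[ℂ] N} (h : IsHom M N f)
    {m : ℤ} {x : M} (hx : Homog M m x) : Homog N m (f x) := by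
  have h1 := LinearMap.congr_fun (h.map_proj m) x
  simp only [LinearMap.comp_apply] at h1
  rw [Homog, ← h1, hx]

theorem IsHom.map_lower {M : ModCo.{u} p} {N : ModCo.{v} p} {f : M →ₗ[ℂ] N} (h : IsHom M N f)
    (x : M) : f (lower M x) = lower N (f x) := by
  have h1 := LinearMap.congr_fun h.map_act (F p 1 ⊗ₜ[ℂ] x)
  exact h1

theorem IsHom.map_raise (hp : 2 ≤ p) {M : ModCo.{u} p} {N : ModCo.{v} p} {f : M →ₗ[ℂ] N}
    (h : IsHom M N f) (x : M) : f (raise M x) = raise N (f x) := by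
  have h1 := congrArg (comp p 1 N) (LinearMap.congr_fun h.map_coact x)
  simp only [LinearMap.comp_apply] at h1
  rw [comp_lTensor f (show 1 < p by omega)] at h1
  exact h1.symm

end equivalence

end
end NicholsLoop
namespace NicholsLoop
noncomputable section

/-! ### The loop diagram in terms of raising and lowering operators -/

section loop

variable {p : ℕ} [NeZero p]

/-- The operator that acts by `𝔮^{cj/2}` on the component of charge `j`. -/
def weight {V : Type u} [AddCommGroup V] [Module ℂ V] (P : ZMod (4 * p) → Module.End ℂ V)
    (c : ZMod (4 * p)) : Module.End ℂ V := ∑ j, chargeForm p c j • P j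

theorem chargeForm_comm (i j : ZMod (4 * p)) : chargeForm p i j = chargeForm p j i := by
  rw [chargeForm, chargeForm, mul_comm]

theorem braid_tmul_left {V : Type u} {W : Type v}
    [AddCommGroup V] [Module ℂ V] [AddCommGroup W] [Module ℂ W]
    {P : ZMod (4 * p) → Module.End ℂ V} (R : ZMod (4 * p) → Module.End ℂ W)
    (hP : OrthogonalIdempotents P) {i : ZMod (4 * p)} {x : V} (y : W) (hx : P i x = x) :
    braid P R (x ⊗ₜ[ℂ] y) = weight R i y ⊗ₜ[ℂ] x := by
  have h1 : ∀ i', i' ≠ i → P i' x = 0 := fun i' hi => by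
    rw [← hx, ← Module.End.mul_apply, hP.ortho hi]; rfl
  simp only [braid, LinearMap.sum_apply, LinearMap.smul_apply, LinearMap.comp_apply,
    TensorProduct.map_tmul]
  rw [Finset.sum_eq_single i]
  · simp [hx, weight, LinearMap.sum_apply, TensorProduct.sum_tmul, TensorProduct.smul_tmul']
  · intro i' _ hi; simp [h1 i' hi]
  · simp

theorem braid_tmul_right {V : Type u} {W : Type v}
    [AddCommGroup V] [Module ℂ V] [AddCommGroup W] [Module ℂ W]
    (P : ZMod (4 * p) → Module.End ℂ V) {R : ZMod (4 * p) → Module.End ℂ W}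
    (hR : OrthogonalIdempotents R) {j : ZMod (4 * p)} (x : V) {y : W} (hy : R j y = y) :
    braid P R (x ⊗ₜ[ℂ] y) = y ⊗ₜ[ℂ] weight P j x := by
  have h2 : ∀ j', j' ≠ j → R j' y = 0 := fun j' hj => by
    rw [← hy, ← Module.End.mul_apply, hR.ortho hj]; rfl
  simp only [braid, LinearMap.sum_apply, LinearMap.smul_apply, LinearMap.comp_apply,
    TensorProduct.map_tmul]
  rw [Finset.sum_comm, Finset.sum_eq_single j]
  · simp [hy, weight, LinearMap.sum_apply, TensorProduct.tmul_sum, chargeForm_comm]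
  · intro i' _ hi; simp [h2 i' hi]
  · simp

theorem ydBraid_tmul_left {M : ModCo.{u} p} {E G : Module.End ℂ M} (hM : IsLowerRaise M E G)
    (N : ModCo.{v} p) {m : ℤ} {x : M} (hx : Homog M m x) (z : N) :
    ydBraid M N (x ⊗ₜ[ℂ] z) = ∑ k ∈ Finset.range p,
      N.act (F p k ⊗ₜ[ℂ] weight N.proj ((m + 2 * k : ℤ) : ZMod (4 * p)) z) ⊗ₜ[ℂ] (E ^ k) x := by
  simp only [ydBraid, LinearMap.comp_apply, LinearMap.rTensor_tmul, hM.coact_eq,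
    TensorProduct.sum_tmul, map_sum, LinearEquiv.coe_coe, TensorProduct.assoc_tmul,
    LinearMap.lTensor_tmul]
  refine Finset.sum_congr rfl fun k _ => ?_
  rw [braid_tmul_left _ hM.grading.toOrthogonalIdempotents z (hM.homog_raise_pow hx k),
    TensorProduct.assoc_symm_tmul, LinearMap.rTensor_tmul]

/-- The variant with a homogeneous second factor. In the double braiding only the vectors of `Y` are
then required to be homogeneous, and the vector of `Z`, over which a trace is taken, stays
arbitrary. -/
theorem ydBraid_tmul_right {M : ModCo.{u} p} {E G : Module.End ℂ M} (hM : IsLowerRaise M E G)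
    {N : ModCo.{v} p} {E' G' : Module.End ℂ N} (hN : IsLowerRaise N E' G') {m : ℤ} (x : M) {z : N}
    (hz : Homog N m z) :
    ydBraid M N (x ⊗ₜ[ℂ] z) = ∑ l ∈ Finset.range p,
      (qFac p l)⁻¹ • ((G' ^ l) z ⊗ₜ[ℂ] weight M.proj (m : ZMod (4 * p)) ((E ^ l) x)) := by
  simp only [ydBraid, LinearMap.comp_apply, LinearMap.rTensor_tmul, hM.coact_eq,
    TensorProduct.sum_tmul, map_sum, LinearEquiv.coe_coe, TensorProduct.assoc_tmul,
    LinearMap.lTensor_tmul]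
  refine Finset.sum_congr rfl fun k hk => ?_
  rw [braid_tmul_right _ hN.grading.toOrthogonalIdempotents _ hz,
    TensorProduct.assoc_symm_tmul, LinearMap.rTensor_tmul, hN.act_F k (Finset.mem_range.1 hk),
    TensorProduct.smul_tmul']

/-- The operator on `M` by which `Z → M ⊗ M^∨` contracts: evaluation after the braiding of `M`
with `M^∨` sends `z ⊗ f` to `f (curl z)`. -/
def curl (M : ModCo.{u} p) (E G : Module.End ℂ M) : Module.End ℂ M :=
  ∑ n ∈ Finset.range p, ((-1) ^ n * q p ^ ((n : ℤ) * ((n : ℤ) - 1)) * (qFac p n)⁻¹) •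
    (G ^ n * E ^ n * ∑ j, (chargeForm p j j)⁻¹ • M.proj j)

theorem weight_apply {M : ModCo.{u} p} (h : CompleteOrthogonalIdempotents M.proj) (n : ℤ) {m : ℤ}
    {x : M} (hx : Homog M m x) : weight M.proj (n : ZMod (4 * p)) x = qHalf p ^ (n * m) • x := by
  rw [weight, LinearMap.sum_apply, Finset.sum_eq_single (m : ZMod (4 * p))]
  · rw [LinearMap.smul_apply, chargeForm_intCast, show M.proj m x = x from hx]
  · intro j _ hj; rw [LinearMap.smul_apply, hx.proj_eq h, if_neg hj.symm, smul_zero]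
  · simp

theorem curl_apply {M : ModCo.{u} p} (h : CompleteOrthogonalIdempotents M.proj)
    (E G : Module.End ℂ M) {m : ℤ} {x : M} (hx : Homog M m x) :
    curl M E G x = qHalf p ^ (-(m * m)) • ∑ n ∈ Finset.range p,
      ((-1) ^ n * q p ^ ((n : ℤ) * ((n : ℤ) - 1)) * (qFac p n)⁻¹) • (G ^ n) ((E ^ n) x) := by
  have h1 : (∑ j, (chargeForm p j j)⁻¹ • M.proj j) x = qHalf p ^ (-(m * m)) • x := by
    rw [LinearMap.sum_apply, Finset.sum_eq_single (m : ZMod (4 * p))]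
    · rw [LinearMap.smul_apply, chargeForm_intCast, show M.proj m x = x from hx, zpow_neg]
    · intro j _ hj; rw [LinearMap.smul_apply, hx.proj_eq h, if_neg hj.symm, smul_zero]
    · simp
  rw [curl, LinearMap.sum_apply, Finset.smul_sum]
  refine Finset.sum_congr rfl fun n _ => ?_
  rw [LinearMap.smul_apply, Module.End.mul_apply, h1, Module.End.mul_apply, map_smul, map_smul,
    smul_comm]

theorem weight_dual_apply {M : ModCo.{u} p} (h : CompleteOrthogonalIdempotents M.proj) (n : ℤ)
    {m : ℤ} {x : M} (hx : Homog M m x) (f : Module.Dual ℂ M) :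
    (weight (fun i => (M.proj (-i)).dualMap) (n : ZMod (4 * p)) f) x =
      qHalf p ^ (-(n * m)) * f x := by
  rw [weight, LinearMap.sum_apply, LinearMap.sum_apply, Finset.sum_eq_single (-m : ZMod (4 * p))]
  · rw [LinearMap.smul_apply, LinearMap.smul_apply, LinearMap.dualMap_apply, neg_neg,
      show M.proj m x = x from hx, ← Int.cast_neg, chargeForm_intCast, smul_eq_mul, mul_neg]
  · intro j _ hj
    rw [LinearMap.smul_apply, LinearMap.smul_apply, LinearMap.dualMap_apply, hx.proj_eq h, if_neg]
    · simp
    · intro h1; rw [h1, neg_neg] at hj; exact hj rfl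
  · simp

/-- The linear functionals on `M`, as elements of the dual module. -/
def toDual (M : ModCo.{u} p) : Module.Dual ℂ M ≃ₗ[ℂ] dual M := LinearEquiv.refl ℂ (Module.Dual ℂ M)

/-- The evaluation `M^∨ ⊗ M → ℂ`. -/
def dualEv (M : ModCo.{u} p) : dual M ⊗[ℂ] M →ₗ[ℂ] ℂ := contractLeft ℂ M

/-- The coevaluation `ℂ → M ⊗ M^∨`. -/
def dualCoev (M : ModCo.{u} p) : ℂ →ₗ[ℂ] M ⊗[ℂ] dual M := coevaluation ℂ M

theorem dualEv_tmul (M : ModCo.{u} p) (f : dual M) (x : M) :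
    dualEv M (f ⊗ₜ[ℂ] x) = (toDual M).symm f x := contractLeft_apply _ _

theorem dualCoev_one (M : ModCo.{u} p) : dualCoev M 1 =
    ∑ i, Module.Basis.ofVectorSpace ℂ M i ⊗ₜ[ℂ]
      toDual M ((Module.Basis.ofVectorSpace ℂ M).coord i) :=
  coevaluation_apply_one ℂ M

theorem weight_dual_toDual (M : ModCo.{u} p) (c : ZMod (4 * p)) (f : Module.Dual ℂ M) :
    weight (dual M).proj c (toDual M f) =
      toDual M (weight (fun i => (M.proj (-i)).dualMap) c f) := rfl

theorem dual_act_apply (M : ModCo.{u} p) (h : Nich p) (f : Module.Dual ℂ M) :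
    (toDual M).symm ((dual M).act (h ⊗ₜ[ℂ] toDual M f)) =
      (TensorProduct.lift
        (LinearMap.mk₂ ℂ
          (fun (f : Module.Dual ℂ M) (h : Nich p) => f ∘ₗ M.act ∘ₗ TensorProduct.mk ℂ (Nich p) M h)
          (fun _ _ _ => rfl) (fun _ _ _ => rfl)
          (fun _ _ _ => by ext; simp)
          (fun _ _ _ => by ext; simp)))
      (braid (nichProj p) (fun i => (M.proj (-i)).dualMap)
        ((nichAntipode p).rTensor (Module.Dual ℂ M) (h ⊗ₜ[ℂ] f))) := rfl

/-- The sign and `𝔮^{n(n-1)}` come from the antipode. The power of `𝔮^{1/2}` comes from moving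
`F(n)` past `f`, of which only the component dual to the charge `m - 2n` of `G^n x` matters. -/
theorem dual_act_F {M : ModCo.{u} p} {E G : Module.End ℂ M} (hM : IsLowerRaise M E G) {n : ℕ}
    (hn : n < p) (f : Module.Dual ℂ M) {m : ℤ} {x : M} (hx : Homog M m x) :
    (toDual M).symm ((dual M).act (F p n ⊗ₜ[ℂ] toDual M f)) x =
      (-1) ^ n * q p ^ ((n : ℤ) * ((n : ℤ) - 1)) * (qFac p n)⁻¹ *
        qHalf p ^ (2 * n * (m - 2 * n)) * f ((G ^ n) x) := by
  have hb : OrthogonalIdempotents (nichProj p) := nichProj_complete.toOrthogonalIdempotents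
  rw [dual_act_apply]
  simp only [LinearMap.rTensor_tmul, nichAntipode_F hn,
    ← TensorProduct.smul_tmul', map_smul]
  rw [braid_tmul_left _ hb f (nichProj_F n), TensorProduct.lift.tmul]
  simp only [LinearMap.smul_apply, LinearMap.mk₂_apply, LinearMap.comp_apply,
    TensorProduct.mk_apply]
  rw [hM.act_F n hn, map_smul, weight_dual_apply hM.grading _ (hM.homog_lower_pow hx n),
    smul_eq_mul, smul_eq_mul,
    show -(-2 * (n : ℤ) * (m - 2 * n)) = 2 * n * (m - 2 * n) by ring]
  ring

/-- The dual action contributes the exponent `2nm` of `𝔮^{1/2}` and the braiding contributes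
`-(m+2n)m`. Their sum `-m²` does not depend on `n`, which leaves the twist of `curl`. -/
theorem dualEv_ydBraid {M : ModCo.{u} p} {E G : Module.End ℂ M} (hM : IsLowerRaise M E G) (x : M)
    (f : Module.Dual ℂ M) :
    dualEv M (ydBraid M (dual M) (x ⊗ₜ[ℂ] toDual M f)) = f (curl M E G x) := by
  have : (dualEv M ∘ₗ ydBraid M (dual M)) ∘ₗ
      (TensorProduct.mk ℂ M (dual M)).flip (toDual M f) = f ∘ₗ curl M E G := by
    refine hom_ext_homog hM.grading fun m x hx => ?_
    simp only [LinearMap.comp_apply, LinearMap.flip_apply, TensorProduct.mk_apply]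
    rw [ydBraid_tmul_left hM (dual M) hx, curl_apply hM.grading E G hx, map_sum, map_smul, map_sum,
      Finset.smul_sum]
    refine Finset.sum_congr rfl fun n hn => ?_
    rw [Finset.mem_range] at hn
    rw [dualEv_tmul, weight_dual_toDual, dual_act_F hM hn _ (hM.homog_raise_pow hx n)]
    have h1 : Homog M m ((G ^ n) ((E ^ n) x)) := by
      have := hM.homog_lower_pow (hM.homog_raise_pow hx n) n
      rwa [add_sub_cancel_right] at this
    rw [weight_dual_apply hM.grading (m + 2 * n) h1 f, map_smul, smul_eq_mul, smul_eq_mul,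
      show -(m * m) = 2 * n * (m + 2 * n - 2 * n) + -((m + 2 * n) * m) by ring,
      zpow_add₀ (qHalf_ne_zero p)]
    ring
  exact LinearMap.congr_fun this x

/-- Only the grading and the action of `Z^∨` enter: `Z` is braided past `Z^∨`, so the coaction of
the dual is never evaluated. -/
theorem loop_eq (Y : ModCo.{u} p) (Z : ModCo.{v} p) (θ : Module.End ℂ Z) (y : Y) :
    loop Y Z θ y = TensorProduct.rid ℂ Y ((dualEv Z).lTensor Y ((ydBraid Z (dual Z)).lTensor Y
      (TensorProduct.assoc ℂ Y Z (dual Z) ((θ.lTensor Y).rTensor (dual Z)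
        ((ydBraid Z Y ∘ₗ ydBraid Y Z).rTensor (dual Z) ((TensorProduct.assoc ℂ Y Z (dual Z)).symm
          ((dualCoev Z).lTensor Y (y ⊗ₜ[ℂ] (1 : ℂ))))))))) := rfl

/-- By cyclicity the trace of `T P_j = (T P_j) P_j` equals that of `P_j T P_j`, which is zero
because `T` leaves the component `j`. -/
theorem trace_eq_zero_of_shift {M : ModCo.{u} p} (h : CompleteOrthogonalIdempotents M.proj)
    {T : Module.End ℂ M} {d : ℤ} (hd : (d : ZMod (4 * p)) ≠ 0)
    (hT : ∀ m x, Homog M m x → Homog M (m + d) (T x)) : LinearMap.trace ℂ M T = 0 := by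
  have h1 : T = ∑ j, T * M.proj j := by rw [← Finset.mul_sum, h.complete, mul_one]
  rw [h1, map_sum]
  refine Finset.sum_eq_zero fun j _ => ?_
  have h2 : M.proj j * (T * M.proj j) = 0 := by
    ext x
    have h3 := (hT _ _ (homog_proj h j x)).proj_eq h j
    rw [Module.End.mul_apply, Module.End.mul_apply, h3, if_neg]
    · rfl
    · push_cast
      rw [ZMod.natCast_val, ZMod.cast_id, add_eq_left]
      exact hd
  rw [show T * M.proj j = (T * M.proj j) * M.proj j by rw [mul_assoc, h.idem j],
    LinearMap.trace_mul_comm, h2, map_zero]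

theorem homog_curl {M : ModCo.{u} p} {E G : Module.End ℂ M} (hM : IsLowerRaise M E G) {m : ℤ}
    {x : M} (hx : Homog M m x) : Homog M m (curl M E G x) := by
  rw [curl_apply hM.grading E G hx]
  refine Homog.smul ?_ _
  rw [Homog, map_sum]
  refine Finset.sum_congr rfl fun n _ => ?_
  refine Homog.smul ?_ _
  have := hM.homog_lower_pow (hM.homog_raise_pow hx n) n
  rwa [add_sub_cancel_right] at this

theorem homog_weight {M : ModCo.{u} p} (h : CompleteOrthogonalIdempotents M.proj) (n : ℤ) {m : ℤ}
    {x : M} (hx : Homog M m x) : Homog M m (weight M.proj (n : ZMod (4 * p)) x) := by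
  rw [weight_apply h n hx]; exact hx.smul _

/-- The coefficients of the loop operator. -/
def loopTrace (Z : ModCo.{v} p) (E G θ : Module.End ℂ Z) (n : ℤ) (k : ℕ) : ℂ :=
  LinearMap.trace ℂ Z (curl Z E G * θ * weight Z.proj (n : ZMod (4 * p)) * E ^ k * G ^ k *
    weight Z.proj (n : ZMod (4 * p)))

/-- The double braiding sends `y ⊗ z` to a sum over `k`, `l` of `G^l E^k y` tensored with an
operator containing `E^l G^k` applied to `z`. Closing the loop takes the trace of this operator
after `θ` and `curl`. It shifts the charge by `2(l-k)`, which is nonzero modulo `4p` for distinct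
`k, l < p`, so only `k = l` survives. -/
theorem loop_apply {Y : ModCo.{u} p} {E G : Module.End ℂ Y} (hY : IsLowerRaise Y E G)
    {Z : ModCo.{v} p} {E' G' : Module.End ℂ Z} (hZ : IsLowerRaise Z E' G') {θ : Module.End ℂ Z}
    (hθ : ∀ m x, Homog Z m x → Homog Z m (θ x)) {m : ℤ} {y : Y} (hy : Homog Y m y) :
    loop Y Z θ y = ∑ k ∈ Finset.range p, ((qFac p k)⁻¹ * (qFac p k)⁻¹ *
      loopTrace Z E' G' θ (m + 2 * k) k) • (G ^ k) ((E ^ k) y) := by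
  have hBB : ∀ z : Z, ydBraid Z Y (ydBraid Y Z (y ⊗ₜ[ℂ] z)) =
      ∑ k ∈ Finset.range p, ∑ l ∈ Finset.range p, ((qFac p k)⁻¹ * (qFac p l)⁻¹) •
        (G ^ l) ((E ^ k) y) ⊗ₜ[ℂ] (weight Z.proj ((m + 2 * k : ℤ) : ZMod (4 * p)) * E' ^ l *
          G' ^ k * weight Z.proj ((m + 2 * k : ℤ) : ZMod (4 * p))) z := by
    intro z
    rw [ydBraid_tmul_left hY Z hy, map_sum]
    refine Finset.sum_congr rfl fun k hk => ?_
    rw [hZ.act_F k (Finset.mem_range.1 hk), ← TensorProduct.smul_tmul', map_smul,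
      ydBraid_tmul_right hZ hY _ (hY.homog_raise_pow hy k), Finset.smul_sum]
    refine Finset.sum_congr rfl fun l hl => ?_
    rw [smul_smul]; rfl
  set b := Module.Basis.ofVectorSpace ℂ Z
  have hloop : loop Y Z θ y = ∑ i, ∑ k ∈ Finset.range p, ∑ l ∈ Finset.range p,
      ((qFac p k)⁻¹ * (qFac p l)⁻¹ * b.coord i ((curl Z E' G' * θ *
        weight Z.proj ((m + 2 * k : ℤ) : ZMod (4 * p)) * E' ^ l *
          G' ^ k * weight Z.proj ((m + 2 * k : ℤ) : ZMod (4 * p))) (b i))) •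
        (G ^ l) ((E ^ k) y) := by
    rw [loop_eq, LinearMap.lTensor_tmul, dualCoev_one, TensorProduct.tmul_sum]
    simp only [map_sum]
    refine Finset.sum_congr rfl fun i _ => ?_
    rw [TensorProduct.assoc_symm_tmul, LinearMap.rTensor_tmul, LinearMap.comp_apply, hBB]
    simp only [LinearMap.rTensor_tmul, map_sum, map_smul, TensorProduct.sum_tmul,
      ← TensorProduct.smul_tmul', LinearMap.lTensor_tmul, TensorProduct.assoc_tmul,
      dualEv_ydBraid hZ, TensorProduct.rid_tmul, mul_smul, Module.End.mul_apply]
    rfl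
  rw [hloop, Finset.sum_comm]
  refine Finset.sum_congr rfl fun k hk => ?_
  rw [Finset.mem_range] at hk
  rw [Finset.sum_comm]
  have htr : ∀ T : Module.End ℂ Z, ∑ i, b.coord i (T (b i)) = LinearMap.trace ℂ Z T := by
    intro T
    classical
    rw [LinearMap.trace_eq_matrix_trace ℂ b, Matrix.trace]
    simp [LinearMap.toMatrix_apply]
  simp only [← Finset.sum_smul, ← Finset.mul_sum, htr]
  rw [Finset.sum_eq_single k]
  · rfl
  · intro l hl hlk
    rw [Finset.mem_range] at hl
    rw [trace_eq_zero_of_shift hZ.grading (d := 2 * l - 2 * k)]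
    · simp
    · rw [Ne, ZMod.intCast_zmod_eq_zero_iff_dvd]
      intro hd
      have h1 : |2 * (l : ℤ) - 2 * k| < ((4 * p : ℕ) : ℤ) := by
        rw [abs_lt]; push_cast; constructor <;> omega
      have := Int.eq_zero_of_abs_lt_dvd hd h1
      omega
    · intro n x hx
      have h1 := homog_curl hZ (hθ _ _ (homog_weight hZ.grading (m + 2 * k) (hZ.homog_raise_pow
        (hZ.homog_lower_pow (homog_weight hZ.grading (m + 2 * k) hx) k) l)))
      rw [show n + (2 * (l : ℤ) - 2 * k) = n - 2 * k + 2 * l by ring]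
      exact h1
  · intro h; exact absurd (Finset.mem_range.2 hk) h

end loop

end
end NicholsLoop
namespace NicholsLoop
noncomputable section

/-! ### Central elements -/

section central

variable {p : ℕ} [NeZero p]

/-- The eigenvalue of `E^k F^k` on `F^s w`, for a highest weight vector `w` of charge `a`. -/
def gCoef (p : ℕ) (a s : ℤ) (k : ℕ) : ℂ :=
  ∏ i ∈ Finset.range k, (qInt p (s + 1 + i) * (1 - qq p (s + i - a)))

/-- The coefficients of the loop operator of a module with the basis `F^s w`, `s < n`, for a
highest weight vector `w` of charge `a`. -/
def chiCoef (p n : ℕ) (a m : ℤ) (k : ℕ) : ℂ :=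
  ∑ s ∈ Finset.range n, q p ^ ((m + 2 * k + 1) * (a - 2 * s)) * gCoef p a s k

/-- The operator `y ↦ ∑_k c(m, k) ⟨k⟩!⁻² F^k E^k y` for `y` of charge `m`. -/
def chargeSum (Y : ModCo.{u} p) (c : ℤ → ℕ → ℂ) : Module.End ℂ Y :=
  ∑ j : ZMod (4 * p), ∑ k ∈ Finset.range p,
    ((qFac p k)⁻¹ * (qFac p k)⁻¹ * c j.val k) • (lower Y ^ k * raise Y ^ k * Y.proj j)

/-- The loop operator of a module with the basis `F^s w`, `s < n`, for a highest weight vector `w`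
of charge `a`. -/
def chi (n : ℕ) (a : ℤ) (Y : ModCo.{u} p) : Module.End ℂ Y := chargeSum Y (chiCoef p n a)

theorem q_zpow_congr {a b : ℤ} (h : ((2 * p : ℕ) : ℤ) ∣ a - b) : q p ^ a = q p ^ b := by
  obtain ⟨k, hk⟩ := h
  rw [show a = b + 2 * k * p by push_cast at hk; linarith, zpow_add₀ (q_ne_zero p), q_zpow_mul_p,
    zpow_mul]
  norm_num

theorem chiCoef_congr (n : ℕ) (a : ℤ) {m m' : ℤ} (h : ((2 * p : ℕ) : ℤ) ∣ m - m') (k : ℕ) :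
    chiCoef p n a m k = chiCoef p n a m' k := by
  refine Finset.sum_congr rfl fun s _ => ?_
  congr 1
  refine q_zpow_congr ?_
  rw [show (m + 2 * k + 1) * (a - 2 * s) - (m' + 2 * k + 1) * (a - 2 * s) =
    (m - m') * (a - 2 * s) by ring]
  exact h.mul_right _

theorem chargeSum_apply {Y : ModCo.{u} p} (h : CompleteOrthogonalIdempotents Y.proj)
    {c : ℤ → ℕ → ℂ} (hc : ∀ m m' : ℤ, ((4 * p : ℕ) : ℤ) ∣ m - m' → c m = c m') {m : ℤ} {y : Y}
    (hy : Homog Y m y) :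
    chargeSum Y c y = ∑ k ∈ Finset.range p,
      ((qFac p k)⁻¹ * (qFac p k)⁻¹ * c m k) • (lower Y ^ k) ((raise Y ^ k) y) := by
  rw [chargeSum, LinearMap.sum_apply, Finset.sum_eq_single (m : ZMod (4 * p))]
  · rw [LinearMap.sum_apply]
    refine Finset.sum_congr rfl fun k _ => ?_
    rw [LinearMap.smul_apply, Module.End.mul_apply, Module.End.mul_apply,
      show Y.proj m y = y from hy, hc _ m]
    rw [← ZMod.intCast_zmod_eq_zero_iff_dvd]
    simp
  · intro j _ hj
    rw [LinearMap.sum_apply]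
    refine Finset.sum_eq_zero fun k _ => ?_
    rw [LinearMap.smul_apply, Module.End.mul_apply, hy.proj_eq h, if_neg hj.symm]
    simp
  · simp

theorem chi_apply {Y : ModCo.{u} p} (h : CompleteOrthogonalIdempotents Y.proj) (n : ℕ) (a : ℤ)
    {m : ℤ} {y : Y} (hy : Homog Y m y) :
    chi n a Y y = ∑ k ∈ Finset.range p,
      ((qFac p k)⁻¹ * (qFac p k)⁻¹ * chiCoef p n a m k) • (lower Y ^ k) ((raise Y ^ k) y) := by
  refine chargeSum_apply h (fun m m' hm => ?_) hy
  ext k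
  refine chiCoef_congr n a (dvd_trans ⟨2, ?_⟩ hm) k
  push_cast; ring

theorem gCoef_succ (a s : ℤ) (k : ℕ) :
    gCoef p a s (k + 1) = gCoef p a s k * (qInt p (s + 1 + k) * (1 - qq p (s + k - a))) := by
  rw [gCoef, gCoef, Finset.prod_range_succ]

theorem gCoef_succ' (a s : ℤ) (k : ℕ) :
    gCoef p a s (k + 1) = qInt p (s + 1) * (1 - qq p (s - a)) * gCoef p a (s + 1) k := by
  rw [gCoef, gCoef, Finset.prod_range_succ', mul_comm]
  congr 1
  · simp
  · refine Finset.prod_congr rfl fun i _ => ?_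
    rw [show s + 1 + ((i + 1 : ℕ) : ℤ) = s + 1 + 1 + i by push_cast; ring,
      show s + ((i + 1 : ℕ) : ℤ) - a = s + 1 + i - a by push_cast; ring]

@[simp] theorem gCoef_zero (a s : ℤ) : gCoef p a s 0 = 1 := by simp [gCoef]

theorem gCoef_neg_one (a : ℤ) (k : ℕ) : gCoef p a (-1) (k + 1) = 0 := by
  rw [gCoef_succ']; simp

theorem gCoef_self (a : ℤ) (k : ℕ) : gCoef p a a (k + 1) = 0 := by
  rw [gCoef_succ']; simp

/-- The condition for the span of `F^s w`, `s < n`, to be closed. -/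
def Closed (p n : ℕ) (a : ℤ) : Prop := qInt p n * (1 - qq p (n - 1 - a)) = 0

theorem Closed.gCoef_eq_zero {n : ℕ} {a : ℤ} (h : Closed p n a) (k : ℕ) :
    gCoef p a (n - 1) (k + 1) = 0 := by
  rw [gCoef_succ', sub_add_cancel]
  rw [Closed] at h
  rw [h, zero_mul]

theorem Closed.of_dvd {n : ℕ} {a : ℤ} (h : (p : ℤ) ∣ n - 1 - a) : Closed p n a := by
  rw [Closed, (qq_eq_one_iff _).2 h]; simp

theorem gCoef_recursion (hp : 2 ≤ p) (a s : ℤ) (k : ℕ) :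
    qInt p (k + 1) * gCoef p a s k * (qq p (k + 2 * s - a) - 1) + gCoef p a s (k + 1) =
      qq p (k + 1) * gCoef p a (s - 1) (k + 1) := by
  rw [gCoef_succ, gCoef_succ', sub_add_cancel]
  rw [show (k : ℤ) + 2 * s - a = k + s + s + -a by ring, show s + k - a = s + k + -a by ring,
    show s - 1 - a = s + -1 + -a by ring]
  have h1 := one_sub_qq_ne hp
  have h2 := qq_ne_zero (p := p) 1
  simp only [qInt_eq, qq_add, qq_neg]
  field_simp
  ring

/-- The coefficientwise form of centrality. By `gCoef_recursion` the sum consists of differences of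
consecutive values of `f`, so it telescopes. Here `f 0 = 0` because of a factor `⟨0⟩`, and `f n = 0`
because the tower is closed. -/
theorem Closed.chiCoef_recursion (hp : 2 ≤ p) {n : ℕ} {a : ℤ} (h : Closed p n a) (m : ℤ) (k : ℕ) :
    qInt p (k + 1) * (qq p k * chiCoef p n a (m - 2) k - chiCoef p n a m k) +
      chiCoef p n a (m - 2) (k + 1) * (1 - qq p (-(m + k))) = 0 := by
  set P : ℕ → ℂ := fun s => q p ^ ((m + 2 * k + 1) * (a - 2 * s)) with hP
  set f : ℕ → ℂ := fun s => P s * (qq p (k + 1) * gCoef p a (s - 1) (k + 1)) with hf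
  have h1 : chiCoef p n a (m - 2) k =
      ∑ s ∈ Finset.range n, P s * (qq p (2 * s - a) * gCoef p a s k) := by
    refine Finset.sum_congr rfl fun s _ => ?_
    rw [← mul_assoc]
    congr 1
    rw [hP, qq, ← zpow_add₀ (q_ne_zero p)]
    congr 1; ring
  have h2 : chiCoef p n a (m - 2) (k + 1) = ∑ s ∈ Finset.range n, P s * gCoef p a s (k + 1) := by
    refine Finset.sum_congr rfl fun s _ => ?_
    congr 2; push_cast; ring
  have h3 : chiCoef p n a (m - 2) (k + 1) * qq p (-(m + k)) = ∑ s ∈ Finset.range n, f (s + 1) := by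
    rw [h2, Finset.sum_mul]
    refine Finset.sum_congr rfl fun s _ => ?_
    rw [hf]
    dsimp only
    rw [show (((s + 1 : ℕ) : ℤ) - 1) = s by push_cast; ring, mul_right_comm, ← mul_assoc]
    congr 1
    rw [hP, qq, qq, ← zpow_add₀ (q_ne_zero p), ← zpow_add₀ (q_ne_zero p)]
    congr 1; push_cast; ring
  have h4 : ∑ s ∈ Finset.range n, f (s + 1) = ∑ s ∈ Finset.range n, f s := by
    have h5 := Finset.sum_range_succ f n
    have h6 := Finset.sum_range_succ' f n
    have h7 : f n = 0 := by simp [hf, h.gCoef_eq_zero]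
    have h8 : f 0 = 0 := by simp [hf, gCoef_neg_one]
    rw [h7] at h5
    rw [h8, h5, add_zero, add_zero] at h6
    exact h6.symm
  rw [mul_sub (chiCoef p n a (m - 2) (k + 1)), h3, h4, h1, h2, chiCoef, mul_one, mul_sub,
    Finset.mul_sum, Finset.mul_sum, Finset.mul_sum, ← Finset.sum_sub_distrib,
    ← Finset.sum_sub_distrib, ← Finset.sum_add_distrib]
  refine Finset.sum_eq_zero fun s _ => ?_
  simp only [hf]
  rw [← gCoef_recursion hp, show (k : ℤ) + 2 * s - a = k + (2 * s - a) by ring, qq_add]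
  ring

theorem pow_mul_eq_zero_of_eq {Y : Type u} [AddCommGroup Y] [Module ℂ Y] {G : Module.End ℂ Y}
    (h : G ^ p = 0) (y : Y) : (G ^ p) y = 0 := by rw [h]; rfl

theorem homog_chargeSum {Y : ModCo.{u} p} {E G : Module.End ℂ Y} (hp : 2 ≤ p)
    (hY : IsLowerRaise Y E G) (n : ℕ) (a : ℤ) {m : ℤ} {y : Y} (hy : Homog Y m y) :
    Homog Y m (chi n a Y y) := by
  rw [chi_apply hY.grading n a hy, hY.lower_eq hp, hY.raise_eq hp, Homog, map_sum]
  refine Finset.sum_congr rfl fun k _ => ?_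
  refine Homog.smul ?_ _
  have := hY.homog_lower_pow (hY.homog_raise_pow hy k) k
  rwa [add_sub_cancel_right] at this

/-- Both sides are expanded in the vectors `G^{k+1} E^k y`; the last of them vanishes since `G^p =
0`. Equality of the coefficients is `chiCoef_recursion`. -/
theorem Closed.chi_lower (hp : 2 ≤ p) {n : ℕ} {a : ℤ} (h : Closed p n a) {Y : ModCo.{u} p}
    {E G : Module.End ℂ Y} (hY : IsEF Y E G) (y : Y) : chi n a Y (G y) = G (chi n a Y y) := by
  have : chi n a Y ∘ₗ G = G ∘ₗ chi n a Y := by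
    refine hom_ext_homog hY.grading fun m y hy => ?_
    rw [LinearMap.comp_apply, LinearMap.comp_apply, chi_apply hY.grading n a hy,
      chi_apply hY.grading n a (hY.homog_lower m y hy), hY.lower_eq hp, hY.raise_eq hp, map_sum]
    obtain ⟨N, hN⟩ : ∃ N, p = N + 1 := ⟨p - 1, by omega⟩
    have hsub : ∀ k : ℕ, (G ^ (k + 1)) ((E ^ (k + 1)) (G y)) =
        qq p (k + 1) • (G ^ (k + 2)) ((E ^ (k + 1)) y) +
        (qInt p (k + 1) * (1 - qq p (-(m + k)))) • (G ^ (k + 1)) ((E ^ k) y) := by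
      intro k
      rw [hY.raise_pow_lower hp hy, map_add, map_smul, map_smul, pow_succ G (k + 1)]
      rfl
    have hG : (G ^ (N + 1)) ((E ^ N) y) = 0 := by
      rw [← hN]; exact pow_mul_eq_zero_of_eq hY.lower_pow _
    have hr : Finset.range p = Finset.range (N + 1) := by rw [hN]
    rw [hr]
    have e1 := Finset.sum_range_succ' (fun k => ((qFac p k)⁻¹ * (qFac p k)⁻¹ *
      chiCoef p n a (m - 2) k) • (G ^ k) ((E ^ k) (G y))) N
    have e2 := Finset.sum_range_succ (fun k => G (((qFac p k)⁻¹ * (qFac p k)⁻¹ *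
      chiCoef p n a m k) • (G ^ k) ((E ^ k) y))) N
    refine e1.trans (Eq.trans ?_ e2.symm)
    simp only [map_smul]
    rw [← Module.End.mul_apply G (G ^ N), ← pow_succ', hG, smul_zero, add_zero]
    simp only [hsub, smul_add, Finset.sum_add_distrib, smul_smul]
    have e3 := Finset.sum_range_succ' (fun k : ℕ => ((qFac p k)⁻¹ * (qFac p k)⁻¹ *
      chiCoef p n a (m - 2) k * qq p k) • (G ^ (k + 1)) ((E ^ k) y)) N
    have e4 := Finset.sum_range_succ (fun k : ℕ => ((qFac p k)⁻¹ * (qFac p k)⁻¹ *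
      chiCoef p n a (m - 2) k * qq p k) • (G ^ (k + 1)) ((E ^ k) y)) N
    rw [hG, smul_zero, add_zero] at e4
    rw [e4] at e3
    rw [add_right_comm]
    simp only [Nat.cast_zero, qq_zero, mul_one, zero_add, pow_one, pow_zero,
      Module.End.one_apply, Nat.cast_add, Nat.cast_one] at e3 ⊢
    rw [← e3, ← Finset.sum_add_distrib]
    refine Finset.sum_congr rfl fun k hk => ?_
    rw [Finset.mem_range] at hk
    rw [← Module.End.mul_apply G (G ^ k), ← pow_succ', ← add_smul]
    congr 1
    have h1 := h.chiCoef_recursion hp m k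
    have h2 := qFac_ne_zero hp (show k < p by omega)
    have h3 : qInt p (k + 1) ≠ 0 := qInt_ne_zero_of_lt hp (by omega) (by omega)
    rw [qFac_succ]
    field_simp
    linear_combination h1
  exact LinearMap.congr_fun this y

/-- The mirror image of `chi_lower`: coefficients of `G^k E^{k+1} y` are compared, with the
recursion taken at charge `m + 2`. -/
theorem Closed.chi_raise (hp : 2 ≤ p) {n : ℕ} {a : ℤ} (h : Closed p n a) {Y : ModCo.{u} p}
    {E G : Module.End ℂ Y} (hY : IsEF Y E G) (y : Y) : chi n a Y (E y) = E (chi n a Y y) := by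
  have : chi n a Y ∘ₗ E = E ∘ₗ chi n a Y := by
    refine hom_ext_homog hY.grading fun m y hy => ?_
    rw [LinearMap.comp_apply, LinearMap.comp_apply, chi_apply hY.grading n a hy,
      chi_apply hY.grading n a (hY.homog_raise m y hy), hY.lower_eq hp, hY.raise_eq hp, map_sum]
    obtain ⟨N, hN⟩ : ∃ N, p = N + 1 := ⟨p - 1, by omega⟩
    have hsub : ∀ k : ℕ, E ((G ^ (k + 1)) ((E ^ (k + 1)) y)) =
        qq p (k + 1) • (G ^ (k + 1)) ((E ^ (k + 2)) y) +
        (qInt p (k + 1) * (1 - qq p (-(m + 2 + k)))) • (G ^ k) ((E ^ (k + 1)) y) := by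
      intro k
      rw [hY.raise_lower_pow hp (hY.homog_raise_pow hy (k + 1)),
        show m + 2 * ((k + 1 : ℕ) : ℤ) - k = m + 2 + k by push_cast; ring, pow_succ' E (k + 1)]
      rfl
    have hE : (E ^ (N + 1)) y = 0 := by
      rw [← hN]; exact pow_mul_eq_zero_of_eq hY.raise_pow _
    have hr : Finset.range p = Finset.range (N + 1) := by rw [hN]
    rw [hr]
    have e1 := Finset.sum_range_succ' (fun k => E (((qFac p k)⁻¹ * (qFac p k)⁻¹ *
      chiCoef p n a m k) • (G ^ k) ((E ^ k) y))) N
    have e2 := Finset.sum_range_succ (fun k => ((qFac p k)⁻¹ * (qFac p k)⁻¹ *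
      chiCoef p n a (m + 2) k) • (G ^ k) ((E ^ k) (E y))) N
    refine e2.trans (Eq.trans ?_ e1.symm)
    simp only [map_smul]
    simp only [← Module.End.mul_apply (E ^ _) E, ← pow_succ]
    rw [hE, map_zero, smul_zero, add_zero]
    simp only [hsub, smul_add, Finset.sum_add_distrib, smul_smul]
    have e3 := Finset.sum_range_succ' (fun k : ℕ => ((qFac p k)⁻¹ * (qFac p k)⁻¹ *
      chiCoef p n a m k * qq p k) • (G ^ k) ((E ^ (k + 1)) y)) N
    have e4 := Finset.sum_range_succ (fun k : ℕ => ((qFac p k)⁻¹ * (qFac p k)⁻¹ *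
      chiCoef p n a m k * qq p k) • (G ^ k) ((E ^ (k + 1)) y)) N
    rw [hE, map_zero, smul_zero, add_zero] at e4
    rw [e4] at e3
    rw [add_right_comm]
    simp only [Nat.cast_zero, qq_zero, mul_one, zero_add, pow_one, pow_zero,
      Module.End.one_apply, Nat.cast_add, Nat.cast_one] at e3 ⊢
    rw [← e3, ← Finset.sum_add_distrib]
    refine Finset.sum_congr rfl fun k hk => ?_
    rw [Finset.mem_range] at hk
    rw [← add_smul]
    congr 1
    have h1 := h.chiCoef_recursion hp (m + 2) k
    rw [add_sub_cancel_right] at h1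
    have h2 := qFac_ne_zero hp (show k < p by omega)
    have h3 : qInt p (k + 1) ≠ 0 := qInt_ne_zero_of_lt hp (by omega) (by omega)
    rw [qFac_succ]
    field_simp
    linear_combination -h1
  exact LinearMap.congr_fun this y

theorem Closed.isHom_chi (hp : 2 ≤ p) {n : ℕ} {a : ℤ} (h : Closed p n a) {Y : ModCo.{u} p}
    (hY : IsYD Y) : IsHom Y Y (chi n a Y) := by
  have hE := hY.isEF hp
  exact hE.isHom hE (fun m x hx => homog_chargeSum hp hE.toIsLowerRaise n a hx)
    (h.chi_raise hp hE) (h.chi_lower hp hE)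

theorem chi_natural (hp : 2 ≤ p) (n : ℕ) (a : ℤ) {Y : ModCo.{u} p} {Y' : ModCo.{v} p} (hY : IsYD Y)
    (hY' : IsYD Y') {f : Y →ₗ[ℂ] Y'} (hf : IsHom Y Y' f) : f ∘ₗ chi n a Y = chi n a Y' ∘ₗ f := by
  refine hom_ext_homog hY.grading fun m y hy => ?_
  rw [LinearMap.comp_apply, LinearMap.comp_apply, chi_apply hY.grading n a hy,
    chi_apply hY'.grading n a (hf.map_homog hy), map_sum]
  have h1 : ∀ k x, f ((lower Y ^ k) x) = (lower Y' ^ k) (f x) := by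
    intro k
    induction k with
    | zero => intro x; rfl
    | succ r ih => intro x; rw [pow_succ, pow_succ, Module.End.mul_apply, ih, hf.map_lower]; rfl
  have h2 : ∀ k x, f ((raise Y ^ k) x) = (raise Y' ^ k) (f x) := by
    intro k
    induction k with
    | zero => intro x; rfl
    | succ r ih => intro x; rw [pow_succ, pow_succ, Module.End.mul_apply, ih, hf.map_raise hp]; rfl
  exact Finset.sum_congr rfl fun k _ => by rw [map_smul, h1, h2]

/-- A morphism commutes with every natural family, so it is enough that one of the two factors is
known to be a morphism. -/
theorem Closed.commute (hp : 2 ≤ p) {n n' : ℕ} {a a' : ℤ} (h : Closed p n a) {Y : ModCo.{u} p}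
    (hY : IsYD Y) : Commute (chi n a Y) (chi n' a' Y) :=
  chi_natural hp n' a' hY hY (h.isHom_chi hp hY)

end central

end
end NicholsLoop
namespace NicholsLoop
noncomputable section

/-! ### Relations between the central elements -/

section relations

variable {p : ℕ} [NeZero p]

theorem neg_one_zpow_congr {a b : ℤ} (h : (2 : ℤ) ∣ a - b) : (-1 : ℂ) ^ a = (-1) ^ b := by
  obtain ⟨k, hk⟩ := h
  rw [show a = b + 2 * k by linarith, zpow_add₀ (by norm_num), zpow_mul]
  norm_num

/-- `gCoef` depends on `a` modulo `p` only. The remaining power of `𝔮` changes by `𝔮^{-νp(m+2k+1)}`,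
a sign independent of `k` and `s`. -/
theorem chiCoef_sub_mul (n : ℕ) (b ν m : ℤ) (k : ℕ) :
    chiCoef p n (b - ν * p) m k = (-1) ^ (ν * (m + 1)) * chiCoef p n b m k := by
  rw [chiCoef, chiCoef, Finset.mul_sum]
  refine Finset.sum_congr rfl fun s _ => ?_
  rw [← mul_assoc]
  congr 1
  · rw [show (m + 2 * k + 1) * (b - ν * p - 2 * s) = (-(ν * (m + 1)) - 2 * (ν * k)) * p +
      (m + 2 * k + 1) * (b - 2 * s) by ring, zpow_add₀ (q_ne_zero p), q_zpow_mul_p]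
    congr 1
    exact neg_one_zpow_congr ⟨-(ν * (m + 1)) - ν * k, by ring⟩
  · refine Finset.prod_congr rfl fun i _ => ?_
    congr 2
    exact qq_congr ⟨ν, by ring⟩

/-- Multiplication by `(-1)^{ν(m+1)}` on the component of charge `m`. -/
def signOp (ν : ℤ) (Y : ModCo.{u} p) : Module.End ℂ Y := chi 1 (0 - ν * p) Y

theorem closed_simple (r : ℕ) (ν : ℤ) : Closed p r ((r : ℤ) - 1 - ν * p) :=
  Closed.of_dvd ⟨ν, by ring⟩

theorem closed_two : Closed p 2 1 := Closed.of_dvd ⟨0, by norm_num⟩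

theorem sum_range_single_zero {V : Type u} [AddCommMonoid V] {n : ℕ} (hn : 0 < n) {f : ℕ → V}
    (h : ∀ k, f (k + 1) = 0) : ∑ k ∈ Finset.range n, f k = f 0 := by
  obtain ⟨n, rfl⟩ : ∃ m, n = m + 1 := ⟨n - 1, by omega⟩
  rw [Finset.sum_range_succ', Finset.sum_eq_zero fun k _ => h k, zero_add]

theorem chiCoef_one_zero (m : ℤ) (k : ℕ) : chiCoef p 1 0 m k = if k = 0 then 1 else 0 := by
  rw [chiCoef]
  cases k with
  | zero => simp
  | succ k => simp [gCoef_succ']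

theorem signOp_apply {Y : ModCo.{u} p} (h : CompleteOrthogonalIdempotents Y.proj)
    (ν : ℤ) {m : ℤ} {y : Y} (hy : Homog Y m y) : signOp ν Y y = (-1 : ℂ) ^ (ν * (m + 1)) • y := by
  rw [signOp, chi_apply h _ _ hy, sum_range_single_zero (Nat.pos_of_ne_zero (NeZero.ne p))]
  · rw [chiCoef_sub_mul, chiCoef_one_zero]; simp
  · intro k; rw [chiCoef_sub_mul, chiCoef_one_zero]; simp

theorem signOp_add {Y : ModCo.{u} p} (h : CompleteOrthogonalIdempotents Y.proj) (ν ν' : ℤ) :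
    signOp (ν + ν') Y = signOp ν Y * signOp ν' Y := by
  refine hom_ext_homog h fun m y hy => ?_
  rw [Module.End.mul_apply, signOp_apply h _ hy, signOp_apply h _ hy, map_smul,
    signOp_apply h _ hy, smul_smul, ← zpow_add₀ (by norm_num)]
  congr 2; ring

theorem chi_sub_mul {Y : ModCo.{u} p} (h : CompleteOrthogonalIdempotents Y.proj) (n : ℕ)
    (b ν : ℤ) : chi n (b - ν * p) Y = chi n b Y * signOp ν Y := by
  refine hom_ext_homog h fun m y hy => ?_
  rw [Module.End.mul_apply, signOp_apply h _ hy, map_smul, chi_apply h _ _ hy, chi_apply h _ _ hy,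
    Finset.smul_sum]
  refine Finset.sum_congr rfl fun k _ => ?_
  rw [chiCoef_sub_mul, smul_smul]
  congr 1; ring

theorem chi_period {Y : ModCo.{u} p} (h : CompleteOrthogonalIdempotents Y.proj) (n : ℕ)
    (b ν : ℤ) : chi n (b - (ν + 2) * p) Y = chi n (b - ν * p) Y := by
  refine hom_ext_homog h fun m y hy => ?_
  rw [chi_sub_mul h, chi_sub_mul h, Module.End.mul_apply, Module.End.mul_apply,
    signOp_apply h _ hy, signOp_apply h _ hy]
  congr 2
  exact neg_one_zpow_congr ⟨m + 1, by ring⟩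

theorem chi_one_zero {Y : ModCo.{u} p} (h : CompleteOrthogonalIdempotents Y.proj) :
    chi 1 0 Y = 1 := by
  refine hom_ext_homog h fun m y hy => ?_
  have := signOp_apply h 0 hy
  simpa [signOp] using this

theorem chi_zero (a : ℤ) {Y : ModCo.{u} p} (h : CompleteOrthogonalIdempotents Y.proj) :
    chi 0 a Y = 0 := by
  refine hom_ext_homog h fun m y hy => ?_
  rw [chi_apply h _ _ hy]; simp [chiCoef]

theorem chiCoef_zero (n : ℕ) (a m : ℤ) :
    chiCoef p n a m 0 = ∑ s ∈ Finset.range n, q p ^ ((m + 1) * (a - 2 * s)) := by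
  simp [chiCoef]

theorem chi_apply_of_raise_eq_zero {Y : ModCo.{u} p} (h : CompleteOrthogonalIdempotents Y.proj)
    (n : ℕ) (a : ℤ) {m : ℤ} {y : Y} (hy : Homog Y m y) (hE : raise Y y = 0) :
    chi n a Y y = chiCoef p n a m 0 • y := by
  rw [chi_apply h _ _ hy, sum_range_single_zero (Nat.pos_of_ne_zero (NeZero.ne p))]
  · simp
  · intro k; rw [pow_succ (raise Y), Module.End.mul_apply, hE]; simp

theorem chiCoef_two (hp : 2 ≤ p) (m : ℤ) :
    chiCoef p 2 1 m 0 = q p ^ (m + 1) + q p ^ (-(m + 1)) ∧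
    chiCoef p 2 1 m 1 = q p ^ (m + 1) * (qq p 1 - 1) ∧ ∀ k, chiCoef p 2 1 m (k + 2) = 0 := by
  refine ⟨?_, ?_, fun k => ?_⟩
  · rw [chiCoef_zero, Finset.sum_range_succ, Finset.sum_range_one]
    congr 2 <;> push_cast <;> ring
  · rw [chiCoef, Finset.sum_range_succ, Finset.sum_range_one]
    simp only [gCoef, Finset.prod_range_one]
    have : qq p ((1 : ℕ) + (0 : ℕ) - 1) = 1 := by simp
    rw [this, sub_self, mul_zero, mul_zero, add_zero]
    have h1 : qInt p (((0 : ℕ) : ℤ) + 1 + (0 : ℕ)) = 1 := by simpa using qInt_one hp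
    have h2 : qq p (((0 : ℕ) : ℤ) + (0 : ℕ) - 1) = (qq p 1)⁻¹ := by
      rw [← qq_neg]; congr 1
    have h3 : q p ^ ((m + 2 * (1 : ℕ) + 1) * (1 - 2 * (0 : ℕ))) = q p ^ (m + 1) * qq p 1 := by
      rw [qq, ← zpow_add₀ (q_ne_zero p)]; congr 1; push_cast; ring
    have h4 := qq_ne_zero (p := p) 1
    rw [h1, h2, h3]
    field_simp
  · rw [chiCoef, Finset.sum_range_succ, Finset.sum_range_one, gCoef_succ', gCoef_succ', gCoef_succ']
    simp

theorem chi_two_apply (hp : 2 ≤ p) {Y : ModCo.{u} p} (h : CompleteOrthogonalIdempotents Y.proj)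
    {m : ℤ} {y : Y} (hy : Homog Y m y) :
    chi 2 1 Y y = (q p ^ (m + 1) + q p ^ (-(m + 1))) • y +
      (q p ^ (m + 1) * (qq p 1 - 1)) • lower Y (raise Y y) := by
  obtain ⟨h0, h1, h2⟩ := chiCoef_two hp m
  rw [chi_apply h _ _ hy]
  have : Finset.range p = Finset.range ((p - 2) + 1 + 1) := by congr 1; omega
  rw [this, Finset.sum_range_succ', Finset.sum_range_succ', Finset.sum_eq_zero, h0, h1]
  · simp [qFac_one hp, add_comm]
  · intro k _; rw [h2]; simp

/-- All products share the factors `∏ ⟨s+1+i⟩` and `∏ (1 - 𝔮^{2(s+i-r)})` over `i < k`. Without them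
an identity between a few powers of `𝔮²` remains. -/
theorem gCoef_mul_recursion (hp : 2 ≤ p) (r s : ℤ) (k : ℕ) :
    gCoef p r s (k + 1) + gCoef p r (s - 1) (k + 1) +
      qq p (2 * s - r - 1) * (qq p (k + 1) - 1) * qInt p (k + 1) * gCoef p r s k =
    gCoef p (r + 1) s (k + 1) + gCoef p (r - 1) (s - 1) (k + 1) := by
  have h0 : ∀ a s : ℤ, ∀ k, gCoef p a s k = (∏ i ∈ Finset.range k, qInt p (s + 1 + i)) *
      ∏ i ∈ Finset.range k, (1 - qq p (s + i - a)) := fun a s k => Finset.prod_mul_distrib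
  have e1 : ∏ i ∈ Finset.range (k + 1), qInt p (s + 1 + i) =
      (∏ i ∈ Finset.range k, qInt p (s + 1 + i)) * qInt p (s + 1 + k) := Finset.prod_range_succ _ _
  have e2 : ∏ i ∈ Finset.range (k + 1), qInt p (s - 1 + 1 + i) =
      (∏ i ∈ Finset.range k, qInt p (s + 1 + i)) * qInt p s := by
    rw [Finset.prod_range_succ']
    congr 1
    · exact Finset.prod_congr rfl fun i _ => by congr 1; push_cast; ring
    · congr 1; push_cast; ring
  have f1 : ∏ i ∈ Finset.range (k + 1), (1 - qq p (s + i - r)) =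
      (∏ i ∈ Finset.range k, (1 - qq p (s + i - r))) * (1 - qq p (s + k - r)) :=
    Finset.prod_range_succ _ _
  have f2 : ∏ i ∈ Finset.range (k + 1), (1 - qq p (s - 1 + i - r)) =
      (∏ i ∈ Finset.range k, (1 - qq p (s + i - r))) * (1 - qq p (s - 1 - r)) := by
    rw [Finset.prod_range_succ']
    congr 1
    · refine Finset.prod_congr rfl fun i _ => ?_
      rw [show s - 1 + ((i + 1 : ℕ) : ℤ) - r = s + i - r by push_cast; ring]
    · simp
  have f3 : ∏ i ∈ Finset.range (k + 1), (1 - qq p (s + i - (r + 1))) =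
      ∏ i ∈ Finset.range (k + 1), (1 - qq p (s - 1 + i - r)) :=
    Finset.prod_congr rfl fun i _ => by
      rw [show s + i - (r + 1) = s - 1 + i - r by ring]
  have f4 : ∏ i ∈ Finset.range (k + 1), (1 - qq p (s - 1 + i - (r - 1))) =
      ∏ i ∈ Finset.range (k + 1), (1 - qq p (s + i - r)) :=
    Finset.prod_congr rfl fun i _ => by
      rw [show s - 1 + i - (r - 1) = s + i - r by ring]
  rw [h0, h0, h0, h0, h0, f4, f3, f1, f2, e1, e2]
  generalize (∏ i ∈ Finset.range k, qInt p (s + 1 + i)) = A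
  generalize (∏ i ∈ Finset.range k, (1 - qq p (s + i - r))) = B
  have h1 := one_sub_qq_ne hp
  have h2 := qq_ne_zero (p := p) 1
  have h3 := qq_ne_zero (p := p) r
  rw [show 2 * s - r - 1 = s + s + -r + -1 by ring, show s + k - r = s + k + -r by ring,
    show s - 1 - r = s + -1 + -r by ring]
  simp only [qInt_eq, qq_add, qq_neg]
  field_simp
  ring

theorem chiCoef_mul_zero (r : ℕ) (m : ℤ) :
    (q p ^ (m + 1) + q p ^ (-(m + 1))) * chiCoef p (r + 1) r m 0 =
      chiCoef p (r + 2) (r + 1) m 0 + chiCoef p r (r - 1) m 0 := by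
  have h1 : q p ^ (m + 1) * chiCoef p (r + 1) r m 0 =
      ∑ s ∈ Finset.range (r + 1), q p ^ ((m + 1) * ((r : ℤ) + 1 - 2 * s)) := by
    rw [chiCoef_zero, Finset.mul_sum]
    refine Finset.sum_congr rfl fun s _ => ?_
    rw [← zpow_add₀ (q_ne_zero p)]; congr 1; ring
  have h2 : q p ^ (-(m + 1)) * chiCoef p (r + 1) r m 0 =
      ∑ s ∈ Finset.range (r + 1), q p ^ ((m + 1) * ((r : ℤ) - 1 - 2 * s)) := by
    rw [chiCoef_zero, Finset.mul_sum]
    refine Finset.sum_congr rfl fun s _ => ?_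
    rw [← zpow_add₀ (q_ne_zero p)]; congr 1; ring
  rw [add_mul, h1, h2, chiCoef_zero, chiCoef_zero, Finset.sum_range_succ _ (r + 1),
    Finset.sum_range_succ (fun s : ℕ => q p ^ ((m + 1) * ((r : ℤ) - 1 - 2 * s))) r,
    show (r : ℤ) + 1 - 2 * ((r + 1 : ℕ) : ℤ) = r - 1 - 2 * r by push_cast; ring]
  ring

/-- This is the coefficient of `G^{k+1} E^{k+1}` in `chi_two_mul`, multiplied by `⟨k+1⟩!²`. Shifting
`s` by one in the sums with the lower power of `𝔮` aligns all of them, the boundary terms vanish,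
and what is left holds termwise by `gCoef_mul_recursion`. -/
theorem chiCoef_mul_succ (hp : 2 ≤ p) (r : ℕ) (m : ℤ) (k : ℕ) :
    (q p ^ (m + 1 + 2 * (k + 1)) + q p ^ (-(m + 1 + 2 * (k + 1)))) *
        chiCoef p (r + 1) r m (k + 1) +
      q p ^ (m + 1) * (qq p (k + 1) - 1) * qq p k * qInt p (k + 1) * chiCoef p (r + 1) r m k =
      chiCoef p (r + 2) (r + 1) m (k + 1) + chiCoef p r (r - 1) m (k + 1) := by
  set x : ℤ → ℂ := fun j => q p ^ ((m + 1 + 2 * (k + 1)) * j) with hx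
  have h1 : q p ^ (m + 1 + 2 * (k + 1)) * chiCoef p (r + 1) r m (k + 1) =
      ∑ s ∈ Finset.range (r + 1), x (r + 1 - 2 * s) * gCoef p r s (k + 1) := by
    rw [chiCoef, Finset.mul_sum]
    refine Finset.sum_congr rfl fun s _ => ?_
    rw [← mul_assoc, ← zpow_add₀ (q_ne_zero p)]; congr 2; push_cast; ring
  have h2 : q p ^ (-(m + 1 + 2 * (k + 1))) * chiCoef p (r + 1) r m (k + 1) =
      ∑ s ∈ Finset.range r, x (r - 1 - 2 * s) * gCoef p r s (k + 1) := by
    rw [chiCoef, Finset.sum_range_succ, gCoef_self, mul_zero, add_zero, Finset.mul_sum]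
    refine Finset.sum_congr rfl fun s _ => ?_
    rw [← mul_assoc, ← zpow_add₀ (q_ne_zero p)]; congr 2; push_cast; ring
  have h3 : q p ^ (m + 1) * (qq p (k + 1) - 1) * qq p k * qInt p (k + 1) *
      chiCoef p (r + 1) r m k = ∑ s ∈ Finset.range (r + 1), x (r + 1 - 2 * s) *
        (qq p (2 * s - r - 1) * (qq p (k + 1) - 1) * qInt p (k + 1) * gCoef p r s k) := by
    rw [chiCoef, Finset.mul_sum]
    refine Finset.sum_congr rfl fun s _ => ?_
    have : q p ^ (m + 1) * qq p k * q p ^ ((m + 2 * k + 1) * ((r : ℤ) - 2 * s)) =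
        x (r + 1 - 2 * s) * qq p (2 * s - r - 1) := by
      rw [hx, qq, qq, ← zpow_add₀ (q_ne_zero p), ← zpow_add₀ (q_ne_zero p),
        ← zpow_add₀ (q_ne_zero p)]
      congr 1; ring
    linear_combination ((qq p (k + 1) - 1) * qInt p (k + 1) * gCoef p r s k) * this
  have h4 : chiCoef p (r + 2) (r + 1) m (k + 1) =
      ∑ s ∈ Finset.range (r + 1), x (r + 1 - 2 * s) * gCoef p (r + 1) s (k + 1) := by
    have := gCoef_self (p := p) (r + 1) k
    have hc : ((r + 1 : ℕ) : ℤ) = r + 1 := by push_cast; rfl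
    rw [chiCoef, Finset.sum_range_succ, hc, this, mul_zero, add_zero]
    refine Finset.sum_congr rfl fun s _ => ?_
    congr 2; push_cast; ring
  have h5 : chiCoef p r (r - 1) m (k + 1) =
      ∑ s ∈ Finset.range r, x (r - 1 - 2 * s) * gCoef p (r - 1) s (k + 1) := by
    rw [chiCoef]
    refine Finset.sum_congr rfl fun s _ => ?_
    congr 2; push_cast; ring
  set f : ℕ → ℂ := fun s => x (r + 1 - 2 * s) *
    (gCoef p r (s - 1) (k + 1) - gCoef p (r - 1) (s - 1) (k + 1)) with hf
  have h6 : ∑ s ∈ Finset.range r, x (r - 1 - 2 * s) * gCoef p r s (k + 1) -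
      ∑ s ∈ Finset.range r, x (r - 1 - 2 * s) * gCoef p (r - 1) s (k + 1) =
      ∑ s ∈ Finset.range (r + 1), f s := by
    rw [Finset.sum_range_succ', ← Finset.sum_sub_distrib]
    have : f 0 = 0 := by simp [hf, gCoef_neg_one]
    rw [this, add_zero]
    refine Finset.sum_congr rfl fun s _ => ?_
    simp only [hf]
    rw [show (((s + 1 : ℕ) : ℤ) - 1) = s by push_cast; ring,
      show (r : ℤ) + 1 - 2 * ((s + 1 : ℕ) : ℤ) = r - 1 - 2 * s by push_cast; ring]
    ring
  rw [add_mul, h1, h2, h3, h4, h5, ← sub_eq_zero]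
  have h7 : ∑ s ∈ Finset.range (r + 1), f s = ∑ s ∈ Finset.range (r + 1),
      x (r + 1 - 2 * s) * gCoef p (r + 1) s (k + 1) -
      ∑ s ∈ Finset.range (r + 1), x (r + 1 - 2 * s) * gCoef p r s (k + 1) -
      ∑ s ∈ Finset.range (r + 1), x (r + 1 - 2 * s) *
        (qq p (2 * s - r - 1) * (qq p (k + 1) - 1) * qInt p (k + 1) * gCoef p r s k) := by
    rw [← Finset.sum_sub_distrib, ← Finset.sum_sub_distrib]
    refine Finset.sum_congr rfl fun s _ => ?_
    have := gCoef_mul_recursion hp r s k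
    simp only [hf]
    linear_combination x (r + 1 - 2 * s) * this
  linear_combination h6 + h7

/-- The decomposition of the product of a two-dimensional and an `(r+1)`-dimensional representation,
but for the formal operators: there is no bound on `r`, and no module need exist beyond `p`. Since
`chi 2 1` has only the terms `k = 0, 1`, the other factor is evaluated just on `y` and `G E y`. -/
theorem chi_two_mul (hp : 2 ≤ p) (r : ℕ) {Y : ModCo.{u} p} (hY : IsYD Y) :
    chi 2 1 Y * chi (r + 1) r Y = chi (r + 2) (r + 1) Y + chi r (r - 1) Y := by
  have hE := hY.isEF hp
  have h := hY.grading
  -- The factors are swapped so that the explicit two-term formula for `chi 2 1` applies to `y`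
  -- itself.
  rw [(closed_two.commute hp hY).eq]
  refine hom_ext_homog h fun m y hy => ?_
  have hy' : Homog Y m (lower Y (raise Y y)) := by
    have := hE.homog_lower _ _ (hE.homog_raise _ _ hy)
    rwa [add_sub_cancel_right] at this
  rw [Module.End.mul_apply, LinearMap.add_apply, chi_two_apply hp h hy, map_add, map_smul, map_smul,
    chi_apply h _ _ hy, chi_apply h _ _ hy, chi_apply h _ _ hy, chi_apply h _ _ hy']
  set X : ℕ → Y := fun k => (lower Y ^ k) ((raise Y ^ k) y) with hX
  have hXp : X p = 0 := pow_mul_eq_zero_of_eq hE.lower_pow _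
  have hsub : ∀ k : ℕ, (lower Y ^ k) ((raise Y ^ k) (lower Y (raise Y y))) =
      qq p k • X (k + 1) + (qInt p k * (1 - qq p (-(m + 1 + k)))) • X k := by
    intro k
    cases k with
    | zero => simp [hX]
    | succ k =>
      rw [hE.raise_pow_lower hp (hE.homog_raise _ _ hy), map_add, map_smul, map_smul,
        show -(m + 1 + ((k + 1 : ℕ) : ℤ)) = -(m + 2 + k) by push_cast; ring]
      simp only [hX]
      rw [pow_succ (lower Y) (k + 1), pow_succ (raise Y) (k + 1), pow_succ (raise Y) k]
      push_cast
      rfl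
  set C : ℕ → ℂ := chiCoef p (r + 1) r m with hC
  set d : ℕ → ℂ := fun k => (qFac p k)⁻¹ * (qFac p k)⁻¹ with hd
  -- `d'` is the sequence `d C 𝔮^{2k}` shifted by one, with `0` at the start; the term pushed out at
  -- the top is a multiple of `G^p E^p y = 0`.
  set d' : ℕ → ℂ := fun k => match k with
    | 0 => 0
    | k + 1 => d k * C k * qq p k with hd'
  have hshift : ∑ k ∈ Finset.range p, (d k * C k * qq p k) • X (k + 1) =
      ∑ k ∈ Finset.range p, d' k • X k := by
    have e1 := Finset.sum_range_succ' (fun k : ℕ => d' k • X k) p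
    have e2 := Finset.sum_range_succ (fun k : ℕ => d' k • X k) p
    rw [hXp, smul_zero, add_zero] at e2
    rw [e2] at e1
    simpa [hd'] using e1.symm
  simp only [hsub, smul_add, Finset.sum_add_distrib, smul_smul, Finset.smul_sum]
  have hshift' : ∑ k ∈ Finset.range p,
      (q p ^ (m + 1) * (qq p 1 - 1) * (d k * C k * qq p k)) • X (k + 1) =
      ∑ k ∈ Finset.range p, (q p ^ (m + 1) * (qq p 1 - 1) * d' k) • X k := by
    have := congrArg (fun v => (q p ^ (m + 1) * (qq p 1 - 1)) • v) hshift
    simpa only [Finset.smul_sum, smul_smul] using this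
  rw [hshift', ← Finset.sum_add_distrib, ← Finset.sum_add_distrib, ← Finset.sum_add_distrib]
  refine Finset.sum_congr rfl fun k hk => ?_
  rw [Finset.mem_range] at hk
  rw [← add_smul, ← add_smul, ← add_smul]
  congr 1
  have hq1 : ∀ n : ℤ, (qq p 1 - 1) * qInt p n = qq p n - 1 := fun n => by
    have := one_sub_qq_ne hp
    rw [qInt_eq]; field_simp; ring
  cases k with
  | zero =>
    have := chiCoef_mul_zero (p := p) r m
    simp only [Nat.cast_zero, qInt_zero, zero_mul, mul_zero, add_zero, hd', hd, qFac_zero, hC]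
    linear_combination this
  | succ k =>
    have h1 := chiCoef_mul_succ hp r m k
    have h2 : qFac p k ≠ 0 := qFac_ne_zero hp (by omega)
    have h3 : qInt p (k + 1) ≠ 0 := qInt_ne_zero_of_lt hp (by omega) (by omega)
    have h4 := hq1 (k + 1)
    have h5 : q p ^ (m + 1 + 2 * (k + 1)) = q p ^ (m + 1) * qq p (k + 1) := by
      rw [qq, ← zpow_add₀ (q_ne_zero p)]
    have h6 : q p ^ (-(m + 1 + 2 * (k + 1))) = q p ^ (-(m + 1)) * (qq p (k + 1))⁻¹ := by
      rw [← qq_neg, qq, ← zpow_add₀ (q_ne_zero p)]; congr 1; ring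
    have h7 : qq p (-(m + 1 + ((k + 1 : ℕ) : ℤ))) = (q p ^ (m + 1))⁻¹ * (q p ^ (m + 1))⁻¹ *
        (qq p (k + 1))⁻¹ := by
      rw [← qq_neg, ← zpow_neg, qq, qq, ← zpow_add₀ (q_ne_zero p), ← zpow_add₀ (q_ne_zero p)]
      congr 1; push_cast; ring
    have h8 : q p ^ (-(m + 1)) = (q p ^ (m + 1))⁻¹ := zpow_neg _ _
    have h9 : q p ^ (m + 1) ≠ 0 := zpow_ne_zero _ (q_ne_zero p)
    have h10 := qq_ne_zero (p := p) (k + 1)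
    rw [h5, h6, h8] at h1
    rw [h7, h8]
    simp only [hd', hd, qFac_succ, Nat.cast_add, Nat.cast_one]
    rw [← hC] at h1
    generalize chiCoef p (r + 2) (r + 1) m (k + 1) = c1 at *
    generalize chiCoef p r (r - 1) m (k + 1) = c2 at *
    generalize C (k + 1) = c3 at *
    generalize C k = c4 at *
    generalize qFac p k = u at *
    generalize qInt p (k + 1) = b at *
    generalize q p ^ (m + 1) = x at *
    generalize qq p (k + 1) = z at *
    have hc : c1 = (x * z + x⁻¹ * z⁻¹) * c3 + x * (z - 1) * qq p k * b * c4 - c2 := by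
      linear_combination -h1
    rw [hc]
    field_simp
    linear_combination (c3 * (x ^ 2 * z - 1) + x ^ 2 * z * b * qq p k * c4) * h4

end relations

end
end NicholsLoop
namespace NicholsLoop
noncomputable section

/-! ### Reflection at `p`, Chebyshev polynomials and the fusion rule -/

section fusion

variable {p : ℕ} [NeZero p]

/-- In the sum over `0 ≤ s ≤ p` each end term gives the sign `(-1)^{m+1}` for `k = 0` and nothing
for `k > 0`. The inner terms are those of `chi (p-1) (p-2)`, because modulo `p` the arguments of the
proportional factors `⟨·⟩` and `1 - 𝔮^{2·}` change places. -/
theorem chi_succ_p (hp : 2 ≤ p) {Y : ModCo.{u} p} (h : CompleteOrthogonalIdempotents Y.proj) :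
    chi (p + 1) p Y = chi (p - 1) (p - 2) Y + 2 • signOp 1 Y := by
  obtain ⟨N, rfl⟩ : ∃ N, p = N + 1 := ⟨p - 1, by omega⟩
  rw [Nat.add_sub_cancel]
  refine hom_ext_homog h fun m y hy => ?_
  have hp0 : ((N + 1 : ℕ) : ℤ) = N + 1 := by push_cast; rfl
  rw [LinearMap.add_apply, LinearMap.smul_apply, signOp, chi_apply h _ _ hy, chi_apply h _ _ hy,
    chi_apply h _ _ hy, Finset.smul_sum, ← Finset.sum_add_distrib]
  refine Finset.sum_congr rfl fun k hk => ?_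
  rw [Finset.mem_range] at hk
  rw [two_smul, ← add_smul, ← add_smul]
  congr 1
  rw [← mul_add, ← mul_add]
  congr 1
  rw [chiCoef_sub_mul, chiCoef_one_zero, chiCoef, Finset.sum_range_succ, Finset.sum_range_succ',
    add_assoc]
  congr 1
  · rw [chiCoef]
    refine Finset.sum_congr rfl fun s _ => ?_
    congr 1
    · congr 2; push_cast; ring
    · refine Finset.prod_congr rfl fun i _ => ?_
      have e1 : qq (N + 1) (((s + 1 : ℕ) : ℤ) + i - (N + 1 : ℕ)) = qq (N + 1) (s + 1 + i) :=
        qq_congr ⟨-1, by push_cast; ring⟩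
      have e2 : qq (N + 1) ((s : ℤ) + i - ((N + 1 : ℕ) - 2)) = qq (N + 1) (s + 1 + 1 + i) :=
        qq_congr ⟨-1, by push_cast; ring⟩
      rw [e1, e2, qInt_eq, qInt_eq]
      rw [show (((s + 1 : ℕ) : ℤ) + 1 + i) = s + 1 + 1 + i by push_cast; ring]
      ring
  · cases k with
    | zero =>
      simp only [gCoef_zero, mul_one, if_true]
      congr 1
      · rw [show (m + 2 * ((0 : ℕ) : ℤ) + 1) * (((N + 1 : ℕ) : ℤ) - 2 * (0 : ℕ)) =
          (1 * (m + 1)) * (N + 1 : ℕ) by push_cast; ring, q_zpow_mul_p]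
      · rw [show (m + 2 * ((0 : ℕ) : ℤ) + 1) * (((N + 1 : ℕ) : ℤ) - 2 * (N + 1 : ℕ)) =
          (-(1 * (m + 1))) * (N + 1 : ℕ) by push_cast; ring, q_zpow_mul_p]
        exact neg_one_zpow_congr ⟨-(m + 1), by ring⟩
    | succ k =>
      have e1 : gCoef (N + 1) ((N + 1 : ℕ) : ℤ) ((0 : ℕ) : ℤ) (k + 1) = 0 := by
        rw [gCoef_succ', (qq_eq_one_iff _).2 ⟨-1, by push_cast; ring⟩]; simp
      have e2 := gCoef_self (p := N + 1) ((N + 1 : ℕ) : ℤ) k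
      rw [e1, e2]; simp

/-- Modulo `p`, the shift by `r` exchanges the arguments of `⟨·⟩` and `1 - 𝔮^{2·}`, and these two
expressions are proportional. -/
theorem gCoef_shift (r : ℕ) (ν s : ℤ) (k : ℕ) :
    gCoef p ((r : ℤ) - 1 - ν * p) (r + s) k = gCoef p (-(r : ℤ) - 1 - ν * p) s k := by
  refine Finset.prod_congr rfl fun i _ => ?_
  have e1 : qq p ((r : ℤ) + s + i - (r - 1 - ν * p)) = qq p (s + 1 + i) :=
    qq_congr ⟨ν, by ring⟩
  have e2 : qq p ((s : ℤ) + i - (-r - 1 - ν * p)) = qq p (r + s + 1 + i) :=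
    qq_congr ⟨ν, by ring⟩
  rw [e1, e2, qInt_eq, qInt_eq]
  ring

/-- The tower of length `p` breaks at `s = r`, where a new tower of charge `-r - 1 - νp = (p-r) - 1
- (ν+1)p` begins. -/
theorem chi_p_eq {Y : ModCo.{u} p} (h : CompleteOrthogonalIdempotents Y.proj) {r : ℕ} (hr : r ≤ p)
    (ν : ℤ) : chi p ((r : ℤ) - 1 - ν * p) Y = chi r ((r : ℤ) - 1 - ν * p) Y +
      chi (p - r) (((p - r : ℕ) : ℤ) - 1 - (ν + 1) * p) Y := by
  refine hom_ext_homog h fun m y hy => ?_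
  rw [LinearMap.add_apply, chi_apply h _ _ hy, chi_apply h _ _ hy, chi_apply h _ _ hy,
    ← Finset.sum_add_distrib]
  refine Finset.sum_congr rfl fun k _ => ?_
  rw [← add_smul, ← mul_add]
  congr 2
  rw [chiCoef]
  conv_lhs => rw [show Finset.range p = Finset.range (r + (p - r)) by congr 1; omega]
  rw [Finset.sum_range_add]
  congr 1
  refine Finset.sum_congr rfl fun s _ => ?_
  rw [Nat.cast_sub hr, show (p : ℤ) - r - 1 - (ν + 1) * p = -r - 1 - ν * p by ring,
    Nat.cast_add, gCoef_shift]
  congr 2; ring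

/-- The charge belongs to `p - r` with index `ν + 1`. Breaking that tower leads back to `r` with
index `ν + 2`, which is equivalent to `ν`. -/
theorem chi_p_neg_eq {Y : ModCo.{u} p} (h : CompleteOrthogonalIdempotents Y.proj) {r : ℕ}
    (hr : r ≤ p) (ν : ℤ) : chi p (-(r : ℤ) - 1 - ν * p) Y = chi r ((r : ℤ) - 1 - ν * p) Y +
      chi (p - r) (((p - r : ℕ) : ℤ) - 1 - (ν + 1) * p) Y := by
  have h1 := chi_p_eq h (Nat.sub_le p r) (ν + 1)
  rw [Nat.cast_sub hr, show (p : ℤ) - r - 1 - (ν + 1) * p = -r - 1 - ν * p by ring] at h1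
  rw [h1, Nat.sub_sub_self hr, show ν + 1 + 1 = ν + 2 by ring, chi_period h, add_comm,
    Nat.cast_sub hr, show (p : ℤ) - r - 1 - (ν + 1) * p = -r - 1 - ν * p by ring]

open Polynomial in
-- `chi_two_mul` is the three-term recursion of the polynomials `S_n`, and the initial values agree:
-- `chi 0 _ = 0` and `chi 1 0 = 1`.
theorem chi_eq_aeval (hp : 2 ≤ p) {Y : ModCo.{u} p} (hY : IsYD Y) (r : ℕ) :
    chi r (r - 1) Y = aeval (chi 2 1 Y) (Chebyshev.S ℂ (r - 1)) := by
  induction r using Nat.twoStepInduction with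
  | zero => simp [chi_zero _ hY.grading]
  | one => simp [chi_one_zero hY.grading]
  | more r h1 h2 =>
    have h3 := chi_two_mul hp r hY
    rw [show (((r + 1 : ℕ) : ℤ) - 1) = r by push_cast; ring] at h2
    rw [show (((r + 2 : ℕ) : ℤ) - 1) = r + 1 by push_cast; ring]
    rw [h1, h2] at h3
    rw [Chebyshev.S_add_one, map_sub, map_mul, aeval_X, h3, add_sub_cancel_right]

open Polynomial in
-- The Clebsch–Gordan rule before any truncation. With `m` in `ℤ` the induction on `n` needs no
-- comparison of `n` with `m`.
theorem S_mul_S (n : ℕ) (m : ℤ) : Chebyshev.S ℂ n * Chebyshev.S ℂ m =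
    ∑ j ∈ Finset.range (n + 1), Chebyshev.S ℂ (m - n + 2 * j) := by
  induction n using Nat.twoStepInduction with
  | zero => simp
  | one =>
    rw [Finset.sum_range_succ, Finset.sum_range_one]
    have := Chebyshev.S_add_one ℂ m
    rw [show m - ((1 : ℕ) : ℤ) + 2 * (0 : ℕ) = m - 1 by push_cast; ring,
      show m - ((1 : ℕ) : ℤ) + 2 * (1 : ℕ) = m + 1 by push_cast; ring, this]
    simp
  | more n h1 h2 =>
    have e : ((n + 2 : ℕ) : ℤ) = n + 2 := by push_cast; rfl
    have e1 : ((n + 1 : ℕ) : ℤ) = n + 1 := by push_cast; rfl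
    rw [e1] at h2
    have hX : ∀ i : ℤ, X * Chebyshev.S ℂ i = Chebyshev.S ℂ (i + 1) + Chebyshev.S ℂ (i - 1) := by
      intro i; rw [Chebyshev.S_add_one]; ring
    rw [e, Chebyshev.S_add_two, sub_mul, mul_assoc, h1, h2, Finset.mul_sum]
    simp only [hX]
    rw [Finset.sum_add_distrib, Finset.sum_range_succ _ (n + 1), Finset.sum_range_succ _ (n + 2)]
    have e2 : ∑ j ∈ Finset.range (n + 1), Chebyshev.S ℂ (m - (n + 1) + 2 * j + 1) =
        ∑ j ∈ Finset.range (n + 1), Chebyshev.S ℂ (m - n + 2 * j) :=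
      Finset.sum_congr rfl fun j _ => by congr 1; ring
    have e3 : ∑ j ∈ Finset.range (n + 2), Chebyshev.S ℂ (m - (n + 1) + 2 * j - 1) =
        ∑ j ∈ Finset.range (n + 2), Chebyshev.S ℂ (m - (n + 2) + 2 * j) :=
      Finset.sum_congr rfl fun j _ => by congr 1; ring
    have e4 : m - (n + 1) + 2 * ((n + 1 : ℕ) : ℤ) + 1 = m - (n + 2) + 2 * ((n + 2 : ℕ) : ℤ) := by
      push_cast; ring
    rw [e2, e3, e4]
    ring

/-- The values `s ≤ p` that are congruent to `p - N + 1` modulo `2` and at least `p - N + 1`. -/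
def upperHalf (p N : ℕ) : Finset ℕ :=
  (Finset.Icc 1 p).filter fun s => (p : ℤ) - N + 1 ≤ s ∧ (2 : ℤ) ∣ s - ((p : ℤ) - N + 1)

/-- The progression is symmetric about `p`. Raising `N` by two adds the outer pair `p ± (N+1)`,
which is one value of `P`; the middle term `p` is present for odd `N` only. -/
theorem sum_upperHalf {V : Type u} [AddCommGroup V] {f : ℤ → V} {P : ℕ → V} (hPp : P p = f p)
    (hP : ∀ j : ℕ, 1 ≤ j → j < p → P (p - j) = f (p - j) + f (p + j)) {N : ℕ} (hN : N ≤ p) :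
    ∑ i ∈ Finset.range N, f (p - N + 1 + 2 * i) = ∑ s ∈ upperHalf p N, P s := by
  induction N using Nat.twoStepInduction with
  | zero =>
    rw [Finset.range_zero, Finset.sum_empty, upperHalf, Finset.filter_false_of_mem,
      Finset.sum_empty]
    intro s hs h
    rw [Finset.mem_Icc] at hs
    push_cast at h
    omega
  | one =>
    have : upperHalf p 1 = {p} := by
      ext s
      simp only [upperHalf, Finset.mem_filter, Finset.mem_Icc, Finset.mem_singleton]
      constructor
      · rintro ⟨⟨h1, h2⟩, h3, h4⟩; push_cast at h3; omega
      · rintro rfl; exact ⟨⟨hN, le_rfl⟩, by push_cast; omega, by simp⟩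
    rw [this, Finset.sum_singleton, Finset.sum_range_one, hPp]
    congr 1; push_cast; ring
  | more N ih _ =>
    have h1 : upperHalf p (N + 2) = insert (p - (N + 1)) (upperHalf p N) := by
      ext s
      simp only [upperHalf, Finset.mem_filter, Finset.mem_Icc, Finset.mem_insert]
      push_cast
      omega
    have h2 : p - (N + 1) ∉ upperHalf p N := by
      simp only [upperHalf, Finset.mem_filter, Finset.mem_Icc]
      omega
    rw [h1, Finset.sum_insert h2, ← ih (by omega), hP (N + 1) (by omega) (by omega),
      Finset.sum_range_succ, Finset.sum_range_succ']
    have e1 : ∀ i : ℕ, f (p - ((N + 2 : ℕ) : ℤ) + 1 + 2 * ((i + 1 : ℕ) : ℤ)) =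
        f (p - N + 1 + 2 * i) := fun i => by congr 1; push_cast; ring
    rw [Finset.sum_congr rfl fun i _ => e1 i]
    have e2 : (p : ℤ) - ((N + 2 : ℕ) : ℤ) + 1 + 2 * ((0 : ℕ) : ℤ) = p - (N + 1 : ℕ) := by
      push_cast; ring
    have e3 : (p : ℤ) - ((N + 2 : ℕ) : ℤ) + 1 + 2 * ((N + 1 : ℕ) : ℤ) = p + (N + 1 : ℕ) := by
      push_cast; ring
    rw [e2, e3]
    abel

theorem fusionX_eq_image {r₁ r₂ : ℕ} (h1 : 1 ≤ r₁) (h12 : r₁ ≤ r₂) (h2 : r₂ ≤ p) :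
    fusionX p r₁ r₂ = (Finset.range (min r₁ (p - r₂))).image fun j => r₂ - r₁ + 1 + 2 * j := by
  ext s
  simp only [fusionX, Finset.mem_filter, Finset.mem_Icc, Finset.mem_image, Finset.mem_range]
  rw [abs_of_nonpos (show (r₁ : ℤ) - r₂ ≤ 0 by omega)]
  constructor
  · rintro ⟨⟨h3, h4⟩, h5, h6, k, hk⟩
    refine ⟨k.toNat, ?_, by omega⟩
    have h7 := abs_le.1 (show |(r₁ : ℤ) + r₂ - p| ≤ p - 1 - s by linarith)
    omega
  · rintro ⟨j, hj, rfl⟩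
    refine ⟨by omega, by omega, ?_, ⟨j, by push_cast; omega⟩⟩
    have h7 : |(r₁ : ℤ) + r₂ - p| ≤ p - 1 - ((r₂ - r₁ + 1 + 2 * j : ℕ) : ℤ) := by
      rw [abs_le]; omega
    linarith

theorem fusionP_eq {r₁ r₂ : ℕ} : fusionP p r₁ r₂ = upperHalf p (r₁ + r₂ - p) := by
  ext s
  simp only [fusionP, upperHalf, Finset.mem_filter, Finset.mem_Icc]
  rcases le_or_gt p (r₁ + r₂) with h | h
  · rw [Nat.cast_sub h]
    push_cast
    rw [show (p : ℤ) - (r₁ + r₂ - p) + 1 = 2 * p - r₁ - r₂ + 1 by ring]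
  · rw [Nat.sub_eq_zero_of_le h.le]
    push_cast
    omega

/-- The progression ends at `r₁ + r₂ - 1`. Its part symmetric about `p` starts at `2p - r₁ - r₂ + 1`
and folds into values of `P`; the first `p - r₂` terms remain as they are. If `r₁ + r₂ ≤ p`, nothing
is folded. -/
theorem sum_fusion {V : Type u} [AddCommGroup V] {f : ℤ → V} {P : ℕ → V} (hPp : P p = f p)
    (hP : ∀ j : ℕ, 1 ≤ j → j < p → P (p - j) = f (p - j) + f (p + j)) {r₁ r₂ : ℕ} (h1 : 1 ≤ r₁)
    (h12 : r₁ ≤ r₂) (h2 : r₂ ≤ p) :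
    ∑ j ∈ Finset.range r₁, f (r₂ - r₁ + 1 + 2 * j) =
      ∑ s ∈ fusionX p r₁ r₂, f s + ∑ s ∈ fusionP p r₁ r₂, P s := by
  rw [fusionX_eq_image h1 h12 h2, fusionP_eq, Finset.sum_image (fun a _ b _ h => by omega), ← sum_upperHalf hPp hP (show r₁ + r₂ - p ≤ p by omega)]
  rcases le_or_gt p (r₁ + r₂) with h | h
  · rw [min_eq_right (by omega)]
    conv_lhs => rw [show r₁ = (p - r₂) + (r₁ + r₂ - p) by omega, Finset.sum_range_add]
    congr 1
    · refine Finset.sum_congr rfl fun j _ => ?_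
      congr 1; omega
    · refine Finset.sum_congr rfl fun j _ => ?_
      congr 1; omega
  · rw [min_eq_left (by omega), Nat.sub_eq_zero_of_le h.le, Finset.range_zero, Finset.sum_empty,
      add_zero]
    refine Finset.sum_congr rfl fun j _ => ?_
    congr 1; omega

theorem fusionX_comm (r₁ r₂ : ℕ) : fusionX p r₁ r₂ = fusionX p r₂ r₁ := by
  rw [fusionX, fusionX, abs_sub_comm, add_comm (r₁ : ℤ)]

theorem fusionP_comm (r₁ r₂ : ℕ) : fusionP p r₁ r₂ = fusionP p r₂ r₁ := by
  rw [fusionP_eq, fusionP_eq, add_comm]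

/-- The loop operators of the simple modules, without the sign. -/
def chiInt (Y : ModCo.{u} p) (n : ℤ) : Module.End ℂ Y :=
  Polynomial.aeval (chi 2 1 Y) (Polynomial.Chebyshev.S ℂ (n - 1))

theorem commute_signOp (hp : 2 ≤ p) {Y : ModCo.{u} p} (hY : IsYD Y) (ν : ℤ)
    (f : Polynomial ℂ) : Commute (Polynomial.aeval (chi 2 1 Y) f) (signOp ν Y) := by
  have h1 : Commute (chi 2 1 Y) (signOp ν Y) := closed_two.commute hp hY
  induction f using Polynomial.induction_on with
  | C a => rw [Polynomial.aeval_C]; exact Algebra.commutes a _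
  | add f g hf hg => rw [map_add]; exact hf.add_left hg
  | monomial n a _ =>
    rw [map_mul, Polynomial.aeval_C, map_pow, Polynomial.aeval_X]
    exact Commute.mul_left (Algebra.commutes a (signOp ν Y)) (h1.pow_left _)

/-- Both sides satisfy the Chebyshev recursion in `j`. For `j = 0` the extra term contains `S_{-1} =
0`, and `j = 1` is `chi_succ_p`. -/
theorem chiInt_p_add (hp : 2 ≤ p) {Y : ModCo.{u} p} (hY : IsYD Y) (j : ℕ) :
    chiInt Y (p + j) = chiInt Y (p - j) + 2 • (chiInt Y j * signOp 1 Y) := by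
  have hrec : ∀ i : ℤ, chiInt Y (i + 1) = chi 2 1 Y * chiInt Y i - chiInt Y (i - 1) := by
    intro i
    rw [chiInt, chiInt, chiInt, show i + 1 - 1 = (i - 1) + 1 by ring,
      Polynomial.Chebyshev.S_add_one, map_sub, map_mul, Polynomial.aeval_X]
  induction j using Nat.twoStepInduction with
  | zero => simp [chiInt]
  | one =>
    have h1 := chi_succ_p hp hY.grading
    have h2 := chi_eq_aeval hp hY (p + 1)
    have h3 := chi_eq_aeval hp hY (p - 1)
    rw [show (((p - 1 : ℕ) : ℤ) - 1) = p - 2 by omega] at h3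
    rw [show (((p + 1 : ℕ) : ℤ) - 1) = p by omega] at h2
    rw [h2, h3] at h1
    rw [chiInt, chiInt, chiInt, show (p : ℤ) + (1 : ℕ) - 1 = p by push_cast; ring,
      show (p : ℤ) - (1 : ℕ) - 1 = p - 2 by push_cast; ring, h1]
    simp
  | more j h1 h2 =>
    have e1 := hrec (p + (j + 1))
    have e2 := hrec (p - (j + 1))
    have e3 := hrec (j + 1)
    rw [show (p : ℤ) + (j + 1) - 1 = p + j by ring, show (p : ℤ) + (j + 1) + 1 = p + (j + 2) by ring]
      at e1
    rw [show (p : ℤ) - (j + 1) + 1 = p - j by ring, show (p : ℤ) - (j + 1) - 1 = p - (j + 2) by ring]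
      at e2
    rw [show (j : ℤ) + 1 + 1 = j + 2 by ring, show (j : ℤ) + 1 - 1 = j by ring] at e3
    push_cast at h1 h2 ⊢
    rw [e1, h2, h1, e3, mul_add, mul_smul_comm, ← mul_assoc, sub_mul, smul_sub, e2]
    abel

theorem chi_simple_eq (hp : 2 ≤ p) {Y : ModCo.{u} p} (hY : IsYD Y) (r : ℕ) (ν : ℤ) :
    chi r (r - 1 - ν * p) Y = chiInt Y r * signOp ν Y := by
  rw [chi_sub_mul hY.grading, chi_eq_aeval hp hY, chiInt]

/-- The sign operators commute with everything here and multiply to `signOp (ν₁ + ν₂)`, so the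
product reduces to `S_mul_S`. The folding hypothesis of `sum_fusion` is `chiInt_p_add`. The family
`P` is abstract, which keeps the rule independent of the two-vertex modules. -/
theorem chi_fusion (hp : 2 ≤ p) {Y : ModCo.{u} p} (hY : IsYD Y) {P : ℕ → ℤ → Module.End ℂ Y}
    (hPp : ∀ ν, P p ν = chi p (p - 1 - ν * p) Y)
    (hP : ∀ r ν, 1 ≤ r → r < p → P r ν = 2 • chi r (r - 1 - ν * p) Y +
      2 • chi (p - r) (((p - r : ℕ) : ℤ) - 1 - (ν + 1) * p) Y)
    {r₁ r₂ : ℕ} (ν₁ ν₂ : ℤ) (h1 : 1 ≤ r₁) (h1' : r₁ ≤ p) (h2 : 1 ≤ r₂) (h2' : r₂ ≤ p) :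
    chi r₁ (r₁ - 1 - ν₁ * p) Y * chi r₂ (r₂ - 1 - ν₂ * p) Y =
      ∑ s ∈ fusionX p r₁ r₂, chi s (s - 1 - (ν₁ + ν₂) * p) Y +
      ∑ s ∈ fusionP p r₁ r₂, P s (ν₁ + ν₂) := by
  wlog h12 : r₁ ≤ r₂ generalizing r₁ r₂ ν₁ ν₂
  · have := this ν₂ ν₁ h2 h2' h1 h1' (by omega)
    rw [((closed_simple r₁ ν₁).commute hp hY).eq, this, fusionX_comm, fusionP_comm,
      add_comm ν₂]
  have hc : ∀ n : ℤ, Commute (signOp ν₁ Y) (chiInt Y n) := fun n => (commute_signOp hp hY ν₁ _).symm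
  rw [chi_simple_eq hp hY, chi_simple_eq hp hY, mul_assoc, ← mul_assoc (signOp ν₁ Y), (hc r₂).eq,
    mul_assoc (chiInt Y r₂), ← mul_assoc, ← signOp_add hY.grading]
  have hprod : chiInt Y r₁ * chiInt Y r₂ =
      ∑ j ∈ Finset.range r₁, chiInt Y (r₂ - r₁ + 1 + 2 * j) := by
    rw [chiInt, chiInt, ← map_mul]
    obtain ⟨n, rfl⟩ : ∃ n, r₁ = n + 1 := ⟨r₁ - 1, by omega⟩
    rw [show (((n + 1 : ℕ) : ℤ) - 1) = n by push_cast; ring, S_mul_S, map_sum]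
    refine Finset.sum_congr rfl fun j _ => ?_
    rw [chiInt]
    congr 2; push_cast; ring
  rw [hprod, Finset.sum_mul]
  simp only [chi_simple_eq hp hY]
  refine sum_fusion (f := fun n => chiInt Y n * signOp (ν₁ + ν₂) Y)
    (P := fun s => P s (ν₁ + ν₂)) ?_ ?_ h1 h12 h2'
  · rw [hPp, chi_simple_eq hp hY]
  · intro j hj hj'
    rw [hP _ _ (by omega) (by omega), chi_simple_eq hp hY, chi_simple_eq hp hY,
      chiInt_p_add hp hY, add_mul, Nat.sub_sub_self hj'.le, smul_mul_assoc, mul_assoc (chiInt Y j),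
      ← signOp_add hY.grading, add_comm 1 (ν₁ + ν₂), Nat.cast_sub hj'.le, two_smul (R := ℕ), add_assoc]

end fusion

end
end NicholsLoop
namespace NicholsLoop
noncomputable section

/-! ### Highest weight vectors -/

section highestWeight

variable {p : ℕ} [NeZero p]

/-- The antipode coefficients satisfy `c_{k+1} ⟨k+1⟩ = -𝔮^{2k} c_k`. Hence `∑ c_k G^k E^k` passes
through `G` with the factor `𝔮^{-2m}`, which the twist `𝔮^{-m²/2}` turns into the charge-independent
`𝔮^{-2}`. -/
theorem IsEF.curl_lower (hp : 2 ≤ p) {M : ModCo.{u} p} {E G : Module.End ℂ M} (h : IsEF M E G)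
    {m : ℤ} {x : M} (hx : Homog M m x) :
    curl M E G (G x) = q p ^ (-2 : ℤ) • G (curl M E G x) := by
  rw [curl_apply h.grading E G hx, curl_apply h.grading E G (h.homog_lower _ _ hx)]
  set c : ℕ → ℂ := fun n => (-1) ^ n * q p ^ ((n : ℤ) * ((n : ℤ) - 1)) * (qFac p n)⁻¹ with hc
  obtain ⟨N, hN⟩ : ∃ N, p = N + 1 := ⟨p - 1, by omega⟩
  have hr : Finset.range p = Finset.range (N + 1) := by rw [hN]
  have hG : (G ^ (N + 1)) ((E ^ N) x) = 0 := by
    rw [← hN]; exact pow_mul_eq_zero_of_eq h.lower_pow _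
  have hsub : ∀ k : ℕ, (G ^ (k + 1)) ((E ^ (k + 1)) (G x)) =
      qq p (k + 1) • (G ^ (k + 2)) ((E ^ (k + 1)) x) +
      (qInt p (k + 1) * (1 - qq p (-(m + k)))) • (G ^ (k + 1)) ((E ^ k) x) := by
    intro k
    rw [h.raise_pow_lower hp hx, map_add, map_smul, map_smul, pow_succ G (k + 1)]
    rfl
  have key : ∑ n ∈ Finset.range p, c n • (G ^ n) ((E ^ n) (G x)) =
      qq p (-m) • G (∑ n ∈ Finset.range p, c n • (G ^ n) ((E ^ n) x)) := by
    rw [hr, map_sum]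
    have e1 := Finset.sum_range_succ' (fun n => c n • (G ^ n) ((E ^ n) (G x))) N
    have e2 := Finset.sum_range_succ (fun n => G (c n • (G ^ n) ((E ^ n) x))) N
    rw [e2, e1]
    simp only [map_smul]
    rw [← Module.End.mul_apply G (G ^ N), ← pow_succ', hG, smul_zero, add_zero]
    simp only [hsub, smul_add, Finset.sum_add_distrib, smul_smul, Finset.smul_sum]
    have e3 := Finset.sum_range_succ' (fun k : ℕ => (c k * qq p k) • (G ^ (k + 1)) ((E ^ k) x)) N
    have e4 := Finset.sum_range_succ (fun k : ℕ => (c k * qq p k) • (G ^ (k + 1)) ((E ^ k) x)) N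
    rw [hG, smul_zero, add_zero] at e4
    rw [e4] at e3
    rw [add_right_comm]
    simp only [Nat.cast_zero, qq_zero, mul_one, zero_add, pow_one, pow_zero,
      Module.End.one_apply, Nat.cast_add, Nat.cast_one] at e3 ⊢
    rw [← e3, ← Finset.sum_add_distrib]
    refine Finset.sum_congr rfl fun k hk => ?_
    rw [Finset.mem_range] at hk
    rw [← Module.End.mul_apply G (G ^ k), ← pow_succ', ← add_smul]
    congr 1
    have h2 := qFac_ne_zero hp (show k < p by omega)
    have h3 : qInt p (k + 1) ≠ 0 := qInt_ne_zero_of_lt hp (by omega) (by omega)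
    have h4 : qq p (-(m + k)) = qq p (-m) * (qq p k)⁻¹ := by
      rw [← qq_neg, ← qq_add]; congr 1; ring
    have h5 : q p ^ (((k + 1 : ℕ) : ℤ) * (((k + 1 : ℕ) : ℤ) - 1)) =
        q p ^ ((k : ℤ) * (k - 1)) * qq p k := by
      rw [qq, ← zpow_add₀ (q_ne_zero p)]; congr 1; push_cast; ring
    have h6 := qq_ne_zero (p := p) k
    simp only [hc]
    rw [h4, h5, qFac_succ, pow_succ]
    field_simp
    ring
  rw [key, map_smul, smul_smul, smul_smul]
  congr 1
  rw [qq, q_zpow_eq, q_zpow_eq, ← zpow_add₀ (qHalf_ne_zero p), ← zpow_add₀ (qHalf_ne_zero p)]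
  congr 1; ring

theorem End.pow_mem {V : Type u} [AddCommGroup V] [Module ℂ V] {N : Submodule ℂ V}
    {T : Module.End ℂ V} (hT : ∀ x ∈ N, T x ∈ N) (k : ℕ) {x : V} (hx : x ∈ N) : (T ^ k) x ∈ N := by
  induction k with
  | zero => exact hx
  | succ k ih => rw [pow_succ', Module.End.mul_apply]; exact hT _ ih

/-- `w` is a vector of charge `a` which `E` sends to the submodule `N`. -/
structure IsHighest (M : ModCo.{u} p) (E G : Module.End ℂ M) (N : Submodule ℂ M) (a : ℤ)
    (w : M) : Prop where
  raise_mem : ∀ x ∈ N, E x ∈ N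
  lower_mem : ∀ x ∈ N, G x ∈ N
  homog : Homog M a w
  mem : E w ∈ N

/-- `θ` acts on `M / N` by the ribbon scalar of charge `a` at `w`. -/
structure IsRibbonAt (M : ModCo.{u} p) (G : Module.End ℂ M) (N : Submodule ℂ M) (a : ℤ)
    (w : M) (θ : Module.End ℂ M) : Prop where
  homog : ∀ m x, Homog M m x → Homog M m (θ x)
  lower : ∀ x, θ (G x) = G (θ x)
  mem : ∀ x ∈ N, θ x ∈ N
  apply_mem : θ w - qHalf p ^ ((a + 1) ^ 2 - 1) • w ∈ N

section

variable {M : ModCo.{u} p} {E G : Module.End ℂ M} (h : IsEF M E G) {N : Submodule ℂ M} {a : ℤ}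
  {w : M} (hw : IsHighest M E G N a w)
include h hw

/-- Modulo `N` the vector `w` is annihilated by `E`, so only the scalar part of `raise_lower_pow`
survives at each step. -/
theorem IsHighest.raise_pow_mem (hp : 2 ≤ p) (s k : ℕ) :
    (E ^ k) ((G ^ k) ((G ^ s) w)) - gCoef p a s k • (G ^ s) w ∈ N := by
  induction k with
  | zero => simp
  | succ k ih =>
    have h1 : (E ^ (k + 1)) ((G ^ (k + 1)) ((G ^ s) w)) =
        (E ^ k) (E ((G ^ (k + s + 1)) w)) := by
      rw [pow_succ E, Module.End.mul_apply, ← Module.End.mul_apply (G ^ (k + 1)), ← pow_add]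
      congr 4; ring
    rw [h1, h.raise_lower_pow hp hw.homog, map_add, map_smul, map_smul, pow_add G k s,
      gCoef_succ, Module.End.mul_apply (G ^ k) (G ^ s) w]
    have h2 : (E ^ k) ((G ^ (k + s + 1)) (E w)) ∈ N :=
      End.pow_mem hw.raise_mem _ (End.pow_mem hw.lower_mem _ hw.mem)
    have h3 := N.add_mem (N.smul_mem (qq p ((k + s : ℕ) + 1)) h2)
      (N.smul_mem (qInt p ((k + s : ℕ) + 1) * (1 - qq p (-(a - (k + s : ℕ))))) ih)
    convert h3 using 1
    rw [smul_sub, smul_smul, show -(a - ((k + s : ℕ) : ℤ)) = s + k - a by push_cast; ring,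
      show (((k + s : ℕ) : ℤ) + 1) = s + 1 + k by push_cast; ring]
    rw [add_sub_assoc]
    congr 3
    ring

/-- At `w` all terms of `curl` containing `E` lie in `N`; `curl_lower` carries the result along the
tower. -/
theorem IsHighest.curl_mem (hp : 2 ≤ p) (s : ℕ) :
    curl M E G ((G ^ s) w) - (qHalf p ^ (-(a * a)) * q p ^ (-2 * (s : ℤ))) • (G ^ s) w ∈ N := by
  induction s with
  | zero =>
    rw [pow_zero, Module.End.one_apply, curl_apply h.grading E G hw.homog]
    obtain ⟨n, hn⟩ : ∃ n, p = n + 1 := ⟨p - 1, by omega⟩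
    have hr : Finset.range p = Finset.range (n + 1) := by rw [hn]
    rw [hr, Finset.sum_range_succ']
    simp only [Nat.cast_zero, mul_zero, zpow_zero, mul_one, pow_zero, zero_mul, qFac_zero, inv_one,
      one_smul, Module.End.one_apply]
    rw [smul_add, add_sub_cancel_right]
    refine N.smul_mem _ (N.sum_mem fun k _ => N.smul_mem _ (End.pow_mem hw.lower_mem _ ?_))
    rw [pow_succ, Module.End.mul_apply]
    exact End.pow_mem hw.raise_mem _ hw.mem
  | succ s ih =>
    rw [pow_succ', Module.End.mul_apply, h.curl_lower hp (h.homog_lower_pow hw.homog s)]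
    have := N.smul_mem (q p ^ (-2 : ℤ)) (hw.lower_mem _ ih)
    convert this using 1
    rw [map_sub, map_smul, smul_sub, smul_smul]
    congr 2
    rw [show -2 * (((s + 1 : ℕ) : ℤ)) = -2 + -2 * s by push_cast; ring, zpow_add₀ (q_ne_zero p)]
    ring

theorem IsHighest.curl_mem_of_mem {m : ℤ} {x : M} (hx : Homog M m x) (hxN : x ∈ N) :
    curl M E G x ∈ N := by
  rw [curl_apply h.grading E G hx]
  exact N.smul_mem _ (N.sum_mem fun k _ => N.smul_mem _ (End.pow_mem hw.lower_mem _
    (End.pow_mem hw.raise_mem _ hxN)))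

/-- Exponents of `𝔮^{1/2}`: the two weights give `2n(a-2s)`, the ribbon map `(a+1)² - 1`, and `curl`
gives `-a² - 4s`. The sum is `2(n+1)(a-2s)`; the ribbon map serves to cancel the quadratic term. -/
theorem IsHighest.loop_mem (hp : 2 ≤ p) {θ : Module.End ℂ M} (hθ : IsRibbonAt M G N a w θ) (n : ℤ)
    (k s : ℕ) :
    (curl M E G * θ * weight M.proj (n : ZMod (4 * p)) * E ^ k * G ^ k *
      weight M.proj (n : ZMod (4 * p))) ((G ^ s) w) -
      (q p ^ ((n + 1) * (a - 2 * s)) * gCoef p a s k) • (G ^ s) w ∈ N := by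
  have hs := h.homog_lower_pow hw.homog s
  have hks : Homog M (a - 2 * s) ((E ^ k) ((G ^ k) ((G ^ s) w))) := by
    have := h.homog_raise_pow (h.homog_lower_pow hs k) k
    rwa [sub_add_cancel] at this
  simp only [Module.End.mul_apply]
  rw [weight_apply h.grading n hs, map_smul, map_smul, map_smul, weight_apply h.grading n hks,
    map_smul, map_smul, map_smul, map_smul, smul_smul]
  set g := gCoef p a s k
  set x0 := (E ^ k) ((G ^ k) ((G ^ s) w)) - g • (G ^ s) w with hx0
  have hx0N : x0 ∈ N := hw.raise_pow_mem h hp s k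
  have hx0h : Homog M (a - 2 * s) x0 := by
    rw [Homog, hx0, map_sub, hks, hs.smul g]
  have e0 : (E ^ k) ((G ^ k) ((G ^ s) w)) = x0 + g • (G ^ s) w := by rw [hx0, sub_add_cancel]
  have hθs : ∀ s : ℕ, θ ((G ^ s) w) = (G ^ s) (θ w) := by
    intro s
    induction s with
    | zero => rfl
    | succ s ih =>
      rw [pow_succ', Module.End.mul_apply, Module.End.mul_apply, hθ.lower, ih]
  set x1 := θ w - qHalf p ^ ((a + 1) ^ 2 - 1) • w with hx1
  have hx1h : Homog M a x1 := by
    rw [Homog, hx1, map_sub, hθ.homog _ _ hw.homog, hw.homog.smul _]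
  have e1 : θ w = x1 + qHalf p ^ ((a + 1) ^ 2 - 1) • w := by rw [hx1, sub_add_cancel]
  set x2 := curl M E G ((G ^ s) w) - (qHalf p ^ (-(a * a)) * q p ^ (-2 * (s : ℤ))) • (G ^ s) w
    with hx2
  have e2 : curl M E G ((G ^ s) w) =
      x2 + (qHalf p ^ (-(a * a)) * q p ^ (-2 * (s : ℤ))) • (G ^ s) w := by rw [hx2, sub_add_cancel]
  have m2 : x2 ∈ N := hw.curl_mem h hp s
  have m1 : curl M E G ((G ^ s) x1) ∈ N :=
    hw.curl_mem_of_mem h (h.homog_lower_pow hx1h s) (End.pow_mem hw.lower_mem _ hθ.apply_mem)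
  have m0 : curl M E G (θ x0) ∈ N := hw.curl_mem_of_mem h (hθ.homog _ _ hx0h) (hθ.mem _ hx0N)
  set c := qHalf p ^ (n * (a - 2 * s))
  set τ := qHalf p ^ ((a + 1) ^ 2 - 1)
  have hfin : (c * c) • curl M E G (θ ((E ^ k) ((G ^ k) ((G ^ s) w)))) -
      (q p ^ ((n + 1) * (a - 2 * s)) * g) • (G ^ s) w =
      (c * c) • (curl M E G (θ x0) + g • curl M E G ((G ^ s) x1) + (g * τ) • x2) := by
    have e4 : q p ^ ((n + 1) * (a - 2 * s)) * g =
        c * c * (g * τ * (qHalf p ^ (-(a * a)) * q p ^ (-2 * (s : ℤ)))) := by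
      rw [q_zpow_eq, q_zpow_eq]
      rw [show 2 * ((n + 1) * (a - 2 * (s : ℤ))) = n * (a - 2 * s) + n * (a - 2 * s) +
        ((a + 1) ^ 2 - 1) + -(a * a) + 2 * (-2 * s) by ring, zpow_add₀ (qHalf_ne_zero p),
        zpow_add₀ (qHalf_ne_zero p), zpow_add₀ (qHalf_ne_zero p), zpow_add₀ (qHalf_ne_zero p)]
      ring
    rw [e0, e4, map_add, map_smul, hθs, e1]
    simp only [map_add, map_smul]
    rw [e2]
    module
  rw [hfin]
  exact N.smul_mem _ (N.add_mem (N.add_mem m0 (N.smul_mem _ m1)) (N.smul_mem _ m2))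

end

theorem trace_of_flag {V : Type u} [AddCommGroup V] [Module ℂ V] {ι : Type v} {κ : Type w}
    [Fintype ι] [Fintype κ] (b : Module.Basis (ι ⊕ κ) ℂ V) (T : Module.End ℂ V) (c : ι → ℂ)
    (d : κ → ℂ) (hc : ∀ i, T (b (Sum.inl i)) = c i • b (Sum.inl i))
    (hd : ∀ k, T (b (Sum.inr k)) - d k • b (Sum.inr k) ∈
      Submodule.span ℂ (Set.range fun i => b (Sum.inl i))) :
    LinearMap.trace ℂ V T = ∑ i, c i + ∑ k, d k := by
  classical
  rw [LinearMap.trace_eq_matrix_trace ℂ b, Matrix.trace, Fintype.sum_sum_type]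
  congr 1
  · refine Finset.sum_congr rfl fun i _ => ?_
    rw [Matrix.diag_apply, LinearMap.toMatrix_apply, hc]
    simp
  · refine Finset.sum_congr rfl fun k _ => ?_
    rw [Matrix.diag_apply, LinearMap.toMatrix_apply]
    have h1 : ∀ x ∈ Submodule.span ℂ (Set.range fun i => b (Sum.inl i)),
        b.coord (Sum.inr k) x = 0 := by
      intro x hx
      induction hx using Submodule.span_induction with
      | mem x hx => obtain ⟨i, rfl⟩ := hx; simp
      | zero => simp
      | add x y _ _ hx hy => rw [map_add, hx, hy, add_zero]
      | smul a x _ hx => rw [map_smul, hx, smul_zero]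
    have h2 := h1 _ (hd k)
    rw [map_sub, map_smul, sub_eq_zero] at h2
    simpa using h2

theorem trace_of_eigenbasis {V : Type u} [AddCommGroup V] [Module ℂ V] {ι : Type v}
    [Fintype ι] (b : Module.Basis ι ℂ V) (T : Module.End ℂ V) (c : ι → ℂ)
    (hc : ∀ i, T (b i) = c i • b i) : LinearMap.trace ℂ V T = ∑ i, c i := by
  classical
  rw [LinearMap.trace_eq_matrix_trace ℂ b, Matrix.trace]
  refine Finset.sum_congr rfl fun i _ => ?_
  rw [Matrix.diag_apply, LinearMap.toMatrix_apply, hc]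
  simp

/-- Multiplication by `𝔮^{-2m}` on the component of charge `m`. -/
def kOp (M : ModCo.{u} p) : Module.End ℂ M := ∑ j : ZMod (4 * p), qq p (-(j.val : ℤ)) • M.proj j

theorem kOp_apply {M : ModCo.{u} p} (h : CompleteOrthogonalIdempotents M.proj) {m : ℤ} {x : M}
    (hx : Homog M m x) : kOp M x = qq p (-m) • x := by
  rw [kOp, LinearMap.sum_apply, Finset.sum_eq_single (m : ZMod (4 * p))]
  · rw [LinearMap.smul_apply, show M.proj m x = x from hx]
    congr 1
    refine qq_congr ?_
    have : ((4 * p : ℕ) : ℤ) ∣ -(((m : ZMod (4 * p)).val : ℤ)) - -m := by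
      rw [← ZMod.intCast_zmod_eq_zero_iff_dvd]; simp
    exact dvd_trans ⟨4, by push_cast; ring⟩ this
  · intro j _ hj; rw [LinearMap.smul_apply, hx.proj_eq h, if_neg hj.symm, smul_zero]
  · simp

section generators

variable {M : ModCo.{u} p} {ι : Type v} {e : ι → M}

theorem homog_of_generators (h : CompleteOrthogonalIdempotents M.proj)
    (hspan : Submodule.span ℂ (Set.range e) = ⊤) {c : ι → ℤ} (he : ∀ i, Homog M (c i) (e i))
    {T : Module.End ℂ M} {d : ℤ} (hT : ∀ i, Homog M (c i + d) (T (e i))) (m : ℤ) (x : M)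
    (hx : Homog M m x) : Homog M (m + d) (T x) := by
  have h1 : T ∘ₗ M.proj m = M.proj ((m + d : ℤ) : ZMod (4 * p)) ∘ₗ T := by
    refine LinearMap.ext_on_range hspan fun i => ?_
    rw [LinearMap.comp_apply, LinearMap.comp_apply, (he i).proj_eq h, (hT i).proj_eq h]
    push_cast
    simp only [add_left_inj]
    split_ifs <;> simp
  have h2 := LinearMap.congr_fun h1 x
  rw [LinearMap.comp_apply, LinearMap.comp_apply, show M.proj m x = x from hx] at h2
  exact h2.symm

/-- The scalar in the commutation relation depends on the charge. With `kOp` the relation is the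
linear identity `E G = 𝔮² G E + 1 - K`, which can be tested on a spanning set. -/
theorem isEF_of_generators (h : CompleteOrthogonalIdempotents M.proj)
    (hspan : Submodule.span ℂ (Set.range e) = ⊤) {c : ι → ℤ} (he : ∀ i, Homog M (c i) (e i))
    {E G : Module.End ℂ M} (hE : ∀ i, Homog M (c i + 2) (E (e i)))
    (hG : ∀ i, Homog M (c i - 2) (G (e i))) (hEp : ∀ i, (E ^ p) (e i) = 0)
    (hGp : ∀ i, (G ^ p) (e i) = 0)
    (hact : ∀ r < p, ∀ i, M.act (F p r ⊗ₜ[ℂ] e i) = (qFac p r)⁻¹ • (G ^ r) (e i))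
    (hcoact : ∀ i, M.coact (e i) = ∑ k ∈ Finset.range p, F p k ⊗ₜ[ℂ] (E ^ k) (e i))
    (hcomm : ∀ i, E (G (e i)) = qq p 1 • G (E (e i)) + (1 - qq p (-c i)) • e i) : IsEF M E G where
  grading := h
  homog_raise := homog_of_generators h hspan he hE
  homog_lower := homog_of_generators h hspan he hG
  raise_pow := LinearMap.ext_on_range hspan hEp
  lower_pow := LinearMap.ext_on_range hspan hGp
  act_F r hr x := by
    have : M.act ∘ₗ TensorProduct.mk ℂ (Nich p) M (F p r) = (qFac p r)⁻¹ • G ^ r :=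
      LinearMap.ext_on_range hspan fun i => hact r hr i
    exact LinearMap.congr_fun this x
  coact_eq x := by
    have : M.coact = ∑ k ∈ Finset.range p, TensorProduct.mk ℂ (Nich p) M (F p k) ∘ₗ E ^ k :=
      LinearMap.ext_on_range hspan fun i => by rw [hcoact, LinearMap.sum_apply]; rfl
    rw [this, LinearMap.sum_apply]; rfl
  comm m x hx := by
    have : E ∘ₗ G = qq p 1 • (G ∘ₗ E) + (1 - kOp M) := by
      refine LinearMap.ext_on_range hspan fun i => ?_
      simp only [LinearMap.comp_apply, LinearMap.add_apply, LinearMap.smul_apply,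
        LinearMap.sub_apply, Module.End.one_apply]
      rw [hcomm, kOp_apply h (he i), sub_smul, one_smul]
    have h1 := LinearMap.congr_fun this x
    simp only [LinearMap.comp_apply, LinearMap.add_apply, LinearMap.smul_apply,
      LinearMap.sub_apply, Module.End.one_apply] at h1
    rw [h1, kOp_apply h hx, sub_smul, one_smul]

end generators

end highestWeight

end
end NicholsLoop
namespace NicholsLoop
noncomputable section

/-! ### One-vertex modules -/

section simple

variable {p : ℕ} [NeZero p]

theorem qFac_add (s k : ℕ) :
    qFac p (s + k) = qFac p s * ∏ i ∈ Finset.range k, qInt p ((s : ℤ) + 1 + i) := by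
  rw [qFac, qFac, Finset.prod_range_add]
  congr 1
  refine Finset.prod_congr rfl fun i _ => ?_
  congr 1; push_cast; ring

/-- The powers of `ξ` turn `⟨n⟩` into `1 - 𝔮^{2n}`, and the factorials that occur are invertible
because `s + k < p`. -/
theorem qBinom_mul_prod (hp : 2 ≤ p) {s k : ℕ} (h : s + k < p) (a : ℤ) :
    qBinom p (s + k) k * xi p ^ k * ∏ i ∈ Finset.range k, qInt p ((s : ℤ) + i - a) =
      (qFac p k)⁻¹ * gCoef p a s k := by
  have h1 := qFac_ne_zero hp (show s < p by omega)
  have h2 := qFac_ne_zero hp (show k < p by omega)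
  have h3 : ∏ i ∈ Finset.range k, (1 - qq p ((s : ℤ) + i - a)) =
      xi p ^ k * ∏ i ∈ Finset.range k, qInt p ((s : ℤ) + i - a) := by
    have h4 : xi p ^ k = ∏ _i ∈ Finset.range k, xi p := by
      rw [Finset.prod_const, Finset.card_range]
    rw [h4, ← Finset.prod_mul_distrib]
    exact Finset.prod_congr rfl fun i _ => (xi_mul_qInt hp _).symm
  rw [qBinom, Nat.add_sub_cancel, qFac_add, gCoef, Finset.prod_mul_distrib, h3]
  field_simp

/-- The arguments `i + 1` and `i + 1 - r` are nonzero modulo `p` for `i < s < r ≤ p`. Consequently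
every `V_s` is a nonzero multiple of `G^s V_0`. -/
theorem gCoef_ne_zero (hp : 2 ≤ p) {r : ℕ} (hr : r ≤ p) (ν : ℤ) {s : ℕ} (hs : s < r) :
    gCoef p ((r : ℤ) - 1 - ν * p) 0 s ≠ 0 := by
  rw [gCoef, Finset.prod_ne_zero_iff]
  intro i hi
  rw [Finset.mem_range] at hi
  refine mul_ne_zero (qInt_ne_zero_of_lt hp (by omega) (by omega)) ?_
  rw [sub_ne_zero, ne_comm, Ne, qq_eq_one_iff]
  rintro ⟨c, hc⟩
  have h1 : (p : ℤ) * (ν - c) = r - 1 - i := by linarith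
  have h2 : (0 : ℤ) < p * (ν - c) := by omega
  have h3 : 0 < ν - c := by
    by_contra h; push Not at h; nlinarith [mul_nonneg (show (0 : ℤ) ≤ p by omega) (neg_nonneg.2 h)]
  nlinarith

/-- The vector `V^a_s` of `X(r)_ν`. -/
def simpleVec (p : ℕ) [NeZero p] (r : ℕ) (ν : ℤ) (s : ℕ) : simpleMod p r ν :=
  (vec r s : Fin r → ℂ)

variable {r : ℕ} {ν : ℤ}

theorem simpleVec_eq_zero {s : ℕ} (h : r ≤ s) : simpleVec p r ν s = 0 := vec_eq_zero h

/-- The basis `V^a_s`, `0 ≤ s ≤ r - 1`, of `X(r)_ν`. -/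
def simpleBasis (p : ℕ) [NeZero p] (r : ℕ) (ν : ℤ) : Module.Basis (Fin r) ℂ (simpleMod p r ν) :=
  Pi.basisFun ℂ (Fin r)

theorem simpleBasis_apply (s : Fin r) : simpleBasis p r ν s = simpleVec p r ν s :=
  (Pi.basisFun_apply ℂ (Fin r) s).trans (vec_eq_single s.2).symm

theorem span_simpleVec :
    Submodule.span ℂ (Set.range fun s : Fin r => simpleVec p r ν s) = ⊤ := by
  rw [← (simpleBasis p r ν).span_eq]
  congr 2
  funext s
  exact (simpleBasis_apply s).symm

theorem simpleMod_grading : CompleteOrthogonalIdempotents (simpleMod p r ν).proj :=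
  coordProj_complete _

theorem homog_simpleVec (s : ℕ) :
    Homog (simpleMod p r ν) ((r : ℤ) - 1 - ν * p - 2 * s) (simpleVec p r ν s) := by
  by_cases hs : s < r
  · have h1 : simpleVec p r ν s = (Pi.single ⟨s, hs⟩ 1 : Fin r → ℂ) := vec_eq_single hs
    rw [Homog, h1]
    refine (coordProj_single _ _ _).trans (if_pos rfl)
  · rw [simpleVec_eq_zero (by omega)]; exact Homog.zero _

theorem simpleMod_act {k s : ℕ} (hk : k < p) (hs : s < r) :
    (simpleMod p r ν).act (F p k ⊗ₜ[ℂ] simpleVec p r ν s) =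
      (qBinom p (s + k) k * xi p ^ k *
      ∏ i ∈ Finset.range k, qInt p ((s : ℤ) + i - ((r : ℤ) - 1 - ν * p))) •
        simpleVec p r ν (s + k) := by
  have h1 : simpleVec p r ν s = (Pi.single ⟨s, hs⟩ 1 : Fin r → ℂ) := vec_eq_single hs
  rw [h1, F_eq_single hk]
  exact linOfBasis₂_single _ _ _

theorem simpleMod_coact {s : ℕ} (hs : s < r) :
    (simpleMod p r ν).coact (simpleVec p r ν s) =
      ∑ k ∈ Finset.range (s + 1), F p k ⊗ₜ[ℂ] simpleVec p r ν (s - k) :=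
  linOfBasis_vec (n := r) _ hs

/-- The operator `V^a_s ↦ V^a_{s-1}`. -/
def simpleRaise (p : ℕ) [NeZero p] (r : ℕ) (ν : ℤ) : Module.End ℂ (simpleMod p r ν) :=
  linOfBasis (ι := Fin r) fun s => if (s : ℕ) = 0 then 0 else simpleVec p r ν (s - 1)

/-- The action of `F` on `X(r)_ν`. -/
def simpleLower (p : ℕ) [NeZero p] (r : ℕ) (ν : ℤ) : Module.End ℂ (simpleMod p r ν) :=
  linOfBasis (ι := Fin r) fun s =>
    (qInt p ((s : ℕ) + 1) * (1 - qq p ((s : ℕ) - ((r : ℤ) - 1 - ν * p)))) • simpleVec p r ν (s + 1)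

theorem simpleRaise_apply {s : ℕ} (hs : s < r) :
    simpleRaise p r ν (simpleVec p r ν s) = if s = 0 then 0 else simpleVec p r ν (s - 1) :=
  linOfBasis_vec (n := r) _ hs

theorem simpleLower_apply (s : ℕ) :
    simpleLower p r ν (simpleVec p r ν s) =
      (qInt p (s + 1) * (1 - qq p (s - ((r : ℤ) - 1 - ν * p)))) • simpleVec p r ν (s + 1) := by
  by_cases hs : s < r
  · exact linOfBasis_vec (n := r) _ hs
  · rw [simpleVec_eq_zero (by omega), simpleVec_eq_zero (by omega), map_zero, smul_zero]

theorem simpleRaise_pow_apply {s : ℕ} (hs : s < r) (k : ℕ) :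
    (simpleRaise p r ν ^ k) (simpleVec p r ν s) =
      if k ≤ s then simpleVec p r ν (s - k) else 0 := by
  induction k with
  | zero => simp
  | succ k ih =>
    rw [pow_succ', Module.End.mul_apply, ih]
    split_ifs with h1 h2 h2
    · rw [simpleRaise_apply (by omega), if_neg (by omega), Nat.sub_sub]
    · rw [simpleRaise_apply (by omega), if_pos (by omega)]
    · omega
    · exact map_zero _

theorem simpleLower_pow_apply (s k : ℕ) :
    (simpleLower p r ν ^ k) (simpleVec p r ν s) =
      gCoef p ((r : ℤ) - 1 - ν * p) s k • simpleVec p r ν (s + k) := by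
  induction k with
  | zero => simp [gCoef]
  | succ k ih =>
    rw [pow_succ', Module.End.mul_apply, ih, map_smul, simpleLower_apply, smul_smul, gCoef_succ,
      add_assoc s k 1, show (((s + k : ℕ) : ℤ) + 1) = s + 1 + k by push_cast; ring, Nat.cast_add]

theorem simpleMod_isEF (hp : 2 ≤ p) (hr : r ≤ p) :
    IsEF (simpleMod p r ν) (simpleRaise p r ν) (simpleLower p r ν) := by
  refine isEF_of_generators simpleMod_grading span_simpleVec
    (c := fun s => (r : ℤ) - 1 - ν * p - 2 * (s : ℕ)) (fun s => homog_simpleVec s) (fun s => ?_)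
    (fun s => ?_) (fun s => ?_) (fun s => ?_) (fun k hk s => ?_) (fun s => ?_) (fun s => ?_)
  · rw [simpleRaise_apply s.2]
    split_ifs with h
    · exact Homog.zero _
    · refine (homog_simpleVec _).congr ?_
      rw [Nat.cast_sub (by omega)]; push_cast; ring
  · rw [simpleLower_apply]
    exact ((homog_simpleVec _).smul _).congr (by push_cast; ring)
  · rw [simpleRaise_pow_apply s.2, if_neg (by omega)]
  · rw [simpleLower_pow_apply, simpleVec_eq_zero (by omega), smul_zero]
  · rw [simpleMod_act hk s.2, simpleLower_pow_apply, smul_smul]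
    by_cases h : (s : ℕ) + k < r
    · rw [qBinom_mul_prod hp (by omega)]
    · rw [simpleVec_eq_zero (by omega), smul_zero, smul_zero]
  · rw [simpleMod_coact s.2]
    rw [← Finset.sum_subset (Finset.range_mono (show (s : ℕ) + 1 ≤ p by omega))]
    · refine Finset.sum_congr rfl fun k hk => ?_
      rw [Finset.mem_range] at hk
      rw [simpleRaise_pow_apply s.2, if_pos (by omega)]
    · intro k _ hk
      rw [Finset.mem_range] at hk
      rw [simpleRaise_pow_apply s.2, if_neg (by omega), TensorProduct.tmul_zero]
  · obtain ⟨s, hs⟩ := s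
    dsimp only
    rw [simpleLower_apply, map_smul, simpleRaise_apply hs]
    set a : ℤ := (r : ℤ) - 1 - ν * p with ha
    have h0 := one_sub_qq_ne hp
    -- At the last vector, `s = r - 1`, the target is out of range; there `s - a = νp`, so the
    -- coefficient is zero and the formula holds uniformly.
    have key : (qInt p (s + 1) * (1 - qq p (s - a))) • simpleRaise p r ν (simpleVec p r ν (s + 1)) =
        (qInt p (s + 1) * (1 - qq p (s - a))) • simpleVec p r ν s := by
      by_cases h : s + 1 < r
      · rw [simpleRaise_apply h, if_neg (by omega), Nat.add_sub_cancel]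
      · have : qq p (s - a) = 1 := by
          rw [qq_eq_one_iff]
          exact ⟨ν, by rw [ha, show (r : ℤ) = s + 1 by omega]; ring⟩
        rw [this, sub_self, mul_zero, zero_smul, zero_smul]
    rw [key]
    rcases Nat.eq_zero_or_pos s with rfl | hpos
    · rw [if_pos rfl, map_zero, smul_zero, zero_add]
      simp [qInt_one hp]
    · rw [if_neg (by omega), simpleLower_apply, Nat.sub_add_cancel hpos, smul_smul, ← add_smul,
        Nat.cast_sub (by omega : 1 ≤ s)]
      congr 1
      rw [qInt_eq, qInt_eq, show ((s : ℤ) - ((1 : ℕ) : ℤ) + 1) = s by push_cast; ring,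
        show ((s : ℤ) - ((1 : ℕ) : ℤ) - a) = s - a - 1 by push_cast; ring, qq_sub _ 1,
        show -(a - 2 * (s : ℤ)) = s - a + s by ring, qq_add (s - a) s, qq_add s 1]
      have h1 := qq_ne_zero (p := p) 1
      field_simp
      ring

theorem simpleMod_isHighest (hr1 : 1 ≤ r) :
    IsHighest (simpleMod p r ν) (simpleRaise p r ν) (simpleLower p r ν) ⊥ ((r : ℤ) - 1 - ν * p)
      (simpleVec p r ν 0) where
  raise_mem x hx := by rw [(Submodule.mem_bot ℂ).1 hx, map_zero]; exact Submodule.zero_mem _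
  lower_mem x hx := by rw [(Submodule.mem_bot ℂ).1 hx, map_zero]; exact Submodule.zero_mem _
  homog := (homog_simpleVec 0).congr (by push_cast; ring)
  mem := by rw [simpleRaise_apply hr1, if_pos rfl]; exact Submodule.zero_mem _

theorem simpleRibbon_apply (x : simpleMod p r ν) :
    simpleRibbon p r ν x = (qHalf p ^ (((r : ℤ) - ν * p) ^ 2 - 1)) • x := rfl

theorem simpleMod_isRibbonAt :
    IsRibbonAt (simpleMod p r ν) (simpleLower p r ν) ⊥ ((r : ℤ) - 1 - ν * p)
      (simpleVec p r ν 0) (simpleRibbon p r ν) where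
  homog m x hx := by rw [simpleRibbon_apply]; exact hx.smul _
  lower x := by rw [simpleRibbon_apply, simpleRibbon_apply, map_smul]
  mem x hx := by rw [(Submodule.mem_bot ℂ).1 hx, map_zero]; exact Submodule.zero_mem _
  apply_mem := by
    rw [simpleRibbon_apply, show (r : ℤ) - 1 - ν * p + 1 = r - ν * p by ring, sub_self]
    exact Submodule.zero_mem _

theorem loopTrace_simpleMod (hp : 2 ≤ p) (hr1 : 1 ≤ r) (hr : r ≤ p) (m : ℤ) (k : ℕ) :
    loopTrace (simpleMod p r ν) (simpleRaise p r ν) (simpleLower p r ν) (simpleRibbon p r ν)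
      (m + 2 * k) k = chiCoef p r ((r : ℤ) - 1 - ν * p) m k := by
  rw [chiCoef, Finset.sum_range, loopTrace]
  refine trace_of_eigenbasis (simpleBasis p r ν) _ _ fun s => ?_
  have h1 := (simpleMod_isHighest hr1).loop_mem (simpleMod_isEF hp hr) hp
    (simpleMod_isRibbonAt (ν := ν)) (m + 2 * k) k s
  rw [Submodule.mem_bot, sub_eq_zero, simpleLower_pow_apply, map_smul, zero_add] at h1
  -- The eigenvalue is known on `G^s V_0`, a nonzero multiple of `V_s`; the factor is now cancelled.
  have h3 := gCoef_ne_zero hp hr ν s.2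
  rw [smul_comm] at h1
  rw [simpleBasis_apply]
  exact smul_right_injective (simpleMod p r ν) h3 h1

theorem opX_eq (hp : 2 ≤ p) (hr1 : 1 ≤ r) (hr : r ≤ p) (ν : ℤ) {Y : ModCo.{u} p} (hY : IsYD Y) :
    opX p r ν Y = chi r ((r : ℤ) - 1 - ν * p) Y := by
  refine hom_ext_homog hY.grading fun m y hy => ?_
  rw [opX, loop_apply (hY.isEF hp).toIsLowerRaise (simpleMod_isEF hp hr).toIsLowerRaise
    simpleMod_isRibbonAt.homog hy, chi_apply hY.grading _ _ hy]
  refine Finset.sum_congr rfl fun k _ => ?_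
  rw [loopTrace_simpleMod hp hr1 hr]

end simple

end
end NicholsLoop
namespace NicholsLoop
noncomputable section

/-! ### Two-vertex modules -/

section twoVertex

variable {p : ℕ} [NeZero p]

/-- The last factor `⟨·⟩` is removed together with the first factor `1 - 𝔮^{2·}`. This form is
needed because the charge in `actCoef` drops as `u` grows. -/
theorem gCoef_succ_left (a s : ℤ) (n : ℕ) :
    gCoef p a s (n + 1) = gCoef p (a - 1) s n * (qInt p (s + 1 + n) * (1 - qq p (s - a))) := by
  simp only [gCoef, Finset.prod_mul_distrib]
  rw [Finset.prod_range_succ (fun i : ℕ => qInt p (s + 1 + i)),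
    Finset.prod_range_succ' (fun i : ℕ => 1 - qq p (s + i - a))]
  have : ∏ i ∈ Finset.range n, (1 - qq p (s + ((i + 1 : ℕ) : ℤ) - a)) =
      ∏ i ∈ Finset.range n, (1 - qq p (s + i - (a - 1))) :=
    Finset.prod_congr rfl fun i _ => by congr 2; push_cast; ring
  rw [this, Nat.cast_zero, add_zero]
  ring

/-- The vector `V^{a,b}_{s,t}`. -/
def twoVec (p : ℕ) [NeZero p] (a b : ℤ) (s t : ℕ) : twoVertex p a b :=
  (vec₂ p s t : Fin p × Fin p → ℂ)

variable {a b : ℤ}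

theorem twoVec_eq_single {s t : ℕ} (hs : s < p) (ht : t < p) :
    twoVec p a b s t = (Pi.single (⟨s, hs⟩, ⟨t, ht⟩) 1 : Fin p × Fin p → ℂ) :=
  dif_pos ⟨hs, ht⟩

theorem twoVec_eq_zero {s t : ℕ} (h : p ≤ s ∨ p ≤ t) : twoVec p a b s t = 0 :=
  dif_neg fun h' => by omega

/-- Out of range the vector is zero, so coefficients may be compared under the range bounds, which
keep quantities such as `⟨k+1⟩` invertible. -/
theorem smul_twoVec_congr {c d : ℂ} {s t : ℕ} (h : s < p → t < p → c = d) :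
    c • twoVec p a b s t = d • twoVec p a b s t := by
  by_cases hst : s < p ∧ t < p
  · rw [h hst.1 hst.2]
  · rw [twoVec_eq_zero (by omega), smul_zero, smul_zero]

/-- The basis `V^{a,b}_{s,t}` of the two-vertex module. -/
def twoBasis (p : ℕ) [NeZero p] (a b : ℤ) : Module.Basis (Fin p × Fin p) ℂ (twoVertex p a b) :=
  Pi.basisFun ℂ (Fin p × Fin p)

theorem twoBasis_apply (st : Fin p × Fin p) : twoBasis p a b st = twoVec p a b st.1 st.2 :=
  (Pi.basisFun_apply ℂ (Fin p × Fin p) st).trans (twoVec_eq_single st.1.2 st.2.2).symm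

theorem span_twoVec :
    Submodule.span ℂ (Set.range fun st : Fin p × Fin p => twoVec p a b st.1 st.2) = ⊤ := by
  rw [← (twoBasis p a b).span_eq]
  congr 2
  funext st
  exact (twoBasis_apply st).symm

theorem twoVertex_grading : CompleteOrthogonalIdempotents (twoVertex p a b).proj :=
  coordProj_complete _

theorem homog_twoVec (s t : ℕ) :
    Homog (twoVertex p a b) (a + b - 2 * s - 2 * t) (twoVec p a b s t) := by
  by_cases hst : s < p ∧ t < p
  · rw [Homog, twoVec_eq_single hst.1 hst.2]
    exact (coordProj_single _ _ _).trans (if_pos rfl)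
  · rw [twoVec_eq_zero (by omega)]; exact Homog.zero _

theorem linOfBasis_twoVec {W : Type w} [AddCommGroup W] [Module ℂ W] (c : Fin p × Fin p → W)
    {s t : ℕ} (hs : s < p) (ht : t < p) :
    linOfBasis c (twoVec p a b s t : Fin p × Fin p → ℂ) = c (⟨s, hs⟩, ⟨t, ht⟩) := by
  rw [twoVec_eq_single hs ht]; exact linOfBasis_single _ _

theorem twoVertex_act {k s t : ℕ} (hk : k < p) (hs : s < p) (ht : t < p) :
    (twoVertex p a b).act (F p k ⊗ₜ[ℂ] twoVec p a b s t) =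
      ∑ u ∈ Finset.range (k + 1),
        twoCoeff p a b s t k u • twoVec p a b (s + (k - u)) (t + u) := by
  rw [twoVec_eq_single hs ht, F_eq_single hk]
  exact linOfBasis₂_single _ _ _

theorem twoVertex_coact {s t : ℕ} (hs : s < p) (ht : t < p) :
    (twoVertex p a b).coact (twoVec p a b s t) =
      ∑ k ∈ Finset.range (s + 1), F p k ⊗ₜ[ℂ] twoVec p a b (s - k) t :=
  linOfBasis_twoVec (a := a) (b := b) _ hs ht

/-- The operator `V^{a,b}_{s,t} ↦ V^{a,b}_{s-1,t}`. -/
def twoRaise (p : ℕ) [NeZero p] (a b : ℤ) : Module.End ℂ (twoVertex p a b) :=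
  linOfBasis (ι := Fin p × Fin p) fun st =>
    if (st.1 : ℕ) = 0 then 0 else twoVec p a b (st.1 - 1) st.2

/-- The coefficient of `V^{a,b}_{s+1,t}` in `F V^{a,b}_{s,t}`. -/
def lowerLeft (p : ℕ) (a b s t : ℤ) : ℂ := qInt p (s + 1) * (1 - qq p (s + 2 * t - a - b))

/-- The coefficient of `V^{a,b}_{s,t+1}` in `F V^{a,b}_{s,t}`. -/
def lowerRight (p : ℕ) (a b s t : ℤ) : ℂ :=
  q p ^ (2 * s - a) * (qInt p (t + 1) * (1 - qq p (t - b)))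

/-- The action of `F` on the two-vertex module. -/
def twoLower (p : ℕ) [NeZero p] (a b : ℤ) : Module.End ℂ (twoVertex p a b) :=
  linOfBasis (ι := Fin p × Fin p) fun st =>
    lowerLeft p a b (st.1 : ℕ) (st.2 : ℕ) • twoVec p a b (st.1 + 1) st.2 +
      lowerRight p a b (st.1 : ℕ) (st.2 : ℕ) • twoVec p a b st.1 (st.2 + 1)

theorem twoRaise_apply {s : ℕ} (hs : s < p) (t : ℕ) :
    twoRaise p a b (twoVec p a b s t) = if s = 0 then 0 else twoVec p a b (s - 1) t := by
  by_cases ht : t < p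
  · exact linOfBasis_twoVec (a := a) (b := b) _ hs ht
  · rw [twoVec_eq_zero (by omega), twoVec_eq_zero (by omega), map_zero, ite_self]

theorem twoLower_apply (s t : ℕ) :
    twoLower p a b (twoVec p a b s t) = lowerLeft p a b s t • twoVec p a b (s + 1) t +
      lowerRight p a b s t • twoVec p a b s (t + 1) := by
  by_cases hst : s < p ∧ t < p
  · exact linOfBasis_twoVec (a := a) (b := b) _ hst.1 hst.2
  · rw [twoVec_eq_zero (by omega), twoVec_eq_zero (by omega), twoVec_eq_zero (by omega),
      map_zero, smul_zero, smul_zero, add_zero]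

theorem twoRaise_pow_apply {s : ℕ} (hs : s < p) (t k : ℕ) :
    (twoRaise p a b ^ k) (twoVec p a b s t) = if k ≤ s then twoVec p a b (s - k) t else 0 := by
  induction k with
  | zero => simp
  | succ k ih =>
    rw [pow_succ', Module.End.mul_apply, ih]
    split_ifs with h1 h2 h2
    · rw [twoRaise_apply (by omega), if_neg (by omega), Nat.sub_sub]
    · rw [twoRaise_apply (by omega), if_pos (by omega)]
    · omega
    · exact map_zero _

/-- The coefficients of `F(k) V^{a,b}_{s,t}`. -/
def actCoef (p : ℕ) (a b s t : ℤ) (k u : ℕ) : ℂ :=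
  q p ^ ((u : ℤ) * (2 * s - a)) * (qFac p u)⁻¹ * (qFac p (k - u))⁻¹ *
    gCoef p (a + b - 2 * t - u) s (k - u) * gCoef p b t u

theorem twoCoeff_eq (hp : 2 ≤ p) {s t k u : ℕ} (hu : u ≤ k) (hs : s + (k - u) < p)
    (ht : t + u < p) : twoCoeff p a b s t k u = actCoef p a b s t k u := by
  have h1 := qBinom_mul_prod hp hs (a + b - 2 * t - u)
  have h2 := qBinom_mul_prod hp ht b
  have h3 : ∏ i ∈ Finset.Ico u k, qInt p ((s : ℤ) + i + 2 * t - a - b) =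
      ∏ i ∈ Finset.range (k - u), qInt p ((s : ℤ) + i - (a + b - 2 * t - u)) := by
    rw [Finset.prod_Ico_eq_prod_range]
    refine Finset.prod_congr rfl fun i _ => ?_
    congr 1; push_cast; ring
  have h4 : xi p ^ k = xi p ^ (k - u) * xi p ^ u := by rw [← pow_add, Nat.sub_add_cancel hu]
  rw [twoCoeff, actCoef, h3, h4]
  linear_combination (q p ^ ((u : ℤ) * (2 * s - a)) * (qBinom p (t + u) u * xi p ^ u *
    ∏ i ∈ Finset.range u, qInt p ((t : ℤ) + i - b))) * h1 +
    (q p ^ ((u : ℤ) * (2 * s - a)) * ((qFac p (k - u))⁻¹ *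
      gCoef p (a + b - 2 * t - u) s (k - u))) * h2

/-- For `k = n + u + 1`, the vector `V_{s+n+1,t+u+1}` is reached in one more step either across the
left or across the right vertex. After removal of the common factors the two contributions add up by
a three-term identity in powers of `𝔮²`. -/
theorem actCoef_succ (hp : 2 ≤ p) (s t : ℤ) (n u : ℕ) (h : n + u + 1 < p) :
    qInt p (n + u + 1 + 1) * actCoef p a b s t (n + u + 1 + 1) (u + 1) =
      actCoef p a b s t (n + u + 1) (u + 1) * lowerLeft p a b (s + n) (t + (u + 1)) +
      actCoef p a b s t (n + u + 1) u * lowerRight p a b (s + n + 1) (t + u) := by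
  have h0 := one_sub_qq_ne hp
  have e1 : n + u + 1 + 1 - (u + 1) = n + 1 := by omega
  have e2 : n + u + 1 - (u + 1) = n := by omega
  have e3 : n + u + 1 - u = n + 1 := by omega
  have hu := qFac_ne_zero hp (show u < p by omega)
  have hn := qFac_ne_zero hp (show n < p by omega)
  have hu1 : qInt p (u + 1) ≠ 0 := qInt_ne_zero_of_lt hp (by omega) (by omega)
  have hn1 : qInt p (n + 1) ≠ 0 := qInt_ne_zero_of_lt hp (by omega) (by omega)
  simp only [actCoef, e1, e2, e3, lowerLeft, lowerRight]
  rw [gCoef_succ_left (a + b - 2 * t - u) s n, gCoef_succ (a + b - 2 * t - (u + 1 : ℕ)) s n,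
    gCoef_succ b t u, qFac_succ u, qFac_succ n,
    show a + b - 2 * t - u - 1 = a + b - 2 * t - (u + 1 : ℕ) by push_cast; ring]
  set g := gCoef p (a + b - 2 * t - (u + 1 : ℕ)) s n
  set g' := gCoef p b t u
  set z := qq p (s - (a + b - 2 * t - u)) with hz
  rw [show s + n - (a + b - 2 * t - (u + 1 : ℕ)) = s - (a + b - 2 * t - u) + (n + 1) by
      push_cast; ring, qq_add _ ((n : ℤ) + 1), ← hz,
    show s + n + 2 * (t + (u + 1)) - a - b = s - (a + b - 2 * t - u) + (n + u + 2) by ring,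
    qq_add _ ((n : ℤ) + u + 2), ← hz, show ((u + 1 : ℕ) : ℤ) * (2 * s - a) = u * (2 * s - a) + (2 * s - a) by push_cast; ring,
    zpow_add₀ (q_ne_zero p), show 2 * (s + n + 1) - a = (2 * s - a) + 2 * (n + 1) by ring,
    zpow_add₀ (q_ne_zero p), show q p ^ (2 * ((n : ℤ) + 1)) = qq p (n + 1) from rfl,
    show s + (n : ℤ) + 1 = s + 1 + n by ring, show t + (u : ℤ) + 1 = t + 1 + u by ring]
  have key : qInt p (n + u + 1 + 1) * (1 - z * qq p (n + 1)) =
      qInt p (n + 1) * (1 - z * qq p (n + u + 2)) +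
      qq p (n + 1) * qInt p (u + 1) * (1 - z) := by
    rw [qInt_eq, qInt_eq, qInt_eq, show (n : ℤ) + u + 1 + 1 = (n + 1) + (u + 1) by ring,
      show (n : ℤ) + u + 2 = (n + 1) + (u + 1) by ring, qq_add]
    field_simp
    ring
  field_simp
  linear_combination (q p ^ ((u : ℤ) * (2 * s - a)) * q p ^ (2 * s - a) * g *
    qInt p (s + 1 + n) * g' * qInt p (t + 1 + u) * (1 - qq p (t + u - b))) * key

theorem actCoef_zero (s t : ℤ) (k : ℕ) :
    actCoef p a b s t k 0 = (qFac p k)⁻¹ * gCoef p (a + b - 2 * t) s k := by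
  simp [actCoef, gCoef, qFac_zero]

theorem actCoef_self (s t : ℤ) (k : ℕ) :
    actCoef p a b s t k k = q p ^ ((k : ℤ) * (2 * s - a)) * (qFac p k)⁻¹ * gCoef p b t k := by
  simp [actCoef, gCoef, qFac_zero]

/-- This is `F · F(k) = ⟨k+1⟩ F(k+1)` on the level of coefficients; the end terms `u = 0` and `u = k
+ 1` arise in one way only. The case `k = p - 1` is included and yields `G^p = 0`. -/
theorem twoLower_sum_actCoef (hp : 2 ≤ p) (s t k : ℕ) (hk : k < p) :
    twoLower p a b (∑ u ∈ Finset.range (k + 1),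
      actCoef p a b s t k u • twoVec p a b (s + (k - u)) (t + u)) =
    qInt p (k + 1) • ∑ u ∈ Finset.range (k + 2),
      actCoef p a b s t (k + 1) u • twoVec p a b (s + (k + 1 - u)) (t + u) := by
  have h0 := one_sub_qq_ne hp
  have hk' := qFac_ne_zero hp hk
  simp only [map_sum, map_smul, twoLower_apply, smul_add, smul_smul, Finset.smul_sum,
    Finset.sum_add_distrib]
  refine (sum_range_eq_add ?_ ?_ ?_).symm
  · rw [show s + (k - 0) + 1 = s + (k + 1 - 0) by omega]
    refine smul_twoVec_congr fun h1 _ => ?_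
    have hk1 : qInt p (k + 1) ≠ 0 := qInt_ne_zero_of_lt hp (by omega) (by omega)
    rw [actCoef_zero, actCoef_zero, lowerLeft, gCoef_succ, qFac_succ, add_zero, Nat.sub_zero,
      show ((s + k : ℕ) : ℤ) + 1 = s + 1 + k by push_cast; ring,
      show ((s + k : ℕ) : ℤ) + 2 * (t : ℕ) - a - b = s + k - (a + b - 2 * t) by push_cast; ring]
    field_simp
  · rw [show s + (k - k) = s + (k + 1 - (k + 1)) by omega, add_assoc t k 1]
    refine smul_twoVec_congr fun _ h1 => ?_
    have hk1 : qInt p (k + 1) ≠ 0 := qInt_ne_zero_of_lt hp (by omega) (by omega)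
    rw [actCoef_self, actCoef_self, lowerRight, gCoef_succ, qFac_succ, Nat.sub_self, add_zero,
      show ((k + 1 : ℕ) : ℤ) * (2 * s - a) = k * (2 * s - a) + (2 * s - a) by push_cast; ring,
      zpow_add₀ (q_ne_zero p), show ((t + k : ℕ) : ℤ) + 1 = t + 1 + k by push_cast; ring,
      Nat.cast_add]
    field_simp
  · intro u hu
    obtain ⟨n, rfl⟩ : ∃ n, k = n + u + 1 := ⟨k - u - 1, by omega⟩
    rw [show s + (n + u + 1 + 1 - (u + 1)) = s + n + 1 by omega,
      show s + (n + u + 1 - (u + 1)) + 1 = s + n + 1 by omega,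
      show s + (n + u + 1 - (u + 1)) = s + n by omega,
      show s + (n + u + 1 - u) = s + n + 1 by omega, ← add_assoc t u 1, ← add_smul]
    congr 1
    have := actCoef_succ (a := a) (b := b) hp s t n u hk
    push_cast at this ⊢
    rw [add_assoc (t : ℤ) u 1]
    exact this

theorem twoLower_pow_apply (hp : 2 ≤ p) (s t k : ℕ) (hk : k < p) :
    (twoLower p a b ^ k) (twoVec p a b s t) = qFac p k • ∑ u ∈ Finset.range (k + 1),
      actCoef p a b s t k u • twoVec p a b (s + (k - u)) (t + u) := by
  induction k with
  | zero => simp [actCoef_zero, qFac_zero, gCoef]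
  | succ k ih =>
    rw [pow_succ', Module.End.mul_apply, ih (by omega), map_smul,
      twoLower_sum_actCoef hp s t k (by omega), smul_smul, qFac_succ]

/-- The step from exponent `p - 1` to `p` carries the factor `⟨p⟩ = 0`. -/
theorem twoLower_pow_p (hp : 2 ≤ p) (s t : ℕ) :
    (twoLower p a b ^ p) (twoVec p a b s t) = 0 := by
  obtain ⟨k, hk⟩ : ∃ k, p = k + 1 := ⟨p - 1, by omega⟩
  have h1 : twoLower p a b ^ p = twoLower p a b * twoLower p a b ^ k := by
    rw [← pow_succ']; exact congrArg _ hk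
  have h2 : qInt p (k + 1) = 0 := by
    rw [qInt_eq_zero_iff hp]; exact ⟨1, by rw [hk]; push_cast; ring⟩
  rw [h1, Module.End.mul_apply, twoLower_pow_apply hp s t k (by omega), map_smul,
    twoLower_sum_actCoef hp s t k (by omega), h2, zero_smul, smul_zero]

theorem twoVertex_isEF (hp : 2 ≤ p) :
    IsEF (twoVertex p a b) (twoRaise p a b) (twoLower p a b) := by
  refine isEF_of_generators twoVertex_grading span_twoVec
    (c := fun st => a + b - 2 * (st.1 : ℕ) - 2 * (st.2 : ℕ)) (fun st => homog_twoVec _ _)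
    (fun st => ?_) (fun st => ?_) (fun st => ?_) (fun st => ?_) (fun k hk st => ?_) (fun st => ?_)
    (fun st => ?_)
  all_goals obtain ⟨⟨s, hs⟩, ⟨t, ht⟩⟩ := st; dsimp only
  · rw [twoRaise_apply hs]
    split_ifs with h
    · exact Homog.zero _
    · refine (homog_twoVec _ _).congr ?_
      rw [Nat.cast_sub (by omega)]; push_cast; ring
  · rw [twoLower_apply]
    exact (((homog_twoVec _ _).smul _).congr (by push_cast; ring)).add
      (((homog_twoVec _ _).smul _).congr (by push_cast; ring))
  · rw [twoRaise_pow_apply hs, if_neg (by omega)]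
  · exact twoLower_pow_p hp s t
  · rw [twoVertex_act hk hs ht, twoLower_pow_apply hp s t k hk, smul_smul,
      inv_mul_cancel₀ (qFac_ne_zero hp hk), one_smul]
    refine Finset.sum_congr rfl fun u hu => smul_twoVec_congr fun h1 h2 => ?_
    rw [Finset.mem_range] at hu
    exact twoCoeff_eq hp (by omega) h1 h2
  · rw [twoVertex_coact hs ht,
      ← Finset.sum_subset (Finset.range_mono (show s + 1 ≤ p by omega))]
    · refine Finset.sum_congr rfl fun k hk => ?_
      rw [Finset.mem_range] at hk
      rw [twoRaise_pow_apply hs, if_pos (by omega)]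
    · intro k _ hk
      rw [Finset.mem_range] at hk
      rw [twoRaise_pow_apply hs, if_neg (by omega), TensorProduct.tmul_zero]
  · have h0 := one_sub_qq_ne hp
    rw [twoLower_apply, map_add, map_smul, map_smul, twoRaise_apply hs, twoRaise_apply hs]
    -- At `s = p - 1` the target is out of range, and `lowerLeft` contains `⟨p⟩ = 0`.
    have key : lowerLeft p a b s t • twoRaise p a b (twoVec p a b (s + 1) t) =
        lowerLeft p a b s t • twoVec p a b s t := by
      by_cases h : s + 1 < p
      · rw [twoRaise_apply h, if_neg (by omega), Nat.add_sub_cancel]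
      · have : lowerLeft p a b s t = 0 := by
          rw [lowerLeft, show (s : ℤ) + 1 = 1 * p by omega, (qInt_eq_zero_iff hp _).2 ⟨1, by ring⟩,
            zero_mul]
        rw [this, zero_smul, zero_smul]
    rw [key]
    rcases Nat.eq_zero_or_pos s with rfl | hpos
    · rw [if_pos rfl, if_pos rfl, map_zero, smul_zero, smul_zero, zero_add, add_zero]
      congr 1
      rw [lowerLeft, Nat.cast_zero, zero_add, qInt_one hp, one_mul]
      congr 2; ring
    · obtain ⟨s, rfl⟩ : ∃ k, s = k + 1 := ⟨s - 1, by omega⟩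
      rw [if_neg (by omega), if_neg (by omega), twoLower_apply, Nat.add_sub_cancel, smul_add,
        smul_smul, smul_smul, add_right_comm, ← add_smul]
      congr 2
      · rw [lowerLeft, lowerLeft, qInt_eq, qInt_eq]
        push_cast
        set z := qq p (s + 2 * t - a - b) with hz
        rw [show (s : ℤ) + 1 + 2 * t - a - b = s + 2 * t - a - b + 1 by ring,
          show -(a + b - 2 * ((s : ℤ) + 1) - 2 * t) = s + 2 * t - a - b + (s + 1 + 1) by ring,
          qq_add (s + 2 * t - a - b), qq_add (s + 2 * t - a - b), ← hz, qq_add ((s : ℤ) + 1) 1]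
        field_simp
        ring
      · rw [lowerRight, lowerRight, show 2 * (((s + 1 : ℕ) : ℤ)) - a = 2 * 1 + (2 * s - a) by
          push_cast; ring, zpow_add₀ (q_ne_zero p), mul_assoc]
        rfl

end twoVertex

end
end NicholsLoop
namespace NicholsLoop
noncomputable section

/-! ### The ribbon map of two-vertex modules -/

section twoRibbon

variable {p : ℕ} [NeZero p] {a b : ℤ}

/-- The coefficients of the ribbon map, up to the common factor. -/
def ribbonCoef (p : ℕ) (a b t : ℤ) (i : ℕ) : ℂ :=
  q p ^ (-((i : ℤ) * a)) * (qFac p i)⁻¹ * gCoef p b t i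

theorem twoRibbon_apply (hp : 2 ≤ p) {s : ℕ} (hs : s < p) (t : ℕ) :
    twoRibbon p a b (twoVec p a b s t) = qHalf p ^ ((a + b - 2 * (t : ℤ) + 1) ^ 2 - 1) •
      ∑ i ∈ Finset.range (s + 1), ribbonCoef p a b t i • twoVec p a b (s - i) (t + i) := by
  by_cases ht : t < p
  · refine (linOfBasis_twoVec (a := a) (b := b) _ hs ht).trans (congrArg _ ?_)
    refine Finset.sum_congr rfl fun i _ => smul_twoVec_congr fun _ h => ?_
    rw [ribbonCoef, mul_assoc (q p ^ _), mul_assoc (q p ^ _), mul_assoc (q p ^ _),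
      ← qBinom_mul_prod hp h]
    ring
  · rw [twoVec_eq_zero (by omega), map_zero, Finset.sum_eq_zero, smul_zero]
    intro i _
    rw [twoVec_eq_zero (by omega), smul_zero]

theorem ribbonCoef_succ_left (hp : 2 ≤ p) (t : ℤ) {i : ℕ} (hi : i + 1 < p) :
    ribbonCoef p a b (t + 1) i * (qInt p (t + 1) * (1 - qq p (t - b))) =
      ribbonCoef p a b t (i + 1) * (q p ^ a * qInt p (i + 1)) := by
  have h1 : qInt p (i + 1) ≠ 0 := qInt_ne_zero_of_lt hp (by omega) (by omega)
  have h2 := qFac_ne_zero hp (show i < p by omega)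
  have h3 := zpow_ne_zero a (q_ne_zero p)
  rw [ribbonCoef, ribbonCoef, gCoef_succ', qFac_succ,
    show -(((i + 1 : ℕ) : ℤ) * a) = -(i * a) - a by push_cast; ring, zpow_sub₀ (q_ne_zero p)]
  field_simp

theorem ribbonCoef_succ (hp : 2 ≤ p) (t : ℤ) {i : ℕ} (hi : i + 1 < p) :
    ribbonCoef p a b t i * (qInt p (t + i + 1) * (1 - qq p (t + i - b))) =
      ribbonCoef p a b t (i + 1) * (q p ^ a * qInt p (i + 1)) := by
  have h1 : qInt p (i + 1) ≠ 0 := qInt_ne_zero_of_lt hp (by omega) (by omega)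
  have h2 := qFac_ne_zero hp (show i < p by omega)
  have h3 := zpow_ne_zero a (q_ne_zero p)
  rw [ribbonCoef, ribbonCoef, gCoef_succ, qFac_succ,
    show -(((i + 1 : ℕ) : ℤ) * a) = -(i * a) - a by push_cast; ring, zpow_sub₀ (q_ne_zero p),
    show t + (i : ℤ) + 1 = t + 1 + i by ring]
  field_simp

theorem twoRibbon_raise (hp : 2 ≤ p) (x : twoVertex p a b) :
    twoRibbon p a b (twoRaise p a b x) = twoRaise p a b (twoRibbon p a b x) := by
  have : twoRibbon p a b ∘ₗ twoRaise p a b = twoRaise p a b ∘ₗ twoRibbon p a b := by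
    refine LinearMap.ext_on_range span_twoVec fun st => ?_
    obtain ⟨⟨s, hs⟩, ⟨t, ht⟩⟩ := st
    rw [LinearMap.comp_apply, LinearMap.comp_apply, twoRaise_apply hs, twoRibbon_apply hp hs]
    simp only [map_smul, map_sum]
    rcases s with _ | s
    · rw [if_pos rfl, map_zero, Finset.sum_range_one, Nat.zero_sub, twoRaise_apply hs, if_pos rfl,
        smul_zero, smul_zero]
    · rw [if_neg (by omega), Nat.add_sub_cancel, twoRibbon_apply hp (by omega),
        Finset.sum_range_succ _ (s + 1), Nat.sub_self, twoRaise_apply (by omega), if_pos rfl,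
        smul_zero, add_zero]
      congr 1
      refine Finset.sum_congr rfl fun i hi => ?_
      rw [Finset.mem_range] at hi
      rw [twoRaise_apply (by omega), if_neg (by omega), show s + 1 - i - 1 = s - i by omega]
  exact LinearMap.congr_fun this x

/-- With `s = n + i`, the two sides are the coefficients of `V_{s-i-1+1,t+i+1} = V_{n,t+i+1}` in `θ
G V_{s,t}` and `G θ V_{s,t}`, up to the ribbon scalar at `t`. The factor `𝔮^{-2(a+b-2t)}` is the
ratio of the ribbon scalars at `t + 1` and `t`. -/
theorem ribbon_lower_identity (hp : 2 ≤ p) (n t : ℤ) {i : ℕ} (hi : i + 1 < p) :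
    lowerLeft p a b (n + i) t * ribbonCoef p a b t (i + 1) +
      lowerRight p a b (n + i) t * qq p (-(a + b - 2 * t)) * ribbonCoef p a b (t + 1) i =
    ribbonCoef p a b t (i + 1) * lowerLeft p a b (n - 1) (t + (i + 1)) +
      ribbonCoef p a b t i * lowerRight p a b n (t + i) := by
  have h0 := one_sub_qq_ne hp
  have h1 := ribbonCoef_succ_left (a := a) (b := b) hp t hi
  have h2 := ribbonCoef_succ (a := a) (b := b) hp t hi
  have h3 : ∀ x : ℤ, q p ^ (2 * x - a) * q p ^ a = qq p x := fun x => by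
    rw [← zpow_add₀ (q_ne_zero p), sub_add_cancel]; rfl
  simp only [lowerLeft, lowerRight]
  have key : qInt p (n + i + 1) * (1 - qq p (n + i + 2 * t - a - b)) +
      qq p (n + i) * qInt p (i + 1) * qq p (-(a + b - 2 * t)) =
      qInt p (n - 1 + 1) * (1 - qq p (n - 1 + 2 * (t + (i + 1)) - a - b)) +
        qq p n * qInt p (i + 1) := by
    set z := qq p (-(a + b - 2 * t)) with hz
    rw [show n + i + 2 * t - a - b = -(a + b - 2 * t) + n + i by ring,
      show n - 1 + 2 * (t + (i + 1)) - a - b = -(a + b - 2 * t) + n + i + (i + 1) by ring,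
      sub_add_cancel, qInt_eq, qInt_eq, qInt_eq, show n + (i : ℤ) + 1 = n + (i + 1) by ring]
    rw [qq_add (-(a + b - 2 * t) + n + i) ((i : ℤ) + 1), qq_add (-(a + b - 2 * t) + n),
      qq_add (-(a + b - 2 * t)), ← hz, qq_add n ((i : ℤ) + 1), qq_add n, qq_add (i : ℤ) 1]
    field_simp
    ring
  linear_combination ribbonCoef p a b t (i + 1) * key +
    q p ^ (2 * (n + i) - a) * qq p (-(a + b - 2 * t)) * h1 - q p ^ (2 * n - a) * h2 +
    ribbonCoef p a b t (i + 1) * qInt p (i + 1) * qq p (-(a + b - 2 * t)) * h3 (n + i) -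
    ribbonCoef p a b t (i + 1) * qInt p (i + 1) * h3 n

theorem twoRibbon_lower (hp : 2 ≤ p) (x : twoVertex p a b) :
    twoRibbon p a b (twoLower p a b x) = twoLower p a b (twoRibbon p a b x) := by
  have : twoRibbon p a b ∘ₗ twoLower p a b = twoLower p a b ∘ₗ twoRibbon p a b := by
    refine LinearMap.ext_on_range span_twoVec fun st => ?_
    obtain ⟨⟨s, hs⟩, ⟨t, ht⟩⟩ := st
    rw [LinearMap.comp_apply, LinearMap.comp_apply, twoLower_apply, map_add, map_smul, map_smul]
    dsimp only
    set τ := qHalf p ^ ((a + b - 2 * (t : ℤ) + 1) ^ 2 - 1) with hτ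
    have hτ' : qHalf p ^ ((a + b - 2 * ((t + 1 : ℕ) : ℤ) + 1) ^ 2 - 1) =
        τ * qq p (-(a + b - 2 * t)) := by
      rw [hτ, qq, q_zpow_eq, ← zpow_add₀ (qHalf_ne_zero p)]
      congr 1; push_cast; ring
    have h1 : lowerLeft p a b s t • twoRibbon p a b (twoVec p a b (s + 1) t) =
        τ • ∑ i ∈ Finset.range (s + 2), (lowerLeft p a b s t * ribbonCoef p a b t i) •
          twoVec p a b (s + 1 - i) (t + i) := by
      by_cases h : s + 1 < p
      · rw [twoRibbon_apply hp h, smul_comm, Finset.smul_sum]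
        simp only [smul_smul]
        rfl
      · have : lowerLeft p a b s t = 0 := by
          rw [lowerLeft, show (s : ℤ) + 1 = 1 * p by omega, (qInt_eq_zero_iff hp _).2 ⟨1, by ring⟩,
            zero_mul]
        rw [this, zero_smul, Finset.sum_eq_zero, smul_zero]
        intro i _
        rw [zero_mul, zero_smul]
    have h2 : twoLower p a b (twoRibbon p a b (twoVec p a b s t)) =
        τ • (∑ i ∈ Finset.range (s + 2),
          (ribbonCoef p a b t i * lowerLeft p a b ((s : ℤ) - i) (t + i)) •
            twoVec p a b (s + 1 - i) (t + i) +
          ∑ i ∈ Finset.range (s + 1),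
            (ribbonCoef p a b t i * lowerRight p a b ((s : ℤ) - i) (t + i)) •
              twoVec p a b (s - i) (t + (i + 1))) := by
      rw [twoRibbon_apply hp hs, map_smul, map_sum, Finset.sum_range_succ _ (s + 1)]
      -- The term `i = s + 1` is added for equal lengths of the sums; its coefficient contains `⟨0⟩
      -- = 0`.
      have : lowerLeft p a b ((s : ℤ) - (s + 1 : ℕ)) (t + (s + 1 : ℕ)) = 0 := by
        rw [lowerLeft, show (s : ℤ) - (s + 1 : ℕ) + 1 = 0 by push_cast; ring, qInt_zero, zero_mul]
      rw [this, mul_zero, zero_smul, add_zero, ← Finset.sum_add_distrib]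
      congr 1
      refine Finset.sum_congr rfl fun i hi => ?_
      rw [Finset.mem_range] at hi
      rw [map_smul, twoLower_apply, smul_add, smul_smul, smul_smul, Nat.cast_sub (by omega),
        Nat.cast_add, show s - i + 1 = s + 1 - i by omega, add_assoc t i 1]
    rw [h1, h2, twoRibbon_apply hp hs, hτ', smul_smul,
      Finset.sum_range_succ' _ (s + 1), Finset.sum_range_succ' _ (s + 1)]
    have h3 : (lowerRight p a b s t * (τ * qq p (-(a + b - 2 * t)))) •
        ∑ i ∈ Finset.range (s + 1), ribbonCoef p a b ((t + 1 : ℕ) : ℤ) i •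
          twoVec p a b (s - i) (t + 1 + i) =
        τ • ∑ i ∈ Finset.range (s + 1), (lowerRight p a b s t * qq p (-(a + b - 2 * t)) *
          ribbonCoef p a b (t + 1) i) • twoVec p a b (s - i) (t + (i + 1)) := by
      rw [mul_left_comm, mul_smul, Finset.smul_sum]
      congr 1
      refine Finset.sum_congr rfl fun i _ => ?_
      rw [smul_smul, add_assoc, add_comm 1 i, Nat.cast_add, Nat.cast_one]
    rw [h3, ← smul_add]
    congr 1
    rw [add_right_comm, add_right_comm _ (_ • twoVec p a b (s + 1 - 0) (t + 0)),
      ← Finset.sum_add_distrib, ← Finset.sum_add_distrib]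
    congr 1
    · refine Finset.sum_congr rfl fun i hi => ?_
      rw [Finset.mem_range] at hi
      rw [show s + 1 - (i + 1) = s - i by omega, ← add_smul, ← add_smul]
      refine smul_twoVec_congr fun _ h => ?_
      have := ribbon_lower_identity (a := a) (b := b) hp (s - i) t (show i + 1 < p by omega)
      rw [sub_add_cancel] at this
      rw [this]
      push_cast
      rw [show (s : ℤ) - i - 1 = s - (i + 1) by ring]
    · rw [mul_comm]
      simp only [Nat.cast_zero, sub_zero, add_zero]
  exact LinearMap.congr_fun this x

theorem homog_twoRibbon (hp : 2 ≤ p) (m : ℤ) (x : twoVertex p a b)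
    (hx : Homog (twoVertex p a b) m x) : Homog (twoVertex p a b) m (twoRibbon p a b x) := by
  have := homog_of_generators twoVertex_grading span_twoVec
    (c := fun st => a + b - 2 * (st.1 : ℕ) - 2 * (st.2 : ℕ)) (fun st => homog_twoVec _ _)
    (T := twoRibbon p a b) (d := 0) (fun st => ?_) m x hx
  · rwa [add_zero] at this
  · obtain ⟨⟨s, hs⟩, ⟨t, ht⟩⟩ := st
    rw [twoRibbon_apply hp hs]
    refine Homog.smul ?_ _
    refine Finset.sum_induction _ (Homog (twoVertex p a b) _) (fun x y => Homog.add)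
      (Homog.zero _) fun i hi => ?_
    rw [Finset.mem_range] at hi
    refine ((homog_twoVec _ _).smul _).congr ?_
    dsimp only
    rw [Nat.cast_sub (by omega)]
    push_cast
    ring

end twoRibbon

end
end NicholsLoop
namespace NicholsLoop
noncomputable section

/-! ### Pairs of generators with a common loop -/

section projPair

variable {p : ℕ} [NeZero p]

/-- A highest weight vector `x` of charge `r - 1 - νp` together with a vector `y` of charge
`-r - 1 - νp` such that `E y = G^{r-1} x`. -/
structure IsProjPair (M : ModCo.{u} p) (E G : Module.End ℂ M) (r : ℕ) (ν : ℤ) (x y : M) : Prop where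
  isEF : IsEF M E G
  one_le : 1 ≤ r
  lt : r < p
  homog_top : Homog M ((r : ℤ) - 1 - ν * p) x
  homog_bot : Homog M (-(r : ℤ) - 1 - ν * p) y
  raise_top : E x = 0
  raise_bot : E y = (G ^ (r - 1)) x
  ne : (G ^ r) x ≠ 0

theorem qq_sub_ne_one {n ν : ℤ} (h0 : 0 < n) (h : n < p) : 1 - qq p (n + ν * p) ≠ 0 := by
  rw [sub_ne_zero, ne_comm, Ne, qq_eq_one_iff]
  intro h1
  have h2 : (p : ℤ) ∣ n := (Int.dvd_add_left (Dvd.intro_left ν rfl)).1 h1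
  have := Int.le_of_dvd h0 h2
  omega

variable {M : ModCo.{u} p} {E G : Module.End ℂ M} {r : ℕ} {ν : ℤ} {x y : M}
  (h : IsProjPair M E G r ν x y)
include h

theorem IsProjPair.raise_lower_pow_top (hp : 2 ≤ p) (n : ℕ) :
    E ((G ^ (n + 1)) x) = (qInt p (n + 1) * (1 - qq p ((n : ℤ) - r + 1 + ν * p))) • (G ^ n) x := by
  rw [h.isEF.raise_lower_pow hp h.homog_top, h.raise_top, map_zero, smul_zero, zero_add]
  congr 4; ring

theorem IsProjPair.raise_lower_pow_bot (hp : 2 ≤ p) (n : ℕ) :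
    E ((G ^ (n + 1)) y) = qq p (n + 1) • (G ^ (r + n)) x +
      (qInt p (n + 1) * (1 - qq p ((n : ℤ) + r + 1 + ν * p))) • (G ^ n) y := by
  rw [h.isEF.raise_lower_pow hp h.homog_bot, h.raise_bot, ← Module.End.mul_apply, ← pow_add]
  have := h.one_le
  rw [show n + 1 + (r - 1) = r + n by omega]
  congr 5; ring

theorem IsProjPair.raise_lower_pow_self (hp : 2 ≤ p) : E ((G ^ r) x) = 0 := by
  obtain ⟨n, rfl⟩ : ∃ n, r = n + 1 := ⟨r - 1, by have := h.one_le; omega⟩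
  rw [h.raise_lower_pow_top hp, show (n : ℤ) - (n + 1 : ℕ) + 1 + ν * p = ν * p by push_cast; ring,
    qq_mul_p, sub_self, mul_zero, zero_smul]

theorem IsProjPair.lower_pow_of_le {i : ℕ} (hi : p ≤ i) (z : M) : (G ^ i) z = 0 := by
  obtain ⟨j, rfl⟩ := Nat.exists_eq_add_of_le hi
  rw [pow_add, h.isEF.lower_pow, zero_mul]; rfl

/-- Up to `r` this is inherited from `G^r x ≠ 0`. Beyond `r`, `E` takes `G^{i+1} x` to a nonzero
multiple of `G^i x`, since `0 < i - r + 1 < p`. -/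
theorem IsProjPair.lower_pow_top_ne (hp : 2 ≤ p) {i : ℕ} (hi : i < p) : (G ^ i) x ≠ 0 := by
  rcases le_total i r with hir | hir
  · obtain ⟨j, hj⟩ := Nat.exists_eq_add_of_le' hir
    intro h0
    apply h.ne
    rw [hj, pow_add, Module.End.mul_apply, h0, map_zero]
  · induction i, hir using Nat.le_induction with
    | base => exact h.ne
    | succ i hir ih =>
      intro h0
      have h1 := h.raise_lower_pow_top hp i
      rw [h0, map_zero] at h1
      exact smul_ne_zero (mul_ne_zero (qInt_ne_zero_of_lt hp (by omega) (by omega))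
        (qq_sub_ne_one (by omega) (by have := h.one_le; omega))) (ih (by omega)) h1.symm

/-- Applying `E` lowers `i` and normally multiplies `β` by a nonzero scalar. At `i = 0` one more `E`
kills `G^r x` and sends `y` to `G^{r-1} x ≠ 0`. -/
theorem IsProjPair.bot_coeff_eq_zero (hp : 2 ≤ p) {i : ℕ} (hi : i < p) {α β : ℂ}
    (h0 : α • (G ^ (r + i)) x + β • (G ^ i) y = 0) : β = 0 := by
  induction i generalizing α β with
  | zero =>
    have h1 := congrArg E h0
    rw [map_add, map_smul, map_smul, add_zero, h.raise_lower_pow_self hp, smul_zero, zero_add,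
      pow_zero, Module.End.one_apply, h.raise_bot, map_zero] at h1
    have h2 := h.one_le
    have h3 := h.lt
    exact (smul_eq_zero.1 h1).resolve_right (h.lower_pow_top_ne hp (by omega))
  | succ i ih =>
    have h1 := congrArg E h0
    rw [map_add, map_smul, map_smul, ← add_assoc, h.raise_lower_pow_top hp,
      h.raise_lower_pow_bot hp, map_zero, smul_add, smul_smul, smul_smul, smul_smul,
      ← add_assoc, ← add_smul] at h1
    -- In this case the multiple of `G^i y` disappears under `E`. What remains is a multiple of
    -- `G^{p-1} x ≠ 0`, to which `α` does not contribute because of `⟨p⟩ = 0`.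
    by_cases hri : r + i + 1 = p
    · have h2 : qInt p (i + 1) * (1 - qq p ((i : ℤ) + r + 1 + ν * p)) = 0 := by
        rw [show (i : ℤ) + r + 1 + ν * p = (ν + 1) * p by rw [← hri]; push_cast; ring, qq_mul_p,
          sub_self, mul_zero]
      rw [h2, mul_zero, zero_smul, add_zero] at h1
      have h3 : (G ^ (r + (i + 1))) x = 0 := h.lower_pow_of_le (by omega) x
      have h4 := (smul_eq_zero.1 h1).resolve_right (h.lower_pow_top_ne hp (by omega))
      have h5 : qInt p ((r + i : ℕ) + 1) = 0 := by
        rw [qInt_eq_zero_iff hp]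
        exact ⟨1, by rw [← hri]; push_cast; ring⟩
      rw [h5, zero_mul, mul_zero, zero_add] at h4
      exact (mul_eq_zero.1 h4).resolve_right (qq_ne_zero _)
    · have h2 : qInt p (i + 1) * (1 - qq p ((i : ℤ) + r + 1 + ν * p)) ≠ 0 := by
        refine mul_ne_zero (qInt_ne_zero_of_lt hp (by omega) (by omega)) ?_
        rcases lt_or_gt_of_ne hri with h3 | h3
        · exact qq_sub_ne_one (by omega) (by omega)
        · rw [show (i : ℤ) + r + 1 + ν * p = (i + r + 1 - p) + (ν + 1) * p by ring]
          exact qq_sub_ne_one (by omega) (by have := h.lt; omega)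
      exact (mul_eq_zero.1 (ih (by omega) h1)).resolve_right h2

/-- `G^i x` and `G^i y` occupy the positions `i` and `r + i` on a ladder of `2p` distinct charges.
The projection to one charge therefore leaves a relation between at most two vectors, which
`bot_coeff_eq_zero` settles. -/
theorem IsProjPair.linearIndependent (hp : 2 ≤ p) :
    LinearIndependent ℂ (Sum.elim (fun i : Fin p => (G ^ (i : ℕ)) x)
      (fun i : Fin p => (G ^ (i : ℕ)) y)) := by
  rw [Fintype.linearIndependent_iff]
  intro g hg
  set α : ℕ → ℂ := fun n => if hn : n < p then g (Sum.inl ⟨n, hn⟩) else 0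
  set β : ℕ → ℂ := fun n => if hn : n < p then g (Sum.inr ⟨n, hn⟩) else 0
  have hα : ∀ i : Fin p, g (Sum.inl i) = α i := fun i => by simp [α]
  have hβ : ∀ i : Fin p, g (Sum.inr i) = β i := fun i => by simp [β]
  have hαp : ∀ i, p ≤ i → α i = 0 := fun i hi => dif_neg (by omega)
  have hsum : ∑ i ∈ Finset.range p, α i • (G ^ i) x +
      ∑ i ∈ Finset.range p, β i • (G ^ i) y = 0 := by
    rw [Finset.sum_range, Finset.sum_range, ← hg, Fintype.sum_sum_type]
    simp only [hα, hβ, Sum.elim_inl, Sum.elim_inr]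
  have hx : ∀ i : ℕ, Homog M ((r : ℤ) - 1 - ν * p - 2 * i) ((G ^ i) x) :=
    fun i => h.isEF.homog_lower_pow h.homog_top i
  have hy : ∀ i : ℕ, Homog M ((r : ℤ) - 1 - ν * p - 2 * (r + i : ℕ)) ((G ^ i) y) := fun i => by
    have := h.isEF.homog_lower_pow h.homog_bot i
    exact this.congr (by push_cast; ring)
  have hinj : ∀ m n : ℕ, m < 2 * p → n < 2 * p →
      ((((r : ℤ) - 1 - ν * p - 2 * m : ℤ) : ZMod (4 * p)) =
        (((r : ℤ) - 1 - ν * p - 2 * n : ℤ) : ZMod (4 * p)) ↔ m = n) := by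
    intro m n hm hn
    refine ⟨fun h1 => ?_, fun h1 => by rw [h1]⟩
    rw [ZMod.intCast_eq_intCast_iff_dvd_sub] at h1
    obtain ⟨c, hc⟩ := h1
    push_cast at hc
    have hc' : (m : ℤ) - n = 2 * p * c := by linarith
    have : c = 0 := by
      rcases lt_trichotomy c 0 with h2 | h2 | h2
      · nlinarith
      · exact h2
      · nlinarith
    rw [this, mul_zero] at hc'
    omega
  have hproj : ∀ n < 2 * p, (if n < p then α n • (G ^ n) x else 0) +
      (if r ≤ n ∧ n < r + p then β (n - r) • (G ^ (n - r)) y else 0) = 0 := by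
    intro n hn
    have h1 := congrArg (M.proj (((r : ℤ) - 1 - ν * p - 2 * n : ℤ) : ZMod (4 * p))) hsum
    rw [map_zero, map_add, map_sum, map_sum] at h1
    have e1 : ∀ i ∈ Finset.range p, M.proj (((r : ℤ) - 1 - ν * p - 2 * n : ℤ) : ZMod (4 * p))
        (α i • (G ^ i) x) = if n = i then α i • (G ^ i) x else 0 := by
      intro i hi
      rw [Finset.mem_range] at hi
      rw [map_smul, (hx i).proj_eq h.isEF.grading]
      simp only [hinj i n (by omega) hn, eq_comm (a := i)]
      split_ifs <;> simp
    have e2 : ∀ i ∈ Finset.range p, M.proj (((r : ℤ) - 1 - ν * p - 2 * n : ℤ) : ZMod (4 * p))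
        (β i • (G ^ i) y) = if r + i = n then β i • (G ^ i) y else 0 := by
      intro i hi
      rw [Finset.mem_range] at hi
      have h2 := h.lt
      rw [map_smul, (hy i).proj_eq h.isEF.grading]
      simp only [hinj (r + i) n (by omega) hn]
      split_ifs <;> simp
    have e3 : ∑ i ∈ Finset.range p, (if r + i = n then β i • (G ^ i) y else 0) =
        if r ≤ n ∧ n < r + p then β (n - r) • (G ^ (n - r)) y else 0 := by
      by_cases h3 : r ≤ n ∧ n < r + p
      · rw [if_pos h3, Finset.sum_eq_single (n - r), if_pos (by omega)]
        · intro i _ hi; rw [if_neg (by omega)]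
        · intro hi; rw [Finset.mem_range] at hi; omega
      · rw [if_neg h3, Finset.sum_eq_zero]
        intro i hi
        rw [Finset.mem_range] at hi
        rw [if_neg (by omega)]
    rw [Finset.sum_congr rfl e1, Finset.sum_congr rfl e2, Finset.sum_ite_eq, e3] at h1
    simpa only [Finset.mem_range] using h1
  have hlt := h.lt
  have hβ0 : ∀ i < p, β i = 0 := by
    intro i hi
    have h1 := hproj (r + i) (by omega)
    rw [if_pos (show r ≤ r + i ∧ r + i < r + p by omega), Nat.add_sub_cancel_left] at h1
    refine h.bot_coeff_eq_zero hp hi (α := α (r + i)) ?_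
    rw [← h1]
    split_ifs with h2
    · rfl
    · rw [hαp _ (by omega), zero_smul]
  have hα0 : ∀ i < p, α i = 0 := by
    intro i hi
    have h1 := hproj i (by omega)
    have h2 : (if r ≤ i ∧ i < r + p then β (i - r) • (G ^ (i - r)) y else 0) = 0 := by
      split_ifs
      · rw [hβ0 _ (by omega), zero_smul]
      · rfl
    rw [if_pos hi, h2, add_zero] at h1
    exact (smul_eq_zero.1 h1).resolve_right (h.lower_pow_top_ne hp hi)
  rintro (i | i)
  · rw [hα, hα0 _ i.2]
  · rw [hβ, hβ0 _ i.2]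

/-- The span of the vectors `G^i x`. -/
theorem IsProjPair.span_range_eq (z : M) :
    Submodule.span ℂ (Set.range fun i : ℕ => (G ^ i) z) =
      Submodule.span ℂ (Set.range fun i : Fin p => (G ^ (i : ℕ)) z) := by
  refine le_antisymm (Submodule.span_le.2 ?_) (Submodule.span_mono ?_)
  · rintro _ ⟨i, rfl⟩
    by_cases hi : i < p
    · exact Submodule.subset_span ⟨⟨i, hi⟩, rfl⟩
    · dsimp only
      rw [h.lower_pow_of_le (by omega)]
      exact Submodule.zero_mem _
  · rintro _ ⟨i, rfl⟩
    exact ⟨i, rfl⟩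

theorem IsProjPair.isHighest_top : IsHighest M E G ⊥ ((r : ℤ) - 1 - ν * p) x where
  raise_mem z hz := by rw [(Submodule.mem_bot ℂ).1 hz, map_zero]; exact Submodule.zero_mem _
  lower_mem z hz := by rw [(Submodule.mem_bot ℂ).1 hz, map_zero]; exact Submodule.zero_mem _
  homog := h.homog_top
  mem := by rw [h.raise_top]; exact Submodule.zero_mem _

omit h in
theorem mem_of_mem_span_range {N : Submodule ℂ M} {T : Module.End ℂ M} {z : M}
    (hT : ∀ i : ℕ, T ((G ^ i) z) ∈ N) :
    ∀ w ∈ Submodule.span ℂ (Set.range fun i : ℕ => (G ^ i) z), T w ∈ N := by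
  intro w hw
  induction hw using Submodule.span_induction with
  | mem w hw => obtain ⟨i, rfl⟩ := hw; exact hT i
  | zero => rw [map_zero]; exact N.zero_mem
  | add w w' _ _ h1 h2 => rw [map_add]; exact N.add_mem h1 h2
  | smul c w _ h1 => rw [map_smul]; exact N.smul_mem c h1

/-- `y` is not annihilated by `E`, but it is highest modulo the tower of `x`; the module is thus
filtered by two towers of length `p`. -/
theorem IsProjPair.isHighest_bot (hp : 2 ≤ p) :
    IsHighest M E G (Submodule.span ℂ (Set.range fun i : ℕ => (G ^ i) x))
      (-(r : ℤ) - 1 - ν * p) y where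
  raise_mem := mem_of_mem_span_range fun i => by
    rcases i with _ | i
    · rw [pow_zero, Module.End.one_apply, h.raise_top]; exact Submodule.zero_mem _
    · rw [h.raise_lower_pow_top hp]
      exact Submodule.smul_mem _ _ (Submodule.subset_span ⟨i, rfl⟩)
  lower_mem := mem_of_mem_span_range fun i => by
    rw [← Module.End.mul_apply, ← pow_succ']
    exact Submodule.subset_span ⟨i + 1, rfl⟩
  homog := h.homog_bot
  mem := by rw [h.raise_bot]; exact Submodule.subset_span ⟨r - 1, rfl⟩

/-- The ribbon map of a module generated by `x` and `y`. -/
structure IsProjRibbon (M : ModCo.{u} p) (G : Module.End ℂ M) (r : ℕ) (ν : ℤ) (x y : M)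
    (θ : Module.End ℂ M) : Prop where
  homog : ∀ m z, Homog M m z → Homog M m (θ z)
  lower : ∀ z, θ (G z) = G (θ z)
  top : θ x = qHalf p ^ (((r : ℤ) - 1 - ν * p + 1) ^ 2 - 1) • x
  bot : θ y - qHalf p ^ ((-(r : ℤ) - 1 - ν * p + 1) ^ 2 - 1) • y ∈
    Submodule.span ℂ (Set.range fun i : ℕ => (G ^ i) x)

omit h in
theorem IsProjRibbon.lower_pow {θ : Module.End ℂ M} (hθ : IsProjRibbon M G r ν x y θ) (i : ℕ)
    (z : M) : θ ((G ^ i) z) = (G ^ i) (θ z) := by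
  induction i with
  | zero => rfl
  | succ i ih => rw [pow_succ', Module.End.mul_apply, Module.End.mul_apply, hθ.lower, ih]

/-- The basis formed by `G^i x` and `G^i y` for `i < p`. -/
def IsProjPair.basis (hp : 2 ≤ p) (hspan : ⊤ ≤ Submodule.span ℂ (Set.range
    (Sum.elim (fun i : Fin p => (G ^ (i : ℕ)) x) (fun i : Fin p => (G ^ (i : ℕ)) y)))) :
    Module.Basis (Fin p ⊕ Fin p) ℂ M :=
  Module.Basis.mk (h.linearIndependent hp) hspan

/-- The traced operator is triangular for the flag given by the tower of `x`. Its two diagonal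
blocks are computed by `loop_mem` with `N = ⊥` and with `N` the tower of `x`, and each block gives
one `chi p`. -/
theorem IsProjPair.loop_eq (hp : 2 ≤ p) (hspan : ⊤ ≤ Submodule.span ℂ (Set.range
    (Sum.elim (fun i : Fin p => (G ^ (i : ℕ)) x) (fun i : Fin p => (G ^ (i : ℕ)) y))))
    {θ : Module.End ℂ M} (hθ : IsProjRibbon M G r ν x y θ) {Y : ModCo.{v} p} (hY : IsYD Y) :
    loop Y M θ = chi p ((r : ℤ) - 1 - ν * p) Y + chi p (-(r : ℤ) - 1 - ν * p) Y := by
  refine hom_ext_homog hY.grading fun m z hz => ?_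
  rw [loop_apply (hY.isEF hp).toIsLowerRaise h.isEF.toIsLowerRaise hθ.homog hz,
    LinearMap.add_apply, chi_apply hY.grading _ _ hz, chi_apply hY.grading _ _ hz,
    ← Finset.sum_add_distrib]
  refine Finset.sum_congr rfl fun k _ => ?_
  rw [← add_smul, ← mul_add]
  congr 2
  set b := h.basis hp hspan with hb
  have hl : ∀ i : Fin p, b (Sum.inl i) = (G ^ (i : ℕ)) x := fun i => by
    rw [hb, IsProjPair.basis, Module.Basis.mk_apply]; rfl
  have hr : ∀ i : Fin p, b (Sum.inr i) = (G ^ (i : ℕ)) y := fun i => by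
    rw [hb, IsProjPair.basis, Module.Basis.mk_apply]; rfl
  rw [chiCoef, chiCoef, Finset.sum_range, Finset.sum_range, loopTrace]
  have htop : IsRibbonAt M G ⊥ ((r : ℤ) - 1 - ν * p) x θ :=
    ⟨hθ.homog, hθ.lower, fun z hz => by
      rw [(Submodule.mem_bot ℂ).1 hz, map_zero]; exact Submodule.zero_mem _, by
      rw [hθ.top, sub_self]; exact Submodule.zero_mem _⟩
  have hbot : IsRibbonAt M G (Submodule.span ℂ (Set.range fun i : ℕ => (G ^ i) x))
      (-(r : ℤ) - 1 - ν * p) y θ :=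
    ⟨hθ.homog, hθ.lower, mem_of_mem_span_range fun i => by
      rw [hθ.lower_pow, hθ.top, map_smul]
      exact Submodule.smul_mem _ _ (Submodule.subset_span ⟨i, rfl⟩), hθ.bot⟩
  refine trace_of_flag b _ _ _ (fun i => ?_) (fun i => ?_)
  · have := h.isHighest_top.loop_mem h.isEF hp htop (m + 2 * k) k i
    rw [Submodule.mem_bot, sub_eq_zero] at this
    rw [hl]; exact this
  · have := (h.isHighest_bot hp).loop_mem h.isEF hp hbot (m + 2 * k) k i
    simp only [hl, hr]
    rwa [h.span_range_eq] at this

end projPair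

end
end NicholsLoop
namespace NicholsLoop
noncomputable section

/-! ### Induced structures on subspaces -/

section restrict

variable {p : ℕ} [NeZero p] {M : ModCo.{u} p} {S : Submodule ℂ M}

theorem retraction_apply {w : M} (hw : w ∈ S) : retraction M S w = ⟨w, hw⟩ :=
  LinearMap.congr_fun (S.subtype.exists_leftInverse_of_injective S.ker_subtype).choose_spec ⟨w, hw⟩

/-- The inclusion of a subspace with its induced structure. -/
def incl (M : ModCo.{u} p) (S : Submodule ℂ M) : restrict M S →ₗ[ℂ] M := S.subtype

theorem incl_injective : Function.Injective (incl M S) := S.injective_subtype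

theorem incl_mem (z : restrict M S) : incl M S z ∈ S := Subtype.property (p := fun x => x ∈ S) z

/-- The choice of the retraction drops out on vectors that already lie in `S`; every comparison with
the ambient module is made through this. -/
theorem incl_retraction {w : M} (hw : w ∈ S) :
    incl M S (retraction M S w : S) = w := by
  rw [retraction_apply hw]; rfl

theorem incl_restrictEnd {T : Module.End ℂ M} (hT : ∀ w ∈ S, T w ∈ S) (z : restrict M S) :
    incl M S (restrictEnd M S T z) = T (incl M S z) :=
  incl_retraction (hT _ (incl_mem z))

theorem incl_restrictEnd_pow {T : Module.End ℂ M} (hT : ∀ w ∈ S, T w ∈ S) (k : ℕ)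
    (z : restrict M S) : incl M S ((restrictEnd M S T ^ k) z) = (T ^ k) (incl M S z) := by
  induction k with
  | zero => rfl
  | succ k ih => rw [pow_succ', pow_succ', Module.End.mul_apply, Module.End.mul_apply,
      incl_restrictEnd hT, ih]

variable (hproj : ∀ j, ∀ w ∈ S, M.proj j w ∈ S)
include hproj

theorem incl_proj (j : ZMod (4 * p)) (z : restrict M S) :
    incl M S ((restrict M S).proj j z) = M.proj j (incl M S z) :=
  incl_retraction (hproj j _ (incl_mem z))

theorem homog_restrict_iff (m : ℤ) (z : restrict M S) :
    Homog (restrict M S) m z ↔ Homog M m (incl M S z) := by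
  rw [Homog, Homog, ← incl_proj hproj, incl_injective.eq_iff]

theorem restrict_grading (h : CompleteOrthogonalIdempotents M.proj) :
    CompleteOrthogonalIdempotents (restrict M S).proj where
  idem i := by
    refine LinearMap.ext fun z => incl_injective ?_
    rw [Module.End.mul_apply, incl_proj hproj, incl_proj hproj, ← Module.End.mul_apply, h.idem i]
  ortho i j hij := by
    refine LinearMap.ext fun z => incl_injective ?_
    rw [Module.End.mul_apply, incl_proj hproj, incl_proj hproj, ← Module.End.mul_apply,
      h.ortho hij]
    exact (map_zero _).symm
  complete := by
    refine LinearMap.ext fun z => incl_injective ?_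
    rw [LinearMap.sum_apply, map_sum]
    simp only [incl_proj hproj]
    exact (sum_proj h _).symm

theorem IsEF.restrict {E G : Module.End ℂ M} (h : IsEF M E G) (hE : ∀ w ∈ S, E w ∈ S)
    (hG : ∀ w ∈ S, G w ∈ S) :
    IsEF (restrict M S) (restrictEnd M S E) (restrictEnd M S G) where
  grading := restrict_grading hproj h.grading
  homog_raise m z hz := by
    rw [homog_restrict_iff hproj] at hz ⊢
    rw [incl_restrictEnd hE]; exact h.homog_raise _ _ hz
  homog_lower m z hz := by
    rw [homog_restrict_iff hproj] at hz ⊢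
    rw [incl_restrictEnd hG]; exact h.homog_lower _ _ hz
  raise_pow := LinearMap.ext fun z => incl_injective <| by
    rw [incl_restrictEnd_pow hE, h.raise_pow]; exact (map_zero _).symm
  lower_pow := LinearMap.ext fun z => incl_injective <| by
    rw [incl_restrictEnd_pow hG, h.lower_pow]; exact (map_zero _).symm
  act_F r hr z := incl_injective <| by
    have h1 : M.act (F p r ⊗ₜ[ℂ] incl M S z) ∈ S := by
      rw [h.act_F r hr]
      exact S.smul_mem _ (End.pow_mem hG r (incl_mem z))
    rw [map_smul, incl_restrictEnd_pow hG, ← h.act_F r hr]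
    exact incl_retraction h1
  coact_eq z := by
    have h1 : (NicholsLoop.restrict M S).coact z = (retraction M S).lTensor (Nich p) (M.coact (incl M S z)) :=
      rfl
    rw [h1, h.coact_eq, map_sum]
    refine Finset.sum_congr rfl fun k _ => ?_
    rw [LinearMap.lTensor_tmul]
    congr 1
    refine incl_injective ?_
    rw [incl_restrictEnd_pow hE]
    exact incl_retraction (End.pow_mem hE k (incl_mem z))
  comm m z hz := incl_injective <| by
    rw [homog_restrict_iff hproj] at hz
    rw [map_add, map_smul, map_smul, incl_restrictEnd hE, incl_restrictEnd hG,
      incl_restrictEnd hG, incl_restrictEnd hE]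
    exact h.comm _ _ hz

theorem isHom_incl {E G : Module.End ℂ M} (h : IsEF M E G) (hE : ∀ w ∈ S, E w ∈ S)
    (hG : ∀ w ∈ S, G w ∈ S) : IsHom (NicholsLoop.restrict M S) M (incl M S) :=
  (h.restrict hproj hE hG).isHom h (fun m z hz => (homog_restrict_iff hproj m z).1 hz)
    (fun z => incl_restrictEnd hE z) (fun z => incl_restrictEnd hG z)

theorem isHom_restrictEnd {E G : Module.End ℂ M} (h : IsEF M E G) (hE : ∀ w ∈ S, E w ∈ S)
    (hG : ∀ w ∈ S, G w ∈ S) {θ : Module.End ℂ M} (hθ : ∀ w ∈ S, θ w ∈ S)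
    (hθh : ∀ m z, Homog M m z → Homog M m (θ z)) (hθE : ∀ z, θ (E z) = E (θ z))
    (hθG : ∀ z, θ (G z) = G (θ z)) :
    IsHom (NicholsLoop.restrict M S) (NicholsLoop.restrict M S) (restrictEnd M S θ) := by
  refine (h.restrict hproj hE hG).isHom (h.restrict hproj hE hG) (fun m z hz => ?_) (fun z => ?_)
    (fun z => ?_)
  · rw [homog_restrict_iff hproj] at hz ⊢
    rw [incl_restrictEnd hθ]; exact hθh _ _ hz
  · refine incl_injective ?_
    rw [incl_restrictEnd hθ, incl_restrictEnd hE, incl_restrictEnd hE, incl_restrictEnd hθ, hθE]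
  · refine incl_injective ?_
    rw [incl_restrictEnd hθ, incl_restrictEnd hG, incl_restrictEnd hG, incl_restrictEnd hθ, hθG]

end restrict

/-! ### The submodule generated by a pair of vectors -/

section pairRestrict

variable {p : ℕ} [NeZero p] {M : ModCo.{u} p} {E G : Module.End ℂ M} {r : ℕ} {ν : ℤ} {x y : M}

/-- The span of the vectors `G^i y` and `G^i x`. -/
def pairSpan (M : ModCo.{u} p) (G : Module.End ℂ M) (x y : M) : Submodule ℂ M :=
  Submodule.span ℂ (Set.range (fun i : ℕ => (G ^ i) y) ∪ Set.range (fun i : ℕ => (G ^ i) x))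

theorem top_mem_pairSpan (i : ℕ) : (G ^ i) x ∈ pairSpan M G x y :=
  Submodule.subset_span (Or.inr ⟨i, rfl⟩)

theorem bot_mem_pairSpan (i : ℕ) : (G ^ i) y ∈ pairSpan M G x y :=
  Submodule.subset_span (Or.inl ⟨i, rfl⟩)

theorem span_le_pairSpan :
    Submodule.span ℂ (Set.range fun i : ℕ => (G ^ i) x) ≤ pairSpan M G x y :=
  Submodule.span_mono Set.subset_union_right

theorem map_mem_pairSpan {W : Submodule ℂ M} {T : Module.End ℂ M} (hx : ∀ i : ℕ, T ((G ^ i) x) ∈ W)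
    (hy : ∀ i : ℕ, T ((G ^ i) y) ∈ W) : ∀ w ∈ pairSpan M G x y, T w ∈ W := by
  intro w hw
  rw [pairSpan, Submodule.span_union, Submodule.mem_sup] at hw
  obtain ⟨w₁, h1, w₂, h2, rfl⟩ := hw
  rw [map_add]
  exact W.add_mem (mem_of_mem_span_range hy _ h1) (mem_of_mem_span_range hx _ h2)

variable (h : IsProjPair M E G r ν x y)
include h

theorem IsProjPair.raise_mem (hp : 2 ≤ p) : ∀ w ∈ pairSpan M G x y, E w ∈ pairSpan M G x y := by
  refine map_mem_pairSpan (fun i => ?_) (fun i => ?_)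
  · exact span_le_pairSpan ((h.isHighest_bot hp).raise_mem _ (Submodule.subset_span ⟨i, rfl⟩))
  · rcases i with _ | i
    · rw [pow_zero, Module.End.one_apply, h.raise_bot]; exact top_mem_pairSpan _
    · rw [h.raise_lower_pow_bot hp]
      exact Submodule.add_mem _ (Submodule.smul_mem _ _ (top_mem_pairSpan _))
        (Submodule.smul_mem _ _ (bot_mem_pairSpan _))

omit h in
theorem lower_mem_pairSpan : ∀ w ∈ pairSpan M G x y, G w ∈ pairSpan M G x y := by
  refine map_mem_pairSpan (fun i => ?_) (fun i => ?_)
  · rw [← Module.End.mul_apply, ← pow_succ']; exact top_mem_pairSpan _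
  · rw [← Module.End.mul_apply, ← pow_succ']; exact bot_mem_pairSpan _

theorem IsProjPair.proj_mem (j : ZMod (4 * p)) :
    ∀ w ∈ pairSpan M G x y, M.proj j w ∈ pairSpan M G x y := by
  refine map_mem_pairSpan (fun i => ?_) (fun i => ?_)
  · rw [(h.isEF.homog_lower_pow h.homog_top i).proj_eq h.isEF.grading]
    split_ifs
    · exact top_mem_pairSpan _
    · exact Submodule.zero_mem _
  · rw [(h.isEF.homog_lower_pow h.homog_bot i).proj_eq h.isEF.grading]
    split_ifs
    · exact bot_mem_pairSpan _
    · exact Submodule.zero_mem _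

omit h in
theorem IsProjRibbon.mem {θ : Module.End ℂ M} (hθ : IsProjRibbon M G r ν x y θ) :
    ∀ w ∈ pairSpan M G x y, θ w ∈ pairSpan M G x y := by
  refine map_mem_pairSpan (fun i => ?_) (fun i => ?_)
  · rw [hθ.lower_pow, hθ.top, map_smul]
    exact Submodule.smul_mem _ _ (top_mem_pairSpan _)
  · rw [hθ.lower_pow]
    refine End.pow_mem lower_mem_pairSpan i ?_
    have h1 := Submodule.add_mem _ (span_le_pairSpan (y := y) hθ.bot) (Submodule.smul_mem _
      (qHalf p ^ ((-(r : ℤ) - 1 - ν * p + 1) ^ 2 - 1)) (bot_mem_pairSpan (G := G) (x := x) 0))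
    rw [pow_zero, Module.End.one_apply, sub_add_cancel] at h1
    exact h1

/-- The vector `w` of a subspace, as a vector of the induced module. -/
def inSub (M : ModCo.{u} p) (S : Submodule ℂ M) (w : M) (hw : w ∈ S) : restrict M S :=
  (⟨w, hw⟩ : S)

/-- The subspace is a variable with an equation, because it is applied to `projSpan`, which agrees
with `pairSpan` only through `projSpan_eq`. -/
theorem IsProjPair.restrict (hp : 2 ≤ p) {S : Submodule ℂ M} (hS : S = pairSpan M G x y)
    (hx : x ∈ S) (hy : y ∈ S) :
    IsProjPair (restrict M S) (restrictEnd M S E) (restrictEnd M S G) r ν (inSub M S x hx)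
      (inSub M S y hy) := by
  subst hS
  exact {
  isEF := h.isEF.restrict h.proj_mem (h.raise_mem hp) lower_mem_pairSpan
  one_le := h.one_le
  lt := h.lt
  homog_top := (homog_restrict_iff h.proj_mem _ _).2 h.homog_top
  homog_bot := (homog_restrict_iff h.proj_mem _ _).2 h.homog_bot
  raise_top := incl_injective <| by
    rw [incl_restrictEnd (h.raise_mem hp)]; exact h.raise_top.trans (map_zero _).symm
  raise_bot := incl_injective <| by
    rw [incl_restrictEnd (h.raise_mem hp), incl_restrictEnd_pow lower_mem_pairSpan]
    exact h.raise_bot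
  ne h0 := h.ne <| by
    have := congrArg (incl M (pairSpan M G x y)) h0
    rw [incl_restrictEnd_pow lower_mem_pairSpan, map_zero] at this
    exact this }

theorem IsProjPair.restrict_span {S : Submodule ℂ M} (hS : S = pairSpan M G x y)
    (hx : x ∈ S) (hy : y ∈ S) : ⊤ ≤ Submodule.span ℂ (Set.range
    (Sum.elim (fun i : Fin p => (restrictEnd M S G ^ (i : ℕ)) (inSub M S x hx))
      (fun i : Fin p => (restrictEnd M S G ^ (i : ℕ)) (inSub M S y hy)))) := by
  subst hS
  set N := Submodule.span ℂ (Set.range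
    (Sum.elim (fun i : Fin p => (restrictEnd M (pairSpan M G x y) G ^ (i : ℕ)) (inSub M _ x hx))
      (fun i : Fin p => (restrictEnd M (pairSpan M G x y) G ^ (i : ℕ)) (inSub M _ y hy))))
    with hN
  have h1 : pairSpan M G x y ≤ N.map (incl M (pairSpan M G x y)) := by
    refine Submodule.span_le.2 ?_
    rintro _ (⟨i, rfl⟩ | ⟨i, rfl⟩)
    · by_cases hi : i < p
      · exact ⟨_, Submodule.subset_span ⟨Sum.inr ⟨i, hi⟩, rfl⟩,
          incl_restrictEnd_pow lower_mem_pairSpan _ _⟩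
      · dsimp only
        rw [h.lower_pow_of_le (by omega)]; exact Submodule.zero_mem _
    · by_cases hi : i < p
      · exact ⟨_, Submodule.subset_span ⟨Sum.inl ⟨i, hi⟩, rfl⟩,
          incl_restrictEnd_pow lower_mem_pairSpan _ _⟩
      · dsimp only
        rw [h.lower_pow_of_le (by omega)]; exact Submodule.zero_mem _
  intro z _
  obtain ⟨z', hz', h2⟩ := h1 (incl_mem z)
  rwa [← incl_injective h2]

theorem IsProjRibbon.restrict {θ : Module.End ℂ M} (hθ : IsProjRibbon M G r ν x y θ)
    {S : Submodule ℂ M} (hS : S = pairSpan M G x y) (hx : x ∈ S) (hy : y ∈ S) :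
    IsProjRibbon (restrict M S) (restrictEnd M S G) r ν (inSub M S x hx) (inSub M S y hy)
      (restrictEnd M S θ) := by
  subst hS
  exact {
  homog m z hz := by
    rw [homog_restrict_iff h.proj_mem] at hz ⊢
    rw [incl_restrictEnd hθ.mem]; exact hθ.homog _ _ hz
  lower z := incl_injective <| by
    rw [incl_restrictEnd hθ.mem, incl_restrictEnd lower_mem_pairSpan,
      incl_restrictEnd lower_mem_pairSpan, incl_restrictEnd hθ.mem, hθ.lower]
  top := incl_injective <| by
    rw [incl_restrictEnd hθ.mem, map_smul]; exact hθ.top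
  bot := by
    set S := pairSpan M G x y
    set X := inSub M S x hx
    have h1 : Submodule.span ℂ (Set.range fun i : ℕ => (G ^ i) x) ≤
        (Submodule.span ℂ (Set.range fun i : ℕ => (restrictEnd M S G ^ i) X)).map (incl M S) := by
      refine Submodule.span_le.2 ?_
      rintro _ ⟨i, rfl⟩
      exact ⟨_, Submodule.subset_span ⟨i, rfl⟩, incl_restrictEnd_pow lower_mem_pairSpan _ _⟩
    obtain ⟨z, hz, h2⟩ := h1 hθ.bot
    have h3 : z = restrictEnd M S θ (inSub M S y hy) -
        qHalf p ^ ((-(r : ℤ) - 1 - ν * p + 1) ^ 2 - 1) • inSub M S y hy := by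
      refine incl_injective ?_
      rw [h2, map_sub, map_smul, incl_restrictEnd hθ.mem]; rfl
    rw [← h3]; exact hz }

end pairRestrict

end
end NicholsLoop
namespace NicholsLoop
noncomputable section

/-! ### The modules `P^{a,b}_{0,t}` -/

section projMod

variable {p : ℕ} [NeZero p] {a b : ℤ}

theorem twoBasis_coord_twoVec (k : Fin p × Fin p) {s t : ℕ} (hs : s < p) (ht : t < p) :
    (twoBasis p a b).coord k (twoVec p a b s t) =
      if s = k.1 ∧ t = k.2 then 1 else 0 := by
  have h1 : twoVec p a b s t = twoBasis p a b (⟨s, hs⟩, ⟨t, ht⟩) :=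
    (twoBasis_apply (⟨s, hs⟩, ⟨t, ht⟩)).symm
  rw [h1, Module.Basis.coord_apply, Module.Basis.repr_self, Finsupp.single_apply]
  refine if_congr ?_ rfl rfl
  obtain ⟨⟨k1, hk1⟩, ⟨k2, hk2⟩⟩ := k
  simp

/-- The kernel of `E` is spanned by the `V_{0,t}`, and the charge separates these: `a + b - 2t`
takes distinct values modulo `4p` for `t < p`. -/
theorem eq_smul_of_twoRaise_eq_zero {x : twoVertex p a b} (hx : twoRaise p a b x = 0) {n : ℕ}
    (hn : n < p) (hh : Homog (twoVertex p a b) (a + b - 2 * n) x) :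
    ∃ c : ℂ, x = c • twoVec p a b 0 n := by
  have h1 : ∀ (s t : ℕ) (hs : s + 1 < p) (ht : t < p),
      (twoBasis p a b).coord (⟨s + 1, hs⟩, ⟨t, ht⟩) x = 0 := by
    intro s t hs ht
    have h2 : (twoBasis p a b).coord (⟨s + 1, hs⟩, ⟨t, ht⟩) =
        (twoBasis p a b).coord (⟨s, by omega⟩, ⟨t, ht⟩) ∘ₗ twoRaise p a b := by
      refine LinearMap.ext_on_range span_twoVec fun st => ?_
      obtain ⟨⟨s', hs'⟩, ⟨t', ht'⟩⟩ := st
      rw [LinearMap.comp_apply, twoRaise_apply hs', twoBasis_coord_twoVec _ hs' ht']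
      dsimp only
      rcases s' with _ | s'
      · rw [if_neg (by omega), if_pos rfl, map_zero]
      · rw [if_neg (Nat.succ_ne_zero _), Nat.add_sub_cancel,
          twoBasis_coord_twoVec _ (by omega) ht']
        exact if_congr (by simp) rfl rfl
    rw [h2, LinearMap.comp_apply, hx, map_zero]
  have h2 : ∀ (t : ℕ) (ht : t < p), t ≠ n →
      (twoBasis p a b).coord (⟨0, by omega⟩, ⟨t, ht⟩) x = 0 := by
    intro t ht htn
    have h3 : (twoBasis p a b).coord (⟨0, by omega⟩, ⟨t, ht⟩) ∘ₗ
        (twoVertex p a b).proj ((a + b - 2 * n : ℤ) : ZMod (4 * p)) = 0 := by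
      refine LinearMap.ext_on_range span_twoVec fun st => ?_
      obtain ⟨⟨s', hs'⟩, ⟨t', ht'⟩⟩ := st
      rw [LinearMap.comp_apply, (homog_twoVec _ _).proj_eq twoVertex_grading, LinearMap.zero_apply]
      split_ifs with h4
      · rw [twoBasis_coord_twoVec _ hs' ht', if_neg]
        rintro ⟨h5, h6⟩
        dsimp only at h4 h5 h6
        subst h5 h6
        rw [ZMod.intCast_eq_intCast_iff_dvd_sub] at h4
        obtain ⟨c, hc⟩ := h4
        push_cast at hc
        have hc' : (t' : ℤ) - n = 2 * p * c := by linarith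
        have : c = 0 := by
          rcases lt_trichotomy c 0 with h2 | h2 | h2
          · nlinarith
          · exact h2
          · nlinarith
        rw [this, mul_zero] at hc'
        omega
      · exact map_zero _
    have h4 := LinearMap.congr_fun h3 x
    rw [LinearMap.comp_apply, show (twoVertex p a b).proj ((a + b - 2 * n : ℤ) : ZMod (4 * p)) x = x
      from hh] at h4
    exact h4
  refine ⟨(twoBasis p a b).coord (⟨0, by omega⟩, ⟨n, hn⟩) x, ?_⟩
  conv_lhs => rw [← (twoBasis p a b).sum_repr x]
  rw [Finset.sum_eq_single (⟨0, by omega⟩, ⟨n, hn⟩)]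
  · rw [twoBasis_apply]; rfl
  · rintro ⟨⟨s, hs⟩, ⟨t, ht⟩⟩ _ hst
    have : (twoBasis p a b).repr x (⟨s, hs⟩, ⟨t, ht⟩) = 0 := by
      rcases s with _ | s
      · refine h2 t ht fun h3 => hst ?_
        subst h3; rfl
      · exact h1 s t hs ht
    rw [this, zero_smul]
  · intro h3; exact absurd (Finset.mem_univ _) h3

theorem vElt_eq (hp : 2 ≤ p) (t i : ℕ) :
    vElt p a b t i = (twoLower p a b ^ i) (twoVec p a b 0 t) := by
  induction i with
  | zero => rfl
  | succ i ih =>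
    rw [pow_succ', Module.End.mul_apply, ← ih]
    exact (Function.iterate_succ_apply' _ _ _).trans
      (LinearMap.congr_fun ((twoVertex_isEF hp).lower_eq hp) _)

theorem uElt_eq (hp : 2 ≤ p) (t i : ℕ) :
    uElt p a b t i = (twoLower p a b ^ i) (uElt p a b t 0) := by
  induction i with
  | zero => rfl
  | succ i ih =>
    rw [pow_succ', Module.End.mul_apply, ← ih]
    exact (Function.iterate_succ_apply' _ _ _).trans
      (LinearMap.congr_fun ((twoVertex_isEF hp).lower_eq hp) _)

variable {r : ℕ} {ν : ℤ} {t : ℕ}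

theorem Realizes.leftLength_eq (h : Realizes p r ν a b t) : leftLength p a b t = r := by
  obtain ⟨h1, h2, h3, -⟩ := h
  rw [leftLength, h3, show ((r : ℤ) - 1 - ν * p) = (r - 1) + p * (-ν) by ring,
    Int.add_mul_emod_self_left, Int.emod_eq_of_lt (by omega) (by omega)]
  omega

theorem Realizes.add_lt (h : Realizes p r ν a b t) : t + r < p := by
  obtain ⟨h1, h2, -, h4⟩ := h
  have := Int.emod_lt_of_pos a (show (0 : ℤ) < p by omega)
  omega

/-- Here the two alternatives of `Realizes` enter. Modulo `p`, `t + i - b` is `(a mod p) - t -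
(r-1-i)`, which lies strictly between `0` and `p` in the first case, and does so after adding `p` in
the second. -/
theorem Realizes.gCoef_ne_zero (hp : 2 ≤ p) (h : Realizes p r ν a b t) : gCoef p b t r ≠ 0 := by
  have h0 := h.add_lt
  obtain ⟨h1, h2, h3, h4⟩ := h
  rw [gCoef, Finset.prod_ne_zero_iff]
  intro i hi
  rw [Finset.mem_range] at hi
  refine mul_ne_zero (qInt_ne_zero_of_lt hp (by omega) (by omega)) ?_
  have h5 := Int.emod_lt_of_pos a (show (0 : ℤ) < p by omega)
  have h6 := Int.emod_add_mul_ediv a p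
  have h8 := Int.emod_nonneg a (show (p : ℤ) ≠ 0 by omega)
  have h7 : (t : ℤ) + i - b = a % p - t - (r - 1 - i) + (a / p + ν) * p := by linarith
  rcases h4 with h4 | h4
  · rw [h7]
    exact qq_sub_ne_one (by omega) (by omega)
  · rw [h7, show a % p - t - ((r : ℤ) - 1 - i) + (a / p + ν) * p =
      (p + a % p - t - (r - 1 - i)) + (a / p + ν - 1) * p by ring]
    exact qq_sub_ne_one (by omega) (by omega)

/-- For `u < r` the component at `V_{r-u,t+u}` carries a factor `1 - 𝔮^{2νp} = 0`. Only `V_{0,t+r}`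
remains, a second vector annihilated by `E`. -/
theorem Realizes.lower_pow_eq (hp : 2 ≤ p) (h : Realizes p r ν a b t) :
    ∃ κ : ℂ, κ ≠ 0 ∧ (twoLower p a b ^ r) (twoVec p a b 0 t) = κ • twoVec p a b 0 (t + r) := by
  have h0 := h.add_lt
  have hg := h.gCoef_ne_zero hp
  obtain ⟨h1, h2, h3, h4⟩ := h
  refine ⟨qFac p r * actCoef p a b (0 : ℕ) t r r, ?_, ?_⟩
  · have := qFac_ne_zero hp (show r < p by omega)
    rw [actCoef_self]
    exact mul_ne_zero this (mul_ne_zero (mul_ne_zero (zpow_ne_zero _ (q_ne_zero p))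
      (inv_ne_zero this)) hg)
  · rw [twoLower_pow_apply hp _ _ _ (by omega), Finset.sum_range_succ, Finset.sum_eq_zero, zero_add,
      smul_smul, Nat.sub_self]
    intro u hu
    rw [Finset.mem_range] at hu
    have : gCoef p (a + b - 2 * t - u) (0 : ℕ) (r - u) = 0 := by
      rw [gCoef, Finset.prod_eq_zero_iff]
      refine ⟨r - u - 1, Finset.mem_range.2 (by omega), ?_⟩
      rw [h3, show ((0 : ℕ) : ℤ) + (r - u - 1 : ℕ) - (r - 1 - ν * p - u) = ν * p by
        push_cast [show 1 ≤ r - u by omega, show u ≤ r by omega]; ring, qq_mul_p, sub_self, mul_zero]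
    rw [actCoef, this, mul_zero, zero_mul, zero_smul]

theorem Realizes.uElt_zero (h : Realizes p r ν a b t) : uElt p a b t 0 =
    ∑ s ∈ Finset.range r, (qFac p (r - 1) * twoCoeff p a b 0 t (r - 1) s) •
      twoVec p a b (r - s) (t + s) := by
  rw [uElt, h.leftLength_eq]; rfl

/-- The vector is `G^{r-1} V_{0,t}` with the first index of every term raised by one, and `E` lowers
that index. -/
theorem Realizes.raise_uElt (hp : 2 ≤ p) (h : Realizes p r ν a b t) :
    twoRaise p a b (uElt p a b t 0) = (twoLower p a b ^ (r - 1)) (twoVec p a b 0 t) := by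
  have h0 := h.add_lt
  have h1 := h.1
  have h2 := (twoVertex_isEF (a := a) (b := b) hp).act_F (r - 1) (by omega) (twoVec p a b 0 t)
  rw [twoVertex_act (by omega) (by omega) (by omega), show r - 1 + 1 = r by omega] at h2
  have h3 := congrArg (fun z => qFac p (r - 1) • z) h2
  rw [smul_smul, mul_inv_cancel₀ (qFac_ne_zero hp (by omega)), one_smul] at h3
  rw [← h3, h.uElt_zero, map_sum, Finset.smul_sum]
  refine Finset.sum_congr rfl fun s hs => ?_
  rw [Finset.mem_range] at hs
  rw [map_smul, twoRaise_apply (by omega), if_neg (by omega), smul_smul]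
  congr 2
  omega

theorem Realizes.isProjPair (hp : 2 ≤ p) (h : Realizes p r ν a b t) :
    IsProjPair (twoVertex p a b) (twoRaise p a b) (twoLower p a b) r ν (twoVec p a b 0 t)
      (uElt p a b t 0) where
  isEF := twoVertex_isEF hp
  one_le := h.1
  lt := by have := h.add_lt; omega
  homog_top := (homog_twoVec 0 t).congr (by
    rw [← h.2.2.1]; push_cast; ring)
  homog_bot := by
    rw [h.uElt_zero]
    refine Finset.sum_induction _ (Homog (twoVertex p a b) _) (fun x y => Homog.add)
      (Homog.zero _) fun s hs => ((homog_twoVec _ _).smul _).congr ?_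
    rw [Finset.mem_range] at hs
    congr 1
    have := h.2.2.1
    push_cast [show s ≤ r by omega]
    linarith
  raise_top := by rw [twoRaise_apply (by omega), if_pos rfl]
  raise_bot := h.raise_uElt hp
  ne := by
    obtain ⟨κ, h1, h2⟩ := h.lower_pow_eq hp
    have h3 := h.add_lt
    rw [h2]
    refine smul_ne_zero h1 ?_
    rw [twoVec_eq_single (by omega) h3]
    intro h4
    have := congrFun h4 (⟨0, by omega⟩, ⟨t + r, h3⟩)
    rw [Pi.single_eq_same] at this
    exact one_ne_zero this

/-- The ribbon scalars of the two charges agree, since the exponents differ by `4prν`. As `θ`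
commutes with `E`, the difference between `θ` and this scalar at the lower generator is annihilated
by `E`. By its charge it is a multiple of `V_{0,t+r}`, hence of `G^r V_{0,t}`. -/
theorem Realizes.isProjRibbon (hp : 2 ≤ p) (h : Realizes p r ν a b t) :
    IsProjRibbon (twoVertex p a b) (twoLower p a b) r ν (twoVec p a b 0 t) (uElt p a b t 0)
      (twoRibbon p a b) := by
  have hpair := h.isProjPair hp
  have htop : twoRibbon p a b (twoVec p a b 0 t) =
      qHalf p ^ (((r : ℤ) - 1 - ν * p + 1) ^ 2 - 1) • twoVec p a b 0 t := by
    rw [twoRibbon_apply hp (by omega), h.2.2.1, Finset.sum_range_one]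
    simp [ribbonCoef, gCoef, qFac_zero]
  have htwist : qHalf p ^ ((-(r : ℤ) - 1 - ν * p + 1) ^ 2 - 1) =
      qHalf p ^ (((r : ℤ) - 1 - ν * p + 1) ^ 2 - 1) := by
    rw [show (-(r : ℤ) - 1 - ν * p + 1) ^ 2 - 1 =
      (((r : ℤ) - 1 - ν * p + 1) ^ 2 - 1) + 4 * (p : ℤ) * (r * ν) by ring,
      zpow_add₀ (qHalf_ne_zero p), qHalf_zpow_four_mul, mul_one]
  refine ⟨homog_twoRibbon hp, twoRibbon_lower hp, htop, ?_⟩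
  rw [htwist]
  have h1 : twoRaise p a b (twoRibbon p a b (uElt p a b t 0) -
      qHalf p ^ (((r : ℤ) - 1 - ν * p + 1) ^ 2 - 1) • uElt p a b t 0) = 0 := by
    have h2 : ∀ i : ℕ, twoRibbon p a b ((twoLower p a b ^ i) (twoVec p a b 0 t)) =
        (twoLower p a b ^ i) (twoRibbon p a b (twoVec p a b 0 t)) := by
      intro i
      induction i with
      | zero => rfl
      | succ i ih => rw [pow_succ', Module.End.mul_apply, Module.End.mul_apply,
          twoRibbon_lower hp, ih]
    rw [map_sub, map_smul, ← twoRibbon_raise hp, hpair.raise_bot, h2, htop, map_smul, sub_self]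
  obtain ⟨c, hc⟩ := eq_smul_of_twoRaise_eq_zero h1 h.add_lt (by
    have h3 : Homog (twoVertex p a b) (-(r : ℤ) - 1 - ν * p) (twoRibbon p a b (uElt p a b t 0) -
        qHalf p ^ (((r : ℤ) - 1 - ν * p + 1) ^ 2 - 1) • uElt p a b t 0) := by
      rw [Homog, map_sub, homog_twoRibbon hp _ _ hpair.homog_bot, hpair.homog_bot.smul _]
    refine h3.congr (congrArg _ ?_)
    have := h.2.2.1
    push_cast
    linarith)
  obtain ⟨κ, h2, h3⟩ := h.lower_pow_eq hp
  rw [hc, show c • twoVec p a b 0 (t + r) = (c * κ⁻¹) • (twoLower p a b ^ r) (twoVec p a b 0 t) by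
    rw [h3, smul_smul, inv_mul_cancel_right₀ h2]]
  exact Submodule.smul_mem _ _ (Submodule.subset_span ⟨r, rfl⟩)

theorem projSpan_eq (hp : 2 ≤ p) : projSpan p a b t =
    pairSpan (twoVertex p a b) (twoLower p a b) (twoVec p a b 0 t) (uElt p a b t 0) := by
  rw [projSpan, pairSpan]
  congr 3
  · funext i; exact uElt_eq hp t i
  · funext i; exact vElt_eq hp t i

end projMod

end
end NicholsLoop
namespace NicholsLoop
noncomputable section

/-! ### The Yetter–Drinfeld structure of `P^{a,b}_{0,t}` and its loop operator -/

section projMod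

variable {p : ℕ} [NeZero p] {a b : ℤ} {r : ℕ} {ν : ℤ} {t : ℕ}

theorem Realizes.raise_mem (hp : 2 ≤ p) (h : Realizes p r ν a b t) :
    ∀ w ∈ projSpan p a b t, twoRaise p a b w ∈ projSpan p a b t := by
  rw [projSpan_eq hp]; exact (h.isProjPair hp).raise_mem hp

theorem lower_mem_projSpan (hp : 2 ≤ p) :
    ∀ w ∈ projSpan p a b t, twoLower p a b w ∈ projSpan p a b t := by
  rw [projSpan_eq hp]; exact lower_mem_pairSpan

theorem Realizes.proj_mem (hp : 2 ≤ p) (h : Realizes p r ν a b t) (j : ZMod (4 * p)) :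
    ∀ w ∈ projSpan p a b t, (twoVertex p a b).proj j w ∈ projSpan p a b t := by
  rw [projSpan_eq hp]; exact (h.isProjPair hp).proj_mem j

theorem Realizes.ribbon_mem (hp : 2 ≤ p) (h : Realizes p r ν a b t) :
    ∀ w ∈ projSpan p a b t, twoRibbon p a b w ∈ projSpan p a b t := by
  rw [projSpan_eq hp]; exact (h.isProjRibbon hp).mem

/-- The action of `F` on `P^{a,b}_{0,t}`. -/
def projLower (p : ℕ) [NeZero p] (a b : ℤ) (t : ℕ) : Module.End ℂ (projMod p a b t) :=
  restrictEnd (twoVertex p a b) (projSpan p a b t) (twoLower p a b)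

/-- The raising operator of `P^{a,b}_{0,t}`. -/
def projRaise (p : ℕ) [NeZero p] (a b : ℤ) (t : ℕ) : Module.End ℂ (projMod p a b t) :=
  restrictEnd (twoVertex p a b) (projSpan p a b t) (twoRaise p a b)

theorem Realizes.isProjPair_projMod (hp : 2 ≤ p) (h : Realizes p r ν a b t) :
    IsProjPair (projMod p a b t) (projRaise p a b t) (projLower p a b t) r ν (vInP p a b t 0)
      (uInP p a b t 0) :=
  (h.isProjPair hp).restrict hp (projSpan_eq hp) _ _

theorem Realizes.isProjRibbon_projMod (hp : 2 ≤ p) (h : Realizes p r ν a b t) :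
    IsProjRibbon (projMod p a b t) (projLower p a b t) r ν (vInP p a b t 0)
      (uInP p a b t 0) (projRibbon p a b t) :=
  IsProjRibbon.restrict (h.isProjPair hp) (h.isProjRibbon hp) (projSpan_eq hp) _ _

theorem Realizes.span_projMod (hp : 2 ≤ p) (h : Realizes p r ν a b t) :
    ⊤ ≤ Submodule.span ℂ (Set.range
      (Sum.elim (fun i : Fin p => (projLower p a b t ^ (i : ℕ)) (vInP p a b t 0))
        (fun i : Fin p => (projLower p a b t ^ (i : ℕ)) (uInP p a b t 0)))) :=
  (h.isProjPair hp).restrict_span (projSpan_eq hp) _ _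

theorem projLower_pow_vInP (hp : 2 ≤ p) (i j : ℕ) :
    (projLower p a b t ^ i) (vInP p a b t j) = vInP p a b t (i + j) := by
  refine incl_injective ?_
  refine (incl_restrictEnd_pow (lower_mem_projSpan hp) i _).trans ?_
  have h1 : incl _ _ (vInP p a b t j) = vElt p a b t j := rfl
  have h2 : incl _ _ (vInP p a b t (i + j)) = vElt p a b t (i + j) := rfl
  rw [h1, h2, vElt_eq hp, vElt_eq hp, pow_add]; rfl

theorem projLower_pow_uInP (hp : 2 ≤ p) (i j : ℕ) :
    (projLower p a b t ^ i) (uInP p a b t j) = uInP p a b t (i + j) := by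
  refine incl_injective ?_
  refine (incl_restrictEnd_pow (lower_mem_projSpan hp) i _).trans ?_
  have h1 : incl _ _ (uInP p a b t j) = uElt p a b t j := rfl
  have h2 : incl _ _ (uInP p a b t (i + j)) = uElt p a b t (i + j) := rfl
  rw [h1, h2, uElt_eq hp _ j, uElt_eq hp _ (i + j), pow_add]; rfl

theorem Realizes.isYD (hp : 2 ≤ p) (h : Realizes p r ν a b t) : IsYD (projMod p a b t) :=
  (h.isProjPair_projMod hp).isEF.isYD hp

theorem Realizes.isHom_subtype (hp : 2 ≤ p) (h : Realizes p r ν a b t) :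
    IsHom (projMod p a b t) (twoVertex p a b) (projSpan p a b t).subtype :=
  isHom_incl (h.proj_mem hp) (twoVertex_isEF hp) (h.raise_mem hp) (lower_mem_projSpan hp)

theorem Realizes.subtype_comp_projRibbon (hp : 2 ≤ p) (h : Realizes p r ν a b t) :
    (projSpan p a b t).subtype ∘ₗ projRibbon p a b t =
      twoRibbon p a b ∘ₗ (projSpan p a b t).subtype :=
  LinearMap.ext fun z => incl_restrictEnd (h.ribbon_mem hp) z

theorem Realizes.isHom_projRibbon (hp : 2 ≤ p) (h : Realizes p r ν a b t) :
    IsHom (projMod p a b t) (projMod p a b t) (projRibbon p a b t) :=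
  isHom_restrictEnd (h.proj_mem hp) (twoVertex_isEF hp) (h.raise_mem hp) (lower_mem_projSpan hp)
    (h.ribbon_mem hp) (homog_twoRibbon hp) (twoRibbon_raise hp) (twoRibbon_lower hp)

theorem Realizes.finrank_eq (hp : 2 ≤ p) (h : Realizes p r ν a b t) :
    Module.finrank ℂ (projMod p a b t) = 2 * p := by
  rw [Module.finrank_eq_card_basis ((h.isProjPair_projMod hp).basis hp (h.span_projMod hp)),
    Fintype.card_sum, Fintype.card_fin]
  ring

/-- The two towers of length `p` break into the same two shorter ones in opposite order, whence the
factor `2`. The result involves only `r` and `ν`, so it does not depend on the realization. -/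
theorem Realizes.opPab_eq (hp : 2 ≤ p) (h : Realizes p r ν a b t) {Y : ModCo.{u} p}
    (hY : IsYD Y) : opPab p a b t Y = 2 • chi r ((r : ℤ) - 1 - ν * p) Y +
      2 • chi (p - r) (((p - r : ℕ) : ℤ) - 1 - (ν + 1) * p) Y := by
  have hr : r ≤ p := by have := h.add_lt; omega
  rw [opPab, (h.isProjPair_projMod hp).loop_eq hp (h.span_projMod hp) (h.isProjRibbon_projMod hp)
    hY, chi_p_eq hY.grading hr, chi_p_neg_eq hY.grading hr]
  abel

end projMod

/-! ### The operators -/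

section operators

variable {p : ℕ} [NeZero p]

theorem realizes_standard {r : ℕ} (h1 : 1 ≤ r) (hr : r < p) (ν : ℤ) :
    Realizes p r ν ((p : ℤ) - 1) ((r : ℤ) - p - ν * p) 0 := by
  refine ⟨h1, by omega, by push_cast; ring, Or.inl ?_⟩
  rw [Int.emod_eq_of_lt (by omega) (by omega)]
  push_cast
  omega

theorem opP_eq (hp : 2 ≤ p) {r : ℕ} (h1 : 1 ≤ r) (hr : r < p) (ν : ℤ) {Y : ModCo.{u} p}
    (hY : IsYD Y) : opP p r ν Y = 2 • chi r ((r : ℤ) - 1 - ν * p) Y +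
      2 • chi (p - r) (((p - r : ℕ) : ℤ) - 1 - (ν + 1) * p) Y := by
  rw [opP, if_neg hr.ne, (realizes_standard h1 hr ν).opPab_eq hp hY]

theorem opP_self (ν : ℤ) (Y : ModCo.{u} p) : opP p p ν Y = opX p p ν Y := if_pos rfl

theorem IsHom.add {Y Y' : ModCo.{u} p} {f g : Y →ₗ[ℂ] Y'} (hf : IsHom Y Y' f)
    (hg : IsHom Y Y' g) : IsHom Y Y' (f + g) where
  map_proj i := by rw [LinearMap.add_comp, LinearMap.comp_add, hf.map_proj, hg.map_proj]
  map_act := by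
    rw [LinearMap.add_comp, LinearMap.lTensor_add, LinearMap.comp_add, hf.map_act, hg.map_act]
  map_coact := by
    rw [LinearMap.comp_add, LinearMap.lTensor_add, LinearMap.add_comp, hf.map_coact, hg.map_coact]

theorem opX_isIdentityEndo (hp : 2 ≤ p) {r : ℕ} (h1 : 1 ≤ r) (hr : r ≤ p) (ν : ℤ) :
    IsIdentityEndo.{u} (opX.{u} p r ν) where
  isHom Y hY := by rw [opX_eq hp h1 hr ν hY]; exact (closed_simple r ν).isHom_chi hp hY
  natural Y Y' hY hY' f hf := by
    rw [opX_eq hp h1 hr ν hY, opX_eq hp h1 hr ν hY']; exact chi_natural hp _ _ hY hY' hf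

theorem opP_isIdentityEndo (hp : 2 ≤ p) {r : ℕ} (h1 : 1 ≤ r) (hr : r ≤ p) (ν : ℤ) :
    IsIdentityEndo.{u} (opP.{u} p r ν) := by
  rcases hr.eq_or_lt with rfl | hr
  · have h : (opP.{u} r r ν) = opX r r ν := by funext Y; exact opP_self ν Y
    rw [h]; exact opX_isIdentityEndo hp h1 le_rfl ν
  · constructor
    · intro Y hY
      have hX := (closed_simple r ν).isHom_chi hp hY
      have hX' := (closed_simple (p - r) (ν + 1)).isHom_chi hp hY
      rw [opP_eq hp h1 hr ν hY, two_nsmul, two_nsmul]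
      exact (hX.add hX).add (hX'.add hX')
    · intro Y Y' hY hY' f hf
      rw [opP_eq hp h1 hr ν hY, opP_eq hp h1 hr ν hY', LinearMap.comp_add, LinearMap.add_comp,
        LinearMap.comp_smul, LinearMap.comp_smul, LinearMap.smul_comp, LinearMap.smul_comp,
        chi_natural hp _ _ hY hY' hf, chi_natural hp _ _ hY hY' hf]

theorem op_fusion (hp : 2 ≤ p) {Y : ModCo.{u} p} (hY : IsYD Y) {r₁ r₂ : ℕ} (ν₁ ν₂ : ℤ)
    (h1 : 1 ≤ r₁) (h1' : r₁ ≤ p) (h2 : 1 ≤ r₂) (h2' : r₂ ≤ p) :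
    opX p r₁ ν₁ Y * opX p r₂ ν₂ Y = ∑ s ∈ fusionX p r₁ r₂, opX p s (ν₁ + ν₂) Y +
      ∑ s ∈ fusionP p r₁ r₂, opP p s (ν₁ + ν₂) Y := by
  rw [opX_eq hp h1 h1' _ hY, opX_eq hp h2 h2' _ hY,
    chi_fusion hp hY (P := fun r ν => opP p r ν Y)
      (fun ν => by rw [opP_self, opX_eq hp (by omega) le_rfl _ hY])
      (fun r ν hr1 hr => opP_eq hp hr1 hr ν hY) ν₁ ν₂ h1 h1' h2 h2']
  congr 1
  refine Finset.sum_congr rfl fun s hs => ?_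
  rw [fusionX, Finset.mem_filter, Finset.mem_Icc] at hs
  rw [opX_eq hp hs.1.1 hs.1.2 _ hY]

theorem opX_period (hp : 2 ≤ p) {r : ℕ} (h1 : 1 ≤ r) (hr : r ≤ p) (ν : ℤ) {Y : ModCo.{u} p}
    (hY : IsYD Y) : opX p r (ν + 2) Y = opX p r ν Y := by
  rw [opX_eq hp h1 hr _ hY, opX_eq hp h1 hr _ hY, chi_period hY.grading]

theorem opP_period (hp : 2 ≤ p) {r : ℕ} (h1 : 1 ≤ r) (hr : r ≤ p) (ν : ℤ) {Y : ModCo.{u} p}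
    (hY : IsYD Y) : opP p r (ν + 2) Y = opP p r ν Y := by
  rcases hr.eq_or_lt with rfl | hr
  · rw [opP_self, opP_self, opX_period hp h1 le_rfl ν hY]
  · rw [opP_eq hp h1 hr _ hY, opP_eq hp h1 hr _ hY, chi_period hY.grading,
      show ν + 2 + 1 = ν + 1 + 2 by ring, chi_period hY.grading]

/-! ### Shifting charges -/

theorem chargeShift_grading {Y : ModCo.{u} p} (h : CompleteOrthogonalIdempotents Y.proj)
    (c : ZMod (4 * p)) : CompleteOrthogonalIdempotents (chargeShift Y c).proj where
  idem _ := h.idem _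
  ortho _ _ hij := h.ortho fun h' => hij (sub_left_injective h')
  complete := (Fintype.sum_equiv (Equiv.subRight c) _ _ fun _ => rfl).trans h.complete

theorem homog_chargeShift {Y : ModCo.{u} p} {m : ℤ} {y : Y} :
    Homog (chargeShift Y (2 * p)) m y ↔ Homog Y (m - 2 * p) y := by
  have h1 : ((m : ZMod (4 * p)) - 2 * p) = ((m - 2 * p : ℤ) : ZMod (4 * p)) := by push_cast; ring
  have h2 : Homog (chargeShift Y (2 * p)) m y ↔ Y.proj ((m : ZMod (4 * p)) - 2 * p) y = y := Iff.rfl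
  rw [h2, h1]
  rfl

theorem IsEF.chargeShift {Y : ModCo.{u} p} {E G : Module.End ℂ Y} (h : IsEF Y E G) :
    IsEF (chargeShift Y (2 * p)) E G where
  grading := chargeShift_grading h.grading _
  homog_raise m y hy := by
    exact homog_chargeShift.2 ((h.homog_raise _ _ (homog_chargeShift.1 hy)).congr
      (by push_cast; ring))
  homog_lower m y hy := by
    exact homog_chargeShift.2 ((h.homog_lower _ _ (homog_chargeShift.1 hy)).congr
      (by push_cast; ring))
  raise_pow := h.raise_pow
  lower_pow := h.lower_pow
  act_F := h.act_F
  coact_eq := h.coact_eq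
  comm m y hy := by
    have := h.comm _ _ (homog_chargeShift.1 hy)
    rw [qq_congr (show (p : ℤ) ∣ -(m - 2 * p) - -m from ⟨2, by ring⟩)] at this
    exact this

/-- `E` and `G` are unchanged, and `chiCoef` depends on the charge modulo `2p` only. -/
theorem chi_chargeShift {Y : ModCo.{u} p} (hY : CompleteOrthogonalIdempotents Y.proj) (n : ℕ)
    (a : ℤ) : chi n a (chargeShift Y (2 * p)) = chi n a Y := by
  have h2 := chargeShift_grading hY (2 * p)
  refine hom_ext_homog (M := chargeShift Y (2 * p)) h2 fun m y hy => ?_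
  rw [chi_apply h2 _ _ hy]
  refine ((chi_apply hY n a (homog_chargeShift.1 hy)).trans ?_).symm
  refine Finset.sum_congr rfl fun k _ => ?_
  rw [chiCoef_congr (m' := m) n a ⟨-1, by push_cast; ring⟩ k]
  rfl

theorem opX_chargeShift (hp : 2 ≤ p) {Y : ModCo.{u} p} (hY : IsYD Y) {r : ℕ} (h1 : 1 ≤ r)
    (hr : r ≤ p) (ν : ℤ) : opX p r ν (chargeShift Y (2 * p)) = opX p r ν Y := by
  have hY' := (hY.isEF hp).chargeShift.isYD hp
  exact (opX_eq hp h1 hr ν hY').trans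
    ((chi_chargeShift hY.grading _ _).trans (opX_eq hp h1 hr ν hY).symm)

theorem opP_chargeShift (hp : 2 ≤ p) {Y : ModCo.{u} p} (hY : IsYD Y) {r : ℕ} (h1 : 1 ≤ r)
    (hr : r ≤ p) (ν : ℤ) : opP p r ν (chargeShift Y (2 * p)) = opP p r ν Y := by
  have hY' := (hY.isEF hp).chargeShift.isYD hp
  rcases hr.eq_or_lt with rfl | hr
  · exact (opP_self ν _).trans ((opX_chargeShift hp hY h1 le_rfl ν).trans (opP_self ν Y).symm)
  · refine (opP_eq hp h1 hr ν hY').trans (Eq.trans ?_ (opP_eq hp h1 hr ν hY).symm)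
    rw [chi_chargeShift hY.grading, chi_chargeShift hY.grading]
    rfl

end operators

end
end NicholsLoop
namespace NicholsLoop
noncomputable section

/-! ### Eigenvalues -/

section eigenvalues

variable {p : ℕ} [NeZero p]

theorem chiCoef_eq_eigenLam (r r' : ℕ) (ν ν' : ℤ) :
    chiCoef p r ((r : ℤ) - 1 - ν * p) ((r' : ℤ) - 1 - ν' * p) 0 = eigenLam p r' ν' r ν := by
  rw [chiCoef_zero, eigenLam, Finset.mul_sum]
  refine Finset.sum_bij (fun s _ => s + 1) (fun s hs => ?_) (fun _ _ _ _ h => by omega)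
    (fun i hi => ?_) (fun s _ => ?_)
  · rw [Finset.mem_range] at hs; rw [Finset.mem_Icc]; omega
  · rw [Finset.mem_Icc] at hi
    exact ⟨i - 1, Finset.mem_range.2 (by omega), by omega⟩
  · rw [show ((r' : ℤ) - 1 - ν' * p + 1) * ((r : ℤ) - 1 - ν * p - 2 * s) =
      (-(ν' * (r - 1 - 2 * s)) - ν * r' + ν * ν' * p) * p +
        (r' : ℤ) * (r + 1 - 2 * ((s + 1 : ℕ) : ℤ)) by push_cast; ring, zpow_add₀ (q_ne_zero p),
      q_zpow_mul_p]
    congr 1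
    refine neg_one_zpow_congr ?_
    exact ⟨-(ν' * r) + ν' * s - ν * r', by ring⟩

/-- Multiplication by `z - z⁻¹` makes the sum telescope. -/
theorem mul_sum_eigenLam (z : ℂ) (hz : z ≠ 0) (r : ℕ) :
    (z - z⁻¹) * ∑ i ∈ Finset.Icc 1 r, z ^ ((r : ℤ) + 1 - 2 * i) = z ^ r - (z ^ r)⁻¹ := by
  have h1 : ∀ n : ℕ, ∑ i ∈ Finset.Icc 1 n, (z - z⁻¹) * z ^ ((r : ℤ) + 1 - 2 * i) =
      z ^ (r : ℤ) - z ^ ((r : ℤ) - 2 * n) := by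
    intro n
    induction n with
    | zero => simp
    | succ n ih =>
      rw [Finset.sum_Icc_succ_top (by omega), ih, sub_mul, ← zpow_one_add₀ hz, ← zpow_neg_one,
        ← zpow_add₀ hz]
      push_cast
      rw [show (1 : ℤ) + (r + 1 - 2 * (n + 1)) = r - 2 * n by ring,
        show (-1 : ℤ) + (r + 1 - 2 * (n + 1)) = r - 2 * (n + 1) by ring]
      ring
  rw [Finset.mul_sum, h1, show (r : ℤ) - 2 * r = -r by ring, zpow_neg, zpow_natCast]

theorem q_pow_sub_inv_ne_zero {r : ℕ} (h1 : 1 ≤ r) (hr : r < p) :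
    q p ^ r - (q p ^ r)⁻¹ ≠ 0 := by
  have h0 := pow_ne_zero r (q_ne_zero p)
  intro h
  have h2 : qq p r = 1 := by
    rw [qq, show (2 : ℤ) * r = ((r + r : ℕ) : ℤ) by push_cast; ring, zpow_natCast, pow_add]
    rw [sub_eq_zero] at h
    nth_rw 2 [h]
    exact mul_inv_cancel₀ h0
  rw [qq_eq_one_iff] at h2
  have := Int.le_of_dvd (by omega) h2
  omega

theorem eigenLam_eq_div {r' : ℕ} (h1 : 1 ≤ r') (hr : r' < p) (ν' : ℤ) (r : ℕ) (ν : ℤ) :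
    eigenLam p r' ν' r ν = (-1) ^ (ν' * (r + 1) + ν * r' + p * ν * ν') *
      ((q p ^ (r' * r) - (q p ^ (r' * r))⁻¹) / (q p ^ r' - (q p ^ r')⁻¹)) := by
  rw [eigenLam]
  congr 1
  rw [eq_div_iff (q_pow_sub_inv_ne_zero h1 hr), pow_mul,
    ← mul_sum_eigenLam _ (pow_ne_zero r' (q_ne_zero p)), mul_comm]
  congr 1
  refine Finset.sum_congr rfl fun i _ => ?_
  rw [← zpow_natCast, ← zpow_mul]

/-- Since `𝔮^{p-r'} = -𝔮^{-r'}`, the quotient acquires the sign `(-1)^{r+1}`, which is the sign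
caused by `ν' ↦ ν' + 1`. -/
theorem eigenLam_reflect {r' : ℕ} (h1 : 1 ≤ r') (hr : r' < p) (ν' : ℤ) (r : ℕ) (ν : ℤ) :
    eigenLam p r' ν' r ν = eigenLam p (p - r') (ν' + 1) r ν := by
  rw [eigenLam_eq_div h1 hr, eigenLam_eq_div (by omega) (by omega)]
  have h2 : q p ^ (p - r') = -(q p ^ r')⁻¹ := by
    rw [pow_sub₀ _ (q_ne_zero p) hr.le, ← zpow_natCast (q p) p, q_pow_p, neg_one_mul]
  have h0 := pow_ne_zero r' (q_ne_zero p)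
  have h3 := q_pow_sub_inv_ne_zero h1 hr
  rw [pow_mul, pow_mul, h2]
  set z := q p ^ r'
  rw [neg_pow, inv_neg, inv_inv, mul_inv, inv_pow, inv_inv,
    show ((-1 : ℂ) ^ r)⁻¹ = (-1) ^ r by rw [← inv_pow]; norm_num, Nat.cast_sub hr.le]
  have h4 : (-1 : ℂ) ^ ((ν' + 1) * ((r : ℤ) + 1) + ν * ((p : ℤ) - r') + p * ν * (ν' + 1)) =
      (-1) ^ (ν' * ((r : ℤ) + 1) + ν * r' + p * ν * ν') * (-1) ^ (r + 1) := by
    rw [← zpow_natCast (-1 : ℂ) (r + 1), ← zpow_add₀ (by norm_num)]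
    refine neg_one_zpow_congr ⟨ν * p - ν * r', ?_⟩
    push_cast; ring
  rw [h4, mul_assoc _ ((-1 : ℂ) ^ (r + 1))]
  congr 1
  have h5 : (-1 : ℂ) ^ r * (-1) ^ r = 1 := by rw [← mul_pow]; norm_num
  rw [show -z⁻¹ - -z = z - z⁻¹ by ring, ← mul_sub, ← mul_div_assoc]
  congr 1
  rw [pow_succ]
  linear_combination -(z ^ r - (z ^ r)⁻¹) * h5

theorem eigenLam_self (r : ℕ) (ν' ν : ℤ) :
    eigenLam p p ν' r ν = (-1) ^ ((ν' + 1) * (r - 1 - ν * p)) * r := by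
  have h1 : ∀ i ∈ Finset.Icc 1 r, q p ^ ((p : ℤ) * (r + 1 - 2 * i)) = (-1) ^ ((r : ℤ) + 1) := by
    intro i _
    rw [mul_comm, q_zpow_mul_p]
    exact neg_one_zpow_congr ⟨-i, by ring⟩
  rw [eigenLam, Finset.sum_congr rfl h1, Finset.sum_const, Nat.card_Icc, nsmul_eq_mul,
    Nat.add_sub_cancel, mul_left_comm, ← zpow_add₀ (by norm_num), mul_comm]
  congr 1
  exact neg_one_zpow_congr ⟨ν' + 1 + ν * p + ν * ν' * p, by ring⟩

theorem Closed.chi_lower_pow (hp : 2 ≤ p) {n : ℕ} {a : ℤ} (h : Closed p n a) {Y : ModCo.{u} p}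
    {E G : Module.End ℂ Y} (hY : IsEF Y E G) (i : ℕ) (y : Y) :
    chi n a Y ((G ^ i) y) = (G ^ i) (chi n a Y y) := by
  induction i with
  | zero => rfl
  | succ i ih =>
    rw [pow_succ', Module.End.mul_apply, Module.End.mul_apply, h.chi_lower hp hY, ih]

/-- Centrality reduces the claim to `x`, where `E x = 0` leaves only the term `k = 0`. -/
theorem chi_highest (hp : 2 ≤ p) {Y : ModCo.{u} p} {E G : Module.End ℂ Y} (hY : IsEF Y E G)
    {r' : ℕ} {ν' : ℤ} {x : Y} (hx : Homog Y ((r' : ℤ) - 1 - ν' * p) x) (hE : E x = 0) (r : ℕ)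
    (ν : ℤ) (i : ℕ) : chi r ((r : ℤ) - 1 - ν * p) Y ((G ^ i) x) =
      eigenLam p r' ν' r ν • (G ^ i) x := by
  rw [(closed_simple r ν).chi_lower_pow hp hY, chi_apply_of_raise_eq_zero hY.grading _ _ hx,
    chiCoef_eq_eigenLam, map_smul]
  rw [hY.raise_eq hp]; exact hE

theorem opX_simpleMod (hp : 2 ≤ p) {r' r : ℕ} (ν' ν : ℤ) (h1' : 1 ≤ r') (hr' : r' ≤ p)
    (h1 : 1 ≤ r) (hr : r ≤ p) : opX p r ν (simpleMod p r' ν') = eigenLam p r' ν' r ν • 1 := by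
  have hEF := simpleMod_isEF (ν := ν') hp hr'
  rw [opX_eq hp h1 hr ν (hEF.isYD hp)]
  refine LinearMap.ext_on_range span_simpleVec fun s => ?_
  have h2 := chi_highest hp hEF (homog_simpleVec 0 |>.congr (by push_cast; ring))
    (by rw [simpleRaise_apply h1', if_pos rfl]) r ν s
  rw [simpleLower_pow_apply, map_smul, smul_comm, zero_add] at h2
  exact smul_right_injective (simpleMod p r' ν') (gCoef_ne_zero hp hr' ν' s.2) h2

/-! ### The action on `P^{a,b}_{0,t}` -/

/-- The diagonal coefficients of `𝔛(r)_0` in terms of `z = 𝔮^{r'}` and `ε = (-1)^{ν'}`. -/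
def diagSeq (ε z : ℂ) (r : ℕ) : ℂ := ε ^ (r + 1) * ((z ^ r - (z ^ r)⁻¹) / (z - z⁻¹))

/-- The off-diagonal coefficients of `𝔛(r)_0`, divided by `-𝔮^{1-r'}(𝔮 - 𝔮⁻¹)`. -/
def offSeq (ε z : ℂ) (r : ℕ) : ℂ := ε ^ (r + 1) *
  (((z ^ r - (z ^ r)⁻¹) * (z + z⁻¹) - r * ((z ^ r + (z ^ r)⁻¹) * (z - z⁻¹))) / (z - z⁻¹) ^ 3)

theorem diagSeq_recursion {ε z : ℂ} (hε : ε ^ 2 = 1) (hz : z ≠ 0) (r : ℕ) :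
    ε * (z + z⁻¹) * diagSeq ε z (r + 1) = diagSeq ε z (r + 2) + diagSeq ε z r := by
  simp only [diagSeq, div_eq_mul_inv (b := z - z⁻¹)]
  set d := (z - z⁻¹)⁻¹
  rw [show ε ^ (r + 2 + 1) = ε ^ (r + 1) * ε ^ 2 by ring, hε,
    show ε ^ (r + 1 + 1) = ε ^ (r + 1) * ε by ring]
  have h1 : (z + z⁻¹) * (z ^ (r + 1) - (z ^ (r + 1))⁻¹) =
      z ^ (r + 2) - (z ^ (r + 2))⁻¹ + (z ^ r - (z ^ r)⁻¹) := by
    field_simp; ring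
  linear_combination ε ^ 2 * ε ^ (r + 1) * d * h1 +
    ε ^ (r + 1) * d * (z ^ (r + 2) - (z ^ (r + 2))⁻¹ + (z ^ r - (z ^ r)⁻¹)) * hε

/-- Powers of a Jordan block behave like a derivative: the off-diagonal entries obey the recursion
of the diagonal ones with a diagonal entry as source term. -/
theorem offSeq_recursion {ε z : ℂ} (hε : ε ^ 2 = 1) (hz : z ≠ 0) (hd : z - z⁻¹ ≠ 0) (r : ℕ) :
    ε * (z + z⁻¹) * offSeq ε z (r + 1) - ε * diagSeq ε z (r + 1) =
      offSeq ε z (r + 2) + offSeq ε z r := by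
  have h1 : (z + z⁻¹) * (((z ^ (r + 1) - (z ^ (r + 1))⁻¹) * (z + z⁻¹) -
      ((r + 1 : ℕ) : ℂ) * ((z ^ (r + 1) + (z ^ (r + 1))⁻¹) * (z - z⁻¹)))) -
      (z ^ (r + 1) - (z ^ (r + 1))⁻¹) * (z - z⁻¹) ^ 2 =
      ((z ^ (r + 2) - (z ^ (r + 2))⁻¹) * (z + z⁻¹) -
        ((r + 2 : ℕ) : ℂ) * ((z ^ (r + 2) + (z ^ (r + 2))⁻¹) * (z - z⁻¹))) +
      ((z ^ r - (z ^ r)⁻¹) * (z + z⁻¹) - r * ((z ^ r + (z ^ r)⁻¹) * (z - z⁻¹))) := by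
    push_cast
    field_simp
    ring
  have h2 : diagSeq ε z (r + 1) = ε ^ (r + 1 + 1) * ((z ^ (r + 1) - (z ^ (r + 1))⁻¹) *
      (z - z⁻¹) ^ 2 * ((z - z⁻¹) ^ 3)⁻¹) := by
    rw [diagSeq]; congr 1
    generalize z - z⁻¹ = d at hd
    field_simp
  rw [h2]
  simp only [offSeq, div_eq_mul_inv (b := (z - z⁻¹) ^ 3)]
  rw [show ε ^ (r + 2 + 1) = ε ^ (r + 1) * ε ^ 2 by ring, hε,
    show ε ^ (r + 1 + 1) = ε ^ (r + 1) * ε by ring]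
  set d := ((z - z⁻¹) ^ 3)⁻¹
  linear_combination ε ^ 2 * ε ^ (r + 1) * d * h1 + ε ^ (r + 1) * d *
    (((z ^ (r + 2) - (z ^ (r + 2))⁻¹) * (z + z⁻¹) -
        ((r + 2 : ℕ) : ℂ) * ((z ^ (r + 2) + (z ^ (r + 2))⁻¹) * (z - z⁻¹))) +
      ((z ^ r - (z ^ r)⁻¹) * (z + z⁻¹) - r * ((z ^ r + (z ^ r)⁻¹) * (z - z⁻¹)))) * hε

theorem neg_one_zpow_mul_natCast (ν : ℤ) (n : ℕ) : (-1 : ℂ) ^ (ν * n) = ((-1) ^ ν) ^ n := by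
  rw [zpow_mul, zpow_natCast]

variable {M : ModCo.{u} p} {E G : Module.End ℂ M} {r' : ℕ} {ν' : ℤ} {x y : M}
  (h : IsProjPair M E G r' ν' x y)
include h

/-- The off-diagonal coefficient of `𝔛(2)_0`. -/
theorem IsProjPair.chi_two_bot (hp : 2 ≤ p) : chi 2 1 M y =
    ((-1) ^ ν' * (q p ^ r' + (q p ^ r')⁻¹)) • y +
      ((-1) ^ ν' * (q p ^ (1 - (r' : ℤ)) * (q p - (q p)⁻¹))) • (G ^ r') x := by
  have h1 := h.one_le
  have h0 := q_ne_zero p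
  rw [chi_two_apply hp h.isEF.grading h.homog_bot, h.isEF.lower_eq hp, h.isEF.raise_eq hp,
    h.raise_bot, ← Module.End.mul_apply, ← pow_succ', Nat.sub_add_cancel h1]
  have h2 : q p ^ (-(r' : ℤ) - 1 - ν' * p + 1) = (-1) ^ ν' * (q p ^ r')⁻¹ := by
    rw [show -(r' : ℤ) - 1 - ν' * p + 1 = (-ν') * p + -r' by ring, zpow_add₀ h0, q_zpow_mul_p,
      zpow_neg (q p), zpow_natCast]
    congr 1
    exact neg_one_zpow_congr ⟨-ν', by ring⟩
  have h3 : q p ^ (-(-(r' : ℤ) - 1 - ν' * p + 1)) = (-1) ^ ν' * q p ^ r' := by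
    rw [show -(-(r' : ℤ) - 1 - ν' * p + 1) = ν' * p + r' by ring, zpow_add₀ h0, q_zpow_mul_p,
      zpow_natCast]
  rw [h3, h2, qq_one]
  congr 2
  · ring
  · rw [zpow_sub₀ h0, zpow_one, zpow_natCast]
    field_simp

/-- On `y` and `G^{r'} x` the operator `chi 2 1` is a Jordan block with eigenvalue `ε(z + z⁻¹)`,
where `z = 𝔮^{r'}` and `ε = (-1)^{ν'}`. By `chi_two_mul` the entries of `chi r (r-1)` follow the
recursions of `diagSeq` and `offSeq`. -/
theorem IsProjPair.chi_bot (hp : 2 ≤ p) (r : ℕ) : chi r ((r : ℤ) - 1) M y =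
    diagSeq ((-1) ^ ν') (q p ^ r') r • y +
      (-(q p ^ (1 - (r' : ℤ)) * (q p - (q p)⁻¹)) * offSeq ((-1) ^ ν') (q p ^ r') r) •
        (G ^ r') x := by
  have hz := pow_ne_zero r' (q_ne_zero p)
  have hd := q_pow_sub_inv_ne_zero h.one_le h.lt
  have hε : ((-1 : ℂ) ^ ν') ^ 2 = 1 := by
    rw [← zpow_natCast, ← zpow_mul, mul_comm, zpow_mul]; norm_num
  have hY := h.isEF.isYD hp
  have htwo := h.chi_two_bot hp
  have htop : chi 2 1 M ((G ^ r') x) = ((-1) ^ ν' * (q p ^ r' + (q p ^ r')⁻¹)) • (G ^ r') x := by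
    have h1 := chi_highest hp h.isEF h.homog_top h.raise_top 2 0 r'
    rw [show ((2 : ℕ) : ℤ) - 1 - 0 * p = 1 by norm_num, eigenLam_eq_div h.one_le h.lt] at h1
    rw [h1]
    congr 1
    have h2 : (-1 : ℂ) ^ (ν' * (((2 : ℕ) : ℤ) + 1) + 0 * r' + p * 0 * ν') = (-1) ^ ν' :=
      neg_one_zpow_congr ⟨ν', by push_cast; ring⟩
    rw [h2, pow_mul]
    congr 1
    set z := q p ^ r'
    rw [div_eq_iff hd]
    field_simp
    ring
  set ε : ℂ := (-1) ^ ν'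
  set z := q p ^ r'
  set c := q p ^ (1 - (r' : ℤ)) * (q p - (q p)⁻¹)
  induction r using Nat.strong_induction_on with
  | _ r ih =>
    rcases r with _ | _ | r
    · rw [chi_zero _ hY.grading]
      simp [diagSeq, offSeq]
    · rw [show (((0 + 1 : ℕ) : ℤ) - 1) = 0 by norm_num, chi_one_zero hY.grading]
      have e1 : diagSeq ε z (0 + 1) = 1 := by
        simp only [diagSeq, zero_add, pow_one]
        rw [div_self hd, mul_one]
        exact hε
      have e2 : offSeq ε z (0 + 1) = 0 := by
        simp only [offSeq, zero_add, pow_one, Nat.cast_one]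
        rw [show (z - z⁻¹) * (z + z⁻¹) - 1 * ((z + z⁻¹) * (z - z⁻¹)) = 0 by ring, zero_div,
          mul_zero]
      rw [e1, e2, mul_zero, zero_smul, add_zero, one_smul]; rfl
    · have h1 := LinearMap.congr_fun (chi_two_mul hp r hY) y
      have i0 := ih r (by omega)
      have i1 := ih (r + 1) (by omega)
      rw [show ((r + 1 : ℕ) : ℤ) - 1 = r by push_cast; ring] at i1
      rw [Module.End.mul_apply, LinearMap.add_apply, i0, i1, map_add, map_smul, map_smul, htwo,
        htop, ← sub_eq_iff_eq_add] at h1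
      rw [show ((r + 1 + 1 : ℕ) : ℤ) - 1 = r + 1 by push_cast; ring, ← h1]
      have r1 := diagSeq_recursion hε hz r
      have r2 := offSeq_recursion hε hz hd r
      rw [← sub_eq_iff_eq_add] at r1 r2
      rw [show r + 1 + 1 = r + 2 from rfl, ← r1, ← r2]
      module

/-- The index `ν` enters through `signOp ν`, a scalar at `y`, and centrality transports the formula
along `G^i`. -/
theorem IsProjPair.chi_bot_sign (hp : 2 ≤ p) (r : ℕ) (ν : ℤ) (i : ℕ) :
    chi r ((r : ℤ) - 1 - ν * p) M ((G ^ i) y) =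
      eigenLam p r' ν' r ν • (G ^ i) y + offDiagMu p r' ν' r ν • (G ^ (r' + i)) x := by
  have h1 : chi r ((r : ℤ) - 1 - ν * p) M y =
      eigenLam p r' ν' r ν • y + offDiagMu p r' ν' r ν • (G ^ r') x := by
    rw [chi_sub_mul h.isEF.grading, Module.End.mul_apply, signOp_apply h.isEF.grading _ h.homog_bot,
      map_smul, h.chi_bot hp, smul_add, smul_smul, smul_smul, eigenLam_eq_div h.one_le h.lt]
    have h2 : (-1 : ℂ) ^ (ν' * ((r : ℤ) + 1) + ν * r' + p * ν * ν') =
        (-1) ^ (ν * (-(r' : ℤ) - 1 - ν' * p + 1)) * ((-1) ^ ν') ^ (r + 1) := by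
      rw [← neg_one_zpow_mul_natCast, ← zpow_add₀ (by norm_num)]
      refine neg_one_zpow_congr ⟨ν * r' + p * ν * ν', ?_⟩
      push_cast; ring
    congr 2
    · rw [h2, diagSeq, pow_mul]; ring
    · rw [offDiagMu, add_assoc, add_assoc, zpow_add₀ (by norm_num), ← add_assoc, h2, offSeq,
        pow_mul]
      ring
  rw [(closed_simple r ν).chi_lower_pow hp h.isEF, h1, map_add, map_smul, map_smul,
    ← Module.End.mul_apply, ← pow_add, add_comm i]

end eigenvalues

/-! ### The action on `P^{a,b}_{0,t}` -/

section projAction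

variable {p : ℕ} [NeZero p] {a b : ℤ} {r' : ℕ} {ν' : ℤ} {t : ℕ}

theorem Realizes.opX_uInP (hp : 2 ≤ p) (h : Realizes p r' ν' a b t) {r : ℕ} (h1 : 1 ≤ r)
    (hr : r ≤ p) (ν : ℤ) (i : ℕ) : opX p r ν (projMod p a b t) (uInP p a b t i) =
      eigenLam p r' ν' r ν • uInP p a b t i +
        offDiagMu p r' ν' r ν • vInP p a b t (r' + i) := by
  have h2 := (h.isProjPair_projMod hp).chi_bot_sign hp r ν i
  rw [projLower_pow_uInP hp, projLower_pow_vInP hp, add_zero, add_zero] at h2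
  rw [opX_eq hp h1 hr ν (h.isYD hp), h2]

theorem Realizes.opX_vInP (hp : 2 ≤ p) (h : Realizes p r' ν' a b t) {r : ℕ} (h1 : 1 ≤ r)
    (hr : r ≤ p) (ν : ℤ) (i : ℕ) : opX p r ν (projMod p a b t) (vInP p a b t i) =
      eigenLam p r' ν' r ν • vInP p a b t i := by
  have h3 := h.isProjPair_projMod hp
  have h2 := chi_highest hp h3.isEF h3.homog_top h3.raise_top r ν i
  rw [projLower_pow_vInP hp, add_zero] at h2
  rw [opX_eq hp h1 hr ν (h.isYD hp), h2]

end projAction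

end
end NicholsLoop
namespace NicholsLoop
noncomputable section

/-! ### Linear independence -/

section independence

open Polynomial

theorem degree_chebyshev_S (n : ℕ) : (Chebyshev.S ℂ n).degree = n := by
  induction n using Nat.strong_induction_on with
  | _ n ih =>
    rcases n with _ | _ | n
    · simp [Chebyshev.S_zero]
    · simp [Chebyshev.S_one]
    · have h1 : (X * Chebyshev.S ℂ ((n + 1 : ℕ) : ℤ)).degree = ((n + 2 : ℕ) : WithBot ℕ) := by
        rw [degree_mul, ih (n + 1) (by omega), degree_X]
        norm_cast
        ring
      rw [show ((n + 1 + 1 : ℕ) : ℤ) = n + 2 by push_cast; ring, Chebyshev.S_add_two,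
        show (n : ℤ) + 1 = ((n + 1 : ℕ) : ℤ) by push_cast; ring, degree_sub_eq_left_of_degree_lt, h1]
      rw [h1, ih n (by omega)]
      exact_mod_cast (by omega : n < n + 2)

/-- The polynomials `S_n`, with `S_n` of degree `n`. -/
def chebyshevSequence : Polynomial.Sequence ℂ where
  elems' n := Chebyshev.S ℂ n
  degree_eq' := degree_chebyshev_S

/-- The polynomial that gives `𝔛(1)_1` when it is evaluated at `𝔛(2)_0`. -/
def signPoly (p : ℕ) : ℂ[X] := C (1 / 2) * (Chebyshev.S ℂ p - Chebyshev.S ℂ ((p : ℤ) - 2))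

variable {p : ℕ} [NeZero p]

theorem degree_signPoly (hp : 2 ≤ p) : (signPoly p).degree = p := by
  rw [signPoly, degree_C_mul (by norm_num), degree_sub_eq_left_of_degree_lt, degree_chebyshev_S]
  rw [degree_chebyshev_S, show (p : ℤ) - 2 = ((p - 2 : ℕ) : ℤ) by omega, degree_chebyshev_S]
  exact_mod_cast (by omega : p - 2 < p)

/-- `chi_succ_p` solved for the sign operator. Thus `𝔛(2)_0` alone generates the algebra. -/
theorem signOp_one_eq_aeval (hp : 2 ≤ p) {Y : ModCo.{u} p} (hY : IsYD Y) :
    signOp 1 Y = aeval (chi 2 1 Y) (signPoly p) := by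
  have h1 := chi_succ_p hp hY.grading
  have h2 := chi_eq_aeval hp hY (p + 1)
  have h3 := chi_eq_aeval hp hY (p - 1)
  rw [show ((p + 1 : ℕ) : ℤ) - 1 = p by push_cast; ring] at h2
  rw [show ((p - 1 : ℕ) : ℤ) - 1 = (p : ℤ) - 2 by omega] at h3
  rw [h2, h3] at h1
  rw [signPoly, map_mul, map_sub, aeval_C, h1, add_sub_cancel_left, ← Algebra.smul_def,
    ← Nat.cast_smul_eq_nsmul ℂ, smul_smul]
  norm_num

/-- The polynomial in `𝔛(2)_0` that is the combination of the `𝔛(r)_ν` with coefficients `g`. -/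
def opPoly (p : ℕ) (g : Fin p × Fin 2 → ℂ) : ℂ[X] :=
  ∑ k : Fin p, g (k, 0) • Chebyshev.S ℂ (k : ℕ) +
    (∑ k : Fin p, g (k, 1) • Chebyshev.S ℂ (k : ℕ)) * signPoly p

theorem sum_opX_eq_aeval (hp : 2 ≤ p) {Y : ModCo.{u} p} (hY : IsYD Y) (g : Fin p × Fin 2 → ℂ) :
    ∑ k : Fin p × Fin 2, g k • opX p ((k.1 : ℕ) + 1) ((k.2 : ℕ) : ℤ) Y =
      aeval (chi 2 1 Y) (opPoly p g) := by
  have h1 : ∀ (k : Fin p) (ν : ℤ), opX p ((k : ℕ) + 1) ν Y =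
      aeval (chi 2 1 Y) (Chebyshev.S ℂ (k : ℕ)) * signOp ν Y := by
    intro k ν
    rw [opX_eq hp (by omega) (by omega) ν hY, chi_simple_eq hp hY, chiInt]
    congr 3
    push_cast; ring
  have h2 : signOp 0 Y = 1 := by
    have : signOp 0 Y = chi 1 0 Y := by rw [signOp, zero_mul, sub_zero]
    rw [this, chi_one_zero hY.grading]
  rw [opPoly, map_add, map_mul, map_sum, map_sum, ← signOp_one_eq_aeval hp hY,
    Fintype.sum_prod_type]
  simp only [Fin.sum_univ_two, h1, map_smul]
  rw [Finset.sum_add_distrib, Finset.sum_mul]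
  refine congrArg₂ (· + ·) ?_ ?_
  · refine Finset.sum_congr rfl fun k _ => ?_
    rw [show (((0 : Fin 2) : ℕ) : ℤ) = 0 from rfl, h2, mul_one]
  · refine Finset.sum_congr rfl fun k _ => ?_
    rw [show (((1 : Fin 2) : ℕ) : ℤ) = 1 from rfl, smul_mul_assoc]

/-- A Jordan block detects the derivative of `f` as well as its value. The case `w = 0`, `d = 0` is
the one of a plain eigenvector and serves for the simple modules. -/
theorem aeval_apply_of_jordan {V : Type u} [AddCommGroup V] [Module ℂ V] {A : Module.End ℂ V}
    {y w : V} {c d : ℂ} (hy : A y = c • y + d • w) (hw : A w = c • w) (f : ℂ[X]) :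
    aeval A f y = f.eval c • y + (d * f.derivative.eval c) • w := by
  have h0 : ∀ (f : ℂ[X]), aeval A f w = f.eval c • w := by
    intro f
    induction f using Polynomial.induction_on' with
    | add f g hf hg => rw [map_add, LinearMap.add_apply, hf, hg, eval_add, add_smul]
    | monomial n a =>
      rw [aeval_monomial, eval_monomial]
      have : ∀ n : ℕ, (A ^ n) w = c ^ n • w := by
        intro n
        induction n with
        | zero => simp
        | succ n ih => rw [pow_succ', Module.End.mul_apply, ih, map_smul, hw, smul_smul, pow_succ]
      rw [Module.End.mul_apply, this, Module.algebraMap_end_apply, smul_smul]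
  induction f using Polynomial.induction_on with
  | C a => simp
  | add f g hf hg =>
    rw [map_add, LinearMap.add_apply, hf, hg, derivative_add, eval_add, eval_add]
    module
  | monomial n a ih =>
    rw [pow_succ, ← mul_assoc, mul_comm _ X]
    generalize C a * X ^ n = g at ih ⊢
    rw [map_mul, aeval_X, Module.End.mul_apply, ih, map_add, map_smul, map_smul, hy, hw,
      derivative_mul, derivative_X, eval_add, eval_mul, eval_mul, eval_mul, eval_X, eval_one]
    module

/-- The eigenvalue `𝔮^j + 𝔮^{-j}` of `𝔛(2)_0`. -/
def twoEigen (p j : ℕ) : ℂ := q p ^ j + (q p ^ j)⁻¹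

theorem twoEigen_eq_cos (j : ℕ) : twoEigen p j = 2 * (Real.cos (Real.pi * j / p) : ℂ) := by
  rw [twoEigen, q, ← Complex.exp_nat_mul, ← Complex.exp_neg, Complex.ofReal_cos, Complex.cos]
  push_cast
  rw [mul_div_cancel₀ _ (two_ne_zero)]
  congr 2 <;> ring

theorem twoEigen_injOn : Set.InjOn (twoEigen p) (Set.Iic p) := by
  intro i hi j hj hij
  have hp : (0 : ℝ) < p := by exact_mod_cast Nat.pos_of_ne_zero (NeZero.ne p)
  rw [twoEigen_eq_cos, twoEigen_eq_cos] at hij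
  have h1 : Real.cos (Real.pi * i / p) = Real.cos (Real.pi * j / p) := by
    exact_mod_cast mul_left_cancel₀ two_ne_zero hij
  have h2 : ∀ i : ℕ, i ≤ p → Real.pi * i / p ∈ Set.Icc 0 Real.pi := by
    intro i hi
    refine ⟨by positivity, ?_⟩
    rw [div_le_iff₀ hp]
    exact mul_le_mul_of_nonneg_left (by exact_mod_cast hi) Real.pi_pos.le
  have h3 := Real.injOn_cos (h2 i hi) (h2 j hj) h1
  have h4 : Real.pi * i = Real.pi * j := by
    field_simp at h3
    rw [h3]
  exact_mod_cast mul_left_cancel₀ Real.pi_pos.ne' h4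

theorem eigenLam_two (r' : ℕ) (ν' : ℤ) :
    eigenLam p r' ν' 2 0 = (-1) ^ ν' * twoEigen p r' := by
  rw [eigenLam, twoEigen]
  have h1 : (-1 : ℂ) ^ (ν' * (((2 : ℕ) : ℤ) + 1) + 0 * r' + p * 0 * ν') = (-1) ^ ν' :=
    neg_one_zpow_congr ⟨ν', by push_cast; ring⟩
  rw [h1, show Finset.Icc 1 2 = {1, 2} from rfl, Finset.sum_pair (by norm_num)]
  congr 2
  · rw [show (r' : ℤ) * (((2 : ℕ) : ℤ) + 1 - 2 * ((1 : ℕ) : ℤ)) = r' by push_cast; ring,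
      zpow_natCast]
  · rw [show (r' : ℤ) * (((2 : ℕ) : ℤ) + 1 - 2 * ((2 : ℕ) : ℤ)) = -r' by push_cast; ring,
      zpow_neg, zpow_natCast]

theorem eval_eq_zero_of_simple (hp : 2 ≤ p) {f : ℂ[X]}
    (hf : ∀ Y : ModCo.{0} p, IsYD Y → aeval (chi 2 1 Y) f = 0) {r' : ℕ} (h1 : 1 ≤ r')
    (hr : r' ≤ p) (ν' : ℤ) : f.eval ((-1) ^ ν' * twoEigen p r') = 0 := by
  have hEF := simpleMod_isEF (ν := ν') hp hr
  have h2 := opX_simpleMod hp ν' 0 h1 hr (show 1 ≤ 2 by norm_num) hp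
  rw [opX_eq hp (by norm_num) hp 0 (hEF.isYD hp), eigenLam_two,
    show ((2 : ℕ) : ℤ) - 1 - 0 * p = 1 by norm_num] at h2
  have h3 := hf _ (hEF.isYD hp)
  have h4 := aeval_apply_of_jordan (A := chi 2 1 (simpleMod p r' ν')) (y := simpleVec p r' ν' 0)
    (w := 0) (c := (-1) ^ ν' * twoEigen p r') (d := 0) (by rw [h2]; simp) (by simp) f
  rw [h3, LinearMap.zero_apply, smul_zero, add_zero] at h4
  refine (smul_eq_zero.1 h4.symm).resolve_right fun h5 => ?_
  have h6 : simpleVec p r' ν' 0 = simpleBasis p r' ν' ⟨0, h1⟩ := (simpleBasis_apply ⟨0, h1⟩).symm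
  exact (simpleBasis p r' ν').ne_zero ⟨0, h1⟩ (h6 ▸ h5)

/-- The test module is the standard realization of `(r', 0)`. There the off-diagonal entry of `chi 2
1` is nonzero, so the derivative of `f` must vanish at the eigenvalue. -/
theorem derivative_eval_eq_zero (hp : 2 ≤ p) {f : ℂ[X]}
    (hf : ∀ Y : ModCo.{0} p, IsYD Y → aeval (chi 2 1 Y) f = 0) {r' : ℕ} (h1 : 1 ≤ r')
    (hr : r' < p) : f.derivative.eval (twoEigen p r') = 0 := by
  have hR := realizes_standard h1 hr 0
  have hpair := hR.isProjPair_projMod hp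
  have hYD := hR.isYD hp
  have h2 := hpair.chi_two_bot hp
  have h3 := hR.opX_vInP hp (show 1 ≤ 2 by norm_num) hp 0 r'
  have h5 := eval_eq_zero_of_simple hp hf h1 hr.le 0
  rw [opX_eq hp (by norm_num) hp 0 hYD, eigenLam_two,
    show ((2 : ℕ) : ℤ) - 1 - 0 * p = 1 by norm_num, zpow_zero, one_mul] at h3
  rw [zpow_zero, one_mul, one_mul, projLower_pow_vInP hp, add_zero] at h2
  rw [zpow_zero, one_mul] at h5
  have h4 := aeval_apply_of_jordan h2 h3 f
  rw [hf _ hYD, LinearMap.zero_apply, show q p ^ r' + (q p ^ r')⁻¹ = twoEigen p r' from rfl, h5,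
    zero_smul, zero_add] at h4
  have h6 := hpair.ne
  rw [projLower_pow_vInP hp, add_zero] at h6
  have h7 : q p - (q p)⁻¹ ≠ 0 := by
    have := q_pow_sub_inv_ne_zero (p := p) (r := 1) le_rfl (by omega)
    rwa [pow_one] at this
  have h8 := (smul_eq_zero.1 h4.symm).resolve_right h6
  exact (mul_eq_zero.1 h8).resolve_left (mul_ne_zero (zpow_ne_zero _ (q_ne_zero p)) h7)

/-- `f` vanishes at `twoEigen p j` for `0 ≤ j ≤ p`, doubly for `0 < j < p`. These points are
distinct, so `f` has at least `2 + 2(p-1) = 2p` zeros with multiplicity, more than its degree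
permits. -/
theorem eq_zero_of_aeval_eq_zero (hp : 2 ≤ p) {f : ℂ[X]}
    (hf : ∀ Y : ModCo.{0} p, IsYD Y → aeval (chi 2 1 Y) f = 0) (hdeg : f.degree < (2 * p : ℕ)) :
    f = 0 := by
  set e : ℕ → ℕ := fun j => if 0 < j ∧ j < p then 2 else 1 with he
  set P : ℂ[X] := ∏ j ∈ Finset.range (p + 1), (X - C (twoEigen p j)) ^ e j with hP
  have hroot : ∀ j ≤ p, f.eval (twoEigen p j) = 0 := by
    intro j hj
    -- There is no simple module with `r' = 0`; the eigenvalue `2` is found on `X(p)_1`, because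
    -- `-(𝔮^p + 𝔮^{-p}) = 2`.
    rcases Nat.eq_zero_or_pos j with rfl | hpos
    · have h1 := eval_eq_zero_of_simple hp hf (show 1 ≤ p by omega) le_rfl 1
      have h2 : q p ^ p = -1 := by rw [← zpow_natCast, q_pow_p]
      have h3 : (-1 : ℂ) ^ (1 : ℤ) * twoEigen p p = twoEigen p 0 := by
        rw [twoEigen, twoEigen, h2]; norm_num
      rwa [h3] at h1
    · have h1 := eval_eq_zero_of_simple hp hf hpos hj 0
      rwa [zpow_zero, one_mul] at h1
  have hdvd : P ∣ f := by
    refine Finset.prod_dvd_of_coprime (fun i hi j hj hij => ?_) (fun j hj => ?_)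
    · rw [Finset.mem_coe, Finset.mem_range] at hi hj
      refine IsCoprime.pow ?_
      refine isCoprime_X_sub_C_of_isUnit_sub (isUnit_iff_ne_zero.2 (sub_ne_zero.2 fun h => hij ?_))
      exact twoEigen_injOn (Set.mem_Iic.2 (by omega)) (Set.mem_Iic.2 (by omega)) h
    · rw [Finset.mem_range] at hj
      by_cases hf0 : f = 0
      · rw [hf0]; exact dvd_zero _
      rw [← le_rootMultiplicity_iff hf0]
      by_cases h1 : 0 < j ∧ j < p
      · rw [he]
        simp only [if_pos h1]
        exact (one_lt_rootMultiplicity_iff_isRoot hf0).2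
          ⟨hroot j (by omega), derivative_eval_eq_zero hp hf h1.1 h1.2⟩
      · rw [he]
        simp only [if_neg h1]
        exact (rootMultiplicity_pos hf0).2 (hroot j (by omega))
  refine eq_zero_of_dvd_of_degree_lt hdvd ?_
  have hmonic : ∀ j ∈ Finset.range (p + 1), ((X - C (twoEigen p j)) ^ e j).Monic :=
    fun j _ => (monic_X_sub_C _).pow _
  have hnat : P.natDegree = 2 * p := by
    rw [hP, natDegree_prod_of_monic _ _ hmonic]
    simp only [natDegree_pow, natDegree_X_sub_C, mul_one]
    obtain ⟨n, hn⟩ : ∃ n, p = n + 1 := ⟨p - 1, by omega⟩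
    have h1 : ∀ j ∈ Finset.range n, e (j + 1) = 2 := fun j hj => by
      rw [Finset.mem_range] at hj; exact if_pos (by omega)
    have h2 : e 0 = 1 := if_neg (by omega)
    have h3 : e (n + 1) = 1 := if_neg (by omega)
    rw [show p + 1 = n + 1 + 1 by omega, Finset.sum_range_succ, Finset.sum_range_succ',
      Finset.sum_congr rfl h1, h2, h3, Finset.sum_const, Finset.card_range, smul_eq_mul]
    omega
  rw [degree_eq_natDegree (monic_prod_of_monic _ _ hmonic).ne_zero, ← hP, hnat]
  exact hdeg

/-- The multiplier `signPoly` has degree `p`, while both Chebyshev sums have degree less than `p`.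
The two parts cannot cancel, and the `S_n` are independent by their degrees. -/
theorem opPoly_eq_zero (hp : 2 ≤ p) {g : Fin p × Fin 2 → ℂ}
    (hdeg : opPoly p g = 0) : g = 0 := by
  have hlt : ∀ c : Fin p → ℂ, (∑ k, c k • Chebyshev.S ℂ (k : ℕ)).degree < p := by
    intro c
    rw [← mem_degreeLT]
    refine Submodule.sum_mem _ fun k _ => Submodule.smul_mem _ _ ?_
    rw [mem_degreeLT, degree_chebyshev_S]
    exact_mod_cast k.2
  have hind : ∀ c : Fin p → ℂ, ∑ k, c k • Chebyshev.S ℂ (k : ℕ) = 0 → ∀ k, c k = 0 :=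
    Fintype.linearIndependent_iff.1
      (chebyshevSequence.linearIndependent.comp (fun k : Fin p => (k : ℕ)) Fin.val_injective)
  have h1 : ∑ k : Fin p, g (k, 1) • Chebyshev.S ℂ (k : ℕ) = 0 := by
    by_contra h
    rw [opPoly, add_eq_zero_iff_eq_neg] at hdeg
    have h2 := hlt fun k => g (k, 0)
    rw [hdeg, degree_neg, degree_mul, degree_signPoly hp] at h2
    have h3 := zero_le_degree_iff.2 h
    exact absurd h2 (not_lt.2 (le_add_of_nonneg_left h3))
  have h0 : ∑ k : Fin p, g (k, 0) • Chebyshev.S ℂ (k : ℕ) = 0 := by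
    rw [opPoly, h1, zero_mul, add_zero] at hdeg
    exact hdeg
  funext ⟨k, ν⟩
  fin_cases ν
  · exact hind (fun k => g (k, 0)) h0 k
  · exact hind (fun k => g (k, 1)) h1 k

theorem degree_opPoly_lt (hp : 2 ≤ p) (g : Fin p × Fin 2 → ℂ) :
    (opPoly p g).degree < (2 * p : ℕ) := by
  have hlt : ∀ c : Fin p → ℂ, (∑ k, c k • Chebyshev.S ℂ (k : ℕ)).degree < p := by
    intro c
    rw [← mem_degreeLT]
    refine Submodule.sum_mem _ fun k _ => Submodule.smul_mem _ _ ?_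
    rw [mem_degreeLT, degree_chebyshev_S]
    exact_mod_cast k.2
  refine lt_of_le_of_lt (degree_add_le _ _) (max_lt ?_ ?_)
  · exact (hlt _).trans (by exact_mod_cast (by omega : p < 2 * p))
  · rw [degree_mul, degree_signPoly hp, two_mul, Nat.cast_add]
    exact WithBot.add_lt_add_right (WithBot.natCast_ne_bot p) (hlt _)

theorem linearIndependent_opX (hp : 2 ≤ p) :
    LinearIndependent ℂ (fun (k : Fin p × Fin 2) (Y : {Y : ModCo.{0} p // IsYD Y}) =>
      opX p ((k.1 : ℕ) + 1) ((k.2 : ℕ) : ℤ) Y.1) := by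
  rw [Fintype.linearIndependent_iff]
  intro g hg
  refine congrFun (opPoly_eq_zero hp (eq_zero_of_aeval_eq_zero hp (fun Y hY => ?_)
    (degree_opPoly_lt hp g)))
  rw [← sum_opX_eq_aeval hp hY]
  have h1 := congrFun hg ⟨Y, hY⟩
  rw [Finset.sum_apply] at h1
  exact h1

end independence

end
end NicholsLoop

/-! ### The theorem -/

theorem mainTheorem2 (p : ℕ) [NeZero p] (hp : 2 ≤ p) :
    -- The modules that are run around the loop, and their ribbon maps, are well defined.
    (∀ (r : ℕ) (ν : ℤ), 1 ≤ r → r ≤ p →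
      NicholsLoop.IsYD (NicholsLoop.simpleMod p r ν)) ∧
    (∀ (r : ℕ) (ν a b : ℤ) (t : ℕ), NicholsLoop.Realizes p r ν a b t →
      NicholsLoop.IsYD (NicholsLoop.projMod p a b t) ∧
      NicholsLoop.IsHom (NicholsLoop.projMod p a b t) (NicholsLoop.twoVertex p a b)
        (NicholsLoop.projSpan p a b t).subtype ∧
      (NicholsLoop.projSpan p a b t).subtype ∘ₗ NicholsLoop.projRibbon p a b t =
        NicholsLoop.twoRibbon p a b ∘ₗ (NicholsLoop.projSpan p a b t).subtype ∧
      NicholsLoop.IsHom (NicholsLoop.projMod p a b t) (NicholsLoop.projMod p a b t)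
        (NicholsLoop.projRibbon p a b t) ∧
      Module.finrank ℂ (NicholsLoop.projMod p a b t) = 2 * p) ∧
    -- The operators are endomorphisms of the identity functor.
    (∀ (r : ℕ) (ν : ℤ), 1 ≤ r → r ≤ p →
      NicholsLoop.IsIdentityEndo.{u} (NicholsLoop.opX.{u} p r ν) ∧
      NicholsLoop.IsIdentityEndo.{u} (NicholsLoop.opP.{u} p r ν)) ∧
    -- The fusion algebra.
    (∀ Y : NicholsLoop.ModCo.{u} p, NicholsLoop.IsYD Y →
      ∀ (r₁ r₂ : ℕ) (ν₁ ν₂ : ℤ), 1 ≤ r₁ → r₁ ≤ p → 1 ≤ r₂ → r₂ ≤ p →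
        NicholsLoop.opX p r₁ ν₁ Y * NicholsLoop.opX p r₂ ν₂ Y =
          ∑ s ∈ NicholsLoop.fusionX p r₁ r₂, NicholsLoop.opX p s (ν₁ + ν₂) Y +
          ∑ s ∈ NicholsLoop.fusionP p r₁ r₂, NicholsLoop.opP p s (ν₁ + ν₂) Y) ∧
    (∀ Y : NicholsLoop.ModCo.{u} p, NicholsLoop.IsYD Y →
      ∀ (r : ℕ) (ν : ℤ), 1 ≤ r → r < p →
        NicholsLoop.opP p r ν Y =
          2 • NicholsLoop.opX p r ν Y + 2 • NicholsLoop.opX p (p - r) (ν + 1) Y) ∧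
    (∀ Y : NicholsLoop.ModCo.{u} p, NicholsLoop.IsYD Y →
      ∀ ν : ℤ, NicholsLoop.opP p p ν Y = NicholsLoop.opX p p ν Y) ∧
    -- All realizations of `P[r]_ν` give the same operator.
    (∀ Y : NicholsLoop.ModCo.{u} p, NicholsLoop.IsYD Y →
      ∀ (r : ℕ) (ν a b : ℤ) (t : ℕ), NicholsLoop.Realizes p r ν a b t →
        NicholsLoop.opPab p a b t Y = NicholsLoop.opP p r ν Y) ∧
    -- Dependence on the braiding indices modulo 2 only, for the operators ...
    (∀ Y : NicholsLoop.ModCo.{u} p, NicholsLoop.IsYD Y →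
      ∀ (r : ℕ) (ν : ℤ), 1 ≤ r → r ≤ p →
        NicholsLoop.opX p r (ν + 2) Y = NicholsLoop.opX p r ν Y ∧
        NicholsLoop.opP p r (ν + 2) Y = NicholsLoop.opP p r ν Y) ∧
    -- ... and for the modules that they act on (`ν' ↦ ν' - 2` shifts all charges by `2p`).
    (∀ Y : NicholsLoop.ModCo.{u} p, NicholsLoop.IsYD Y →
      NicholsLoop.IsYD (NicholsLoop.chargeShift Y (2 * p)) ∧
      ∀ (r : ℕ) (ν : ℤ), 1 ≤ r → r ≤ p → ∀ y : Y,
        NicholsLoop.opX p r ν (NicholsLoop.chargeShift Y (2 * p)) y = NicholsLoop.opX p r ν Y y ∧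
        NicholsLoop.opP p r ν (NicholsLoop.chargeShift Y (2 * p)) y = NicholsLoop.opP p r ν Y y) ∧
    -- The action on the simple modules.
    (∀ (r' r : ℕ) (ν' ν : ℤ), 1 ≤ r' → r' ≤ p → 1 ≤ r → r ≤ p →
      NicholsLoop.opX p r ν (NicholsLoop.simpleMod p r' ν') =
        NicholsLoop.eigenLam p r' ν' r ν • 1) ∧
    -- Other expressions for the eigenvalues.
    (∀ (r' r : ℕ) (ν' ν : ℤ), 1 ≤ r' → r' < p → 1 ≤ r → r ≤ p →
      NicholsLoop.eigenLam p r' ν' r ν =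
          (-1) ^ (ν' * (r + 1) + ν * r' + p * ν * ν') *
            ((NicholsLoop.q p ^ (r' * r) - (NicholsLoop.q p ^ (r' * r))⁻¹) /
              (NicholsLoop.q p ^ r' - (NicholsLoop.q p ^ r')⁻¹)) ∧
        NicholsLoop.eigenLam p r' ν' r ν = NicholsLoop.eigenLam p (p - r') (ν' + 1) r ν) ∧
    (∀ (r : ℕ) (ν' ν : ℤ), 1 ≤ r → r ≤ p →
      NicholsLoop.eigenLam p p ν' r ν = (-1) ^ ((ν' + 1) * (r - 1 - ν * p)) * r) ∧
    -- The action on the modules `P[r']_{ν'}`.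
    (∀ (r' r : ℕ) (ν' ν a b : ℤ) (t : ℕ), NicholsLoop.Realizes p r' ν' a b t → 1 ≤ r → r ≤ p →
      ∀ i : ℕ,
        NicholsLoop.opX p r ν (NicholsLoop.projMod p a b t) (NicholsLoop.uInP p a b t i) =
            NicholsLoop.eigenLam p r' ν' r ν • NicholsLoop.uInP p a b t i +
            NicholsLoop.offDiagMu p r' ν' r ν • NicholsLoop.vInP p a b t (r' + i) ∧
        NicholsLoop.opX p r ν (NicholsLoop.projMod p a b t) (NicholsLoop.vInP p a b t i) =
            NicholsLoop.eigenLam p r' ν' r ν • NicholsLoop.vInP p a b t i) ∧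
    -- The `2p` operators are linearly independent.
    LinearIndependent ℂ (fun (k : Fin p × Fin 2)
      (Y : {Y : NicholsLoop.ModCo.{0} p // NicholsLoop.IsYD Y}) =>
        NicholsLoop.opX p ((k.1 : ℕ) + 1) ((k.2 : ℕ) : ℤ) Y.1) := by
  refine ⟨fun r ν _ hr => (NicholsLoop.simpleMod_isEF hp hr).isYD hp,
    fun r ν a b t h => ⟨h.isYD hp, h.isHom_subtype hp, h.subtype_comp_projRibbon hp,
      h.isHom_projRibbon hp, h.finrank_eq hp⟩,
    fun r ν h1 hr => ⟨NicholsLoop.opX_isIdentityEndo hp h1 hr ν,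
      NicholsLoop.opP_isIdentityEndo hp h1 hr ν⟩,
    fun Y hY r₁ r₂ ν₁ ν₂ h1 h1' h2 h2' => NicholsLoop.op_fusion hp hY ν₁ ν₂ h1 h1' h2 h2',
    fun Y hY r ν h1 hr => ?_,
    fun Y _ ν => NicholsLoop.opP_self ν Y,
    fun Y hY r ν a b t h => ?_,
    fun Y hY r ν h1 hr => ⟨NicholsLoop.opX_period hp h1 hr ν hY,
      NicholsLoop.opP_period hp h1 hr ν hY⟩,
    fun Y hY => ⟨(hY.isEF hp).chargeShift.isYD hp, fun r ν h1 hr y =>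
      ⟨LinearMap.congr_fun (NicholsLoop.opX_chargeShift hp hY h1 hr ν) y,
        LinearMap.congr_fun (NicholsLoop.opP_chargeShift hp hY h1 hr ν) y⟩⟩,
    fun r' r ν' ν h1' hr' h1 hr => NicholsLoop.opX_simpleMod hp ν' ν h1' hr' h1 hr,
    fun r' r ν' ν h1' hr' _ _ => ⟨NicholsLoop.eigenLam_eq_div h1' hr' ν' r ν,
      NicholsLoop.eigenLam_reflect h1' hr' ν' r ν⟩,
    fun r ν' ν _ _ => NicholsLoop.eigenLam_self r ν' ν,
    fun r' r ν' ν a b t h h1 hr i => ⟨h.opX_uInP hp h1 hr ν i, h.opX_vInP hp h1 hr ν i⟩,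
    NicholsLoop.linearIndependent_opX hp⟩
  · rw [NicholsLoop.opP_eq hp h1 hr ν hY, NicholsLoop.opX_eq hp h1 hr.le ν hY,
      NicholsLoop.opX_eq hp (by omega) (by omega) (ν + 1) hY]
  · have hr : r < p := by have := h.add_lt; omega
    rw [h.opPab_eq hp hY, NicholsLoop.opP_eq hp h.1 hr ν hY]
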